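/- **Setting.** Let $N\ge 1$ and let $1<p<\infty$ if $N=1,2$, $1<p<\frac{N+2}{N-2}$ if $N\ge 3$. Put $f(u)=|u|^{p-1}u$, $\kappa=\big[\frac{2(p+1)}{(p-1)^2}\big]^{\frac1{p-1}}$, $$J=\Big\lfloor\frac{p+1}{p-1}\Big\rfloor,\qquad \lambda=\min\Big(J-\frac2{p-1},\frac12\Big)\in\big(0,\tfrac12\big],$$ and let $k$ be an integer with $k\ge 2J+2$ and $k\ge\frac{2(p+1)}{\lambda(p-1)}+2$. Let $\chi:\mathbb R\to\mathbb R$ be smooth and even with $\chi=1$ on $[0,1]$, $\chi=0$ on $[2,\infty)$ and $\chi'\le 0\le\chi\le 1$ on $[0,\infty)$. Let $A:\mathbb R^N\to[0,\infty)$ be of class $C^{k-1}$ with $A(x)=|x|^k$ for $|x|\ge 2$ and, for every multi-index $\beta$ with $|\beta|\le k-1$, $|\partial_x^\beta A|\le C_\beta A^{1-|\beta|/k}$ on $\mathbb R^N$ for some constant $C_\beta$. **Ansatz.** For $t>0$, $x\in\mathbb R^N$ let $U_0(t,x)=\kappa(t+A(x))^{-\frac2{p-1}}$. Given $a_1,\dots,a_J>0$,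 $t_1,\dots,t_J>0$ and $t_0=1$, define inductively $\mathcal E_j=-\partial_{tt}U_j+\Delta U_j+f(U_j)$ and, for $1\le j\le J$, $$w_j=-\kappa^{\frac{p-1}2}\frac{p-1}{3p+1}\Big(U_0^{\frac{p+1}2}\int_0^tU_0^{-p}\mathcal E_{j-1}\,ds+U_0^{-p}\int_t^{t_{j-1}}U_0^{\frac{p+1}2}\mathcal E_{j-1}\,ds\Big),\qquad U_j=U_{j-1}+\chi\Big(\frac{A}{a_j}\Big)w_j .$$ Call the parameters *admissible* if $0<a_J\le\dots\le a_1\le1$, $0<t_J\le\dots\le t_1\le 1$ and, for $1\le j\le J$, $0<t\le t_j$, $x\in\mathbb R^N$, $$|U_j-U_0|\le\tfrac14(1-2^{-j})U_0,\qquad |U_j-U_0|\le(1-2^{-j})(1+U_0)^{-\frac{p-1}2}U_0 .$$ **Truncated problem.** For integers $n\ge 1$ with $T_n:=\frac1n<t_J$ let $B_n=\sup_{t\in[T_n,t_J]}\|U_J(t)\|_{L^\infty}$ and $f_n(u)=f(u)\chi(u/B_n)$. By $u_n$ we mean a finite-energy solution on $[T_n,\infty)$, that is $(u_n,\partial_tu_n)\in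 C([T_n,\infty);H^1(\mathbb R^N)\times L^2(\mathbb R^N))$, of $$\partial_{tt}u_n-\Delta u_n=f_n(u_n),\qquad u_n(T_n)=U_J(T_n),\quad \partial_tu_n(T_n)=\partial_tU_J(T_n)$$ (so that, in particular, the data is taken to lie in $H^1\times L^2$), where the equation holds in the sense of distributions in $x$ for every $t$. **Proposition.** Admissible parameters exist. For any admissible parameters there are $C>0$, an integer $n_0\ge1$ and $0<\delta_0<1$, all independent of $n$, such that for all $n\ge n_0$ one has $T_n+\delta_0\le t_J$, and, writing $u_n=U_J+\varepsilon_n$, one has $(\varepsilon_n(t),\partial_t\varepsilon_n(t))\in H^1(\mathbb R^N)\times L^2(\mathbb R^N)$ and $$\|(\varepsilon_n(t),\partial_t\varepsilon_n(t))\|_{H^1\times L^2}\le C\,(t-T_n)^{\frac\lambda2}\qquad\text{for all } t\in[T_n,T_n+\delta_0].$$ -/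

import Mathlib

open MeasureTheory Set Filter Topology
open scoped ENNReal ContDiff InnerProductSpace Gradient

noncomputable section

namespace NLW

/-! ### The energy space -/

/-- Euclidean space `ℝ^N`. -/
abbrev Space (N : ℕ) := EuclideanSpace ℝ (Fin N)

/-- Real-valued square-integrable functions on `ℝ^N`. -/
abbrev L2 (N : ℕ) := Lp ℝ 2 (volume : Measure (Space N))

/-- Square-integrable vector fields on `ℝ^N`. -/
abbrev L2Vec (N : ℕ) := Lp (Space N) 2 (volume : Measure (Space N))

/-- `g` is the weak (distributional) gradient of `u`:
`∫ u ∇φ = - ∫ φ g` for all `φ ∈ C_c^∞(ℝ^N)`. -/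
def IsWeakGradient {N : ℕ} (u : L2 N) (g : L2Vec N) : Prop :=
  ∀ φ : Space N → ℝ, ContDiff ℝ ∞ φ → HasCompactSupport φ →
    ∫ x, u x • ∇ φ x = - ∫ x, φ x • g x

theorem integrable_smul_gradient {N : ℕ} (u : L2 N) {φ : Space N → ℝ}
    (hφ : ContDiff ℝ ∞ φ) (hc : HasCompactSupport φ) :
    Integrable (fun x => u x • ∇ φ x) := by
  have h1 : Continuous (∇ φ) :=
    (InnerProductSpace.toDual ℝ (Space N)).symm.continuous.comp
      (hφ.continuous_fderiv (by simp))
  have h2 : HasCompactSupport (∇ φ) :=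
    (hc.fderiv (𝕜 := ℝ)).comp_left (g := (InnerProductSpace.toDual ℝ (Space N)).symm) (map_zero _)
  exact memLp_one_iff_integrable.1
    ((h1.memLp_of_hasCompactSupport h2 (p := 2)).smul (Lp.memLp u) (r := 1))

theorem integrable_smul_field {N : ℕ} (g : L2Vec N) {φ : Space N → ℝ}
    (hφ : ContDiff ℝ ∞ φ) (hc : HasCompactSupport φ) :
    Integrable (fun x => φ x • g x) :=
  memLp_one_iff_integrable.1
    ((Lp.memLp g).smul (hφ.continuous.memLp_of_hasCompactSupport hc (p := 2)) (r := 1))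

/-- The Sobolev space `H^1(ℝ^N)`, as the space of pairs `(u, ∇u)` with `u ∈ L^2` having a weak
gradient `∇u ∈ L^2`. Its norm is `(‖u‖_{L²}² + ‖∇u‖_{L²}²)^{1/2}`. -/
def SobolevH1 (N : ℕ) : Submodule ℝ (WithLp 2 (L2 N × L2Vec N)) where
  carrier := {w | IsWeakGradient w.fst w.snd}
  zero_mem' := by
    intro φ hφ hc
    have h1 : ∫ x, ((0 : L2 N) x) • ∇ φ x = 0 := by
      rw [integral_eq_zero_of_ae]
      filter_upwards [Lp.coeFn_zero ℝ 2 (volume : Measure (Space N))] with x hx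
      rw [hx]; simp
    have h2 : ∫ x, φ x • ((0 : L2Vec N) x) = 0 := by
      rw [integral_eq_zero_of_ae]
      filter_upwards [Lp.coeFn_zero (Space N) 2 (volume : Measure (Space N))] with x hx
      rw [hx]; simp
    simp only [WithLp.zero_fst, WithLp.zero_snd, h1, h2, neg_zero]
  add_mem' := by
    intro v w hv hw φ hφ hc
    have h1 : ∫ x, ((v.fst + w.fst : L2 N) x) • ∇ φ x
        = (∫ x, v.fst x • ∇ φ x) + ∫ x, w.fst x • ∇ φ x := by
      rw [← integral_add (integrable_smul_gradient _ hφ hc) (integrable_smul_gradient _ hφ hc)]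
      apply integral_congr_ae
      filter_upwards [Lp.coeFn_add v.fst w.fst] with x hx
      rw [hx, Pi.add_apply, add_smul]
    have h2 : ∫ x, φ x • ((v.snd + w.snd : L2Vec N) x)
        = (∫ x, φ x • v.snd x) + ∫ x, φ x • w.snd x := by
      rw [← integral_add (integrable_smul_field _ hφ hc) (integrable_smul_field _ hφ hc)]
      apply integral_congr_ae
      filter_upwards [Lp.coeFn_add v.snd w.snd] with x hx
      rw [hx, Pi.add_apply, smul_add]
    simp only [WithLp.add_fst, WithLp.add_snd, h1, h2, hv φ hφ hc, hw φ hφ hc, neg_add]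
  smul_mem' := by
    intro c w hw φ hφ hc
    have h1 : ∫ x, ((c • w.fst : L2 N) x) • ∇ φ x = c • ∫ x, w.fst x • ∇ φ x := by
      rw [← integral_smul]
      apply integral_congr_ae
      filter_upwards [Lp.coeFn_smul c w.fst] with x hx
      rw [hx, Pi.smul_apply, smul_assoc]
    have h2 : ∫ x, φ x • ((c • w.snd : L2Vec N) x) = c • ∫ x, φ x • w.snd x := by
      rw [← integral_smul]
      apply integral_congr_ae
      filter_upwards [Lp.coeFn_smul c w.snd] with x hx
      rw [hx, Pi.smul_apply, smul_comm]
    simp only [WithLp.smul_fst, WithLp.smul_snd, h1, h2, hw φ hφ hc, smul_neg]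

/-- The energy space `H^1(ℝ^N) × L^2(ℝ^N)` with its Hilbertian product norm. -/
abbrev EnergySpace (N : ℕ) := WithLp 2 (SobolevH1 N × L2 N)

/-- The first component `u` of `(u, v) ∈ H^1 × L^2`, as an element of `L^2`. -/
def pos {N : ℕ} (w : EnergySpace N) : L2 N := (w.fst : WithLp 2 (L2 N × L2Vec N)).fst

/-- The weak gradient `∇u` for `(u, v) ∈ H^1 × L^2`. -/
def grad {N : ℕ} (w : EnergySpace N) : L2Vec N := (w.fst : WithLp 2 (L2 N × L2Vec N)).snd

/-- The second component `v` of `(u, v) ∈ H^1 × L^2`. -/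
def vel {N : ℕ} (w : EnergySpace N) : L2 N := w.snd

/-- `w = (u, ∂ₜu)` is a finite-energy solution on `[T, ∞)` of `∂ₜₜu - Δu = F(u)` with data
`u(T) = u₀`, `∂ₜu(T) = v₀`: it is continuous with values in `H^1 × L^2`, the time derivative of `u`
in `L^2` is the second component, and the equation holds when tested against any
`φ ∈ C_c^∞(ℝ^N)`. -/
structure IsEnergySolution {N : ℕ} (F : ℝ → ℝ) (T : ℝ) (u₀ v₀ : Space N → ℝ)
    (w : ℝ → EnergySpace N) : Prop where
  continuousOn : ContinuousOn w (Ici T)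
  hasDeriv : ∀ t ∈ Ici T, HasDerivWithinAt (fun s => pos (w s)) (vel (w t)) (Ici T) t
  equation : ∀ φ : Space N → ℝ, ContDiff ℝ ∞ φ → HasCompactSupport φ → ∀ t ∈ Ici T,
    HasDerivWithinAt (fun s => ∫ x, vel (w s) x * φ x)
      (-(∫ x, ⟪grad (w t) x, ∇ φ x⟫_ℝ) + ∫ x, F (pos (w t) x) * φ x) (Ici T) t
  initial_pos : pos (w T) =ᵐ[volume] u₀
  initial_vel : vel (w T) =ᵐ[volume] v₀

/-! ### The cut-off and the function `A` -/

/-- Smooth even cut-off functions equal to `1` on `[0,1]`, to `0` on `[2,∞)`, nonincreasing and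
with values in `[0,1]` on `[0,∞)`. -/
structure IsCutoff (χ : ℝ → ℝ) : Prop where
  smooth : ContDiff ℝ ∞ χ
  even : ∀ s, χ (-s) = χ s
  eq_one : ∀ s ∈ Icc (0 : ℝ) 1, χ s = 1
  eq_zero : ∀ s ∈ Ici (2 : ℝ), χ s = 0
  deriv_nonpos : ∀ s ∈ Ici (0 : ℝ), deriv χ s ≤ 0
  mem_Icc : ∀ s ∈ Ici (0 : ℝ), χ s ∈ Icc (0 : ℝ) 1

/-- The assumptions on `A`: it is nonnegative, of class `C^{k-1}`, all its partial derivatives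
`∂_{i_1} ⋯ ∂_{i_m} A` of order `m ≤ k - 1` are bounded by a constant times `A^{1 - m/k}`, and
`A(x) = |x|^k` for `|x| ≥ 2`. -/
structure IsBlowUpShape {N : ℕ} (k : ℕ) (A : Space N → ℝ) : Prop where
  contDiff : ContDiff ℝ ((k - 1 : ℕ) : WithTop ℕ∞) A
  nonneg : ∀ x, 0 ≤ A x
  bound : ∀ m : ℕ, m ≤ k - 1 → ∀ i : Fin m → Fin N, ∃ C : ℝ, ∀ x,
    |iteratedFDeriv ℝ m A x (fun l => EuclideanSpace.single (i l) (1 : ℝ))|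
      ≤ C * A x ^ (1 - (m : ℝ) / (k : ℝ))
  eq_far : ∀ x, 2 ≤ ‖x‖ → A x = ‖x‖ ^ k

/-! ### The ansatz -/

/-- `J = ⌊(p+1)/(p-1)⌋`. -/
def numSteps (p : ℝ) : ℕ := ⌊(p + 1) / (p - 1)⌋₊

/-- `λ = min (J - 2/(p-1), 1/2)`. -/
def rate (p : ℝ) : ℝ := min ((numSteps p : ℝ) - 2 / (p - 1)) (1 / 2)

/-- `κ = [2(p+1)/(p-1)²]^{1/(p-1)}`. -/
def kappa (p : ℝ) : ℝ := (2 * (p + 1) / (p - 1) ^ 2) ^ (1 / (p - 1))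

/-- `f(u) = |u|^{p-1} u`. -/
def nonlin (p : ℝ) (u : ℝ) : ℝ := |u| ^ (p - 1) * u

/-- `U₀(t,x) = κ (t + A(x))^{-2/(p-1)}`. -/
def ansatzZero {N : ℕ} (p : ℝ) (A : Space N → ℝ) (t : ℝ) (x : Space N) : ℝ :=
  kappa p * (t + A x) ^ (-(2 / (p - 1)))

/-- The error `-∂ₜₜU + ΔU + f(U)` of an approximate solution `U`. -/
def residual {N : ℕ} (p : ℝ) (U : ℝ → Space N → ℝ) (t : ℝ) (x : Space N) : ℝ :=
  -iteratedDeriv 2 (fun s => U s x) t + Laplacian.laplacian (U t) x + nonlin p (U t x)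

/-- The correction
`w = -κ^{(p-1)/2} (p-1)/(3p+1) (U₀^{(p+1)/2} ∫₀ᵗ U₀^{-p} E ds + U₀^{-p} ∫ₜ^τ U₀^{(p+1)/2} E ds)`
associated with an error term `E` and a time `τ`. -/
def correction {N : ℕ} (p : ℝ) (A : Space N → ℝ) (τ : ℝ) (E : ℝ → Space N → ℝ)
    (t : ℝ) (x : Space N) : ℝ :=
  -(kappa p ^ ((p - 1) / 2) * ((p - 1) / (3 * p + 1))) *
    (ansatzZero p A t x ^ ((p + 1) / 2) * (∫ s in (0 : ℝ)..t, ansatzZero p A s x ^ (-p) * E s x)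
      + ansatzZero p A t x ^ (-p) *
        (∫ s in t..τ, ansatzZero p A s x ^ ((p + 1) / 2) * E s x))

/-- The refined ansatz `U_j`: `U_{j+1} = U_j + χ(A/a_{j+1}) w_{j+1}`, where `w_{j+1}` is the
correction associated with the error of `U_j` and the time `t_j`. -/
def ansatz {N : ℕ} (p : ℝ) (χ : ℝ → ℝ) (A : Space N → ℝ) (a τ : ℕ → ℝ) :
    ℕ → ℝ → Space N → ℝ
  | 0 => ansatzZero p A
  | j + 1 => fun t x => ansatz p χ A a τ j t x
      + χ (A x / a (j + 1)) * correction p A (τ j) (residual p (ansatz p χ A a τ j)) t x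

/-- The choice of the parameters `0 < a_J ≤ ⋯ ≤ a_1 ≤ 1` and `0 < t_J ≤ ⋯ ≤ t_1 ≤ t_0 = 1` of the
ansatz: they are small enough that, for `1 ≤ j ≤ J` and `0 < t ≤ t_j`, `U_j` is close to `U_0`. -/
structure IsParameterChoice {N : ℕ} (p : ℝ) (χ : ℝ → ℝ) (A : Space N → ℝ) (a τ : ℕ → ℝ) :
    Prop where
  time_zero : τ 0 = 1
  time_anti : ∀ j, j < numSteps p → τ (j + 1) ≤ τ j
  time_pos : ∀ j ≤ numSteps p, 0 < τ j
  cut_le_one : a 1 ≤ 1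
  cut_anti : ∀ j, 1 ≤ j → j < numSteps p → a (j + 1) ≤ a j
  cut_pos : ∀ j, 1 ≤ j → j ≤ numSteps p → 0 < a j
  close : ∀ j, 1 ≤ j → j ≤ numSteps p → ∀ t ∈ Ioc (0 : ℝ) (τ j), ∀ x : Space N,
    |ansatz p χ A a τ j t x - ansatzZero p A t x|
        ≤ 1 / 4 * (1 - (2 : ℝ)⁻¹ ^ j) * ansatzZero p A t x ∧
    |ansatz p χ A a τ j t x - ansatzZero p A t x|
        ≤ (1 - (2 : ℝ)⁻¹ ^ j) * (1 + ansatzZero p A t x) ^ (-((p - 1) / 2)) * ansatzZero p A t x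

/-! ### The truncated nonlinearity -/

/-- `sup_{t ∈ [T, t_J]} ‖U(t)‖_{L^∞}`. -/
def supNorm {N : ℕ} (U : ℝ → Space N → ℝ) (T tJ : ℝ) : ℝ :=
  (⨆ t ∈ Icc T tJ, eLpNorm (U t) ∞ volume).toReal

/-- `u ↦ f(u) χ(u/B)`. -/
def truncNonlin (p : ℝ) (χ : ℝ → ℝ) (B : ℝ) (u : ℝ) : ℝ := nonlin p u * χ (u / B)

end NLW

end

open NLW

/-!
The proof combines a symbol calculus for the ansatz with a weighted energy estimate.

*The ansatz.* Write `d = t + A(x)` and call `g` a symbol of order `α` (`HasOrder`) if its space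
derivatives of order `m` are `O(d^(α - m/k))`. Since `|∂^β A| ≲ A^(1-|β|/k)`, `d` is a symbol of order
`1`, and a space derivative costs only `1/k` orders. The correction `w_j` solves the linearization
of `∂ₜₜu = f(u)` at `U₀` with right-hand side the previous residual and gains two orders
(`HasOrder.correction`), so the new residual comes from `Δ w_j` and a Taylor remainder and is better
by `2 - 2/k` orders (`IsRegularAnsatz.step`). Small `a_j`, `t_j` make the corrections small against
`U₀` (`exists_parameterChoiceUpTo`). After `J` steps the residual satisfies
`∫ W |ℰ_J|² ≲ t^(-2+λ)` with the weight `W = 1 + d^(-2θ)`, `θ = (p+1)/(p-1)`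
(`exists_residual_weighted_le`).

*The energy.* The error `e = u - U_J` solves `∂ₜₜe - Δe = f'(U₀) e + …`, where
`f'(U₀) = θ (θ + 1) / d²` is critically singular. The functional
`½ ∫ W ((∂ₜe)² + |∇e|² + (f'(U₀) + 1) e²)` has a time derivative whose most singular terms add up to
minus a square (`quadratic_density_le`); the wrong sign of the linear potential is thereby absorbed,
and `∇W`, which is of lower order because `A` is flat, costs an integrable power of `t`. The
nonlinear terms are superlinear but too large where `|e| ≳ U`; there the potential
`F(U+e) - F(U) - f(U) e` is subtracted from the energy, with a smooth cut-off in `e / U`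
(`potential`). What is left of the nonlinearity is `O(U^(p-1-s) |e|^(1+s))` with `0 < s ≤ 1`, which
is subcritical (`abs_sub_potForce_le`, `subcritical_sq_le`). All bounds are uniform in the truncation height
`B_n ≥ U_J` (`IsTruncatedPower`). The terms of size `|e|^(p+1)` are controlled by the energy through
the Sobolev inequality for `W^(1/2) e` (`exists_energy_sobolev`); here `p` is subcritical. The
resulting differential inequality has an integrable singularity at `t = 0`, and a continuity argument
(`exists_bootstrap`) gives an energy `O((t - T_n)^λ)` on an interval of uniform length.

*Weak solutions.* A finite-energy solution is only a continuous curve in `H¹ × L²`, so the energy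
identity with a variable weight is proved in a Hilbert space, by Steklov averages in time
(`IsWeakWave`, `kineticEnergy`), and test functions are dense in `H¹`
(`exists_testFunction_approx`). If `U₀(1)` is not square integrable, there is no finite-energy
solution with the data of the ansatz (`memLp_of_isEnergySolution`), so only the choice of `n₀` and
`δ₀` is at stake; otherwise the ansatz itself is a curve in the energy space.
-/

noncomputable section

namespace NLW

open Real (hasDerivAt_rpow_const mul_rpow norm_eq_abs norm_of_nonneg rpow_add rpow_add_one
  rpow_le_one_of_one_le_of_nonpos rpow_le_rpow rpow_le_rpow_of_exponent_ge rpow_le_rpow_of_nonpos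
  rpow_mul rpow_natCast rpow_neg rpow_nonneg rpow_one rpow_pos_of_pos rpow_two rpow_zero
  zero_rpow)
open Function (update update_of_ne update_self)
open Laplacian (laplacian)

/-! ### Symbols in `t + A(x)` -/

/-- The partial derivative `∂ᵢ f`. -/
def pderiv {N : ℕ} (i : Fin N) (f : Space N → ℝ) (x : Space N) : ℝ :=
  fderiv ℝ f x (EuclideanSpace.single i (1 : ℝ))

/-- Joint continuity on `(0, τ) × ℝ^N` together with the bound `|g| ≤ C (t + A)^α`. -/
def HasOrderZero {N : ℕ} (A : Space N → ℝ) (τ α : ℝ) (g : ℝ → Space N → ℝ) : Prop :=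
  ContinuousOn (fun q : ℝ × Space N => g q.1 q.2) (Ioo 0 τ ×ˢ univ) ∧
    ∃ C : ℝ, 0 < C ∧ ∀ t ∈ Ioo 0 τ, ∀ x, |g t x| ≤ C * (t + A x) ^ α

/-- `g` is a symbol of order `α` on `(0, τ) × ℝ^N` with `n` space derivatives: every space
derivative of order `m ≤ n` is continuous and bounded by a constant times `(t + A)^(α - m δ)`. -/
def HasOrder {N : ℕ} (A : Space N → ℝ) (δ τ : ℝ) : ℕ → ℝ → (ℝ → Space N → ℝ) → Prop
  | 0, α, g => HasOrderZero A τ α g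
  | n + 1, α, g => HasOrderZero A τ α g ∧ (∀ t ∈ Ioo 0 τ, Differentiable ℝ (g t)) ∧
      ∀ i, HasOrder A δ τ n (α - δ) (fun t x => pderiv i (g t) x)

section Symbols

variable {N : ℕ} {A : Space N → ℝ} {δ τ α β : ℝ} {n : ℕ} {g h : ℝ → Space N → ℝ}

lemma HasOrder.zero (hg : HasOrder A δ τ n α g) : HasOrderZero A τ α g := by
  cases n with
  | zero => exact hg
  | succ n => exact hg.1

lemma HasOrder.differentiable (hg : HasOrder A δ τ (n + 1) α g) {t : ℝ} (ht : t ∈ Ioo 0 τ) :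
    Differentiable ℝ (g t) := hg.2.1 t ht

lemma HasOrder.partial_deriv (hg : HasOrder A δ τ (n + 1) α g) (i : Fin N) :
    HasOrder A δ τ n (α - δ) (fun t x => pderiv i (g t) x) := hg.2.2 i

lemma HasOrder.of_succ (hg : HasOrder A δ τ (n + 1) α g) : HasOrder A δ τ n α g := by
  induction n generalizing α g with
  | zero => exact hg.1
  | succ n ih => exact ⟨hg.1, hg.2.1, fun i => ih (hg.2.2 i)⟩

lemma HasOrder.of_le {m : ℕ} (hg : HasOrder A δ τ n α g) (hm : m ≤ n) :
    HasOrder A δ τ m α g := by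
  induction n, hm using Nat.le_induction with
  | base => exact hg
  | succ n _ ih => exact ih hg.of_succ

lemma HasOrderZero.congr (hg : HasOrderZero A τ α g) (e : ∀ t ∈ Ioo 0 τ, ∀ x, h t x = g t x) :
    HasOrderZero A τ α h := by
  obtain ⟨h1, C, hC, h2⟩ := hg
  refine ⟨h1.congr fun q hq => e q.1 hq.1 q.2, C, hC, fun t ht x => ?_⟩
  rw [e t ht x]; exact h2 t ht x

lemma HasOrder.congr (hg : HasOrder A δ τ n α g) (e : ∀ t ∈ Ioo 0 τ, ∀ x, h t x = g t x) :
    HasOrder A δ τ n α h := by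
  induction n generalizing α g h with
  | zero => exact HasOrderZero.congr hg e
  | succ n ih =>
    have e' : ∀ t ∈ Ioo 0 τ, h t = g t := fun t ht => funext (e t ht)
    refine ⟨hg.1.congr e, fun t ht => by rw [e' t ht]; exact hg.2.1 t ht, fun i => ?_⟩
    exact ih (hg.2.2 i) fun t ht x => by rw [e' t ht]

lemma HasOrder.of_eq (hg : HasOrder A δ τ n α g) (e : α = β) : HasOrder A δ τ n β g := e ▸ hg

lemma HasOrder.mono_time {τ' : ℝ} (hg : HasOrder A δ τ n α g) (hτ : τ' ≤ τ) :
    HasOrder A δ τ' n α g := by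
  have hs : Ioo 0 τ' ⊆ Ioo 0 τ := Ioo_subset_Ioo_right hτ
  have h0 : ∀ {α : ℝ} {g : ℝ → Space N → ℝ}, HasOrderZero A τ α g → HasOrderZero A τ' α g := by
    rintro α g ⟨h1, C, hC, h2⟩
    exact ⟨h1.mono (prod_mono hs le_rfl), C, hC, fun t ht x => h2 t (hs ht) x⟩
  induction n generalizing α g with
  | zero => exact h0 hg
  | succ n ih => exact ⟨h0 hg.1, fun t ht => hg.2.1 t (hs ht), fun i => ih (hg.2.2 i)⟩

lemma hasOrder_zero (α : ℝ) (hA : ∀ x, 0 ≤ A x) :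
    HasOrder A δ τ n α (fun _ _ => 0) := by
  have h0 : ∀ α : ℝ, HasOrderZero A τ α (fun _ _ => (0 : ℝ)) := fun α => by
    refine ⟨continuousOn_const, 1, one_pos, fun t ht x => ?_⟩
    rw [abs_zero, one_mul]
    exact rpow_nonneg (add_nonneg ht.1.le (hA x)) _
  induction n generalizing α with
  | zero => exact h0 α
  | succ n ih =>
    refine ⟨h0 α, fun t _ => differentiable_const _, fun i => (ih (α - δ)).congr fun t _ x => ?_⟩
    simp [NLW.pderiv]

lemma hasOrder_const (c : ℝ) (hA : ∀ x, 0 ≤ A x) :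
    HasOrder A δ τ n 0 (fun _ _ => c) := by
  have h0 : HasOrderZero A τ 0 (fun _ _ => c) := by
    refine ⟨continuousOn_const, |c| + 1, by positivity, fun t ht x => ?_⟩
    rw [rpow_zero]; linarith
  cases n with
  | zero => exact h0
  | succ n =>
    refine ⟨h0, fun t _ => differentiable_const _,
      fun i => (hasOrder_zero _ hA).congr fun t _ x => ?_⟩
    simp [NLW.pderiv]

lemma HasOrder.add (hg : HasOrder A δ τ n α g) (hh : HasOrder A δ τ n α h) :
    HasOrder A δ τ n α (fun t x => g t x + h t x) := by
  have h0 : ∀ {α : ℝ} {g h : ℝ → Space N → ℝ}, HasOrderZero A τ α g → HasOrderZero A τ α h →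
      HasOrderZero A τ α (fun t x => g t x + h t x) := by
    rintro α g h ⟨h1, C, hC, h2⟩ ⟨h3, D, hD, h4⟩
    refine ⟨h1.add h3, C + D, by positivity, fun t ht x => (abs_add_le _ _).trans ?_⟩
    rw [add_mul]; exact add_le_add (h2 t ht x) (h4 t ht x)
  induction n generalizing α g h with
  | zero => exact h0 hg hh
  | succ n ih =>
    refine ⟨h0 hg.1 hh.1, fun t ht => (hg.2.1 t ht).add (hh.2.1 t ht), fun i => ?_⟩
    refine (ih (hg.2.2 i) (hh.2.2 i)).congr fun t ht x => ?_
    have := fderiv_fun_add ((hg.2.1 t ht) x) ((hh.2.1 t ht) x)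
    simp only [NLW.pderiv, this, add_apply]

lemma HasOrder.mul (hA : ∀ x, 0 ≤ A x) (hg : HasOrder A δ τ n α g) (hh : HasOrder A δ τ n β h) :
    HasOrder A δ τ n (α + β) (fun t x => g t x * h t x) := by
  have h0 : ∀ {α β : ℝ} {g h : ℝ → Space N → ℝ}, HasOrderZero A τ α g → HasOrderZero A τ β h →
      HasOrderZero A τ (α + β) (fun t x => g t x * h t x) := by
    rintro α β g h ⟨h1, C, hC, h2⟩ ⟨h3, D, hD, h4⟩
    refine ⟨h1.mul h3, C * D, by positivity, fun t ht x => ?_⟩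
    have hd : 0 < t + A x := add_pos_of_pos_of_nonneg ht.1 (hA x)
    rw [abs_mul, rpow_add hd]
    calc |g t x| * |h t x| ≤ (C * (t + A x) ^ α) * (D * (t + A x) ^ β) :=
          mul_le_mul (h2 t ht x) (h4 t ht x) (abs_nonneg _) (by positivity)
      _ = _ := by ring
  induction n generalizing α β g h with
  | zero => exact h0 hg hh
  | succ n ih =>
    refine ⟨h0 hg.1 hh.1, fun t ht => (hg.2.1 t ht).mul (hh.2.1 t ht), fun i => ?_⟩
    refine (((ih (hg.2.2 i) hh.of_succ).of_eq (β := α + β - δ) (by ring)).add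
      ((ih hg.of_succ (hh.2.2 i)).of_eq (by ring))).congr fun t ht x => ?_
    have := fderiv_fun_mul ((hg.2.1 t ht) x) ((hh.2.1 t ht) x)
    simp only [NLW.pderiv, this, add_apply, smul_apply,
      smul_eq_mul]
    ring

lemma HasOrder.const_mul (hA : ∀ x, 0 ≤ A x) (c : ℝ) (hg : HasOrder A δ τ n α g) :
    HasOrder A δ τ n α (fun t x => c * g t x) :=
  ((hasOrder_const c hA).mul hA hg).of_eq (zero_add α)

lemma HasOrder.neg (hA : ∀ x, 0 ≤ A x) (hg : HasOrder A δ τ n α g) :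
    HasOrder A δ τ n α (fun t x => - g t x) :=
  (hg.const_mul hA (-1)).congr fun t _ x => by ring

lemma HasOrder.sub (hA : ∀ x, 0 ≤ A x) (hg : HasOrder A δ τ n α g) (hh : HasOrder A δ τ n α h) :
    HasOrder A δ τ n α (fun t x => g t x - h t x) :=
  (hg.add (hh.neg hA)).congr fun t _ x => by ring

lemma HasOrder.sum (hA : ∀ x, 0 ≤ A x) {ι : Type*} (s : Finset ι) {G : ι → ℝ → Space N → ℝ}
    (hG : ∀ i ∈ s, HasOrder A δ τ n α (G i)) :
    HasOrder A δ τ n α (fun t x => ∑ i ∈ s, G i t x) := by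
  classical
  induction s using Finset.induction_on with
  | empty => simpa using hasOrder_zero α hA
  | insert a s ha ih =>
    refine ((hG a (Finset.mem_insert_self a s)).add
      (ih fun i hi => hG i (Finset.mem_insert_of_mem hi))).congr fun t _ x => ?_
    rw [Finset.sum_insert ha]

/-- Real powers of a symbol that is bounded below by a multiple of its weight. -/
lemma HasOrder.rpow (hA : ∀ x, 0 ≤ A x) {c : ℝ} (hc : 0 < c)
    (hg : HasOrder A δ τ n α g) (hlow : ∀ t ∈ Ioo 0 τ, ∀ x, c * (t + A x) ^ α ≤ g t x) (q : ℝ) :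
    HasOrder A δ τ n (α * q) (fun t x => g t x ^ q) := by
  have hpos : ∀ t ∈ Ioo 0 τ, ∀ x, 0 < g t x := fun t ht x => by
    have hd : 0 < t + A x := add_pos_of_pos_of_nonneg ht.1 (hA x)
    exact lt_of_lt_of_le (by positivity) (hlow t ht x)
  have h0 : ∀ q : ℝ, HasOrderZero A τ (α * q) (fun t x => g t x ^ q) := by
    intro q
    obtain ⟨h1, C, hC, h2⟩ := hg.zero
    refine ⟨h1.rpow_const fun y hy => Or.inl (hpos y.1 hy.1 y.2).ne', C ^ q + c ^ q,
      by positivity, fun t ht x => ?_⟩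
    have hd : 0 < t + A x := add_pos_of_pos_of_nonneg ht.1 (hA x)
    have hgp := hpos t ht x
    rw [abs_of_pos (rpow_pos_of_pos hgp q), rpow_mul hd.le]
    have hup : g t x ≤ C * (t + A x) ^ α := (le_abs_self _).trans (h2 t ht x)
    have hlo := hlow t ht x
    have hdq : 0 < (t + A x) ^ α := rpow_pos_of_pos hd α
    rcases le_total 0 q with hq | hq
    · calc g t x ^ q ≤ (C * (t + A x) ^ α) ^ q := rpow_le_rpow hgp.le hup hq
        _ = C ^ q * ((t + A x) ^ α) ^ q := mul_rpow hC.le hdq.le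
        _ ≤ _ := by gcongr; linarith [rpow_pos_of_pos hc q]
    · calc g t x ^ q ≤ (c * (t + A x) ^ α) ^ q :=
            rpow_le_rpow_of_nonpos (by positivity) hlo hq
        _ = c ^ q * ((t + A x) ^ α) ^ q := mul_rpow hc.le hdq.le
        _ ≤ _ := by gcongr; linarith [rpow_pos_of_pos hC q]
  suffices H : ∀ m ≤ n, ∀ q : ℝ, HasOrder A δ τ m (α * q) (fun t x => g t x ^ q) from
    H n le_rfl q
  intro m
  induction m with
  | zero => exact fun _ q => h0 q
  | succ m ih =>
    intro hm q
    have hgm := hg.of_le hm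
    refine ⟨h0 q, fun t ht => (hgm.2.1 t ht).rpow_const fun x => Or.inl (hpos t ht x).ne',
      fun i => ?_⟩
    refine ((((ih (by omega) (q - 1)).const_mul hA q).mul hA (hgm.2.2 i)).of_eq
      (β := α * q - δ) (by ring)).congr fun t ht x => ?_
    have := (((hgm.2.1 t ht) x).hasFDerivAt.rpow_const (p := q) (Or.inl (hpos t ht x).ne')).fderiv
    simp only [NLW.pderiv, this, smul_apply, smul_eq_mul]

lemma exists_abs_rpow_sub_le (q : ℝ) : ∃ C : ℝ, 0 < C ∧ ∀ a ∈ Icc (3 / 4 : ℝ) (5 / 4),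
    ∀ b ∈ Icc (3 / 4 : ℝ) (5 / 4), |a ^ q - b ^ q| ≤ C * |a - b| := by
  have hcont : ContinuousOn (fun a : ℝ => |q * a ^ (q - 1)|) (Icc (3 / 4 : ℝ) (5 / 4)) :=
    (continuousOn_const.mul (continuousOn_id.rpow_const fun y hy =>
      Or.inl (by have := hy.1; simp only [id]; linarith))).abs
  obtain ⟨C, hC⟩ := isCompact_Icc.bddAbove_image hcont
  refine ⟨max C 1, by positivity, fun a ha b hb => ?_⟩
  exact Convex.norm_image_sub_le_of_norm_hasDerivWithin_le (f := fun a : ℝ => a ^ q)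
    (fun y hy => (hasDerivAt_rpow_const (Or.inl (by have := hy.1; linarith))).hasDerivWithinAt)
    (fun y hy => (hC (mem_image_of_mem _ hy)).trans (le_max_left _ _)) (convex_Icc _ _) hb ha

/-- Difference of the `q`-th powers of two symbols of order `0` with values in `[3/4, 5/4]`. -/
lemma HasOrder.rpow_sub_rpow (hA : ∀ x, 0 ≤ A x) {γ : ℝ} (hg : HasOrder A δ τ n 0 g)
    (hh : HasOrder A δ τ n 0 h) (hgm : ∀ t ∈ Ioo 0 τ, ∀ x, g t x ∈ Icc (3 / 4 : ℝ) (5 / 4))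
    (hhm : ∀ t ∈ Ioo 0 τ, ∀ x, h t x ∈ Icc (3 / 4 : ℝ) (5 / 4))
    (hd : HasOrder A δ τ n γ (fun t x => g t x - h t x)) (q : ℝ) :
    HasOrder A δ τ n γ (fun t x => g t x ^ q - h t x ^ q) := by
  have hrp : ∀ {f : ℝ → Space N → ℝ}, HasOrder A δ τ n 0 f →
      (∀ t ∈ Ioo 0 τ, ∀ x, f t x ∈ Icc (3 / 4 : ℝ) (5 / 4)) → ∀ q : ℝ,
      HasOrder A δ τ n 0 (fun t x => f t x ^ q) := fun hf hfm q =>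
    (hf.rpow hA (c := 3 / 4) (by norm_num)
      (fun t ht x => by rw [rpow_zero, mul_one]; exact (hfm t ht x).1) q).of_eq (zero_mul q)
  have h0 : ∀ q : ℝ, HasOrderZero A τ γ (fun t x => g t x ^ q - h t x ^ q) := by
    intro q
    obtain ⟨C, hC, hL⟩ := exists_abs_rpow_sub_le q
    obtain ⟨h1, D, hD, h2⟩ := hd.zero
    refine ⟨(hrp hg hgm q).zero.1.sub (hrp hh hhm q).zero.1, C * D, by positivity,
      fun t ht x => ?_⟩
    calc _ ≤ C * |g t x - h t x| := hL _ (hgm t ht x) _ (hhm t ht x)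
      _ ≤ C * (D * (t + A x) ^ γ) := by gcongr; exact h2 t ht x
      _ = _ := by ring
  suffices H : ∀ m ≤ n, ∀ q : ℝ, HasOrder A δ τ m γ (fun t x => g t x ^ q - h t x ^ q) from
    H n le_rfl q
  intro m
  induction m with
  | zero => exact fun _ q => h0 q
  | succ m ih =>
    intro hm q
    have hgm' := hg.of_le hm
    have hhm' := hh.of_le hm
    have hdm := hd.of_le hm
    have hg0 : ∀ t ∈ Ioo 0 τ, ∀ x, g t x ≠ 0 := fun t ht x => by have := (hgm t ht x).1; linarith
    have hh0 : ∀ t ∈ Ioo 0 τ, ∀ x, h t x ≠ 0 := fun t ht x => by have := (hhm t ht x).1; linarith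
    refine ⟨h0 q, fun t ht => ((hgm'.2.1 t ht).rpow_const fun x => Or.inl (hg0 t ht x)).sub
      ((hhm'.2.1 t ht).rpow_const fun x => Or.inl (hh0 t ht x)), fun i => ?_⟩
    -- `∂(g^q - h^q) = q g^(q-1) ∂(g - h) + q (g^(q-1) - h^(q-1)) ∂h`
    refine ((((((hrp hg hgm (q - 1)).of_le (by omega)).const_mul hA q).mul hA
        (hdm.2.2 i)).of_eq (β := γ - δ) (by ring)).add
      ((((ih (by omega) (q - 1)).const_mul hA q).mul hA (hhm'.2.2 i)).of_eq (by ring))).congr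
      fun t ht x => ?_
    have e1 := ((hgm'.2.1 t ht) x).hasFDerivAt.rpow_const (p := q) (Or.inl (hg0 t ht x))
    have e2 := ((hhm'.2.1 t ht) x).hasFDerivAt.rpow_const (p := q) (Or.inl (hh0 t ht x))
    have e3 := ((hgm'.2.1 t ht) x).hasFDerivAt.fun_sub ((hhm'.2.1 t ht) x).hasFDerivAt
    simp only [NLW.pderiv, (e1.fun_sub e2).fderiv, e3.fderiv, smul_apply,
      sub_apply, smul_eq_mul]
    ring

/-- The second order Taylor remainder of `y ↦ y^p` at two symbols of order `0` close to `1`. -/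
lemma HasOrder.rpow_remainder (hA : ∀ x, 0 ≤ A x) {γ σ : ℝ} (hg : HasOrder A δ τ n 0 g)
    (hh : HasOrder A δ τ n 0 h) (hgm : ∀ t ∈ Ioo 0 τ, ∀ x, g t x ∈ Icc (3 / 4 : ℝ) (5 / 4))
    (hhm : ∀ t ∈ Ioo 0 τ, ∀ x, h t x ∈ Icc (3 / 4 : ℝ) (5 / 4))
    (hd : HasOrder A δ τ n γ (fun t x => g t x - h t x))
    (hg1 : HasOrder A δ τ n σ (fun t x => g t x - 1))
    (hh1 : HasOrder A δ τ n σ (fun t x => h t x - 1)) (q : ℝ) :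
    HasOrder A δ τ n (γ + σ)
      (fun t x => g t x ^ q - h t x ^ q - q * (g t x - h t x)) := by
  have one : HasOrder A δ τ n 0 (fun _ _ => (1 : ℝ)) := hasOrder_const 1 hA
  have onem : ∀ t ∈ Ioo 0 τ, ∀ x : Space N, (fun _ _ => (1 : ℝ)) t x ∈ Icc (3 / 4 : ℝ) (5 / 4) :=
    fun _ _ _ => by norm_num
  have h0 : HasOrderZero A τ (γ + σ)
      (fun t x => g t x ^ q - h t x ^ q - q * (g t x - h t x)) := by
    obtain ⟨C, hC, hL⟩ := exists_abs_rpow_sub_le (q - 1)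
    obtain ⟨-, D, hD, h2⟩ := hd.zero
    obtain ⟨-, D1, hD1, h3⟩ := hg1.zero
    obtain ⟨-, D2, hD2, h4⟩ := hh1.zero
    refine ⟨((hg.rpow_sub_rpow hA hh hgm hhm hd q).sub hA (hd.const_mul hA q)).zero.1,
      (|q| + 1) * (C * (D1 + D2)) * D, by positivity, fun t ht x => ?_⟩
    have hdp : 0 < t + A x := add_pos_of_pos_of_nonneg ht.1 (hA x)
    have key : ∀ a ∈ Icc (3 / 4 : ℝ) (5 / 4), ∀ b ∈ Icc (3 / 4 : ℝ) (5 / 4),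
        |a ^ q - b ^ q - q * (a - b)| ≤ |q| * (C * (|a - 1| + |b - 1|)) * |a - b| := by
      intro a ha b hb
      have hsub : uIcc b a ⊆ Icc (3 / 4 : ℝ) (5 / 4) := uIcc_subset_Icc hb ha
      have := Convex.norm_image_sub_le_of_norm_hasDerivWithin_le
        (f := fun a : ℝ => a ^ q - q * a)
        (f' := fun a => q * a ^ (q - 1) - q * 1) (C := |q| * (C * (|a - 1| + |b - 1|)))
        (s := uIcc b a)
        (fun y hy => (((hasDerivAt_rpow_const
          (Or.inl (by have := (hsub hy).1; linarith))).sub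
            ((hasDerivAt_id y).const_mul q))).hasDerivWithinAt)
        (fun y hy => by
          have h5 := hL y (hsub hy) 1 (by norm_num)
          rw [Real.one_rpow] at h5
          have h6 : |y - 1| ≤ |a - 1| + |b - 1| := by
            rcases mem_uIcc.1 hy with hy | hy
            · exact (abs_le_max_abs_abs (sub_le_sub_right hy.1 1) (sub_le_sub_right hy.2 1)).trans
                (max_le (by linarith [abs_nonneg (a - 1)]) (by linarith [abs_nonneg (b - 1)]))
            · exact (abs_le_max_abs_abs (sub_le_sub_right hy.1 1) (sub_le_sub_right hy.2 1)).trans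
                (max_le (by linarith [abs_nonneg (b - 1)]) (by linarith [abs_nonneg (a - 1)]))
          rw [norm_eq_abs, ← mul_sub, abs_mul]
          gcongr
          exact h5.trans (by gcongr))
        (convex_uIcc _ _) left_mem_uIcc right_mem_uIcc
      simp only [norm_eq_abs] at this
      calc _ = |a ^ q - q * a - (b ^ q - q * b)| := by congr 1; ring
        _ ≤ _ := this
    refine (key _ (hgm t ht x) _ (hhm t ht x)).trans ?_
    rw [rpow_add hdp]
    calc _ ≤ |q| * (C * (D1 * (t + A x) ^ σ + D2 * (t + A x) ^ σ)) * (D * (t + A x) ^ γ) := by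
          gcongr
          · exact h3 t ht x
          · exact h4 t ht x
          · exact h2 t ht x
      _ ≤ (|q| + 1) * (C * (D1 * (t + A x) ^ σ + D2 * (t + A x) ^ σ)) * (D * (t + A x) ^ γ) := by
          gcongr; linarith
      _ = _ := by ring
  cases n with
  | zero => exact h0
  | succ n =>
    have hg0 : ∀ t ∈ Ioo 0 τ, ∀ x, g t x ≠ 0 := fun t ht x => by have := (hgm t ht x).1; linarith
    have hh0 : ∀ t ∈ Ioo 0 τ, ∀ x, h t x ≠ 0 := fun t ht x => by have := (hhm t ht x).1; linarith
    have d1 : HasOrder A δ τ (n + 1) σ (fun t x => g t x ^ (q - 1) - 1) :=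
      (hg.rpow_sub_rpow hA one hgm onem hg1 (q - 1)).congr fun t _ x => by rw [Real.one_rpow]
    have d2 := hg.rpow_sub_rpow hA hh hgm hhm hd (q - 1)
    have hh' : ∀ i, HasOrder A δ τ n (σ - δ) (fun t x => pderiv i (h t) x) := fun i =>
      (hh1.2.2 i).congr fun t ht x => by
        simp only [NLW.pderiv, fderiv_sub_const]
    refine ⟨h0, fun t ht => ?_, fun i => ?_⟩
    · exact (((hg.2.1 t ht).rpow_const fun x => Or.inl (hg0 t ht x)).sub
        ((hh.2.1 t ht).rpow_const fun x => Or.inl (hh0 t ht x))).sub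
        (((hg.2.1 t ht).sub (hh.2.1 t ht)).const_mul q)
    -- `∂(g^q - h^q - q (g - h)) = q (g^(q-1) - 1) ∂(g - h) + q (g^(q-1) - h^(q-1)) ∂h`
    refine (((((d1.of_succ).const_mul hA q).mul hA
        (hd.2.2 i)).of_eq (β := γ + σ - δ) (by ring)).add
      (((d2.of_succ.const_mul hA q).mul hA (hh' i)).of_eq (by ring))).congr
      fun t ht x => ?_
    have e1 := ((hg.2.1 t ht) x).hasFDerivAt.rpow_const (p := q) (Or.inl (hg0 t ht x))
    have e2 := ((hh.2.1 t ht) x).hasFDerivAt.rpow_const (p := q) (Or.inl (hh0 t ht x))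
    have e3 := ((hg.2.1 t ht) x).hasFDerivAt.fun_sub ((hh.2.1 t ht) x).hasFDerivAt
    simp only [NLW.pderiv, ((e1.fun_sub e2).fun_sub (e3.const_mul q)).fderiv, e3.fderiv,
      smul_apply, sub_apply, smul_eq_mul]
    ring

end Symbols

/-! ### Powers, products and derivatives of symbols -/

section SymbolsTwo

variable {N : ℕ} {A : Space N → ℝ} {δ τ α β : ℝ} {n : ℕ} {g h : ℝ → Space N → ℝ}

/-- A linear functional on `ℝ^N` in terms of its values on the standard basis. -/
lemma clm_eq_sum (L : Space N →L[ℝ] ℝ) :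
    L = ∑ i, L (EuclideanSpace.single i (1 : ℝ)) • (EuclideanSpace.proj i : Space N →L[ℝ] ℝ) := by
  ext v
  conv_lhs => rw [← (EuclideanSpace.basisFun (Fin N) ℝ).sum_repr v]
  simp [mul_comm]

lemma norm_clm_le_sum (L : Space N →L[ℝ] ℝ) :
    ‖L‖ ≤ ∑ i, |L (EuclideanSpace.single i (1 : ℝ))| := by
  conv_lhs => rw [clm_eq_sum L]
  refine (norm_sum_le _ _).trans (Finset.sum_le_sum fun i _ => ?_)
  rw [norm_smul, norm_eq_abs]
  refine mul_le_of_le_one_right (abs_nonneg _) ?_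
  refine ContinuousLinearMap.opNorm_le_bound _ zero_le_one fun v => ?_
  rw [one_mul]
  exact EuclideanSpace.norm_eq v ▸ PiLp.norm_apply_le v i

lemma HasOrder.continuousOn_fderiv (hg : HasOrder A δ τ (n + 1) α g) :
    ContinuousOn (fun q : ℝ × Space N => fderiv ℝ (g q.1) q.2) (Ioo 0 τ ×ˢ univ) := by
  have : (fun q : ℝ × Space N => fderiv ℝ (g q.1) q.2) = fun q => ∑ i, NLW.pderiv i (g q.1) q.2 •
      (EuclideanSpace.proj i : Space N →L[ℝ] ℝ) := funext fun q => clm_eq_sum _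
  rw [this]
  exact continuousOn_finsetSum _ fun i _ => (hg.2.2 i).zero.1.smul continuousOn_const

lemma HasOrderZero.continuous (hg : HasOrderZero A τ α g) {t : ℝ} (ht : t ∈ Ioo 0 τ) :
    Continuous (g t) :=
  continuousOn_univ.1 (hg.1.comp (f := fun x : Space N => (t, x))
    (continuous_const.prodMk continuous_id).continuousOn fun x _ => ⟨ht, mem_univ x⟩)

lemma HasOrderZero.continuousOn_time (hg : HasOrderZero A τ α g) (x : Space N) :
    ContinuousOn (fun t => g t x) (Ioo 0 τ) :=
  hg.1.comp (f := fun t : ℝ => (t, x))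
    (continuous_id.prodMk continuous_const).continuousOn fun t ht => ⟨ht, mem_univ x⟩

lemma HasOrder.continuous_fderiv (hg : HasOrder A δ τ (n + 1) α g) {t : ℝ} (ht : t ∈ Ioo 0 τ) :
    Continuous (fderiv ℝ (g t)) :=
  continuousOn_univ.1 (hg.continuousOn_fderiv.comp (f := fun x : Space N => (t, x))
    (continuous_const.prodMk continuous_id).continuousOn fun x _ => ⟨ht, mem_univ x⟩)

lemma HasOrder.differentiable_fderiv (hg : HasOrder A δ τ (n + 2) α g) {t : ℝ}
    (ht : t ∈ Ioo 0 τ) : Differentiable ℝ (fderiv ℝ (g t)) := by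
  have : fderiv ℝ (g t) = fun x => ∑ i, NLW.pderiv i (g t) x •
      (EuclideanSpace.proj i : Space N →L[ℝ] ℝ) := funext fun q => clm_eq_sum _
  rw [this]
  exact Differentiable.fun_sum fun i _ => ((hg.2.2 i).2.1 t ht).smul_const _

lemma HasOrder.laplacian_eq (hg : HasOrder A δ τ (n + 2) α g) {t : ℝ}
    (ht : t ∈ Ioo 0 τ) (x : Space N) :
    laplacian (g t) x = ∑ i, NLW.pderiv i (NLW.pderiv i (g t)) x := by
  rw [InnerProductSpace.laplacian_eq_iteratedFDeriv_orthonormalBasis _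
    (EuclideanSpace.basisFun (Fin N) ℝ)]
  refine Finset.sum_congr rfl fun i _ => ?_
  rw [iteratedFDeriv_two_apply]
  simp only [Matrix.cons_val_zero, Matrix.cons_val_one, EuclideanSpace.basisFun_apply]
  have h1 := (hg.differentiable_fderiv ht x).hasFDerivAt.clm_apply
    (hasFDerivAt_const (EuclideanSpace.single i (1 : ℝ)) x)
  have h2 : NLW.pderiv i (g t) = fun y => fderiv ℝ (g t) y (EuclideanSpace.single i (1 : ℝ)) := rfl
  rw [h2, NLW.pderiv, h1.fderiv]
  simp

lemma HasOrder.laplacian (hA : ∀ x, 0 ≤ A x) (hg : HasOrder A δ τ (n + 2) α g) :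
    HasOrder A δ τ n (α - 2 * δ) (fun t x => laplacian (g t) x) :=
  ((HasOrder.sum hA Finset.univ fun i _ => (hg.2.2 i).2.2 i).of_eq (by ring)).congr
    fun _ ht x => hg.laplacian_eq ht x

/-- The distance `t + A` is a symbol of order `1`. -/
lemma hasOrder_shape {k : ℕ} (hk : 1 ≤ k) (hA : IsBlowUpShape k A) :
    HasOrder A (1 / k) τ (k - 1) 1 (fun t x => t + A x) := by
  have hk0 : (0 : ℝ) < k := by exact_mod_cast hk
  have hAc : Continuous A := hA.contDiff.continuous
  have partialA : ∀ n m : ℕ, n + m ≤ k - 1 → 1 ≤ m → ∀ i : Fin m → Fin N,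
      HasOrder A (1 / k) τ n (1 - m * (1 / (k : ℝ))) (fun _ x =>
        iteratedFDeriv ℝ m A x (fun l => EuclideanSpace.single (i l) (1 : ℝ))) := by
    have h0 : ∀ m : ℕ, m ≤ k - 1 → ∀ i : Fin m → Fin N,
        HasOrderZero A τ (1 - m * (1 / (k : ℝ))) (fun _ x =>
        iteratedFDeriv ℝ m A x (fun l => EuclideanSpace.single (i l) (1 : ℝ))) := by
      intro m hm i
      obtain ⟨C, hC⟩ := hA.bound m hm i
      have hc : Continuous fun x => iteratedFDeriv ℝ m A x
          (fun l => EuclideanSpace.single (i l) (1 : ℝ)) :=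
        (continuous_eval_const _).comp
          (hA.contDiff.continuous_iteratedFDeriv (by exact_mod_cast hm))
      refine ⟨(hc.comp continuous_snd).continuousOn, |C| + 1, by positivity, fun t ht x => ?_⟩
      have hm' : (m : ℝ) ≤ k := by exact_mod_cast (by omega : m ≤ k)
      calc _ ≤ C * A x ^ (1 - (m : ℝ) / (k : ℝ)) := hC x
        _ ≤ (|C| + 1) * A x ^ (1 - (m : ℝ) / (k : ℝ)) := by
          have := hA.nonneg x
          gcongr; linarith [le_abs_self C]
        _ ≤ _ := by
          rw [mul_one_div]
          have := hA.nonneg x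
          have : 0 ≤ 1 - (m : ℝ) / k := by rw [sub_nonneg, div_le_one hk0]; exact hm'
          gcongr; linarith [ht.1]
    intro n
    induction n with
    | zero => exact fun m hm _ i => h0 m (by omega) i
    | succ n ih =>
      intro m hm h1 i
      have hd : Differentiable ℝ (iteratedFDeriv ℝ m A) :=
        hA.contDiff.differentiable_iteratedFDeriv (by exact_mod_cast (by omega : m < k - 1))
      refine ⟨h0 m (by omega) i, fun t _ => ?_, fun j => ?_⟩
      · exact fun x => ((hd x).hasFDerivAt.continuousMultilinear_apply_const _).differentiableAt
      refine ((ih (m + 1) (by omega) (by omega) (Fin.cons j i)).of_eq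
        (by push_cast; ring)).congr fun t _ x => ?_
      rw [NLW.pderiv, ((hd x).hasFDerivAt.continuousMultilinear_apply_const _).fderiv,
        iteratedFDeriv_succ_apply_left]
      simp only [Fin.cons_zero]
      rfl
  have h0 : HasOrderZero A τ 1 (fun t x => t + A x) := by
    refine ⟨(continuous_fst.add (hAc.comp continuous_snd)).continuousOn, 1, one_pos,
      fun t ht x => ?_⟩
    rw [rpow_one, one_mul, abs_of_nonneg (add_nonneg ht.1.le (hA.nonneg x))]
  rcases hn : k - 1 with _ | n
  · exact h0
  · have hd : Differentiable ℝ A := hA.contDiff.differentiable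
      (by rw [hn]; exact_mod_cast Nat.succ_ne_zero n)
    refine ⟨h0, fun t _ => hd.const_add t, fun j => ?_⟩
    refine ((partialA n 1 (by omega) le_rfl (fun _ => j)).of_eq (by push_cast; ring)).congr
      fun t _ x => ?_
    rw [iteratedFDeriv_one_apply, NLW.pderiv, fderiv_const_add]

/-- Smooth functions of `A / a` which vanish for `A > 2 a` are symbols of every nonpositive order,
and those which moreover vanish for `|A| < a` are symbols of every order. -/
lemma hasOrder_cutoff {k : ℕ} (hk : 1 ≤ k) (hA : IsBlowUpShape k A) {a : ℝ} (ha : 0 < a)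
    (hτ : 0 < τ) {χ : ℝ → ℝ} (hχ : ContDiff ℝ ∞ χ) (h2 : ∀ s, 2 < s → χ s = 0) {γ : ℝ}
    (h1 : γ ≤ 0 ∨ ∀ s ∈ Ioo (-1 : ℝ) 1, χ s = 0) :
    HasOrder A (1 / k) τ (k - 1) γ (fun _ x => χ (A x / a)) := by
  have hAc : Continuous A := hA.contDiff.continuous
  have h0 : ∀ χ : ℝ → ℝ, ContDiff ℝ ∞ χ → (∀ s, 2 < s → χ s = 0) → ∀ γ : ℝ,
      (γ ≤ 0 ∨ ∀ s ∈ Ioo (-1 : ℝ) 1, χ s = 0) → HasOrderZero A τ γ (fun _ x => χ (A x / a)) := by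
    intro χ hχ h2 γ h1
    obtain ⟨C, hC⟩ := isCompact_Icc.bddAbove_image
      (hχ.continuous.abs.continuousOn (s := Icc (0 : ℝ) 2))
    set c : ℝ := min (a ^ γ) ((2 * a + τ) ^ γ) with hc
    have hcpos : 0 < c := lt_min (by positivity) (by positivity)
    refine ⟨((hχ.continuous.comp (hAc.div_const a)).comp continuous_snd).continuousOn,
      (|C| + 1) / c, by positivity, fun t ht x => ?_⟩
    have hd : 0 < t + A x := add_pos_of_pos_of_nonneg ht.1 (hA.nonneg x)
    by_cases hz : χ (A x / a) = 0
    · simp only [hz, abs_zero]; positivity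
    have hle : A x / a ≤ 2 := not_lt.1 fun hlt => hz (h2 _ hlt)
    have hle' : A x ≤ 2 * a := (div_le_iff₀ ha).1 hle
    have hcd : c ≤ (t + A x) ^ γ := by
      rcases le_total γ 0 with hγ | hγ
      · exact (min_le_right _ _).trans
          (rpow_le_rpow_of_nonpos hd (by linarith [ht.2]) hγ)
      · rcases h1 with h1 | h1
        · rw [le_antisymm h1 hγ] at hc ⊢; simp [hc]
        · have : 1 ≤ A x / a := not_lt.1 fun hlt => hz (h1 _ ⟨by linarith [div_nonneg (hA.nonneg x) ha.le], hlt⟩)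
          rw [le_div_iff₀ ha] at this
          exact (min_le_left _ _).trans (rpow_le_rpow ha.le (by linarith [ht.1]) hγ)
    calc |χ (A x / a)| ≤ C := hC ⟨A x / a, ⟨div_nonneg (hA.nonneg x) ha.le, hle⟩, rfl⟩
      _ ≤ |C| + 1 := by linarith [le_abs_self C]
      _ = (|C| + 1) / c * c := by field_simp
      _ ≤ _ := by gcongr
  suffices H : ∀ n ≤ k - 1, ∀ χ : ℝ → ℝ, ContDiff ℝ ∞ χ → (∀ s, 2 < s → χ s = 0) → ∀ γ : ℝ,
      (γ ≤ 0 ∨ ∀ s ∈ Ioo (-1 : ℝ) 1, χ s = 0) → HasOrder A (1 / k) τ n γ (fun _ x => χ (A x / a)) from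
    H _ le_rfl χ hχ h2 γ h1
  intro n
  induction n with
  | zero => exact fun _ χ hχ h2 γ h1 => h0 χ hχ h2 γ h1
  | succ n ih =>
    intro hn χ hχ h2 γ h1
    have hsh := (hasOrder_shape (τ := τ) hk hA).of_le hn
    have hdA : Differentiable ℝ A := fun x => by
      have := (hA.contDiff.of_le (m := 1) (by exact_mod_cast (by omega : 1 ≤ k - 1)))
      exact this.differentiable (by norm_num) x
    have hχd : Differentiable ℝ χ := hχ.differentiable (by simp)
    refine ⟨h0 χ hχ h2 γ h1, fun t _ => hχd.comp (by simpa [div_eq_mul_inv] using hdA.mul_const a⁻¹), fun i => ?_⟩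
    have hdχ : ContDiff ℝ ∞ (deriv χ) := hχ.iterate_deriv 1
    have z2 : ∀ s, 2 < s → deriv χ s = 0 := fun s hs => by
      have : χ =ᶠ[𝓝 s] fun _ => 0 := by
        filter_upwards [lt_mem_nhds hs] with y hy using h2 y hy
      rw [this.deriv_eq, deriv_const]
    have z1 : γ - 1 ≤ 0 ∨ ∀ s ∈ Ioo (-1 : ℝ) 1, deriv χ s = 0 := by
      rcases h1 with h1 | h1
      · exact Or.inl (by linarith)
      · refine Or.inr fun s hs => ?_
        have : χ =ᶠ[𝓝 s] fun _ => 0 := by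
          filter_upwards [isOpen_Ioo.mem_nhds hs] with y hy using h1 y hy
        rw [this.deriv_eq, deriv_const]
    refine ((((ih (by omega) _ hdχ z2 _ z1).const_mul hA.nonneg a⁻¹).mul hA.nonneg
      (hsh.2.2 i)).of_eq (by ring)).congr fun t ht x => ?_
    have e := ((hχd (A x / a)).hasDerivAt.comp_hasFDerivAt x
      ((hdA x).hasFDerivAt.mul_const a⁻¹)).fderiv
    have e' : (fun y => χ (A y / a)) = χ ∘ fun y => A y * a⁻¹ := by
      funext y; simp [div_eq_mul_inv]
    rw [e', NLW.pderiv, e]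
    simp only [NLW.pderiv, fderiv_const_add, smul_apply, smul_eq_mul]
    ring

lemma hasOrder_one_sub_cutoff {k : ℕ} (hk : 1 ≤ k) (hA : IsBlowUpShape k A) {a : ℝ} (ha : 0 < a)
    (hτ : 0 < τ) {χ : ℝ → ℝ} (hχ : IsCutoff χ) {γ : ℝ} (hγ : 0 ≤ γ) :
    HasOrder A (1 / k) τ (k - 1) γ (fun _ x => 1 - χ (A x / a)) := by
  have hc := hasOrder_cutoff hk hA ha hτ hχ.smooth (fun s hs => hχ.eq_zero s hs.le)
    (γ := 0) (Or.inl le_rfl)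
  have h1 : HasOrder A (1 / k) τ (k - 1) 0 (fun _ x => 1 - χ (A x / a)) :=
    (hasOrder_const 1 hA.nonneg).sub hA.nonneg hc
  have h0 : HasOrderZero A τ γ (fun _ x => 1 - χ (A x / a)) := by
    refine ⟨h1.zero.1, a⁻¹ ^ γ, by positivity, fun t ht x => ?_⟩
    have hd : 0 < t + A x := add_pos_of_pos_of_nonneg ht.1 (hA.nonneg x)
    have hs : 0 ≤ A x / a := div_nonneg (hA.nonneg x) ha.le
    rcases le_total (A x / a) 1 with h | h
    · simp only [hχ.eq_one _ ⟨hs, h⟩, sub_self, abs_zero]; positivity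
    · have := hχ.mem_Icc _ hs
      rw [abs_of_nonneg (by linarith [this.2]), ← mul_rpow (by positivity) hd.le]
      refine (by linarith [this.1] : 1 - χ (A x / a) ≤ 1).trans (Real.one_le_rpow ?_ hγ)
      rw [le_div_iff₀ ha, one_mul] at h
      rw [← div_eq_inv_mul, le_div_iff₀ ha]; linarith [ht.1]
  rcases hn : k - 1 with _ | n
  · exact h0
  rw [hn] at hc h1
  refine ⟨h0, h1.2.1, fun i => ?_⟩
  -- only the derivative of the cut-off matters, and it is supported in `a ≤ A ≤ 2 a`
  have z2 : ∀ s, 2 < s → deriv χ s = 0 := fun s hs => by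
    have : χ =ᶠ[𝓝 s] fun _ => 0 := by
      filter_upwards [lt_mem_nhds hs] with y hy using hχ.eq_zero y hy.le
    rw [this.deriv_eq, deriv_const]
  have z1 : ∀ s ∈ Ioo (-1 : ℝ) 1, deriv χ s = 0 := fun s hs => by
    have : χ =ᶠ[𝓝 s] fun _ => 1 := by
      filter_upwards [isOpen_Ioo.mem_nhds hs] with y hy
      rcases le_total 0 y with h | h
      · exact hχ.eq_one y ⟨h, hy.2.le⟩
      · rw [← hχ.even]; exact hχ.eq_one (-y) ⟨by linarith, by linarith [hy.1]⟩
    rw [this.deriv_eq, deriv_const]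
  have hdχ : ContDiff ℝ ∞ (deriv χ) := hχ.smooth.iterate_deriv 1
  have hsh := (hasOrder_shape (τ := τ) hk hA).of_le (m := n + 1) (by omega)
  have hdA : Differentiable ℝ A := fun x => by
    have := (hA.contDiff.of_le (m := 1) (by exact_mod_cast (by omega : 1 ≤ k - 1)))
    exact this.differentiable (by norm_num) x
  have hχd : Differentiable ℝ χ := hχ.smooth.differentiable (by simp)
  refine (((((hasOrder_cutoff hk hA ha hτ hdχ z2 (γ := γ - 1) (Or.inr z1)).of_le
    (by omega)).const_mul hA.nonneg (-a⁻¹)).mul hA.nonneg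
      (hsh.2.2 i)).of_eq (by ring)).congr fun t ht x => ?_
  have e := (((hχd (A x / a)).hasDerivAt.comp_hasFDerivAt x
    ((hdA x).hasFDerivAt.mul_const a⁻¹)).const_sub 1).fderiv
  have e' : (fun y => 1 - χ (A y / a)) = fun y => 1 - (χ ∘ fun y => A y * a⁻¹) y := by
    funext y; simp [div_eq_mul_inv]
  rw [e', NLW.pderiv, e]
  simp only [NLW.pderiv, fderiv_const_add, neg_apply, smul_apply, smul_eq_mul]
  ring

end SymbolsTwo

/-! ### Time integrals of symbols -/

section TimeIntegrals

variable {N : ℕ} {A : Space N → ℝ} {δ τ α β : ℝ} {n : ℕ} {g h : ℝ → Space N → ℝ}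

/-- The integration domains `(0, t)` and `(t, τ)`, as families of subsets of `(0, τ)` depending on
`t` whose membership is locally constant away from `t`. -/
structure IsTimeDomain (τ : ℝ) (I : ℝ → Set ℝ) : Prop where
  meas : ∀ t, MeasurableSet (I t)
  subset : ∀ t ∈ Ioo 0 τ, I t ⊆ Ioo 0 τ
  locally_const : ∀ t, ∀ s, s ≠ t → ∀ᶠ t' in 𝓝 t, (s ∈ I t' ↔ s ∈ I t)

lemma isTimeDomain_left : IsTimeDomain τ (fun t => Ioo 0 t) where
  meas _ := measurableSet_Ioo
  subset t ht s hs := ⟨hs.1, hs.2.trans ht.2⟩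
  locally_const t s hs := by
    rcases lt_or_gt_of_ne hs with h | h
    · filter_upwards [lt_mem_nhds h] with t' ht'
      simp [h, ht']
    · filter_upwards [gt_mem_nhds h] with t' ht'
      simp only [mem_Ioo]; constructor <;> intro H <;> exact absurd H.2 (by linarith)

lemma isTimeDomain_right : IsTimeDomain τ (fun t => Ioo t τ) where
  meas _ := measurableSet_Ioo
  subset t ht s hs := ⟨ht.1.trans hs.1, hs.2⟩
  locally_const t s hs := by
    rcases lt_or_gt_of_ne hs with h | h
    · filter_upwards [lt_mem_nhds h] with t' ht'
      simp only [mem_Ioo]; constructor <;> intro H <;> exact absurd H.1 (by linarith)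
    · filter_upwards [gt_mem_nhds h] with t' ht'
      simp [h, ht']

lemma integrableOn_of_bound {G : ℝ → ℝ} (hG : ContinuousOn G (Ioo 0 τ)) {I : Set ℝ}
    (hI : I ⊆ Ioo 0 τ) (hm : MeasurableSet I) {K : ℝ} (hK : ∀ s ∈ I, |G s| ≤ K) :
    IntegrableOn G I := by
  have hfin : volume I ≠ (⊤ : ℝ≥0∞) := ((measure_mono hI).trans_lt (by simp)).ne
  have : IsFiniteMeasure (volume.restrict I) := ⟨by simpa using hfin.lt_top⟩
  exact Integrable.of_bound ((hG.mono hI).aestronglyMeasurable hm) K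
    ((ae_restrict_iff' hm).2 (ae_of_all _ hK))

lemma continuousOn_integral_timeDomain {I : ℝ → Set ℝ} (hI : IsTimeDomain τ I)
    (hg : ContinuousOn (fun q : ℝ × Space N => g q.1 q.2) (Ioo 0 τ ×ˢ univ))
    (hK : ∀ t ∈ Ioo 0 τ, ∀ x : Space N, ∃ K : ℝ, ∀ᶠ q : ℝ × Space N in 𝓝 (t, x),
      ∀ s ∈ I q.1, |g s q.2| ≤ K) :
    ContinuousOn (fun q : ℝ × Space N => ∫ s in I q.1, g s q.2) (Ioo 0 τ ×ˢ univ) := by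
  rintro ⟨t, x⟩ ⟨ht, -⟩
  refine ContinuousAt.continuousWithinAt ?_
  obtain ⟨K, hK⟩ := hK t ht x
  have hopen : IsOpen (Ioo 0 τ ×ˢ (univ : Set (Space N))) := isOpen_Ioo.prod isOpen_univ
  have hnear : ∀ᶠ q : ℝ × Space N in 𝓝 (t, x), q.1 ∈ Ioo 0 τ :=
    continuous_fst.continuousAt.eventually (isOpen_Ioo.mem_nhds ht)
  have hgs : ∀ y : Space N, ContinuousOn (fun s => g s y) (Ioo 0 τ) := fun y =>
    hg.comp (f := fun t : ℝ => (t, y))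
      (continuous_id.prodMk continuous_const).continuousOn fun t ht => ⟨ht, mem_univ y⟩
  have e : (fun q : ℝ × Space N => ∫ s in I q.1, g s q.2) =ᶠ[𝓝 (t, x)]
      fun q => ∫ s in Ioo 0 τ, (I q.1).indicator (fun s => g s q.2) s := by
    filter_upwards [hnear] with q hq
    rw [setIntegral_indicator (hI.meas _), inter_eq_self_of_subset_right (hI.subset _ hq)]
  refine ContinuousAt.congr ?_ e.symm
  refine continuousAt_of_dominated (bound := fun _ => |K|) ?_ ?_ (integrable_const _) ?_
  · filter_upwards with q
    exact (((hgs q.2).aestronglyMeasurable measurableSet_Ioo)).indicator (hI.meas _)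
  · filter_upwards [hK] with q hq
    refine ae_of_all _ fun s => ?_
    by_cases hs : s ∈ I q.1
    · rw [indicator_of_mem hs]; exact (hq s hs).trans (le_abs_self K)
    · rw [indicator_of_notMem hs, norm_zero]; exact abs_nonneg K
  · have h1 : ∀ᵐ s ∂(volume.restrict (Ioo 0 τ)), s ≠ t :=
      ae_restrict_of_ae (by simp [ae_iff, measure_singleton])
    filter_upwards [h1, ae_restrict_mem measurableSet_Ioo] with s hs hsτ
    have h2 : ∀ᶠ q : ℝ × Space N in 𝓝 (t, x), (s ∈ I q.1 ↔ s ∈ I t) :=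
      (continuous_fst.continuousAt (x := (t, x))).eventually (hI.locally_const t s hs)
    by_cases hst : s ∈ I t
    · have : (fun q : ℝ × Space N => (I q.1).indicator (fun s => g s q.2) s) =ᶠ[𝓝 (t, x)]
          fun q => g s q.2 := by
        filter_upwards [h2] with q hq
        rw [indicator_of_mem (hq.2 hst)]
      refine ContinuousAt.congr ?_ this.symm
      exact ContinuousAt.comp (f := fun q : ℝ × Space N => (s, q.2))
        (g := fun q : ℝ × Space N => g q.1 q.2)
        (hg.continuousAt (hopen.mem_nhds ⟨hsτ, mem_univ x⟩))
        (continuous_const.prodMk continuous_snd).continuousAt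
    · have : (fun q : ℝ × Space N => (I q.1).indicator (fun s => g s q.2) s) =ᶠ[𝓝 (t, x)]
          fun q => 0 := by
        filter_upwards [h2] with q hq
        rw [indicator_of_notMem (fun h => hst (hq.1 h))]
      exact ContinuousAt.congr continuousAt_const this.symm

/-- Integration in time over `I t` raises the order by one. The predicate `P` singles out the orders
for which the integral of the weight is controlled. -/
lemma HasOrder.integral {I : ℝ → Set ℝ} (hI : IsTimeDomain τ I) (hA : ∀ x, 0 ≤ A x)
    (P : ℝ → Prop)
    (hP : ∀ α, P α → ∀ t ∈ Ioo 0 τ, ∀ x : Space N, ∃ K : ℝ, ∀ᶠ q : ℝ × Space N in 𝓝 (t, x),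
      ∀ s ∈ I q.1, (s + A q.2) ^ α ≤ K)
    (hB : ∀ α, P α → ∃ C : ℝ, 0 < C ∧ ∀ t ∈ Ioo 0 τ, ∀ x : Space N,
      ∫ s in I t, (s + A x) ^ α ≤ C * (t + A x) ^ (α + 1))
    (hg : HasOrder A δ τ n α g) (hα : ∀ m ≤ n, P (α - m * δ)) :
    HasOrder A δ τ n (α + 1) (fun t x => ∫ s in I t, g s x) := by
  have hloc : ∀ {α : ℝ} {g : ℝ → Space N → ℝ}, P α → HasOrderZero A τ α g → ∀ t ∈ Ioo 0 τ,
      ∀ x : Space N, ∃ K : ℝ, ∀ᶠ q : ℝ × Space N in 𝓝 (t, x), ∀ s ∈ I q.1, |g s q.2| ≤ K := by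
    rintro α g hPα ⟨h1, C, hC, h2⟩ t ht x
    obtain ⟨K, hK⟩ := hP α hPα t ht x
    refine ⟨C * K, ?_⟩
    have hnear : ∀ᶠ q : ℝ × Space N in 𝓝 (t, x), q.1 ∈ Ioo 0 τ :=
      continuous_fst.continuousAt.eventually (isOpen_Ioo.mem_nhds ht)
    filter_upwards [hK, hnear] with q hq hq' s hs
    exact (h2 s (hI.subset _ hq' hs) _).trans (by gcongr; exact hq s hs)
  have h0 : ∀ {α : ℝ} {g : ℝ → Space N → ℝ}, P α → HasOrderZero A τ α g →
      HasOrderZero A τ (α + 1) (fun t x => ∫ s in I t, g s x) := by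
    intro α g hPα hg
    refine ⟨continuousOn_integral_timeDomain hI hg.1 (hloc hPα hg), ?_⟩
    obtain ⟨h1, C, hC, h2⟩ := hg
    obtain ⟨D, hD, h3⟩ := hB α hPα
    refine ⟨C * D, by positivity, fun t ht x => ?_⟩
    obtain ⟨K, hK⟩ := hP α hPα t ht x
    have hKt := hK.self_of_nhds
    have hint : IntegrableOn (fun s => (s + A x) ^ α) (I t) := by
      refine integrableOn_of_bound (τ := τ) (K := K) ?_ (hI.subset t ht) (hI.meas t) fun s hs => ?_
      · exact (continuous_id.add continuous_const).continuousOn.rpow_const fun s hs =>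
          Or.inl (add_pos_of_pos_of_nonneg hs.1 (hA x)).ne'
      · rw [abs_of_nonneg (rpow_nonneg (add_nonneg (hI.subset t ht hs).1.le (hA x)) _)]
        exact hKt s hs
    calc |∫ s in I t, g s x| ≤ ∫ s in I t, C * (s + A x) ^ α := by
          rw [← norm_eq_abs]
          refine norm_integral_le_of_norm_le (hint.const_mul C) ?_
          exact (ae_restrict_iff' (hI.meas t)).2
            (ae_of_all _ fun s hs => h2 s (hI.subset t ht hs) x)
      _ = C * ∫ s in I t, (s + A x) ^ α := integral_const_mul _ _
      _ ≤ C * (D * (t + A x) ^ (α + 1)) := by gcongr; exact h3 t ht x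
      _ = _ := by ring
  induction n generalizing α g with
  | zero => exact h0 (by simpa using hα 0 le_rfl) hg
  | succ n ih =>
    have hP0 : P α := by simpa using hα 0 (by omega)
    have hP1 : P (α - δ) := by simpa using hα 1 (by omega)
    have key : ∀ t ∈ Ioo 0 τ, ∀ x, HasFDerivAt (fun x => ∫ s in I t, g s x)
        (∫ s in I t, fderiv ℝ (g s) x) x ∧ IntegrableOn (fun s => fderiv ℝ (g s) x) (I t) := by
      intro t ht x
      have hK1 : ∀ i, ∃ K : ℝ, ∀ᶠ q : ℝ × Space N in 𝓝 (t, x), ∀ s ∈ I q.1,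
          |NLW.pderiv i (g s) q.2| ≤ K := fun i => hloc hP1 (hg.2.2 i).zero t ht x
      choose K hK using hK1
      have hev : ∀ᶠ y in 𝓝 x, ∀ s ∈ I t, ‖fderiv ℝ (g s) y‖ ≤ ∑ i, K i := by
        have h1 : Tendsto (fun y : Space N => (t, y)) (𝓝 x) (𝓝 (t, x)) :=
          (Continuous.prodMk_right t).continuousAt
        have := h1.eventually (eventually_all.2 hK)
        filter_upwards [this] with y hy s hs
        exact (norm_clm_le_sum _).trans (Finset.sum_le_sum fun i _ => hy i s hs)
      obtain ⟨K0, hK0⟩ := hloc hP0 hg.1 t ht x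
      have hfin : volume (I t) ≠ (⊤ : ℝ≥0∞) := ((measure_mono (hI.subset t ht)).trans_lt (by simp)).ne
      have : IsFiniteMeasure (volume.restrict (I t)) := ⟨by simpa using hfin.lt_top⟩
      have hmf : AEStronglyMeasurable (fun s => fderiv ℝ (g s) x) (volume.restrict (I t)) := by
        refine ((hg.continuousOn_fderiv.comp (f := fun s : ℝ => (s, x))
          (continuous_id.prodMk continuous_const).continuousOn
          fun t ht => ⟨ht, mem_univ x⟩).mono (hI.subset t ht)).aestronglyMeasurable (hI.meas t)
      refine ⟨?_, ?_⟩
      · refine hasFDerivAt_integral_of_dominated_of_fderiv_le (bound := fun _ => ∑ i, K i)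
          (F := fun y s => g s y) (F' := fun y s => fderiv ℝ (g s) y) hev ?_ ?_ hmf ?_ (integrable_const _) ?_
        · filter_upwards with y
          exact ((hg.1.continuousOn_time y).mono (hI.subset t ht)).aestronglyMeasurable (hI.meas t)
        · exact integrableOn_of_bound (hg.1.continuousOn_time x) (hI.subset t ht) (hI.meas t)
            hK0.self_of_nhds
        · filter_upwards [ae_restrict_mem (hI.meas t)] with s hs y hy using hy s hs
        · filter_upwards [ae_restrict_mem (hI.meas t)] with s hs y hy
          exact (hg.2.1 s (hI.subset t ht hs) y).hasFDerivAt
      · exact Integrable.of_bound hmf (∑ i, K i)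
          ((ae_restrict_iff' (hI.meas t)).2 (Eventually.of_forall hev.self_of_nhds))
    refine ⟨h0 hP0 hg.1, fun t ht x => (key t ht x).1.differentiableAt, fun i => ?_⟩
    refine ((ih (hg.2.2 i) fun m hm => ?_).of_eq (by ring)).congr fun t ht x => ?_
    · have := hα (m + 1) (by omega)
      push_cast at this
      rwa [show α - δ - m * δ = α - (m + 1) * δ by ring]
    · rw [NLW.pderiv, (key t ht x).1.fderiv, ContinuousLinearMap.integral_apply (key t ht x).2]
      rfl

lemma HasOrder.integral_left (hAc : Continuous A) (hA : ∀ x, 0 ≤ A x)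
    (hg : HasOrder A δ τ n α g) (hδ : 0 ≤ δ) (hα : 0 ≤ α - n * δ) :
    HasOrder A δ τ n (α + 1) (fun t x => ∫ s in (0 : ℝ)..t, g s x) := by
  have := hg.integral isTimeDomain_left hA (fun α => 0 ≤ α) ?_ ?_ fun m hm => ?_
  · refine this.congr fun t ht x => ?_
    rw [intervalIntegral.integral_of_le ht.1.le, integral_Ioc_eq_integral_Ioo]
  · intro α hα t ht x
    refine ⟨(t + 1 + (A x + 1)) ^ α, ?_⟩
    have h1 : ∀ᶠ q : ℝ × Space N in 𝓝 (t, x), q.1 < t + 1 :=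
      continuous_fst.continuousAt.eventually (gt_mem_nhds (by simp))
    have h2 : ∀ᶠ q : ℝ × Space N in 𝓝 (t, x), A q.2 < A x + 1 :=
      (hAc.comp continuous_snd).continuousAt.eventually (gt_mem_nhds (by simp))
    filter_upwards [h1, h2] with q hq1 hq2 s hs
    exact rpow_le_rpow (add_nonneg hs.1.le (hA _)) (by linarith [hs.2]) hα
  · intro α hα
    refine ⟨1, one_pos, fun t ht x => ?_⟩
    have hd : 0 < t + A x := add_pos_of_pos_of_nonneg ht.1 (hA x)
    have h1 := norm_setIntegral_le_of_norm_le_const (μ := volume) (s := Ioo 0 t)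
      (f := fun s => (s + A x) ^ α) (C := (t + A x) ^ α) (by simp) (fun s hs => by
        have hs0 := add_nonneg hs.1.le (hA x)
        rw [norm_of_nonneg (rpow_nonneg hs0 _)]
        exact rpow_le_rpow hs0 (by linarith [hs.2]) hα)
    refine (le_abs_self _).trans (h1.trans ?_)
    rw [one_mul, rpow_add_one hd.ne']
    simp only [measureReal_def, Real.volume_Ioo, sub_zero, ENNReal.toReal_ofReal ht.1.le]
    gcongr
    linarith [hA x]
  · have : (m : ℝ) * δ ≤ n * δ := by gcongr
    linarith

lemma HasOrder.integral_right (hA : ∀ x, 0 ≤ A x)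
    (hg : HasOrder A δ τ n α g) (hδ : 0 ≤ δ) (hα : α < -1) :
    HasOrder A δ τ n (α + 1) (fun t x => ∫ s in t..τ, g s x) := by
  have := hg.integral isTimeDomain_right hA (fun α => α < -1) ?_ ?_ fun m hm => ?_
  · refine this.congr fun t ht x => ?_
    rw [intervalIntegral.integral_of_le ht.2.le, integral_Ioc_eq_integral_Ioo]
  · intro α hα t ht x
    refine ⟨(t / 2) ^ α, ?_⟩
    have h1 : ∀ᶠ q : ℝ × Space N in 𝓝 (t, x), t / 2 < q.1 :=
      continuous_fst.continuousAt.eventually (lt_mem_nhds (by simp [ht.1]))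
    filter_upwards [h1] with q hq1 s hs
    exact rpow_le_rpow_of_nonpos (by linarith [ht.1]) (by linarith [hs.1, hA q.2])
      (by linarith)
  · intro α hα
    refine ⟨1 / (-(α + 1)), by apply one_div_pos.2; linarith, fun t ht x => ?_⟩
    have hd : 0 < t + A x := add_pos_of_pos_of_nonneg ht.1 (hA x)
    rw [← integral_Ioc_eq_integral_Ioo, ← intervalIntegral.integral_of_le ht.2.le,
      intervalIntegral.integral_comp_add_right (fun s => s ^ α), integral_rpow]
    · have h1 : 0 ≤ (τ + A x) ^ (α + 1) := rpow_nonneg (by linarith [ht.2]) _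
      have h2 : 0 < -(α + 1) := by linarith
      rw [← neg_div_neg_eq, neg_sub, div_mul_eq_mul_div, one_mul]
      gcongr
      linarith
    · refine Or.inr ⟨by linarith, ?_⟩
      rw [uIcc_of_le (by linarith [ht.2])]
      exact fun h => by linarith [h.1]
  · have : 0 ≤ (m : ℝ) * δ := by positivity
    linarith

end TimeIntegrals

/-! ### The setting and the first ansatz -/

/-- The standing assumptions on the exponent, the cut-off, and the function `A`. -/
structure IsSetting {N : ℕ} (p : ℝ) (χ : ℝ → ℝ) (k : ℕ) (A : Space N → ℝ) : Prop where
  one_lt : 1 < p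
  cutoff : IsCutoff χ
  large : 2 * (p + 1) / (rate p * (p - 1)) + 2 ≤ (k : ℝ)
  shape : IsBlowUpShape k A

/-- The exponent `2 / (p - 1)` of the blow-up rate. -/
def expo (p : ℝ) : ℝ := 2 / (p - 1)

section Exponents

variable {p : ℝ}

lemma expo_pos (hp : 1 < p) : 0 < expo p := div_pos two_pos (by linarith)

lemma expo_mul (hp : 1 < p) : expo p * (p - 1) = 2 :=
  div_mul_cancel₀ _ (by linarith : p - 1 ≠ 0)

lemma kappa_pos (hp : 1 < p) : 0 < kappa p := by
  have : 0 < p - 1 := by linarith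
  unfold kappa; positivity

/-- `κ^(p-1) = m (m + 1)` with `m = 2/(p-1)`, so that `U₀` solves `∂ₜₜU₀ = f(U₀)`. -/
lemma kappa_rpow (hp : 1 < p) : kappa p ^ (p - 1) = expo p * (expo p + 1) := by
  have : 0 < p - 1 := by linarith
  rw [kappa, ← rpow_mul (by positivity), one_div_mul_cancel this.ne', rpow_one, expo]
  field_simp
  ring

lemma numSteps_pos (hp : 1 < p) : 1 ≤ numSteps p := by
  have : 0 < p - 1 := by linarith
  rw [numSteps, Nat.one_le_floor_iff, one_le_div this]
  linarith

lemma numSteps_le (hp : 1 < p) : (numSteps p : ℝ) ≤ expo p + 1 := by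
  have : 0 < p - 1 := by linarith
  refine (Nat.floor_le (by positivity)).trans (le_of_eq ?_)
  rw [expo]; field_simp; ring

lemma expo_lt_numSteps (hp : 1 < p) : expo p < numSteps p := by
  have : 0 < p - 1 := by linarith
  have h := Nat.lt_floor_add_one ((p + 1) / (p - 1))
  have e : (p + 1) / (p - 1) = expo p + 1 := by rw [expo]; field_simp; ring
  rw [e] at h
  rw [numSteps, e]; linarith

lemma rate_pos (hp : 1 < p) : 0 < rate p :=
  lt_min (by have := expo_lt_numSteps hp; unfold expo at this; linarith) (by norm_num)

lemma rate_le_half : rate p ≤ 1 / 2 := min_le_right _ _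

end Exponents

section Setting

variable {N : ℕ} {p : ℝ} {χ : ℝ → ℝ} {k : ℕ} {A : Space N → ℝ}

/-- `k` is larger than the number of derivatives needed in the construction. -/
lemma IsSetting.lt_k (hS : IsSetting p χ k A) : 4 * numSteps p + 2 ≤ k := by
  have hp := hS.one_lt
  have hr := rate_pos hp
  have h1 : 2 * (p + 1) / (rate p * (p - 1)) = 2 * (expo p + 1) / rate p := by
    have : p - 1 ≠ 0 := by linarith
    rw [expo]; field_simp; ring
  have h2 := hS.large
  rw [h1] at h2
  have h3 : 4 * (expo p + 1) ≤ 2 * (expo p + 1) / rate p := by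
    rw [le_div_iff₀ hr]
    have := expo_pos hp
    nlinarith [rate_le_half (p := p)]
  have h4 := numSteps_le hp
  exact_mod_cast (by linarith : (4 * numSteps p + 2 : ℝ) ≤ k)

lemma IsSetting.six_le (hS : IsSetting p χ k A) : 6 ≤ k := by
  have := hS.lt_k
  have := numSteps_pos hS.one_lt
  omega

lemma IsSetting.dist_pos (hS : IsSetting p χ k A) {t : ℝ} (ht : 0 < t) (x : Space N) :
    0 < t + A x := add_pos_of_pos_of_nonneg ht (hS.shape.nonneg x)

lemma IsSetting.dist_order (hS : IsSetting p χ k A) {τ : ℝ} (β : ℝ) :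
    HasOrder A (1 / k) τ (k - 1) β (fun t x => (t + A x) ^ β) :=
  (((hasOrder_shape (by have := hS.six_le; omega) hS.shape).rpow hS.shape.nonneg one_pos
    (fun t _ x => by rw [rpow_one, one_mul]) β)).of_eq (one_mul β)

lemma ansatzZero_pos (hS : IsSetting p χ k A) {t : ℝ} (ht : 0 < t) (x : Space N) :
    0 < ansatzZero p A t x :=
  mul_pos (kappa_pos hS.one_lt) (rpow_pos_of_pos (hS.dist_pos ht x) _)

lemma ansatzZero_rpow (hS : IsSetting p χ k A) {t : ℝ} (ht : 0 < t) (x : Space N) (q : ℝ) :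
    ansatzZero p A t x ^ q = kappa p ^ q * (t + A x) ^ (-(expo p * q)) := by
  have hd := hS.dist_pos ht x
  rw [ansatzZero, mul_rpow (kappa_pos hS.one_lt).le (by positivity), ← rpow_mul hd.le,
    expo, neg_mul]

lemma ansatzZero_order (hS : IsSetting p χ k A) {τ : ℝ} (q : ℝ) :
    HasOrder A (1 / k) τ (k - 1) (-(expo p * q)) (fun t x => ansatzZero p A t x ^ q) :=
  ((hS.dist_order (-(expo p * q))).const_mul hS.shape.nonneg (kappa p ^ q)).congr
    fun t ht x => ansatzZero_rpow hS ht.1 x q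

lemma ansatzZero_order_one (hS : IsSetting p χ k A) {τ : ℝ} :
    HasOrder A (1 / k) τ (k - 1) (-expo p) (ansatzZero p A) :=
  ((ansatzZero_order hS 1).of_eq (by rw [mul_one])).congr fun t _ x => (rpow_one _).symm

lemma hasDerivAt_dist_rpow (hS : IsSetting p χ k A) {t : ℝ} (ht : 0 < t) (x : Space N) (β : ℝ) :
    HasDerivAt (fun s => (s + A x) ^ β) (β * (t + A x) ^ (β - 1)) t := by
  have := ((hasDerivAt_id t).add_const (A x)).rpow_const (p := β)
    (Or.inl (hS.dist_pos ht x).ne')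
  simpa [mul_comm] using this

/-- The correction in terms of powers of `t + A`, with `m = 2/(p-1)`. -/
lemma correction_eq (hS : IsSetting p χ k A) {τ : ℝ} (E : ℝ → Space N → ℝ) {t : ℝ}
    (ht : t ∈ Ioo 0 τ) (x : Space N) :
    correction p A τ E t x = -(3 + 2 * expo p)⁻¹ *
      ((t + A x) ^ (-(1 + expo p)) * (∫ s in (0 : ℝ)..t, (s + A x) ^ (2 + expo p) * E s x)
      + (t + A x) ^ (2 + expo p) * (∫ s in t..τ, (s + A x) ^ (-(1 + expo p)) * E s x)) := by
  have hp := hS.one_lt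
  have hp1 : p - 1 ≠ 0 := by linarith
  have hκ := kappa_pos hp
  have e1 : -(expo p * ((p + 1) / 2)) = -(1 + expo p) := by
    rw [expo]; field_simp; ring
  have e2 : -(expo p * -p) = 2 + expo p := by
    rw [expo]; field_simp; ring
  have i1 : ∫ s in (0 : ℝ)..t, ansatzZero p A s x ^ (-p) * E s x
      = kappa p ^ (-p) * ∫ s in (0 : ℝ)..t, (s + A x) ^ (2 + expo p) * E s x := by
    rw [← intervalIntegral.integral_const_mul]
    refine intervalIntegral.integral_congr_ae (ae_of_all _ fun s hs => ?_)
    rw [uIoc_of_le ht.1.le] at hs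
    rw [ansatzZero_rpow hS hs.1, e2, mul_assoc]
  have i2 : ∫ s in t..τ, ansatzZero p A s x ^ ((p + 1) / 2) * E s x
      = kappa p ^ ((p + 1) / 2) * ∫ s in t..τ, (s + A x) ^ (-(1 + expo p)) * E s x := by
    rw [← intervalIntegral.integral_const_mul]
    refine intervalIntegral.integral_congr_ae (ae_of_all _ fun s hs => ?_)
    rw [uIoc_of_le ht.2.le] at hs
    rw [ansatzZero_rpow hS (ht.1.trans hs.1), e1, mul_assoc]
  have e3 : kappa p ^ ((p - 1) / 2) * kappa p ^ ((p + 1) / 2) * kappa p ^ (-p) = 1 := by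
    rw [← rpow_add hκ, ← rpow_add hκ, show (p - 1) / 2 + (p + 1) / 2 + -p = 0 by ring,
      rpow_zero]
  have e4 : (p - 1) / (3 * p + 1) = (3 + 2 * expo p)⁻¹ := by
    have h3 : 3 + 2 * expo p = (3 * p + 1) / (p - 1) := by rw [expo]; field_simp; ring
    rw [h3, inv_div]
  rw [correction, i1, i2, ansatzZero_rpow hS ht.1, ansatzZero_rpow hS ht.1, e1, e2, e4]
  linear_combination (-(3 + 2 * expo p)⁻¹ *
      ((t + A x) ^ (-(1 + expo p)) * (∫ s in (0 : ℝ)..t, (s + A x) ^ (2 + expo p) * E s x)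
      + (t + A x) ^ (2 + expo p) * (∫ s in t..τ, (s + A x) ^ (-(1 + expo p)) * E s x))) * e3

/-- The correction gains two orders. -/
lemma HasOrder.correction (hS : IsSetting p χ k A) {τ α : ℝ} {n : ℕ} {E : ℝ → Space N → ℝ}
    (hE : HasOrder A (1 / k) τ n α E) (hn : n ≤ k - 1)
    (h1 : 0 ≤ 2 + expo p + α - n * (1 / (k : ℝ))) (h2 : α < expo p) :
    HasOrder A (1 / k) τ n (α + 2) (correction p A τ E) := by
  have hA := hS.shape.nonneg
  have hAc : Continuous A := hS.shape.contDiff.continuous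
  have hδ : (0 : ℝ) ≤ 1 / k := by positivity
  have d1 : HasOrder A (1 / k) τ n (2 + expo p) (fun t x => (t + A x) ^ (2 + expo p)) :=
    (hS.dist_order _).of_le hn
  have d2 : HasOrder A (1 / k) τ n (-(1 + expo p))
      (fun t x => (t + A x) ^ (-(1 + expo p))) := (hS.dist_order _).of_le hn
  have i1 := (d1.mul hA hE).integral_left hAc hA hδ h1
  have i2 := (d2.mul hA hE).integral_right hA hδ (by linarith)
  refine ((((d2.mul hA i1).of_eq (β := α + 2) (by ring)).add
    ((d1.mul hA i2).of_eq (by ring))).const_mul hA (-(3 + 2 * expo p)⁻¹)).congr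
    fun t ht x => correction_eq hS E ht x

/-- The time derivative of the correction, as a formula. -/
def correctionDeriv {N : ℕ} (p : ℝ) (A : Space N → ℝ) (τ : ℝ) (E : ℝ → Space N → ℝ)
    (t : ℝ) (x : Space N) : ℝ :=
  -(3 + 2 * expo p)⁻¹ * (-(1 + expo p) * (t + A x) ^ (-(1 + expo p) - 1) *
      (∫ s in (0 : ℝ)..t, (s + A x) ^ (2 + expo p) * E s x)
    + (2 + expo p) * (t + A x) ^ (2 + expo p - 1) *
      (∫ s in t..τ, (s + A x) ^ (-(1 + expo p)) * E s x))

lemma HasOrder.correctionDeriv (hS : IsSetting p χ k A) {τ α : ℝ} {n : ℕ}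
    {E : ℝ → Space N → ℝ} (hE : HasOrder A (1 / k) τ n α E) (hn : n ≤ k - 1)
    (h1 : 0 ≤ 2 + expo p + α - n * (1 / (k : ℝ))) (h2 : α < expo p) :
    HasOrder A (1 / k) τ n (α + 1) (correctionDeriv p A τ E) := by
  have hA := hS.shape.nonneg
  have hAc : Continuous A := hS.shape.contDiff.continuous
  have hδ : (0 : ℝ) ≤ 1 / k := by positivity
  have d : ∀ β : ℝ, HasOrder A (1 / k) τ n β (fun t x => (t + A x) ^ β) :=
    fun β => (hS.dist_order β).of_le hn
  have i1 := ((d (2 + expo p)).mul hA hE).integral_left hAc hA hδ h1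
  have i2 := ((d (-(1 + expo p))).mul hA hE).integral_right hA hδ (by linarith)
  exact ((((((d (-(1 + expo p) - 1)).const_mul hA (-(1 + expo p))).mul hA i1).of_eq
    (β := α + 1) (by ring)).add ((((d (2 + expo p - 1)).const_mul hA (2 + expo p)).mul hA
      i2).of_eq (by ring))).const_mul hA (-(3 + 2 * expo p)⁻¹))

lemma hasDerivAt_integral_correction (hS : IsSetting p χ k A) {τ α : ℝ} {E : ℝ → Space N → ℝ}
    (hE : HasOrderZero A τ α E) (h1 : 0 ≤ 2 + expo p + α) {t : ℝ} (ht : t ∈ Ioo 0 τ)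
    (x : Space N) :
    HasDerivAt (fun t => ∫ s in (0 : ℝ)..t, (s + A x) ^ (2 + expo p) * E s x)
        ((t + A x) ^ (2 + expo p) * E t x) t ∧
      HasDerivAt (fun t => ∫ s in t..τ, (s + A x) ^ (-(1 + expo p)) * E s x)
        (-((t + A x) ^ (-(1 + expo p)) * E t x)) t := by
  have d : ∀ β : ℝ, HasOrderZero A τ β (fun t x => (t + A x) ^ β) :=
    fun β => (hS.dist_order β).zero
  have hG : ∀ β : ℝ, ContinuousOn (fun s => (s + A x) ^ β * E s x) (Ioo 0 τ) := fun β =>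
    ((d β).continuousOn_time x).mul (hE.continuousOn_time x)
  have hGt : ∀ β : ℝ, ContinuousAt (fun s => (s + A x) ^ β * E s x) t := fun β =>
    (hG β).continuousAt (isOpen_Ioo.mem_nhds ht)
  have hGm : ∀ β : ℝ, StronglyMeasurableAtFilter (fun s => (s + A x) ^ β * E s x) (𝓝 t) := fun β =>
    (hG β).stronglyMeasurableAtFilter isOpen_Ioo t ht
  obtain ⟨-, C, hC, hb⟩ := hE
  have hbound : ∀ β : ℝ, ∀ s ∈ Ioo 0 τ, |(s + A x) ^ β * E s x| ≤ C * (s + A x) ^ (β + α) := by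
    intro β s hs
    have hd := hS.dist_pos hs.1 x
    rw [abs_mul, abs_of_pos (rpow_pos_of_pos hd β), rpow_add hd]
    calc _ ≤ (s + A x) ^ β * (C * (s + A x) ^ α) := by gcongr; exact hb s hs x
      _ = _ := by ring
  refine ⟨intervalIntegral.integral_hasDerivAt_right ?_ (hGm _) (hGt _),
    intervalIntegral.integral_hasDerivAt_left ?_ (hGm _) (hGt _)⟩
  · rw [intervalIntegrable_iff_integrableOn_Ioo_of_le ht.1.le]
    refine integrableOn_of_bound (hG _) (Ioo_subset_Ioo_right ht.2.le) measurableSet_Ioo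
      (K := C * (t + A x) ^ (2 + expo p + α)) fun s hs => ?_
    refine (hbound _ s ⟨hs.1, hs.2.trans ht.2⟩).trans ?_
    have := (hS.dist_pos hs.1 x).le
    gcongr
    exact hs.2.le
  · rw [intervalIntegrable_iff_integrableOn_Ioo_of_le ht.2.le]
    set β := -(1 + expo p)
    refine integrableOn_of_bound (hG _) (Ioo_subset_Ioo_left ht.1.le) measurableSet_Ioo
      (K := C * ((t + A x) ^ (β + α) + (τ + A x) ^ (β + α))) fun s hs => ?_
    refine (hbound _ s ⟨ht.1.trans hs.1, hs.2⟩).trans ?_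
    have h1 := hS.dist_pos ht.1 x
    have h2 : t + A x ≤ s + A x := by linarith [hs.1]
    have h3 : s + A x ≤ τ + A x := by linarith [hs.2]
    gcongr
    rcases le_total 0 (β + α) with h | h
    · have := rpow_le_rpow (by linarith) h3 h
      have : 0 ≤ (t + A x) ^ (β + α) := by positivity
      linarith
    · have := rpow_le_rpow_of_nonpos h1 h2 h
      have : 0 ≤ (τ + A x) ^ (β + α) := rpow_nonneg (by linarith) _
      linarith

/-- The correction solves `∂ₜₜw = (m + 1)(m + 2) (t + A)^{-2} w + E`, which is the linearisation of
`∂ₜₜu = f(u)` at `U₀`. -/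
lemma hasDerivAt_correction (hS : IsSetting p χ k A) {τ α : ℝ} {E : ℝ → Space N → ℝ}
    (hE : HasOrderZero A τ α E) (h1 : 0 ≤ 2 + expo p + α) {t : ℝ} (ht : t ∈ Ioo 0 τ)
    (x : Space N) :
    HasDerivAt (fun s => correction p A τ E s x) (correctionDeriv p A τ E t x) t ∧
      HasDerivAt (fun s => correctionDeriv p A τ E s x)
        ((expo p + 1) * (expo p + 2) * (t + A x) ^ (-2 : ℝ) * correction p A τ E t x + E t x) t := by
  obtain ⟨g1, g2⟩ := hasDerivAt_integral_correction hS hE h1 ht x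
  have hd := hS.dist_pos ht.1 x
  have hm := expo_pos hS.one_lt
  have dd := hasDerivAt_dist_rpow hS ht.1 x
  have r : ∀ a b : ℝ, (t + A x) ^ a * (t + A x) ^ b = (t + A x) ^ (a + b) :=
    fun a b => (rpow_add hd a b).symm
  have r2 : (t + A x) ^ (-(1 + expo p) - 1) * (t + A x) ^ (2 + expo p) = 1 := by
    rw [r, show -(1 + expo p) - 1 + (2 + expo p) = 0 by ring, rpow_zero]
  have r3 : (t + A x) ^ (2 + expo p - 1) * (t + A x) ^ (-(1 + expo p)) = 1 := by
    rw [r, show 2 + expo p - 1 + -(1 + expo p) = 0 by ring, rpow_zero]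
  refine ⟨?_, ?_⟩
  · have e : (fun s => correction p A τ E s x) =ᶠ[𝓝 t] fun s => -(3 + 2 * expo p)⁻¹ *
      ((s + A x) ^ (-(1 + expo p)) * (∫ s in (0 : ℝ)..s, (s + A x) ^ (2 + expo p) * E s x)
      + (s + A x) ^ (2 + expo p) * (∫ s in s..τ, (s + A x) ^ (-(1 + expo p)) * E s x)) := by
      filter_upwards [isOpen_Ioo.mem_nhds ht] with s hs using correction_eq hS E hs x
    refine HasDerivAt.congr_of_eventuallyEq ?_ e
    refine ((((dd (-(1 + expo p))).mul g1).add ((dd (2 + expo p)).mul g2)).const_mul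
      (-(3 + 2 * expo p)⁻¹)).congr_deriv ?_
    rw [NLW.correctionDeriv]
    ring
  · refine (((((dd (-(1 + expo p) - 1)).const_mul (-(1 + expo p))).mul g1).add
      (((dd (2 + expo p - 1)).const_mul (2 + expo p)).mul g2)).const_mul
      (-(3 + 2 * expo p)⁻¹)).congr_deriv ?_
    rw [correction_eq hS E ht x]
    have s1 : (t + A x) ^ (-(1 + expo p) - 1 - 1)
        = (t + A x) ^ (-2 : ℝ) * (t + A x) ^ (-(1 + expo p)) := by rw [r]; congr 1; ring
    have s2 : (t + A x) ^ (2 + expo p - 1 - 1)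
        = (t + A x) ^ (-2 : ℝ) * (t + A x) ^ (2 + expo p) := by rw [r]; congr 1; ring
    rw [s1, s2]
    have h3 : (3 + 2 * expo p) ≠ 0 := by positivity
    have h4 : (3 + 2 * expo p)⁻¹ * (3 + 2 * expo p) = 1 := inv_mul_cancel₀ h3
    linear_combination (3 + 2 * expo p)⁻¹ * (1 + expo p) * E t x * r2
      + (3 + 2 * expo p)⁻¹ * (2 + expo p) * E t x * r3 + E t x * h4

end Setting

/-! ### The refined ansatz -/

/-- The conditions on the parameters of the ansatz, up to the step `m`. -/
structure IsParameterChoiceUpTo {N : ℕ} (m : ℕ) (p : ℝ) (χ : ℝ → ℝ) (A : Space N → ℝ)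
    (a τ : ℕ → ℝ) : Prop where
  time_zero : τ 0 = 1
  time_anti : ∀ j, j < m → τ (j + 1) ≤ τ j
  time_pos : ∀ j ≤ m, 0 < τ j
  cut_le_one : 1 ≤ m → a 1 ≤ 1
  cut_anti : ∀ j, 1 ≤ j → j < m → a (j + 1) ≤ a j
  cut_pos : ∀ j, 1 ≤ j → j ≤ m → 0 < a j
  close : ∀ j, 1 ≤ j → j ≤ m → ∀ t ∈ Ioc (0 : ℝ) (τ j), ∀ x : Space N,
    |ansatz p χ A a τ j t x - ansatzZero p A t x|
        ≤ 1 / 4 * (1 - (2 : ℝ)⁻¹ ^ j) * ansatzZero p A t x ∧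
    |ansatz p χ A a τ j t x - ansatzZero p A t x|
        ≤ (1 - (2 : ℝ)⁻¹ ^ j) * (1 + ansatzZero p A t x) ^ (-((p - 1) / 2)) * ansatzZero p A t x

/-- The order of the residual of `U_j`. -/
def residualOrder (p δ : ℝ) (j : ℕ) : ℝ := -expo p + 2 * j - 2 * (j + 1) * δ

/-- The regularity of the approximate solution `U` with `r + 2` space derivatives. -/
structure IsRegularAnsatz {N : ℕ} (p : ℝ) (A : Space N → ℝ) (δ τ : ℝ) (r : ℕ) (α : ℝ)
    (U : ℝ → Space N → ℝ) : Prop where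
  order : HasOrder A δ τ (r + 2) (-expo p) U
  ratio : HasOrder A δ τ (r + 2) (2 - 2 * δ) (fun t x => U t x / ansatzZero p A t x - 1)
  mem_Icc : ∀ t ∈ Ioo 0 τ, ∀ x, U t x / ansatzZero p A t x ∈ Icc (3 / 4 : ℝ) (5 / 4)
  differentiable : ∀ t ∈ Ioo 0 τ, ∀ x, DifferentiableAt ℝ (fun s => U s x) t
  differentiable_deriv : ∀ t ∈ Ioo 0 τ, ∀ x,
    DifferentiableAt ℝ (deriv fun s => U s x) t
  deriv_order : HasOrderZero A τ (-expo p - 1) (fun t x => deriv (fun s => U s x) t)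
  residual_order : HasOrder A δ τ r α (residual p U)

section Ansatz

variable {N : ℕ} {p : ℝ} {χ : ℝ → ℝ} {k : ℕ} {A : Space N → ℝ} {a τ : ℕ → ℝ}

lemma isParameterChoice_iff (hp : 1 < p) :
    IsParameterChoice p χ A a τ ↔ IsParameterChoiceUpTo (numSteps p) p χ A a τ :=
  ⟨fun h => ⟨h.time_zero, h.time_anti, h.time_pos, fun _ => h.cut_le_one, h.cut_anti, h.cut_pos,
    h.close⟩, fun h => ⟨h.time_zero, h.time_anti, h.time_pos, h.cut_le_one (numSteps_pos hp),
    h.cut_anti, h.cut_pos, h.close⟩⟩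

lemma nonlin_of_pos {u : ℝ} (hu : 0 < u) : nonlin p u = u ^ p := by
  rw [nonlin, abs_of_pos hu, ← rpow_add_one hu.ne', sub_add_cancel]

lemma hasDerivAt_ansatzZero (hS : IsSetting p χ k A) {t : ℝ} (ht : 0 < t) (x : Space N) :
    HasDerivAt (fun s => ansatzZero p A s x)
      (kappa p * (-expo p * (t + A x) ^ (-expo p - 1))) t :=
  (hasDerivAt_dist_rpow hS ht x (-expo p)).const_mul (kappa p)

lemma hasDerivAt_deriv_ansatzZero (hS : IsSetting p χ k A) {t : ℝ} (ht : 0 < t) (x : Space N) :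
    HasDerivAt (deriv fun s => ansatzZero p A s x) (ansatzZero p A t x ^ p) t := by
  have e : (deriv fun s => ansatzZero p A s x) =ᶠ[𝓝 t]
      fun s => kappa p * (-expo p * (s + A x) ^ (-expo p - 1)) := by
    filter_upwards [lt_mem_nhds ht] with s hs using (hasDerivAt_ansatzZero hS hs x).deriv
  refine HasDerivAt.congr_of_eventuallyEq ?_ e
  refine (((hasDerivAt_dist_rpow hS ht x (-expo p - 1)).const_mul (-expo p)).const_mul
    (kappa p)).congr_deriv ?_
  have hκ := kappa_pos hS.one_lt
  have e1 : kappa p ^ p = kappa p * (expo p * (expo p + 1)) := by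
    rw [← kappa_rpow hS.one_lt, mul_comm, ← rpow_add_one hκ.ne', sub_add_cancel]
  rw [ansatzZero_rpow hS ht, e1]
  have e2 : -(expo p * p) = -expo p - 1 - 1 := by linarith [expo_mul hS.one_lt]
  rw [e2]; ring

lemma residual_ansatzZero (hS : IsSetting p χ k A) {t : ℝ} (ht : 0 < t) (x : Space N) :
    residual p (ansatzZero p A) t x = laplacian (ansatzZero p A t) x := by
  rw [residual, iteratedDeriv_succ, iteratedDeriv_one,
    (hasDerivAt_deriv_ansatzZero hS ht x).deriv, nonlin_of_pos (ansatzZero_pos hS ht x)]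
  ring

lemma ansatzZero_regular (hS : IsSetting p χ k A) (T : ℝ) :
    IsRegularAnsatz p A (1 / k) T (k - 3) (residualOrder p (1 / k) 0)
      (ansatzZero p A) := by
  have h6 := hS.six_le
  have hk : k - 1 = k - 3 + 2 := by omega
  have ord : HasOrder A (1 / k) T (k - 3 + 2) (-expo p) (ansatzZero p A) :=
    hk ▸ ansatzZero_order_one hS
  have one : ∀ t ∈ Ioo 0 T, ∀ x, ansatzZero p A t x / ansatzZero p A t x = 1 := fun t ht x =>
    div_self (ansatzZero_pos hS ht.1 x).ne'
  refine ⟨ord, ?_, fun t ht x => ?_, fun t ht x =>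
    (hasDerivAt_ansatzZero hS ht.1 x).differentiableAt, fun t ht x =>
    (hasDerivAt_deriv_ansatzZero hS ht.1 x).differentiableAt, ?_, ?_⟩
  · exact (hasOrder_zero _ hS.shape.nonneg).congr fun t ht x => by rw [one t ht x, sub_self]
  · rw [one t ht x]; norm_num
  · refine HasOrderZero.congr (((hS.dist_order (τ := T) (-expo p - 1)).const_mul hS.shape.nonneg
      (kappa p * (-expo p))).zero) fun t ht x => ?_
    rw [(hasDerivAt_ansatzZero hS ht.1 x).deriv, mul_assoc]
  · refine ((ord.laplacian hS.shape.nonneg).of_eq ?_).congr fun t ht x =>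
      residual_ansatzZero hS ht.1 x
    rw [residualOrder]; push_cast; ring

lemma laplacian_add_of_hasOrder {δ T α β : ℝ} {n : ℕ} {g h : ℝ → Space N → ℝ}
    (hg : HasOrder A δ T (n + 2) α g) (hh : HasOrder A δ T (n + 2) β h) {t : ℝ}
    (ht : t ∈ Ioo 0 T) (x : Space N) :
    laplacian (fun y => g t y + h t y) x
      = laplacian (g t) x + laplacian (h t) x := by
  have c : ∀ {α : ℝ} {g : ℝ → Space N → ℝ}, HasOrder A δ T (n + 2) α g → ContDiffAt ℝ 2 (g t) x := by
    intro α g hg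
    refine ContDiff.contDiffAt (contDiff_succ_iff_fderiv (n := 1).2 ⟨hg.2.1 t ht, by simp, ?_⟩)
    have : fderiv ℝ (g t) = fun x => ∑ i, NLW.pderiv i (g t) x •
      (EuclideanSpace.proj i : Space N →L[ℝ] ℝ) := funext fun q => clm_eq_sum _
    rw [this]
    refine ContDiff.sum fun i _ => ?_
    have h1 : ContDiff ℝ 1 (NLW.pderiv i (g t)) :=
      contDiff_one_iff_fderiv.2 ⟨(hg.2.2 i).2.1 t ht, (hg.2.2 i).continuous_fderiv ht⟩
    exact h1.smul contDiff_const
  exact (c hg).laplacian_add (c hh)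

lemma correction_index_bounds (hS : IsSetting p χ k A) {j : ℕ} (hj : j + 1 ≤ numSteps p) :
    0 ≤ 2 + expo p + residualOrder p (1 / k) j - ((k - 3 - 2 * j : ℕ) : ℝ) * (1 / (k : ℝ)) ∧
      residualOrder p (1 / k) j < expo p := by
  have hk := hS.lt_k
  have hk0 : (0 : ℝ) < k := by exact_mod_cast (by omega : 0 < k)
  have h1 : (k : ℝ) * (1 / k) = 1 := mul_one_div_cancel hk0.ne'
  have hδ : (0 : ℝ) < 1 / k := by positivity
  constructor
  · rw [residualOrder, Nat.sub_sub, Nat.cast_sub (by omega)]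
    push_cast
    have : (0 : ℝ) ≤ j := by positivity
    nlinarith
  · rw [residualOrder]
    have h2 := numSteps_le hS.one_lt
    have h3 : (j : ℝ) + 1 ≤ numSteps p := by exact_mod_cast hj
    have : 0 < 2 * ((j : ℝ) + 1) * (1 / k) := by positivity
    linarith

/-- One step of the construction: if `U` is regular with residual of the order expected after `j`
steps, then adding the truncated correction improves the residual. -/
lemma IsRegularAnsatz.step (hS : IsSetting p χ k A) {j : ℕ} (hj : j + 1 ≤ numSteps p)
    {U : ℝ → Space N → ℝ} {T T' b : ℝ} (hT' : 0 < T') (hTT' : T' ≤ T) (hb : 0 < b)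
    (hU : IsRegularAnsatz p A (1 / k) T (k - 3 - 2 * j) (residualOrder p (1 / k) j) U)
    (hY : ∀ t ∈ Ioo 0 T', ∀ x, (U t x + χ (A x / b) * correction p A T (residual p U) t x)
      / ansatzZero p A t x ∈ Icc (3 / 4 : ℝ) (5 / 4)) :
    IsRegularAnsatz p A (1 / k) T' (k - 3 - 2 * (j + 1))
      (residualOrder p (1 / k) (j + 1))
      (fun t x => U t x + χ (A x / b) * correction p A T (residual p U) t x) := by
  have hk := hS.lt_k
  have hA := hS.shape.nonneg
  obtain ⟨r, hr⟩ : ∃ r, k - 3 - 2 * j = r + 2 := ⟨k - 5 - 2 * j, by omega⟩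
  have hr' : k - 3 - 2 * (j + 1) = r := by omega
  have hk0 : (0 : ℝ) < k := by exact_mod_cast (by omega : 0 < k)
  set δ : ℝ := 1 / (k : ℝ) with hδ
  have hδ1 : δ ≤ 1 := by
    rw [hδ, div_le_one hk0]; exact_mod_cast (by omega : 1 ≤ k)
  obtain ⟨c1, c2⟩ := correction_index_bounds hS hj
  rw [hr] at hU c1
  rw [hr']
  have h1 : 0 ≤ 2 + expo p + residualOrder p δ j := by
    have : 0 ≤ ((r + 2 : ℕ) : ℝ) * (1 / (k : ℝ)) := by positivity
    linarith
  set E := residual p U with hE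
  set w := correction p A T E
  set α := residualOrder p δ j with hα
  have hT : 0 < T := hT'.trans_le hTT'
  have hk1 : 1 ≤ k := by omega
  have wo : HasOrder A δ T (r + 2) (α + 2) w := hU.residual_order.correction hS (by omega) c1 c2
  have wo' : HasOrder A δ T (r + 2) (α + 1) (correctionDeriv p A T E) :=
    hU.residual_order.correctionDeriv hS (by omega) c1 c2
  have cut : ∀ γ ≤ 0, HasOrder A δ T (r + 2) γ (fun _ x => χ (A x / b)) := fun γ hγ =>
    (hasOrder_cutoff hk1 hS.shape hb hT hS.cutoff.smooth
      (fun s hs => hS.cutoff.eq_zero s hs.le) (Or.inl hγ)).of_le (by omega)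
  have u0 : HasOrder A δ T (r + 2) (expo p) (fun t x => (ansatzZero p A t x)⁻¹) :=
    (((ansatzZero_order hS (-1)).of_eq (β := expo p) (by ring)).of_le (by omega)).congr
      fun t ht x => (Real.rpow_neg_one _).symm
  have hγ : -expo p - (α + 2) ≤ 0 := by rw [hα, residualOrder]; nlinarith
  have ord : HasOrder A δ T (r + 2) (-expo p) (fun t x => U t x + χ (A x / b) * w t x) :=
    (hU.order.of_le (by omega)).add (((cut _ hγ).mul hA wo).of_eq (by ring))
  have ratioy : ∀ γ ≤ 0, HasOrder A δ T (r + 2) (γ + (α + 2) + expo p)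
      (fun t x => χ (A x / b) * w t x * (ansatzZero p A t x)⁻¹) := fun γ hγ =>
    ((cut γ hγ).mul hA wo).mul hA u0
  have ratio : HasOrder A δ T (r + 2) (2 - 2 * δ)
      (fun t x => (U t x + χ (A x / b) * w t x) / ansatzZero p A t x - 1) := by
    refine ((hU.ratio.of_le (by omega)).add
      ((ratioy (-(j * (2 - 2 * δ))) (by nlinarith)).of_eq (β := 2 - 2 * δ)
        (by rw [hα, residualOrder]; ring))).congr fun t ht x => ?_
    ring
  have d1 : ∀ t ∈ Ioo 0 T, ∀ x, HasDerivAt (fun s => U s x + χ (A x / b) * w s x)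
      (deriv (fun s => U s x) t + χ (A x / b) * correctionDeriv p A T E t x) t := fun t ht x =>
    (hU.differentiable t ht x).hasDerivAt.add
      ((hasDerivAt_correction hS hU.residual_order.zero h1 ht x).1.const_mul _)
  have d2 : ∀ t ∈ Ioo 0 T, ∀ x, HasDerivAt (deriv fun s => U s x + χ (A x / b) * w s x)
      (iteratedDeriv 2 (fun s => U s x) t + χ (A x / b) * ((expo p + 1) * (expo p + 2) *
        (t + A x) ^ (-2 : ℝ) * w t x + E t x)) t := fun t ht x => by
    have e : (deriv fun s => U s x + χ (A x / b) * w s x) =ᶠ[𝓝 t]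
        fun s => deriv (fun s => U s x) s + χ (A x / b) * correctionDeriv p A T E s x := by
      filter_upwards [isOpen_Ioo.mem_nhds ht] with s hs using (d1 s hs x).deriv
    refine HasDerivAt.congr_of_eventuallyEq ?_ e
    have h3 := (hU.differentiable_deriv t ht x).hasDerivAt
    rw [← iteratedDeriv_one, ← iteratedDeriv_succ] at h3
    rw [← iteratedDeriv_one]
    exact h3.add ((hasDerivAt_correction hS hU.residual_order.zero h1 ht x).2.const_mul _)
  have hsub : Ioo 0 T' ⊆ Ioo 0 T := Ioo_subset_Ioo_right hTT'
  have hYU : ∀ t ∈ Ioo 0 T', ∀ x, U t x / ansatzZero p A t x ∈ Icc (3 / 4 : ℝ) (5 / 4) :=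
    fun t ht x => hU.mem_Icc t (hsub ht) x
  refine ⟨ord.mono_time hTT', ratio.mono_time hTT', hY,
    fun t ht x => (d1 t (hsub ht) x).differentiableAt,
    fun t ht x => (d2 t (hsub ht) x).differentiableAt, ?_, ?_⟩
  · have h0 : HasOrder A δ T 0 (-expo p - 1)
        (fun t x => deriv (fun s => U s x) t + χ (A x / b) * correctionDeriv p A T E t x) :=
      HasOrder.add (n := 0) (δ := δ) hU.deriv_order
        ((((cut _ hγ).mul hA wo').of_le (Nat.zero_le _)).of_eq (by ring))
    exact HasOrderZero.congr (h0.mono_time hTT').zero fun t ht x => (d1 t (hsub ht) x).deriv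
  -- the new residual is `(1 - χ) E + Δ(χ w)` plus a quadratic remainder
  have t1 : HasOrder A δ T (r + 2) (residualOrder p δ (j + 1))
      (fun t x => (1 - χ (A x / b)) * E t x) :=
    (((hasOrder_one_sub_cutoff hk1 hS.shape hb hT hS.cutoff
      (γ := 2 - 2 * δ) (by linarith)).of_le (by omega)).mul hA hU.residual_order).of_eq
      (by rw [hα, residualOrder, residualOrder]; push_cast; ring)
  have t2 : HasOrder A δ T r (residualOrder p δ (j + 1))
      (fun t x => laplacian (fun x => χ (A x / b) * w t x) x) :=
    (((cut 0 le_rfl).mul hA wo).laplacian hA).of_eq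
      (by rw [hα, residualOrder, residualOrder]; push_cast; ring)
  have zero_order : ∀ {V : ℝ → Space N → ℝ}, HasOrder A δ T (r + 2) (-expo p) V →
      HasOrder A δ T (r + 2) 0 (fun t x => V t x / ansatzZero p A t x) := fun hV =>
    ((hV.mul hA u0).of_eq (by ring)).congr fun t ht x => div_eq_mul_inv _ _
  have t3 : HasOrder A δ T' (r + 2) (residualOrder p δ (j + 1))
      (fun t x => ansatzZero p A t x ^ p *
        (((U t x + χ (A x / b) * w t x) / ansatzZero p A t x) ^ p
          - (U t x / ansatzZero p A t x) ^ p
          - p * ((U t x + χ (A x / b) * w t x) / ansatzZero p A t x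
            - U t x / ansatzZero p A t x))) := by
    refine (((ansatzZero_order hS p).of_le (by omega)).mul hA
      (((zero_order ord).mono_time hTT').rpow_remainder hA
      ((zero_order (hU.order.of_le (by omega))).mono_time hTT') hY hYU
      (γ := (j + 1) * (2 - 2 * δ)) ?_ (ratio.mono_time hTT')
      ((hU.ratio.of_le (by omega)).mono_time hTT') p)).of_eq ?_
    · refine (((ratioy 0 le_rfl).of_eq (β := (j + 1) * (2 - 2 * δ))
        (by rw [hα, residualOrder]; ring)).mono_time hTT').congr fun t ht x => ?_
      ring
    · rw [residualOrder]; push_cast; linarith [expo_mul hS.one_lt]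
  refine ((((t1.mono_time hTT').of_le (by omega)).add (t2.mono_time hTT')).add
    (t3.of_le (by omega))).congr fun t ht x => ?_
  have hu0 := ansatzZero_pos hS ht.1 x
  have pos_of : ∀ {v : ℝ}, v / ansatzZero p A t x ∈ Icc (3 / 4 : ℝ) (5 / 4) → 0 < v := fun hv => by
    have := hv.1
    rw [le_div_iff₀ hu0] at this
    exact lt_of_lt_of_le (by positivity) this
  have pU := pos_of (hYU t ht x)
  have pU' := pos_of (hY t ht x)
  have e2 : iteratedDeriv 2 (fun s => U s x + χ (A x / b) * w s x) t
      = iteratedDeriv 2 (fun s => U s x) t + χ (A x / b) * ((expo p + 1) * (expo p + 2) *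
        (t + A x) ^ (-2 : ℝ) * w t x + E t x) := by
    rw [iteratedDeriv_succ, iteratedDeriv_one, (d2 t (hsub ht) x).deriv]
  have eL := laplacian_add_of_hasOrder (hU.order.of_le (m := r + 2) (by omega))
    ((cut 0 le_rfl).mul hA wo) (hsub ht) x
  have eE : E t x = -iteratedDeriv 2 (fun s => U s x) t + laplacian (U t) x
      + U t x ^ p := by rw [hE, residual, nonlin_of_pos pU]
  have hup : 0 < ansatzZero p A t x ^ p := rpow_pos_of_pos hu0 p
  have eY : ∀ {v : ℝ}, 0 < v → ansatzZero p A t x ^ p * (v / ansatzZero p A t x) ^ p = v ^ p :=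
    fun hv => by rw [Real.div_rpow hv.le hu0.le, mul_div_cancel₀ _ hup.ne']
  -- `p U₀^(p-1) = (m + 1) (m + 2) (t + A)^(-2)`
  have eM : ansatzZero p A t x ^ p * p / ansatzZero p A t x
      = (expo p + 1) * (expo p + 2) * (t + A x) ^ (-2 : ℝ) := by
    have h1 : ansatzZero p A t x ^ p / ansatzZero p A t x = ansatzZero p A t x ^ (p - 1) := by
      rw [Real.rpow_sub_one hu0.ne']
    rw [mul_div_right_comm, h1, ansatzZero_rpow hS ht.1, kappa_rpow hS.one_lt,
      expo_mul hS.one_lt]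
    linear_combination (expo p + 1) * (t + A x) ^ (-2 : ℝ) * expo_mul hS.one_lt
  rw [residual, e2, eL, nonlin_of_pos pU', eE]
  rw [mul_sub, mul_sub, eY pU, eY pU', ← eM]
  ring

lemma div_ansatzZero_mem (hS : IsSetting p χ k A) {m j : ℕ}
    (h : IsParameterChoiceUpTo m p χ A a τ) (hj : j ≤ m) {t : ℝ} (ht : t ∈ Ioc 0 (τ j))
    (x : Space N) :
    ansatz p χ A a τ j t x / ansatzZero p A t x ∈ Icc (3 / 4 : ℝ) (5 / 4) := by
  have hu := ansatzZero_pos hS ht.1 x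
  rcases Nat.eq_zero_or_pos j with rfl | h0
  · rw [ansatz, div_self hu.ne']; norm_num
  · have h1 := (h.close j h0 hj t ht x).1
    have h2 : (0 : ℝ) ≤ 2⁻¹ ^ j := by positivity
    have h3 : 1 / 4 * (1 - (2 : ℝ)⁻¹ ^ j) * ansatzZero p A t x ≤ 1 / 4 * ansatzZero p A t x := by
      gcongr; linarith
    have h4 := abs_le.1 (h1.trans h3)
    constructor
    · rw [le_div_iff₀ hu]; linarith [h4.1]
    · rw [div_le_iff₀ hu]; linarith [h4.2]

lemma ansatz_regular (hS : IsSetting p χ k A) {m j : ℕ} (hm : m ≤ numSteps p)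
    (h : IsParameterChoiceUpTo m p χ A a τ) (hj : j ≤ m) :
    IsRegularAnsatz p A (1 / k) (τ j) (k - 3 - 2 * j) (residualOrder p (1 / k) j)
      (ansatz p χ A a τ j) := by
  induction j with
  | zero => exact ansatzZero_regular hS (τ 0)
  | succ j ih =>
    exact (ih (by omega)).step hS (by omega) (h.time_pos _ hj) (h.time_anti j (by omega))
      (h.cut_pos _ (by omega) hj)
      fun t ht x => div_ansatzZero_mem hS h hj ⟨ht.1, ht.2.le⟩ x

lemma ansatz_congr {a' τ' : ℕ → ℝ} {j : ℕ} (ha : ∀ i ≤ j, a i = a' i)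
    (hτ : ∀ i < j, τ i = τ' i) : ansatz p χ A a τ j = ansatz p χ A a' τ' j := by
  induction j with
  | zero => rfl
  | succ j ih =>
    have := ih (fun i hi => ha i (by omega)) fun i hi => hτ i (by omega)
    simp only [ansatz]
    rw [this, ha (j + 1) le_rfl, hτ j (by omega)]

/-- `(1 + U₀)^(-(p-1)/2)` is comparable to `t + A` where the latter is at most `1`. -/
lemma one_add_ansatzZero_rpow_ge (hS : IsSetting p χ k A) {t : ℝ} (ht : 0 < t) (x : Space N)
    (hd1 : t + A x ≤ 1) :
    (1 + kappa p) ^ (-((p - 1) / 2)) * (t + A x)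
      ≤ (1 + ansatzZero p A t x) ^ (-((p - 1) / 2)) := by
  have hd := hS.dist_pos ht x
  have hκ := kappa_pos hS.one_lt
  have hm := expo_pos hS.one_lt
  have h1 : 1 + ansatzZero p A t x ≤ (1 + kappa p) * (t + A x) ^ (-expo p) := by
    have : 1 ≤ (t + A x) ^ (-expo p) :=
      Real.one_le_rpow_of_pos_of_le_one_of_nonpos hd hd1 (by linarith)
    rw [ansatzZero, ← expo]; linarith
  have h2 := rpow_le_rpow_of_nonpos (z := -((p - 1) / 2))
    (by linarith [ansatzZero_pos hS ht x]) h1 (by linarith [hS.one_lt])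
  refine le_trans (le_of_eq ?_) h2
  rw [mul_rpow (by positivity) (by positivity), ← rpow_mul hd.le]
  have : -expo p * -((p - 1) / 2) = 1 := by linarith [expo_mul hS.one_lt]
  rw [this, rpow_one]

lemma exists_parameterChoiceUpTo (hS : IsSetting p χ k A) {m : ℕ} (hm : m ≤ numSteps p) :
    ∃ a τ : ℕ → ℝ, IsParameterChoiceUpTo m p χ A a τ := by
  induction m with
  | zero =>
    refine ⟨fun _ => 1, fun _ => 1, rfl, fun _ h => absurd h (Nat.not_lt_zero _),
      fun _ _ => one_pos, fun h => absurd h (by norm_num), fun _ _ _ => le_rfl,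
      fun _ _ _ => one_pos, fun j h1 h2 => absurd h2 (by omega)⟩
  | succ j ih =>
    obtain ⟨a, τ, h⟩ := ih (by omega)
    have hκ := kappa_pos hS.one_lt
    have hτ := h.time_pos j le_rfl
    obtain ⟨c1, c2⟩ := correction_index_bounds hS hm
    have hreg := ansatz_regular hS (by omega) h le_rfl
    obtain ⟨-, C, hC, hw⟩ := (hreg.residual_order.correction hS (by omega) c1 c2).zero
    set η : ℝ := 2⁻¹ ^ (j + 1) * min (1 / 4) ((1 + kappa p) ^ (-((p - 1) / 2))) with hη
    have hη0 : 0 < η := mul_pos (by positivity) (lt_min (by norm_num) (by positivity))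
    -- the new cut-off scale and the new time are taken equal and small
    obtain ⟨s, ⟨⟨⟨hs1, hs2⟩, hs3⟩, hs4⟩, hs0⟩ : ∃ s : ℝ, (((s < τ j ∧ s < 1 / 3) ∧
        (1 ≤ j → s < a j)) ∧ C * (kappa p)⁻¹ * (3 * s) ^ (1 / 2 : ℝ) < η) ∧ s ∈ Ioi 0 := by
      have hlim : ContinuousAt (fun s : ℝ => C * (kappa p)⁻¹ * (3 * s) ^ (1 / 2 : ℝ)) 0 :=
        continuousAt_const.mul ((continuousAt_const.mul continuousAt_id).rpow_const
          (Or.inr (by norm_num)))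
      refine (((((gt_mem_nhds hτ).and (gt_mem_nhds (by norm_num))).and (eventually_imp_distrib_left.2
        fun hj => gt_mem_nhds (h.cut_pos j hj le_rfl))).and
        (hlim.eventually_lt_const (by simpa using hη0))).filter_mono nhdsWithin_le_nhds
        |>.and (self_mem_nhdsWithin (s := Ioi 0))).exists
    have hold : ∀ i ≤ j, ansatz p χ A (update a (j + 1) s)
        (update τ (j + 1) s) i = ansatz p χ A a τ i := fun i hi =>
      ansatz_congr (fun l hl => update_of_ne (by omega) _ _)
        fun l hl => update_of_ne (by omega) _ _
    refine ⟨update a (j + 1) s, update τ (j + 1) s, ?_, ?_, ?_, ?_, ?_, ?_, ?_⟩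
    · grind [h.time_zero]
    · grind [h.time_anti]
    · grind [h.time_pos]
    · grind [h.cut_le_one]
    · grind [h.cut_anti]
    · grind [h.cut_pos]
    · intro i hi1 hi t ht x
      rcases Nat.le_succ_iff.1 hi with hi | rfl
      · rw [hold i hi]
        rw [update_of_ne (by omega)] at ht
        exact h.close i hi1 hi t ht x
      rw [update_self] at ht
      have htj : t ∈ Ioo 0 (τ j) := ⟨ht.1, ht.2.trans_lt hs1⟩
      have hu := ansatzZero_pos hS ht.1 x
      have hd := hS.dist_pos ht.1 x
      have hAx := hS.shape.nonneg x
      simp only [ansatz]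
      rw [hold j le_rfl, update_self, update_of_ne (by omega)]
      set W := χ (A x / s) * correction p A (τ j) (residual p (ansatz p χ A a τ j)) t x with hW
      -- the increment is small compared with both quantities
      have hinc : |W| ≤ 2⁻¹ ^ (j + 1) * (1 / 4) * ansatzZero p A t x ∧
          |W| ≤ 2⁻¹ ^ (j + 1) * (1 + ansatzZero p A t x) ^ (-((p - 1) / 2))
            * ansatzZero p A t x := by
        have hAs : 0 ≤ A x / s := div_nonneg hAx hs0.le
        rcases lt_or_ge 2 (A x / s) with hfar | hnear
        · rw [hW, hS.cutoff.eq_zero _ (mem_Ici.2 hfar.le), zero_mul, abs_zero]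
          exact ⟨by positivity, by positivity⟩
        have hA2 : A x ≤ 2 * s := (div_le_iff₀ hs0).1 hnear
        have hd3 : t + A x ≤ 3 * s := by linarith [ht.2]
        have hd1 : t + A x ≤ 1 := by linarith
        have hχ := hS.cutoff.mem_Icc _ hAs
        have hδ : (1 : ℝ) / k ≤ 1 / 4 := by
          have := hS.six_le
          have : (4 : ℝ) ≤ k := by exact_mod_cast (by omega : 4 ≤ k)
          exact one_div_le_one_div_of_le (by norm_num) this
        have h1 : |W| ≤ η * (t + A x) * ansatzZero p A t x := by
          have e1 : (t + A x) ^ (residualOrder p (1 / k) j + 2)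
              ≤ (t + A x) ^ (-expo p) * ((t + A x) * (3 * s) ^ (1 / 2 : ℝ)) := by
            calc (t + A x) ^ (residualOrder p (1 / k) j + 2)
                ≤ (t + A x) ^ (-expo p + 1 + 1 / 2) := by
                  apply rpow_le_rpow_of_exponent_ge hd hd1
                  rw [residualOrder]
                  have : (0 : ℝ) ≤ j := by positivity
                  nlinarith
              _ = (t + A x) ^ (-expo p) * ((t + A x) * (t + A x) ^ (1 / 2 : ℝ)) := by
                  rw [rpow_add hd, rpow_add hd, rpow_one, mul_assoc]
              _ ≤ _ := by gcongr
          calc |W| = |χ (A x / s)| * |correction p A (τ j)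
                (residual p (ansatz p χ A a τ j)) t x| := abs_mul _ _
            _ ≤ 1 * (C * (t + A x) ^ (residualOrder p (1 / k) j + 2)) := by
                gcongr
                · rw [abs_of_nonneg hχ.1]; exact hχ.2
                · exact hw t htj x
            _ ≤ 1 * (C * ((t + A x) ^ (-expo p) * ((t + A x) * (3 * s) ^ (1 / 2 : ℝ)))) := by
                gcongr
            _ = C * (kappa p)⁻¹ * (3 * s) ^ (1 / 2 : ℝ) * (t + A x)
                  * (kappa p * (t + A x) ^ (-expo p)) := by field_simp
            _ ≤ η * (t + A x) * (kappa p * (t + A x) ^ (-expo p)) := by gcongr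
            _ = _ := by rw [ansatzZero, ← expo]
        constructor
        · refine h1.trans ?_
          rw [hη]
          have : min (1 / 4) ((1 + kappa p) ^ (-((p - 1) / 2))) ≤ 1 / 4 := min_le_left _ _
          calc _ ≤ 2⁻¹ ^ (j + 1) * (1 / 4) * 1 * ansatzZero p A t x := by gcongr
            _ = _ := by ring
        · refine h1.trans ?_
          rw [hη]
          have h2 := one_add_ansatzZero_rpow_ge hS ht.1 x hd1
          have : min (1 / 4) ((1 + kappa p) ^ (-((p - 1) / 2)))
            ≤ (1 + kappa p) ^ (-((p - 1) / 2)) := min_le_right _ _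
          calc _ ≤ 2⁻¹ ^ (j + 1) * ((1 + kappa p) ^ (-((p - 1) / 2))) * (t + A x)
                * ansatzZero p A t x := by gcongr
            _ = 2⁻¹ ^ (j + 1) * ((1 + kappa p) ^ (-((p - 1) / 2)) * (t + A x))
                * ansatzZero p A t x := by ring
            _ ≤ _ := by gcongr
      have hprev : |ansatz p χ A a τ j t x - ansatzZero p A t x|
          ≤ 1 / 4 * (1 - (2 : ℝ)⁻¹ ^ j) * ansatzZero p A t x ∧
          |ansatz p χ A a τ j t x - ansatzZero p A t x|
          ≤ (1 - (2 : ℝ)⁻¹ ^ j) * (1 + ansatzZero p A t x) ^ (-((p - 1) / 2))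
            * ansatzZero p A t x := by
        rcases Nat.eq_zero_or_pos j with rfl | hj
        · simp [ansatz]
        · exact h.close j hj le_rfl t ⟨htj.1, htj.2.le⟩ x
      have htri : |ansatz p χ A a τ j t x + W - ansatzZero p A t x|
          ≤ |ansatz p χ A a τ j t x - ansatzZero p A t x| + |W| := by
        rw [add_sub_right_comm]; exact abs_add_le _ _
      have hpow : (2 : ℝ)⁻¹ ^ j = 2 * 2⁻¹ ^ (j + 1) := by rw [pow_succ]; ring
      rw [hpow] at hprev
      rw [Nat.succ_eq_add_one]
      constructor
      · refine htri.trans ((add_le_add hprev.1 hinc.1).trans (le_of_eq ?_)); ring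
      · refine htri.trans ((add_le_add hprev.2 hinc.2).trans (le_of_eq ?_)); ring

/-- Where `A > 2` the refined ansatz coincides with `U₀`, in a neighbourhood. -/
lemma ansatz_eq_far (hS : IsSetting p χ k A) {m j : ℕ}
    (h : IsParameterChoiceUpTo m p χ A a τ) (hj : j ≤ m) {x : Space N} (hx : 2 < A x) (t : ℝ) :
    ansatz p χ A a τ j t x = ansatzZero p A t x := by
  have hle : ∀ i, 1 ≤ i → i ≤ m → a i ≤ 1 := by
    intro i h1
    induction i, h1 using Nat.le_induction with
    | base => exact h.cut_le_one
    | succ i hi ih => exact fun hm => (h.cut_anti i hi (by omega)).trans (ih (by omega))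
  induction j with
  | zero => rfl
  | succ j ih =>
    have h0 := h.cut_pos (j + 1) (by omega) hj
    have h2 : 2 ≤ A x / a (j + 1) := by
      rw [le_div_iff₀ h0]; linarith [hle (j + 1) (by omega) hj]
    simp only [ansatz]
    rw [ih (by omega), hS.cutoff.eq_zero _ h2, zero_mul, add_zero]

end Ansatz

/-! ### Approximation by test functions -/

section Density

lemma tendsto_eLpNorm_two_of_dominated {α E ι : Type*} [MeasurableSpace α] {μ : Measure α}
    [NormedAddCommGroup E] {l : Filter ι} [l.IsCountablyGenerated] {F : ι → α → E} {b : α → ℝ}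
    (hF : ∀ᶠ i in l, AEStronglyMeasurable (F i) μ) (hb : MemLp b 2 μ)
    (hFb : ∀ᶠ i in l, ∀ᵐ x ∂μ, ‖F i x‖ ≤ b x)
    (h0 : ∀ᵐ x ∂μ, Tendsto (fun i => F i x) l (𝓝 0)) :
    Tendsto (fun i => eLpNorm (F i) 2 μ) l (𝓝 0) := by
  have key : Tendsto (fun i => ∫⁻ x, ‖F i x‖ₑ ^ (2 : ℝ) ∂μ) l (𝓝 (∫⁻ _, 0 ∂μ)) := by
    refine tendsto_lintegral_filter_of_dominated_convergence' (fun x => ‖b x‖ₑ ^ (2 : ℝ)) ?_ ?_ ?_ ?_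
    · filter_upwards [hF] with i hi using hi.enorm.pow_const _
    · filter_upwards [hFb] with i hi
      filter_upwards [hi] with x hx
      gcongr
      rw [← ofReal_norm, ← ofReal_norm]
      exact ENNReal.ofReal_le_ofReal (hx.trans (le_abs_self _))
    · have := hb.2
      rw [eLpNorm_eq_lintegral_rpow_enorm_toReal two_ne_zero ENNReal.ofNat_ne_top] at this
      simp only [ENNReal.toReal_ofNat] at this
      exact (ENNReal.rpow_lt_top_iff_of_pos (by norm_num)).1 this |>.ne
    · filter_upwards [h0] with x hx
      have h1 : Tendsto (fun i => ‖F i x‖ₑ) l (𝓝 0) := by simpa using hx.enorm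
      have := (ENNReal.continuous_rpow_const (y := 2)).continuousAt.tendsto.comp h1
      simpa [Function.comp_def] using this
  rw [lintegral_zero] at key
  have := (ENNReal.continuous_rpow_const (y := 1 / 2)).continuousAt.tendsto.comp key
  simp only [Function.comp_def] at this
  rw [ENNReal.zero_rpow_of_pos (by norm_num)] at this
  refine this.congr fun i => ?_
  rw [eLpNorm_eq_lintegral_rpow_enorm_toReal two_ne_zero ENNReal.ofNat_ne_top]
  simp

/-- The space `L^q(ℝ^N)` of `F`-valued functions, for Lebesgue measure. -/
abbrev LpSpace (N : ℕ) (F : Type*) [NormedAddCommGroup F] (q : ℝ≥0∞) :=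
  Lp F q (volume : Measure (Space N))

variable {N : ℕ} {F : Type*} [NormedAddCommGroup F]

/-- Translations are continuous in `L²`. -/
lemma tendsto_eLpNorm_translate_sub (u : LpSpace N F 2) :
    Tendsto (fun y : Space N => eLpNorm (fun x => u (x - y) - u x) 2 volume) (𝓝 0) (𝓝 0) := by
  have h2 : Fact ((2 : ℝ≥0∞) ≠ ⊤) := ⟨ENNReal.ofNat_ne_top⟩
  have hc : Continuous fun y : Space N => (DomAddAct.mk (-y) +ᵥ u : LpSpace N F 2) :=
    (DomAddAct.continuous_mk.comp continuous_neg).vadd continuous_const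
  have h0 : (DomAddAct.mk (-(0 : Space N)) +ᵥ u : LpSpace N F 2) = u := by
    rw [neg_zero, DomAddAct.mk_zero, zero_vadd]
  have ht := hc.tendsto 0
  rw [h0, Lp.tendsto_Lp_iff_tendsto_eLpNorm'] at ht
  refine ht.congr fun y => eLpNorm_congr_ae ?_
  filter_upwards [DomAddAct.vadd_Lp_ae_eq (DomAddAct.mk (-y)) u] with x hx
  rw [Pi.sub_apply, hx]
  simp [sub_eq_neg_add]

variable [NormedSpace ℝ F]

/-- Averages of translations: the `L²` distance between `u` and its mollification is at most the
largest distance between `u` and its translates. -/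
lemma eLpNorm_convolution_sub_le [CompleteSpace F] {ρ : Space N → ℝ} (hρc : Continuous ρ) (hρ0 : ∀ y, 0 ≤ ρ y)
    (hρi : Integrable ρ) (hρ1 : ∫ y, ρ y = 1) {u : Space N → F} (hu : StronglyMeasurable u)
    (hui : ∀ x, Integrable fun y => ρ y • u (x - y)) {ε : ℝ≥0∞}
    (hε : ∀ y, ρ y ≠ 0 → eLpNorm (fun x => u (x - y) - u x) 2 volume ≤ ε) :
    eLpNorm (fun x => (∫ y, ρ y • u (x - y)) - u x) 2 volume ≤ ε := by
  set r : Space N → ℝ≥0∞ := fun y => ENNReal.ofReal (ρ y) with hr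
  have hrm : Measurable r := hρc.measurable.ennreal_ofReal
  have hr1 : ∫⁻ y, r y = 1 := by
    rw [hr, ← ofReal_integral_eq_lintegral_ofReal hρi (ae_of_all _ hρ0), hρ1,
      ENNReal.ofReal_one]
  have hum : StronglyMeasurable fun z : Space N × Space N => u (z.1 - z.2) - u z.1 :=
    (hu.comp_measurable (measurable_fst.sub measurable_snd)).sub (hu.comp_measurable measurable_fst)
  -- Jensen's inequality for the probability density `ρ`
  have h1 : ∀ x, ‖(∫ y, ρ y • u (x - y)) - u x‖ₑ ^ (2 : ℝ)
      ≤ ∫⁻ y, r y * ‖u (x - y) - u x‖ₑ ^ (2 : ℝ) := by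
    intro x
    have hmx : AEMeasurable (fun y => ‖u (x - y) - u x‖ₑ) :=
      ((hum.comp_measurable (measurable_const.prodMk measurable_id)).enorm).aemeasurable
    have e1 : (∫ y, ρ y • u (x - y)) - u x = ∫ y, ρ y • (u (x - y) - u x) := by
      simp_rw [smul_sub]
      rw [integral_sub (hui x) (hρi.smul_const _), integral_smul_const, hρ1, one_smul]
    have e2 : ‖(∫ y, ρ y • u (x - y)) - u x‖ₑ ≤ ∫⁻ y, r y * ‖u (x - y) - u x‖ₑ := by
      rw [e1]
      refine (enorm_integral_le_lintegral_enorm _).trans (le_of_eq (lintegral_congr fun y => ?_))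
      rw [enorm_smul, Real.enorm_of_nonneg (hρ0 y)]
    have e3 : ∫⁻ y, r y * ‖u (x - y) - u x‖ₑ
        = ∫⁻ y, (fun y => r y ^ (1 / 2 : ℝ)) y * (fun y => r y ^ (1 / 2 : ℝ) * ‖u (x - y) - u x‖ₑ) y := by
      refine lintegral_congr fun y => ?_
      have : r y = r y ^ (1 / 2 : ℝ) * r y ^ (1 / 2 : ℝ) := by
        rw [← ENNReal.rpow_add_of_nonneg _ _ (by norm_num) (by norm_num)]; norm_num
      conv_lhs => rw [this, mul_assoc]
    have e4 := ENNReal.lintegral_mul_le_Lp_mul_Lq volume Real.HolderConjugate.two_two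
      (hrm.pow_const (1 / 2 : ℝ)).aemeasurable
      ((hrm.pow_const (1 / 2 : ℝ)).aemeasurable.mul hmx)
    have e5 : ∀ c : ℝ≥0∞, (c ^ (1 / 2 : ℝ)) ^ (2 : ℝ) = c := fun c => by
      rw [← ENNReal.rpow_mul]; norm_num
    simp only [Pi.mul_apply, ENNReal.mul_rpow_of_nonneg _ _ (zero_le_two (α := ℝ)), e5, hr1,
      ENNReal.one_rpow, one_mul] at e4
    calc _ ≤ (∫⁻ y, r y * ‖u (x - y) - u x‖ₑ) ^ (2 : ℝ) := by gcongr
      _ ≤ ((∫⁻ y, r y * ‖u (x - y) - u x‖ₑ ^ (2 : ℝ)) ^ (1 / 2 : ℝ)) ^ (2 : ℝ) := by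
        gcongr; rw [e3]; simpa using e4
      _ = _ := e5 _
  have h2 : ∫⁻ x, ‖(∫ y, ρ y • u (x - y)) - u x‖ₑ ^ (2 : ℝ) ≤ ε ^ (2 : ℝ) := by
    calc _ ≤ ∫⁻ x, ∫⁻ y, r y * ‖u (x - y) - u x‖ₑ ^ (2 : ℝ) := lintegral_mono h1
      _ = ∫⁻ y, ∫⁻ x, r y * ‖u (x - y) - u x‖ₑ ^ (2 : ℝ) := by
        refine lintegral_lintegral_swap ?_
        exact ((hrm.comp measurable_snd).mul (hum.enorm.pow_const _)).aemeasurable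
      _ ≤ ∫⁻ y, r y * ε ^ (2 : ℝ) := by
        refine lintegral_mono fun y => ?_
        have hm : Measurable fun x => ‖u (x - y) - u x‖ₑ ^ (2 : ℝ) :=
          (hum.comp_measurable (measurable_id.prodMk measurable_const)).enorm.pow_const _
        rw [lintegral_const_mul _ hm]
        rcases eq_or_ne (ρ y) 0 with h | h
        · simp [hr, h]
        · have := hε y h
          rw [eLpNorm_eq_lintegral_rpow_enorm_toReal two_ne_zero ENNReal.ofNat_ne_top,
            ENNReal.toReal_ofNat, one_div, ENNReal.rpow_inv_le_iff (by norm_num)] at this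
          gcongr
      _ = ε ^ (2 : ℝ) := by rw [lintegral_mul_const _ hrm, hr1, one_mul]
  rw [eLpNorm_eq_lintegral_rpow_enorm_toReal two_ne_zero ENNReal.ofNat_ne_top,
    ENNReal.toReal_ofNat, one_div, ENNReal.rpow_inv_le_iff (by norm_num)]
  exact h2

lemma integrable_smul_translate {ρ : Space N → ℝ} (hρc : Continuous ρ) (hρ : HasCompactSupport ρ)
    (u : LpSpace N F 2) (x : Space N) :
    Integrable fun y => ρ y • u (x - y) := by
  have h1 : MemLp (fun y => u (x - y)) 2 volume :=
    (Lp.memLp u).comp_measurePreserving (Measure.measurePreserving_sub_left volume x)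
  exact memLp_one_iff_integrable.1
    (h1.smul (hρc.memLp_of_hasCompactSupport hρ (p := 2)) (r := 1))

/-- The gradient of a mollification is the mollification of the weak gradient. -/
lemma hasGradientAt_mollify {u : L2 N} {g : L2Vec N} (h : IsWeakGradient u g)
    {ρ : Space N → ℝ} (hρ : ContDiff ℝ ∞ ρ) (hρc : HasCompactSupport ρ) (x : Space N) :
    HasGradientAt (fun x => ∫ y, ρ y • u (x - y)) (∫ y, ρ y • g (x - y)) x := by
  have hloc : LocallyIntegrable (fun x => u x) volume :=
    (Lp.memLp u).locallyIntegrable (by norm_num)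
  have h1 := hρc.hasFDerivAt_convolution_left (ContinuousLinearMap.lsmul ℝ ℝ)
    (hρ.of_le (by exact_mod_cast le_top)) hloc x
  have hφ : ContDiff ℝ ∞ fun y => ρ (x - y) := hρ.comp (contDiff_const.sub contDiff_id)
  have hφc : HasCompactSupport fun y => ρ (x - y) :=
    hρc.comp_homeomorph (Homeomorph.subLeft x)
  have h2 := h _ hφ hφc
  have hd : Differentiable ℝ ρ := hρ.differentiable (by simp)
  have h3 : ∀ y, ∇ (fun y => ρ (x - y)) y = - ∇ ρ (x - y) := by
    intro y
    have e : fderiv ℝ (fun y => ρ (x - y)) y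
        = (fderiv ℝ ρ (x - y)).comp (-ContinuousLinearMap.id ℝ (Space N)) :=
      ((hd (x - y)).hasFDerivAt.comp y ((hasFDerivAt_id y).const_sub x)).fderiv
    rw [gradient, e, gradient]
    have : (fderiv ℝ ρ (x - y)).comp (-ContinuousLinearMap.id ℝ (Space N)) = - fderiv ℝ ρ (x - y) := by
      ext v; simp
    rw [this, map_neg]
  simp_rw [h3, smul_neg] at h2
  rw [integral_neg, neg_inj] at h2
  have h4 : ∫ y, ρ y • g (x - y) = ∫ y, u (x - y) • ∇ ρ y := by
    rw [← integral_sub_left_eq_self (fun y => ρ y • g (x - y)) volume x,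
      ← integral_sub_left_eq_self (fun y => u (x - y) • ∇ ρ y) volume x]
    simpa using h2.symm
  rw [hasGradientAt_iff_hasFDerivAt, h4]
  have h5 : (InnerProductSpace.toDual ℝ (Space N)) (∫ y, u (x - y) • ∇ ρ y)
      = ∫ y, u (x - y) • fderiv ℝ ρ y := by
    have := ((InnerProductSpace.toDual ℝ (Space N)).toContinuousLinearEquiv.integral_comp_comm
      (μ := volume) (fun y => u (x - y) • ∇ ρ y)).symm
    refine this.trans (integral_congr_ae (ae_of_all _ fun y => ?_))
    simp [gradient]
  have h6 : (convolution (fderiv ℝ ρ) (fun x => u x)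
      (ContinuousLinearMap.precompL (Space N) (ContinuousLinearMap.lsmul ℝ ℝ)) volume x)
      = ∫ y, u (x - y) • fderiv ℝ ρ y := by
    refine integral_congr_ae (ae_of_all _ fun y => ?_)
    ext v
    simp [ContinuousLinearMap.precompL_apply, mul_comm]
  rw [h5, ← h6]
  exact h1

/-- Smooth cut-offs at infinity, with gradients tending to `0` uniformly. -/
lemma exists_cutoff_sequence (N : ℕ) : ∃ (K : ℝ) (η : ℕ → Space N → ℝ), 0 ≤ K ∧
    (∀ n, ContDiff ℝ ∞ (η n)) ∧ (∀ n, HasCompactSupport (η n)) ∧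
    (∀ n x, η n x ∈ Icc (0 : ℝ) 1) ∧ (∀ x, ∀ᶠ n in atTop, η n x = 1) ∧
    ∀ n x, ‖∇ (η n) x‖ ≤ ((n : ℝ) + 1)⁻¹ * K := by
  let c : ContDiffBump (0 : Space N) := ⟨1, 2, by norm_num, by norm_num⟩
  have hcd : ContDiff ℝ ∞ c := c.contDiff
  have hcgc : Continuous (∇ c) := (InnerProductSpace.toDual ℝ (Space N)).symm.continuous.comp
      (hcd.continuous_fderiv (by simp))
  obtain ⟨K, hK⟩ : ∃ K, ∀ x, ‖∇ c x‖ ≤ K := by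
    have hcs : HasCompactSupport (∇ c) :=
      (c.hasCompactSupport.fderiv (𝕜 := ℝ)).comp_left
        (g := (InnerProductSpace.toDual ℝ (Space N)).symm) (map_zero _)
    exact hcgc.bounded_above_of_compact_support hcs
  let η : ℕ → Space N → ℝ := fun n x => c (((n : ℝ) + 1)⁻¹ • x)
  have hn1 : ∀ n : ℕ, 0 < ((n : ℝ) + 1)⁻¹ := fun n => by positivity
  have hη : ∀ n, ContDiff ℝ ∞ (η n) := fun n => hcd.comp (contDiff_const_smul _)
  have hηg : ∀ n x, ∇ (η n) x = ((n : ℝ) + 1)⁻¹ • ∇ c (((n : ℝ) + 1)⁻¹ • x) := by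
    intro n x
    have e : fderiv ℝ (η n) x = ((n : ℝ) + 1)⁻¹ • fderiv ℝ c (((n : ℝ) + 1)⁻¹ • x) :=
      fderiv_comp_smul (f := c) _
    rw [gradient, e, map_smul]; rfl
  have hηc : ∀ n, HasCompactSupport (η n) := fun n =>
    c.hasCompactSupport.comp_smul (hn1 n).ne'
  have hη01 : ∀ n x, η n x ∈ Icc (0 : ℝ) 1 := fun n x => ⟨c.nonneg, c.le_one⟩
  have hη1 : ∀ x, ∀ᶠ n in atTop, η n x = 1 := by
    intro x
    obtain ⟨m, hm⟩ := exists_nat_gt ‖x‖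
    filter_upwards [eventually_ge_atTop m] with n hn
    apply c.one_of_mem_closedBall
    rw [mem_closedBall_zero_iff, norm_smul, norm_of_nonneg (hn1 n).le]
    change _ ≤ (1 : ℝ)
    rw [inv_mul_le_iff₀ (by positivity)]
    have : (m : ℝ) ≤ n := by exact_mod_cast hn
    linarith
  refine ⟨K, η, (norm_nonneg _).trans (hK 0), hη, hηc, hη01, hη1, fun n x => ?_⟩
  rw [hηg, norm_smul, norm_of_nonneg (hn1 n).le]
  gcongr
  exact hK _

lemma continuous_gradient {φ : Space N → ℝ} (h : ContDiff ℝ 1 φ) : Continuous (∇ φ) :=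
  (InnerProductSpace.toDual ℝ (Space N)).symm.continuous.comp (h.continuous_fderiv (by simp))

/-- Cutting off a smooth function of finite `H¹` norm. -/
lemma exists_cutoff_approx {v : Space N → ℝ} (hvs : ContDiff ℝ ∞ v) (hvm : MemLp v 2 volume)
    (hgm : MemLp (∇ v) 2 volume) {ε : ℝ≥0∞} (hε : 0 < ε) :
    ∃ φ : Space N → ℝ, ContDiff ℝ ∞ φ ∧ HasCompactSupport φ ∧
      eLpNorm (fun x => v x - φ x) 2 volume ≤ ε ∧ eLpNorm (fun x => ∇ v x - ∇ φ x) 2 volume ≤ ε := by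
  have hcg : Continuous (∇ v) := (InnerProductSpace.toDual ℝ (Space N)).symm.continuous.comp
      (hvs.continuous_fderiv (by simp))
  obtain ⟨K, η, hK0, hη, hηc, hη01, hη1, hK⟩ := exists_cutoff_sequence N
  have hprod : ∀ n x, ∇ (fun x => η n x * v x) x = η n x • ∇ v x + v x • ∇ (η n) x := by
    intro n x
    have e : fderiv ℝ (fun x => η n x * v x) x = η n x • fderiv ℝ v x + v x • fderiv ℝ (η n) x :=
      fderiv_fun_mul ((hη n).differentiable (by simp) x) (hvs.differentiable (by simp) x)
    simp only [gradient, e, map_add, map_smul]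
  have hinv : Tendsto (fun n : ℕ => ((n : ℝ) + 1)⁻¹) atTop (𝓝 0) := by
    simpa [one_div] using tendsto_one_div_add_atTop_nhds_zero_nat (𝕜 := ℝ)
  have T1 : Tendsto (fun n => eLpNorm (fun x => v x - η n x * v x) 2 volume) atTop (𝓝 0) := by
    refine tendsto_eLpNorm_two_of_dominated (b := fun x => |v x|) ?_ hvm.norm ?_ ?_
    · exact Eventually.of_forall fun n =>
        (hvs.continuous.sub ((hη n).continuous.mul hvs.continuous)).aestronglyMeasurable
    · refine Eventually.of_forall fun n => ae_of_all _ fun x => ?_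
      have := hη01 n x
      rw [show v x - η n x * v x = (1 - η n x) * v x by ring, norm_mul, norm_eq_abs,
        norm_eq_abs, abs_of_nonneg (by linarith [this.2])]
      exact mul_le_of_le_one_left (abs_nonneg _) (by linarith [this.1])
    · refine ae_of_all _ fun x => tendsto_const_nhds.congr' ?_
      filter_upwards [hη1 x] with n hn
      simp [hn]
  have hηg : ∀ n, Continuous (∇ (η n)) := fun n => continuous_gradient ((hη n).of_le (by simp))
  have T2 : Tendsto (fun n => eLpNorm (fun x => ∇ v x - ∇ (fun x => η n x * v x) x) 2 volume)
      atTop (𝓝 0) := by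
    simp_rw [hprod]
    have e : ∀ n x, ∇ v x - (η n x • ∇ v x + v x • ∇ (η n) x)
        = (1 - η n x) • ∇ v x - v x • ∇ (η n) x := fun n x => by module
    simp_rw [e]
    refine tendsto_eLpNorm_two_of_dominated (b := fun x => ‖∇ v x‖ + K * |v x|) ?_
      (hgm.norm.add (hvm.norm.const_mul K)) ?_ ?_
    · exact Eventually.of_forall fun n => (((continuous_const.sub (hη n).continuous).smul hcg).sub
        (hvs.continuous.smul (hηg n))).aestronglyMeasurable
    · refine Eventually.of_forall fun n => ae_of_all _ fun x => ?_
      have := hη01 n x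
      refine (norm_sub_le _ _).trans (add_le_add ?_ ?_)
      · rw [norm_smul, norm_of_nonneg (by linarith [this.2])]
        exact mul_le_of_le_one_left (norm_nonneg _) (by linarith [this.1])
      · rw [norm_smul, norm_eq_abs, mul_comm]
        have h3 : ((n : ℝ) + 1)⁻¹ ≤ 1 := inv_le_one_of_one_le₀ (by linarith [n.cast_nonneg (α := ℝ)])
        gcongr
        exact (hK n x).trans (mul_le_of_le_one_left hK0 h3)
    · refine ae_of_all _ fun x => ?_
      have h0 : Tendsto (fun n : ℕ => |v x| * (((n : ℝ) + 1)⁻¹ * K)) atTop (𝓝 0) := by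
        simpa using (hinv.mul_const K).const_mul |v x|
      refine squeeze_zero_norm' ?_ h0
      filter_upwards [hη1 x] with n hn
      rw [hn, sub_self, zero_smul, zero_sub, norm_neg, norm_smul, norm_eq_abs]
      gcongr
      exact hK n x
  obtain ⟨n, hn1, hn2⟩ := ((T1.eventually (ge_mem_nhds hε)).and
    (T2.eventually (ge_mem_nhds hε))).exists
  exact ⟨fun x => η n x * v x, (hη n).mul hvs, (hηc n).mul_right, hn1, hn2⟩

lemma eLpNorm_sub_le_of_le {F : Type*} [NormedAddCommGroup F] {a b c : Space N → F} {ε : ℝ≥0∞}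
    (ha : AEStronglyMeasurable a volume) (hb : AEStronglyMeasurable b volume)
    (hc : AEStronglyMeasurable c volume)
    (h1 : eLpNorm (fun x => b x - a x) 2 volume ≤ ε / 2)
    (h2 : eLpNorm (fun x => b x - c x) 2 volume ≤ ε / 2) :
    eLpNorm (fun x => a x - c x) 2 volume ≤ ε := by
  calc eLpNorm (fun x => a x - c x) 2 volume
        = eLpNorm ((fun x => b x - c x) - fun x => b x - a x) 2 volume := by
          congr 1; ext x; simp
      _ ≤ eLpNorm (fun x => b x - c x) 2 volume + eLpNorm (fun x => b x - a x) 2 volume :=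
          eLpNorm_sub_le (hb.sub hc) (hb.sub ha) (by norm_num)
      _ ≤ ε / 2 + ε / 2 := add_le_add h2 h1
      _ = ε := ENNReal.add_halves ε

/-- Test functions are dense in `H¹`. -/
lemma exists_testFunction_approx {u : L2 N} {g : L2Vec N} (h : IsWeakGradient u g) {ε : ℝ≥0∞}
    (hε : 0 < ε) : ∃ φ : Space N → ℝ, ContDiff ℝ ∞ φ ∧ HasCompactSupport φ ∧
      eLpNorm (fun x => u x - φ x) 2 volume ≤ ε ∧ eLpNorm (fun x => g x - ∇ φ x) 2 volume ≤ ε := by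
  have hε2 : 0 < ε / 2 := ENNReal.half_pos hε.ne'
  -- regularize
  obtain ⟨r, hr, hru⟩ : ∃ r > 0, ∀ y : Space N, ‖y‖ < r →
      eLpNorm (fun x => u (x - y) - u x) 2 volume ≤ ε / 2 ∧
      eLpNorm (fun x => g (x - y) - g x) 2 volume ≤ ε / 2 := by
    have h1 := (tendsto_eLpNorm_translate_sub u).eventually (ge_mem_nhds hε2)
    have h2 := (tendsto_eLpNorm_translate_sub g).eventually (ge_mem_nhds hε2)
    obtain ⟨r, hr, H⟩ := Metric.eventually_nhds_iff.1 (h1.and h2)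
    exact ⟨r, hr, fun y hy => H (by simpa using hy)⟩
  let b : ContDiffBump (0 : Space N) := ⟨r / 2, r, by positivity, by linarith⟩
  set ρ : Space N → ℝ := b.normed volume with hρd
  have hρ : ContDiff ℝ ∞ ρ := b.contDiff_normed
  have hρc : HasCompactSupport ρ := b.hasCompactSupport_normed
  have hρ0 : ∀ y, ρ y ≠ 0 → ‖y‖ < r := by
    intro y hy
    have : y ∈ Function.support ρ := hy
    rw [hρd, b.support_normed_eq] at this
    simpa [b] using this
  have hi := integrable_smul_translate hρ.continuous hρc u
  have hig := integrable_smul_translate hρ.continuous hρc g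
  have hv := eLpNorm_convolution_sub_le hρ.continuous b.nonneg_normed b.integrable_normed
    b.integral_normed (Lp.stronglyMeasurable u) hi fun y hy => (hru y (hρ0 y hy)).1
  have hvg := eLpNorm_convolution_sub_le hρ.continuous b.nonneg_normed b.integrable_normed
    b.integral_normed (Lp.stronglyMeasurable g) hig fun y hy => (hru y (hρ0 y hy)).2
  set v : Space N → ℝ := fun x => ∫ y, ρ y • u (x - y)
  have hgrad : ∀ x, HasGradientAt v (∫ y, ρ y • g (x - y)) x := hasGradientAt_mollify h hρ hρc
  have hvs : ContDiff ℝ ∞ v :=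
    hρc.contDiff_convolution_left (ContinuousLinearMap.lsmul ℝ ℝ) hρ
      ((Lp.memLp u).locallyIntegrable (by norm_num))
  have hgr : ∀ x, ∇ v x = ∫ y, ρ y • g (x - y) := fun x => (hgrad x).gradient
  simp_rw [← hgr] at hvg
  have hcg : Continuous (∇ v) := continuous_gradient (hvs.of_le (by simp))
  by_cases hεt : ε = (⊤ : ℝ≥0∞)
  · exact ⟨0, contDiff_const, HasCompactSupport.zero, by simp [hεt], by simp [hεt]⟩
  have hlt : ε / 2 < (⊤ : ℝ≥0∞) := ENNReal.div_lt_top hεt two_ne_zero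
  have hvm : MemLp v 2 volume := by
    have : MemLp (fun x => v x - u x) 2 volume :=
      ⟨hvs.continuous.aestronglyMeasurable.sub (Lp.aestronglyMeasurable u), hv.trans_lt hlt⟩
    exact (this.add (Lp.memLp u)).ae_eq (ae_of_all _ fun x => by simp)
  have hgm : MemLp (∇ v) 2 volume := by
    have : MemLp (fun x => ∇ v x - g x) 2 volume :=
      ⟨hcg.aestronglyMeasurable.sub (Lp.aestronglyMeasurable g), hvg.trans_lt hlt⟩
    exact (this.add (Lp.memLp g)).ae_eq (ae_of_all _ fun x => by simp)
  obtain ⟨φ, hφ, hφc, h1, h2⟩ := exists_cutoff_approx hvs hvm hgm hε2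
  exact ⟨φ, hφ, hφc, eLpNorm_sub_le_of_le (Lp.aestronglyMeasurable u) hvm.1
    hφ.continuous.aestronglyMeasurable hv h1, eLpNorm_sub_le_of_le (Lp.aestronglyMeasurable g) hgm.1
    (continuous_gradient (hφ.of_le (by simp))).aestronglyMeasurable hvg h2⟩

end Density

/-! ### The weighted Sobolev inequality -/

section Sobolev
open scoped NNReal

variable {N : ℕ}

/-- The `H¹` norm of a differentiable function, as an extended real. -/
def sobolevNorm (u : Space N → ℝ) : ℝ≥0∞ := eLpNorm u 2 volume + eLpNorm (fderiv ℝ u) 2 volume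

lemma lintegral_enorm_rpow_two {α E : Type*} [MeasurableSpace α] {μ : Measure α}
    [NormedAddCommGroup E] (f : α → E) :
    ∫⁻ x, ‖f x‖ₑ ^ (2 : ℝ) ∂μ = eLpNorm f 2 μ ^ (2 : ℝ) := by
  rw [eLpNorm_eq_lintegral_rpow_enorm_toReal two_ne_zero ENNReal.ofNat_ne_top,
    ENNReal.toReal_ofNat, ← ENNReal.rpow_mul]
  norm_num

/-- Interpolation between `L²` and `L^Q` with a common bound. -/
lemma lintegral_rpow_interpolate {α : Type*} [MeasurableSpace α] {μ : Measure α} {a : α → ℝ≥0∞}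
    (ha : AEMeasurable a μ) {q Q : ℝ} (hq : 2 ≤ q) (hQ : q ≤ Q) {C S : ℝ≥0∞}
    (h2 : ∫⁻ x, a x ^ (2 : ℝ) ∂μ ≤ S ^ (2 : ℝ)) (h : ∫⁻ x, a x ^ Q ∂μ ≤ C * S ^ Q) :
    ∫⁻ x, a x ^ q ∂μ ≤ (1 + C) * S ^ q := by
  rcases eq_or_ne S 0 with rfl | hS0
  · rw [ENNReal.zero_rpow_of_pos (by norm_num)] at h2
    have h3 := (lintegral_eq_zero_iff' (ha.pow_const _)).1 (le_antisymm h2 bot_le)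
    rw [lintegral_congr_ae (g := fun _ => 0) ?_]
    · simp
    · filter_upwards [h3] with x hx
      have : a x = 0 := by simpa using hx
      rw [this, ENNReal.zero_rpow_of_pos (by linarith)]
  rcases eq_or_ne S ⊤ with rfl | hST
  · rw [ENNReal.top_rpow_of_pos (by linarith), ENNReal.mul_top (by simp)]
    exact le_top
  have hpt : ∀ x, a x ^ q ≤ S ^ (q - 2) * a x ^ (2 : ℝ) + S ^ (q - Q) * a x ^ Q := by
    intro x
    rcases le_total (a x) S with h1 | h1
    · refine le_add_right ?_
      calc a x ^ q = a x ^ (q - 2) * a x ^ (2 : ℝ) := by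
            rw [← ENNReal.rpow_add_of_nonneg _ _ (by linarith) (by norm_num)]; ring_nf
        _ ≤ _ := by gcongr
    · refine le_add_left ?_
      calc a x ^ q = S ^ (q - Q) * (S ^ (Q - q) * a x ^ q) := by
            rw [← mul_assoc, ← ENNReal.rpow_add _ _ hS0 hST]; simp
        _ ≤ S ^ (q - Q) * (a x ^ (Q - q) * a x ^ q) := by gcongr
        _ = _ := by
            rw [← ENNReal.rpow_add_of_nonneg _ _ (by linarith) (by linarith)]; ring_nf
  calc ∫⁻ x, a x ^ q ∂μ
      ≤ ∫⁻ x, (S ^ (q - 2) * a x ^ (2 : ℝ) + S ^ (q - Q) * a x ^ Q) ∂μ := lintegral_mono hpt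
    _ = S ^ (q - 2) * ∫⁻ x, a x ^ (2 : ℝ) ∂μ + S ^ (q - Q) * ∫⁻ x, a x ^ Q ∂μ := by
        rw [lintegral_add_left' ((ha.pow_const _).const_mul _),
          lintegral_const_mul'' _ (ha.pow_const _), lintegral_const_mul'' _ (ha.pow_const _)]
    _ ≤ S ^ (q - 2) * S ^ (2 : ℝ) + S ^ (q - Q) * (C * S ^ Q) := by gcongr
    _ = S ^ (q - 2) * S ^ (2 : ℝ) + C * (S ^ (q - Q) * S ^ Q) := by ring
    _ = _ := by
        rw [← ENNReal.rpow_add _ _ hS0 hST, ← ENNReal.rpow_add _ _ hS0 hST, add_mul, one_mul]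
        ring_nf

lemma lintegral_mul_fderiv_le (u : Space N → ℝ) (hu : ContDiff ℝ 1 u) (m : ℕ) :
    (∫⁻ x, ‖fderiv ℝ (fun x => u x ^ (m + 1)) x‖ₑ) ^ (2 : ℝ)
      ≤ ((m + 1 : ℕ) : ℝ≥0∞) ^ (2 : ℝ) * (∫⁻ x, ‖u x‖ₑ ^ (2 * m : ℝ)) * sobolevNorm u ^ (2 : ℝ) := by
  have hd : ∀ x, fderiv ℝ (fun x => u x ^ (m + 1)) x = ((m + 1 : ℕ) * u x ^ m) • fderiv ℝ u x := by
    intro x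
    have := ((hu.differentiable (by simp) x).hasFDerivAt.pow (m + 1)).fderiv
    simpa [nsmul_eq_mul] using this
  have h1 : ∀ x, ‖fderiv ℝ (fun x => u x ^ (m + 1)) x‖ₑ
      = ((m + 1 : ℕ) : ℝ≥0∞) * ((fun x => ‖u x‖ₑ ^ (m : ℝ)) * fun x => ‖fderiv ℝ u x‖ₑ) x := by
    intro x
    rw [hd, enorm_smul, enorm_mul, enorm_pow, Pi.mul_apply, ENNReal.rpow_natCast, mul_assoc]
    congr 1
    rw [Real.enorm_natCast]
  have hm1 : AEMeasurable (fun x => ‖u x‖ₑ ^ (m : ℝ)) volume :=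
    hu.continuous.enorm.aemeasurable.pow_const _
  have hm2 : AEMeasurable (fun x => ‖fderiv ℝ u x‖ₑ) volume :=
    (hu.continuous_fderiv (by simp)).enorm.aemeasurable
  have h2 := ENNReal.lintegral_mul_le_Lp_mul_Lq volume Real.HolderConjugate.two_two hm1 hm2
  simp_rw [h1]
  rw [lintegral_const_mul'' _ (hm1.mul hm2), ENNReal.mul_rpow_of_nonneg _ _ (by norm_num), mul_assoc]
  gcongr
  refine (ENNReal.rpow_le_rpow h2 (by norm_num)).trans ?_
  rw [ENNReal.mul_rpow_of_nonneg _ _ (by norm_num), ← ENNReal.rpow_mul, ← ENNReal.rpow_mul,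
    lintegral_enorm_rpow_two]
  simp only [← ENNReal.rpow_mul]
  norm_num
  rw [mul_comm 2]
  gcongr
  exact le_add_left le_rfl

lemma enorm_le_lintegral_fderiv (u : Space 1 → ℝ) (hu : ContDiff ℝ 1 u)
    (hc : HasCompactSupport u) (x : Space 1) : ‖u x‖ₑ ≤ ∫⁻ y, ‖fderiv ℝ u y‖ₑ := by
  let e : ℝ ≃ₗᵢ[ℝ] Space 1 := (OrthonormalBasis.singleton (Fin 1) ℝ).repr
  have he : MeasurePreserving e volume volume := e.measurePreserving
  have hv : ContDiff ℝ 1 fun s => u (e s) := hu.comp e.contDiff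
  have hvc : HasCompactSupport fun s => u (e s) := hc.comp_homeomorph e.toHomeomorph
  have h1 := hvc.enorm_le_lintegral_Ici_deriv hv (e.symm x)
  simp only [LinearIsometryEquiv.apply_symm_apply] at h1
  have hd : ∀ s, ‖deriv (fun s => u (e s)) s‖ₑ ≤ ‖fderiv ℝ u (e s)‖ₑ := by
    intro s
    have h2 : HasDerivAt (fun s => e s) (e 1) s := e.toContinuousLinearEquiv.hasFDerivAt.hasDerivAt
    have h3 : deriv (fun s => u (e s)) s = fderiv ℝ u (e s) (e 1) :=
      ((hu.differentiable (by simp) (e s)).hasFDerivAt.comp_hasDerivAt s h2).deriv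
    rw [h3, ← ofReal_norm, ← ofReal_norm]
    refine ENNReal.ofReal_le_ofReal ?_
    simpa using (fderiv ℝ u (e s)).le_opNorm (e 1)
  calc ‖u x‖ₑ ≤ ∫⁻ s in Iic (e.symm x), ‖deriv (fun s => u (e s)) s‖ₑ := h1
    _ ≤ ∫⁻ s, ‖deriv (fun s => u (e s)) s‖ₑ := setLIntegral_le_lintegral _ _
    _ ≤ ∫⁻ s, ‖fderiv ℝ u (e s)‖ₑ := lintegral_mono hd
    _ = ∫⁻ y, ‖fderiv ℝ u y‖ₑ :=
      he.lintegral_comp (f := fun y => ‖fderiv ℝ u y‖ₑ) (hu.continuous_fderiv (by simp)).enorm.measurable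

lemma hasCompactSupport_pow {u : Space N → ℝ} (hc : HasCompactSupport u) (m : ℕ) :
    HasCompactSupport fun x => u x ^ (m + 1) :=
  hc.comp_left (g := fun y : ℝ => y ^ (m + 1)) (by simp)

lemma lintegral_rpow_two_le_sobolevNorm (u : Space N → ℝ) :
    ∫⁻ x, ‖u x‖ₑ ^ (2 : ℝ) ≤ sobolevNorm u ^ (2 : ℝ) := by
  rw [lintegral_enorm_rpow_two]
  gcongr
  exact le_add_right le_rfl

lemma exists_even_embedding_one (m : ℕ) (hm : 1 ≤ m) :
    ∃ C : ℝ≥0, ∀ u : Space 1 → ℝ, ContDiff ℝ 1 u → HasCompactSupport u →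
      ∫⁻ x, ‖u x‖ₑ ^ (2 * m : ℝ) ≤ C * sobolevNorm u ^ (2 * m : ℝ) := by
  induction m, hm using Nat.le_induction with
  | base =>
    refine ⟨1, fun u _ _ => ?_⟩
    simpa using lintegral_rpow_two_le_sobolevNorm u
  | succ m hm ih =>
    obtain ⟨C, hC⟩ := ih
    refine ⟨2 * C, fun u hu hc => ?_⟩
    have hsup : ∀ x, ‖u x‖ₑ ^ (2 : ℝ) ≤ 2 * sobolevNorm u ^ (2 : ℝ) := by
      intro x
      have h1 := enorm_le_lintegral_fderiv _ (hu.pow 2) (hasCompactSupport_pow hc 1) x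
      have h2 := lintegral_mul_fderiv_le u hu 1
      have h3 : (∫⁻ x, ‖fderiv ℝ (fun x => u x ^ 2) x‖ₑ) ^ (2 : ℝ)
          ≤ (2 * sobolevNorm u ^ (2 : ℝ)) ^ (2 : ℝ) := by
        refine h2.trans ?_
        rw [ENNReal.mul_rpow_of_nonneg _ _ (by norm_num : (0 : ℝ) ≤ 2), mul_assoc]
        norm_num
        rw [sq (sobolevNorm u ^ 2)]
        gcongr
        simpa using lintegral_rpow_two_le_sobolevNorm u
      have h4 := (ENNReal.rpow_le_rpow_iff (by norm_num)).1 h3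
      refine le_trans ?_ h4
      refine le_trans (le_of_eq ?_) h1
      rw [enorm_pow]
      norm_num
    calc ∫⁻ x, ‖u x‖ₑ ^ (2 * (m + 1 : ℕ) : ℝ)
        = ∫⁻ x, ‖u x‖ₑ ^ (2 : ℝ) * ‖u x‖ₑ ^ (2 * m : ℝ) := by
          refine lintegral_congr fun x => ?_
          rw [← ENNReal.rpow_add_of_nonneg _ _ (by norm_num) (by positivity)]
          push_cast; ring_nf
      _ ≤ ∫⁻ x, 2 * sobolevNorm u ^ (2 : ℝ) * ‖u x‖ₑ ^ (2 * m : ℝ) := by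
          gcongr with x; exact hsup x
      _ = 2 * sobolevNorm u ^ (2 : ℝ) * ∫⁻ x, ‖u x‖ₑ ^ (2 * m : ℝ) :=
          lintegral_const_mul'' _ (hu.continuous.enorm.aemeasurable.pow_const _)
      _ ≤ 2 * sobolevNorm u ^ (2 : ℝ) * (C * sobolevNorm u ^ (2 * m : ℝ)) := by
          gcongr; exact hC u hu hc
      _ = 2 * C * (sobolevNorm u ^ (2 : ℝ) * sobolevNorm u ^ (2 * m : ℝ)) := by ring
      _ = _ := by
          rw [← ENNReal.rpow_add_of_nonneg _ _ (by norm_num) (by positivity)]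
          push_cast; ring_nf

lemma exists_even_embedding_two (m : ℕ) (hm : 1 ≤ m) :
    ∃ C : ℝ≥0, ∀ u : Space 2 → ℝ, ContDiff ℝ 1 u → HasCompactSupport u →
      ∫⁻ x, ‖u x‖ₑ ^ (2 * m : ℝ) ≤ C * sobolevNorm u ^ (2 * m : ℝ) := by
  induction m, hm using Nat.le_induction with
  | base =>
    refine ⟨1, fun u _ _ => ?_⟩
    simpa using lintegral_rpow_two_le_sobolevNorm u
  | succ m hm ih =>
    obtain ⟨C, hC⟩ := ih
    refine ⟨lintegralPowLePowLIntegralFDerivConst (volume : Measure (Space 2)) 2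
      * ((m + 1 : ℕ) ^ 2 * C), fun u hu hc => ?_⟩
    have hconj : Real.HolderConjugate (Module.finrank ℝ (Space 2)) 2 := by
      rw [finrank_euclideanSpace, Fintype.card_fin]
      exact_mod_cast Real.HolderConjugate.two_two
    have h1 := lintegral_pow_le_pow_lintegral_fderiv (volume : Measure (Space 2))
      (hu.pow (m + 1)) (hasCompactSupport_pow hc m) hconj
    have h2 := lintegral_mul_fderiv_le u hu m
    calc ∫⁻ x, ‖u x‖ₑ ^ (2 * (m + 1 : ℕ) : ℝ)
        = ∫⁻ x, ‖u x ^ (m + 1)‖ₑ ^ (2 : ℝ) := by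
          refine lintegral_congr fun x => ?_
          rw [enorm_pow, ← ENNReal.rpow_natCast, ← ENNReal.rpow_mul, mul_comm]
      _ ≤ _ := h1
      _ ≤ lintegralPowLePowLIntegralFDerivConst (volume : Measure (Space 2)) 2
          * (((m + 1 : ℕ) : ℝ≥0∞) ^ (2 : ℝ) * (C * sobolevNorm u ^ (2 * m : ℝ))
            * sobolevNorm u ^ (2 : ℝ)) := by
          gcongr
          refine h2.trans ?_
          gcongr
          exact hC u hu hc
      _ = lintegralPowLePowLIntegralFDerivConst (volume : Measure (Space 2)) 2
          * (((m + 1 : ℕ) : ℝ≥0∞) ^ 2 * C)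
            * (sobolevNorm u ^ (2 * m : ℝ) * sobolevNorm u ^ (2 : ℝ)) := by
          norm_num; ring
      _ = _ := by
          rw [← ENNReal.rpow_add_of_nonneg _ _ (by positivity) (by norm_num)]
          push_cast; ring_nf

/-- The Sobolev embedding `H¹ ⊂ L^q` for compactly supported functions of class `C¹`. -/
lemma exists_sobolev_embedding (hN : 1 ≤ N) {q : ℝ} (hq : 2 ≤ q)
    (hq' : 3 ≤ N → q ≤ 2 * N / ((N : ℝ) - 2)) :
    ∃ C : ℝ≥0, ∀ u : Space N → ℝ, ContDiff ℝ 1 u → HasCompactSupport u →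
      eLpNorm u (ENNReal.ofReal q) volume ≤ C * sobolevNorm u := by
  have hq0 : 0 < q := by linarith
  -- it suffices to control some larger power
  suffices H : ∃ Q : ℝ, q ≤ Q ∧ ∃ C : ℝ≥0, ∀ u : Space N → ℝ, ContDiff ℝ 1 u →
      HasCompactSupport u → ∫⁻ x, ‖u x‖ₑ ^ Q ≤ C * sobolevNorm u ^ Q by
    obtain ⟨Q, hQ, C, hC⟩ := H
    refine ⟨(1 + C) ^ (1 / q), fun u hu hc => ?_⟩
    have h1 := lintegral_rpow_interpolate hu.continuous.enorm.aemeasurable hq hQ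
      (lintegral_rpow_two_le_sobolevNorm u) (hC u hu hc)
    rw [eLpNorm_eq_lintegral_rpow_enorm_toReal (by simpa using hq0) ENNReal.ofReal_ne_top,
      ENNReal.toReal_ofReal hq0.le]
    refine (ENNReal.rpow_le_rpow h1 (by positivity)).trans (le_of_eq ?_)
    rw [ENNReal.mul_rpow_of_nonneg _ _ (by positivity), ← ENNReal.rpow_mul,
      mul_one_div_cancel hq0.ne', ENNReal.rpow_one, ENNReal.coe_rpow_of_nonneg _ (by positivity)]
    simp
  obtain ⟨m, hm⟩ := exists_nat_ge q
  have hm1 : 1 ≤ m := by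
    have : (1 : ℝ) ≤ m := by linarith
    exact_mod_cast this
  have hm2 : q ≤ 2 * m := by linarith
  rcases lt_or_ge N 3 with h3 | h3
  · obtain rfl | rfl : N = 1 ∨ N = 2 := by omega
    · exact ⟨2 * m, hm2, exists_even_embedding_one m hm1⟩
    · exact ⟨2 * m, hm2, exists_even_embedding_two m hm1⟩
  · have hN3 : (3 : ℝ) ≤ N := by exact_mod_cast h3
    refine ⟨2 * N / ((N : ℝ) - 2), hq' h3, ?_⟩
    have hQ0 : 0 < 2 * N / ((N : ℝ) - 2) := by
      apply div_pos <;> linarith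
    set Q : ℝ≥0 := ⟨2 * N / ((N : ℝ) - 2), hQ0.le⟩
    have hfr : Module.finrank ℝ (Space N) = N := by
      rw [finrank_euclideanSpace, Fintype.card_fin]
    have hrel : (Q : ℝ)⁻¹ = ((2 : ℝ≥0) : ℝ)⁻¹ - (Module.finrank ℝ (Space N) : ℝ)⁻¹ := by
      rw [hfr]
      change (2 * N / ((N : ℝ) - 2))⁻¹ = _
      have h2 : (N : ℝ) - 2 ≠ 0 := by linarith
      have h4 : (N : ℝ) ≠ 0 := by linarith
      push_cast
      field_simp
    refine ⟨eLpNormLESNormFDerivOfEqInnerConst (volume : Measure (Space N)) (2 : ℝ≥0) ^ (Q : ℝ),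
      fun u hu hc => ?_⟩
    have h1 := eLpNorm_le_eLpNorm_fderiv_of_eq_inner volume hu hc
      (by norm_num : (1 : ℝ≥0) ≤ 2) (by rw [hfr]; omega) hrel
    have h2 : eLpNorm u Q volume
        ≤ eLpNormLESNormFDerivOfEqInnerConst (volume : Measure (Space N)) (2 : ℝ≥0)
          * sobolevNorm u := by
      refine h1.trans ?_
      gcongr
      exact le_add_left le_rfl
    have h3 := ENNReal.rpow_le_rpow h2 hQ0.le
    have hQne : Q ≠ 0 := by
      intro h; apply hQ0.ne'; exact congrArg NNReal.toReal h
    rw [ENNReal.mul_rpow_of_nonneg _ _ hQ0.le, ← ENNReal.coe_rpow_of_nonneg _ hQ0.le] at h3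
    refine le_trans (le_of_eq ?_) h3
    exact (eLpNorm_nnreal_pow_eq_lintegral hQne).symm

lemma norm_gradient (φ : Space N → ℝ) (x : Space N) : ‖∇ φ x‖ = ‖fderiv ℝ φ x‖ :=
  (InnerProductSpace.toDual ℝ (Space N)).symm.norm_map _

lemma gradient_mul {φ ψ : Space N → ℝ} {x : Space N} (hφ : DifferentiableAt ℝ φ x)
    (hψ : DifferentiableAt ℝ ψ x) :
    ∇ (fun x => φ x * ψ x) x = φ x • ∇ ψ x + ψ x • ∇ φ x := by
  simp only [gradient, fderiv_fun_mul hφ hψ, map_add, map_smul]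

/-- An approximation in `H¹` by test functions, almost everywhere convergent. -/
lemma exists_testFunction_seq {u : L2 N} {g : L2Vec N} (h : IsWeakGradient u g) :
    ∃ φ : ℕ → Space N → ℝ, (∀ n, ContDiff ℝ ∞ (φ n)) ∧ (∀ n, HasCompactSupport (φ n)) ∧
      Tendsto (fun n => eLpNorm (fun x => u x - φ n x) 2 volume) atTop (𝓝 0) ∧
      Tendsto (fun n => eLpNorm (fun x => g x - ∇ (φ n) x) 2 volume) atTop (𝓝 0) ∧
      ∀ᵐ x, Tendsto (fun n => φ n x) atTop (𝓝 (u x)) := by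
  have hpos : ∀ n : ℕ, (0 : ℝ≥0∞) < ((n : ℝ≥0∞) + 1)⁻¹ := fun n => by simp
  choose φ hφ hφc h1 h2 using fun n : ℕ => exists_testFunction_approx h (hpos n)
  have h0 : Tendsto (fun n : ℕ => ((n : ℝ≥0∞) + 1)⁻¹) atTop (𝓝 0) := by
    have := (tendsto_add_atTop_iff_nat 1).2 ENNReal.tendsto_inv_nat_nhds_zero
    simpa using this
  have t1 := tendsto_of_tendsto_of_tendsto_of_le_of_le tendsto_const_nhds h0
    (fun _ => zero_le) h1
  have t2 := tendsto_of_tendsto_of_tendsto_of_le_of_le tendsto_const_nhds h0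
    (fun _ => zero_le) h2
  have t3 : TendstoInMeasure volume φ atTop u := by
    refine tendstoInMeasure_of_tendsto_eLpNorm two_ne_zero
      (fun n => (hφ n).continuous.aestronglyMeasurable) (Lp.aestronglyMeasurable u) ?_
    refine t1.congr fun n => ?_
    rw [← eLpNorm_neg]
    congr 1; ext x; simp
  obtain ⟨ns, hns, hae⟩ := t3.exists_seq_tendsto_ae
  exact ⟨fun n => φ (ns n), fun n => hφ _, fun n => hφc _, t1.comp hns.tendsto_atTop,
    t2.comp hns.tendsto_atTop, hae⟩

/-- The Sobolev embedding for the product of an `H¹` function with a bounded `C¹` weight. -/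
lemma exists_weighted_sobolev (hN : 1 ≤ N) {q : ℝ} (hq : 2 ≤ q)
    (hq' : 3 ≤ N → q ≤ 2 * N / ((N : ℝ) - 2)) :
    ∃ C : ℝ≥0, ∀ (u : L2 N) (g : L2Vec N), IsWeakGradient u g →
      ∀ ζ : Space N → ℝ, ContDiff ℝ 1 ζ → (∃ K, ∀ x, |ζ x| ≤ K) → (∃ K, ∀ x, ‖∇ ζ x‖ ≤ K) →
      eLpNorm (fun x => ζ x * u x) (ENNReal.ofReal q) volume
        ≤ C * (eLpNorm (fun x => ζ x * u x) 2 volume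
          + eLpNorm (fun x => ζ x • g x + u x • ∇ ζ x) 2 volume) := by
  obtain ⟨C, hC⟩ := exists_sobolev_embedding hN hq hq'
  refine ⟨C, fun u g h ζ hζ ⟨K, hK⟩ ⟨K', hK'⟩ => ?_⟩
  obtain ⟨φ, hφ, hφc, t1, t2, hae⟩ := exists_testFunction_seq h
  have hum := Lp.aestronglyMeasurable u
  have hgm := Lp.aestronglyMeasurable g
  have hζm := hζ.continuous.aestronglyMeasurable (μ := volume)
  have hζg := (continuous_gradient hζ).aestronglyMeasurable (μ := volume)
  have hφm := fun n => (hφ n).continuous.aestronglyMeasurable (μ := volume)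
  have hφg := fun n => (continuous_gradient ((hφ n).of_le (by simp) : ContDiff ℝ 1 (φ n))).aestronglyMeasurable
    (μ := volume)
  set S := eLpNorm (fun x => ζ x * u x) 2 volume
  set G := eLpNorm (fun x => ζ x • g x + u x • ∇ ζ x) 2 volume
  set r : ℕ → ℝ≥0∞ := fun n => ENNReal.ofReal K * eLpNorm (fun x => u x - φ n x) 2 volume
      + (ENNReal.ofReal K * eLpNorm (fun x => g x - ∇ (φ n) x) 2 volume
        + ENNReal.ofReal K' * eLpNorm (fun x => u x - φ n x) 2 volume) with hr
  have hr0 : Tendsto r atTop (𝓝 0) := by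
    have a1 := ENNReal.Tendsto.const_mul t1 (Or.inr (ENNReal.ofReal_ne_top (r := K)))
    have a2 := ENNReal.Tendsto.const_mul t2 (Or.inr (ENNReal.ofReal_ne_top (r := K)))
    have a3 := ENNReal.Tendsto.const_mul t1 (Or.inr (ENNReal.ofReal_ne_top (r := K')))
    simpa using a1.add (a2.add a3)
  have b1 : ∀ n, eLpNorm (fun x => ζ x * φ n x) 2 volume
      ≤ S + ENNReal.ofReal K * eLpNorm (fun x => u x - φ n x) 2 volume := by
    intro n
    calc eLpNorm (fun x => ζ x * φ n x) 2 volume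
        = eLpNorm ((fun x => ζ x * u x) - fun x => ζ x * (u x - φ n x)) 2 volume := by
          congr 1; ext x; simp; ring
      _ ≤ S + eLpNorm (fun x => ζ x * (u x - φ n x)) 2 volume :=
          eLpNorm_sub_le (hζm.mul hum) (hζm.mul (hum.sub (hφm n))) (by norm_num)
      _ ≤ _ := by
          gcongr
          refine eLpNorm_le_mul_eLpNorm_of_ae_le_mul (ae_of_all _ fun x => ?_) _
          rw [norm_mul]
          gcongr
          exact hK x
  have b2 : ∀ n, eLpNorm (fderiv ℝ fun x => ζ x * φ n x) 2 volume
      ≤ G + (ENNReal.ofReal K * eLpNorm (fun x => g x - ∇ (φ n) x) 2 volume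
        + ENNReal.ofReal K' * eLpNorm (fun x => u x - φ n x) 2 volume) := by
    intro n
    have e1 : ∀ x, ∇ (fun x => ζ x * φ n x) x = ζ x • ∇ (φ n) x + φ n x • ∇ ζ x := fun x =>
      gradient_mul (hζ.differentiable (by simp) x) ((hφ n).differentiable (by simp) x)
    calc eLpNorm (fderiv ℝ fun x => ζ x * φ n x) 2 volume
        = eLpNorm (∇ fun x => ζ x * φ n x) 2 volume :=
          eLpNorm_congr_norm_ae (ae_of_all _ fun x => (norm_gradient _ x).symm)
      _ = eLpNorm ((fun x => ζ x • g x + u x • ∇ ζ x)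
            - ((fun x => ζ x • (g x - ∇ (φ n) x)) + fun x => (u x - φ n x) • ∇ ζ x)) 2 volume := by
          congr 1; ext1 x; rw [e1]; simp only [Pi.sub_apply, Pi.add_apply]; module
      _ ≤ G + eLpNorm ((fun x => ζ x • (g x - ∇ (φ n) x)) + fun x => (u x - φ n x) • ∇ ζ x) 2
            volume :=
          eLpNorm_sub_le ((hζm.smul hgm).add (hum.smul hζg))
            ((hζm.smul (hgm.sub (hφg n))).add ((hum.sub (hφm n)).smul hζg)) (by norm_num)
      _ ≤ G + (eLpNorm (fun x => ζ x • (g x - ∇ (φ n) x)) 2 volume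
            + eLpNorm (fun x => (u x - φ n x) • ∇ ζ x) 2 volume) := by
          gcongr
          exact eLpNorm_add_le (hζm.smul (hgm.sub (hφg n))) ((hum.sub (hφm n)).smul hζg)
            (by norm_num)
      _ ≤ _ := by
          gcongr
          · refine eLpNorm_le_mul_eLpNorm_of_ae_le_mul (ae_of_all _ fun x => ?_) _
            rw [norm_smul]
            gcongr
            exact hK x
          · refine eLpNorm_le_mul_eLpNorm_of_ae_le_mul (ae_of_all _ fun x => ?_) _
            rw [norm_smul, mul_comm]
            gcongr
            exact hK' x
  have b3 : ∀ n, eLpNorm (fun x => ζ x * φ n x) (ENNReal.ofReal q) volume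
      ≤ C * (S + G + r n) := by
    intro n
    have hcd : ContDiff ℝ 1 fun x => ζ x * φ n x := hζ.mul ((hφ n).of_le (by simp))
    refine (hC _ hcd ((hφc n).mul_left)).trans ?_
    gcongr
    refine (add_le_add (b1 n) (b2 n)).trans (le_of_eq ?_)
    rw [hr]; ring
  have hlim := Lp.eLpNorm_lim_le_liminf_eLpNorm (p := ENNReal.ofReal q)
    (fun n => hζm.mul (hφm n)) (fun x => ζ x * u x)
    (by filter_upwards [hae] with x hx using hx.const_mul (ζ x))
  refine hlim.trans ?_
  have hT : Tendsto (fun n => C * (S + G + r n)) atTop (𝓝 (C * (S + G + 0))) :=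
    ENNReal.Tendsto.const_mul (tendsto_const_nhds.add hr0) (Or.inr ENNReal.coe_ne_top)
  rw [add_zero] at hT
  rw [← hT.liminf_eq]
  exact liminf_le_liminf (Eventually.of_forall b3)

end Sobolev

/-! ### The weighted energy identity for weak solutions of wave equations -/

section Kinetic

variable {N : ℕ}

section Average

lemma intervalIntegrable_of_continuousOn_Ioo {E : Type*} [NormedAddCommGroup E] {γ : ℝ → E}
    {a b : ℝ} (hγ : ContinuousOn γ (Ioo a b)) {s t : ℝ}
    (hs : s ∈ Ioo a b) (ht : t ∈ Ioo a b) : IntervalIntegrable γ volume s t :=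
  (hγ.mono ((ordConnected_Ioo.uIcc_subset hs ht))).intervalIntegrable

variable {E : Type*} [NormedAddCommGroup E] [NormedSpace ℝ E]

/-- The Steklov average of a curve over the time interval `[t, t + h]`. -/
def steklov (h : ℝ) (γ : ℝ → E) (t : ℝ) : E := h⁻¹ • ∫ s in t..t + h, γ s

variable {γ : ℝ → E} {a b : ℝ}

lemma norm_steklov_le {h t M : ℝ} (hh : 0 < h) (hM : ∀ s ∈ Icc t (t + h), ‖γ s‖ ≤ M) :
    ‖steklov h γ t‖ ≤ M := by
  have h1 : ‖∫ s in t..t + h, γ s‖ ≤ M * |t + h - t| :=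
    intervalIntegral.norm_integral_le_of_norm_le_const fun s hs => by
      rw [uIoc_of_le (by linarith)] at hs
      exact hM s ⟨hs.1.le, hs.2⟩
  rw [steklov, norm_smul, norm_inv, norm_of_nonneg hh.le, inv_mul_le_iff₀ hh]
  rw [add_sub_cancel_left, abs_of_pos hh] at h1
  linarith

lemma steklov_eq (hγ : ContinuousOn γ (Ioo a b)) {h s t : ℝ} (hs : s ∈ Ioo a b)
    (ht : t ∈ Ioo a b) (hth : t + h ∈ Ioo a b) :
    steklov h γ t = h⁻¹ • ((∫ r in s..t + h, γ r) - ∫ r in s..t, γ r) := by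
  rw [steklov, intervalIntegral.integral_interval_sub_left
    (intervalIntegrable_of_continuousOn_Ioo hγ hs hth)
    (intervalIntegrable_of_continuousOn_Ioo hγ hs ht)]

variable [CompleteSpace E]

lemma hasDerivAt_primitive (hγ : ContinuousOn γ (Ioo a b)) {s t : ℝ}
    (hs : s ∈ Ioo a b) (ht : t ∈ Ioo a b) : HasDerivAt (fun t => ∫ r in s..t, γ r) (γ t) t :=
  intervalIntegral.integral_hasDerivAt_right (intervalIntegrable_of_continuousOn_Ioo hγ hs ht)
    (hγ.stronglyMeasurableAtFilter isOpen_Ioo t ht) (hγ.continuousAt (isOpen_Ioo.mem_nhds ht))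

lemma hasDerivAt_steklov (hγ : ContinuousOn γ (Ioo a b)) {h t : ℝ}
    (ht : t ∈ Ioo a b) (hth : t + h ∈ Ioo a b) :
    HasDerivAt (steklov h γ) (h⁻¹ • (γ (t + h) - γ t)) t := by
  have h1 : HasDerivAt (fun t' => h⁻¹ • ((∫ r in t..t' + h, γ r) - ∫ r in t..t', γ r))
      (h⁻¹ • (γ (t + h) - γ t)) t :=
    (((hasDerivAt_primitive hγ ht hth).comp_add_const t h).sub
      (hasDerivAt_primitive hγ ht ht)).const_smul _
  refine h1.congr_of_eventuallyEq ?_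
  have e1 : ∀ᶠ t' in 𝓝 t, t' ∈ Ioo a b := isOpen_Ioo.mem_nhds ht
  have e2 : ∀ᶠ t' in 𝓝 t, t' + h ∈ Ioo a b :=
    (continuous_id.add continuous_const).continuousAt.eventually (isOpen_Ioo.mem_nhds hth)
  filter_upwards [e1, e2] with t' h1 h2 using steklov_eq hγ ht h1 h2

lemma tendsto_steklov (hγ : ContinuousOn γ (Ioo a b)) {t : ℝ} (ht : t ∈ Ioo a b) :
    Tendsto (fun h => steklov h γ t) (𝓝[>] 0) (𝓝 (γ t)) := by
  have := (hasDerivAt_primitive hγ ht ht).tendsto_slope_zero_right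
  simpa [steklov] using this

end Average

section Abstract

variable {X Y : Type*} [NormedAddCommGroup X] [InnerProductSpace ℝ X]
  [NormedAddCommGroup Y] [InnerProductSpace ℝ Y]

/-- The kinetic energy `(⟪W₁ v, v⟫ + ⟪W₂ g, g⟫) / 2` with operator weights. -/
def kineticEnergy (W₁ : X →L[ℝ] X) (W₂ : Y →L[ℝ] Y) (v : X) (g : Y) : ℝ :=
  (⟪W₁ v, v⟫_ℝ + ⟪W₂ g, g⟫_ℝ) / 2

/-- The time derivative of the kinetic energy of a solution `(v, g)` with forcing `h`, when the
weights `W₁`, `W₂` have time derivatives `W₁'`, `W₂'` and commutator `Z` with the gradient. -/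
def energyFlux (W₁ W₁' : X →L[ℝ] X) (W₂' : Y →L[ℝ] Y) (Z : X →L[ℝ] Y) (v h : X) (g : Y) : ℝ :=
  (⟪W₁' v, v⟫_ℝ + ⟪W₂' g, g⟫_ℝ) / 2 - ⟪g, Z v⟫_ℝ + ⟪h, W₁ v⟫_ℝ

lemma tendsto_clm_apply {ι E F : Type*} [NormedAddCommGroup E] [NormedSpace ℝ E]
    [NormedAddCommGroup F] [NormedSpace ℝ F] {l : Filter ι} {L : ι → E →L[ℝ] F} {L₀ : E →L[ℝ] F}
    {x : ι → E} {x₀ : E} (hL : Tendsto L l (𝓝 L₀)) (hx : Tendsto x l (𝓝 x₀)) :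
    Tendsto (fun i => L i (x i)) l (𝓝 (L₀ x₀)) :=
  (isBoundedBilinearMap_apply.continuous.tendsto (L₀, x₀)).comp (hL.prodMk_nhds hx)

lemma tendsto_kineticEnergy {ι : Type*} {l : Filter ι} {W₁ : ι → X →L[ℝ] X}
    {W₂ : ι → Y →L[ℝ] Y} {v : ι → X} {g : ι → Y} {w₁ : X →L[ℝ] X} {w₂ : Y →L[ℝ] Y} {v₀ : X} {g₀ : Y}
    (h₁ : Tendsto W₁ l (𝓝 w₁)) (h₂ : Tendsto W₂ l (𝓝 w₂)) (hv : Tendsto v l (𝓝 v₀))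
    (hg : Tendsto g l (𝓝 g₀)) :
    Tendsto (fun i => kineticEnergy (W₁ i) (W₂ i) (v i) (g i)) l (𝓝 (kineticEnergy w₁ w₂ v₀ g₀)) :=
  (((tendsto_clm_apply h₁ hv).inner hv).add ((tendsto_clm_apply h₂ hg).inner hg)).div_const 2

lemma tendsto_energyFlux {ι : Type*} {l : Filter ι} {W₁ W₁' : ι → X →L[ℝ] X}
    {W₂' : ι → Y →L[ℝ] Y} {Z : ι → X →L[ℝ] Y} {v h : ι → X} {g : ι → Y} {w₁ w₁' : X →L[ℝ] X}
    {w₂' : Y →L[ℝ] Y} {z : X →L[ℝ] Y} {v₀ h₀ : X} {g₀ : Y}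
    (h₁ : Tendsto W₁ l (𝓝 w₁)) (h₁' : Tendsto W₁' l (𝓝 w₁')) (h₂' : Tendsto W₂' l (𝓝 w₂'))
    (hZ : Tendsto Z l (𝓝 z)) (hv : Tendsto v l (𝓝 v₀)) (hh : Tendsto h l (𝓝 h₀))
    (hg : Tendsto g l (𝓝 g₀)) :
    Tendsto (fun i => energyFlux (W₁ i) (W₁' i) (W₂' i) (Z i) (v i) (h i) (g i)) l
      (𝓝 (energyFlux w₁ w₁' w₂' z v₀ h₀ g₀)) :=
  (((((tendsto_clm_apply h₁' hv).inner hv).add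
    ((tendsto_clm_apply h₂' hg).inner hg)).div_const 2).sub
    (hg.inner (tendsto_clm_apply hZ hv))).add (hh.inner (tendsto_clm_apply h₁ hv))

lemma abs_energyFlux_le (W₁ W₁' : X →L[ℝ] X) (W₂' : Y →L[ℝ] Y) (Z : X →L[ℝ] Y) (v h : X) (g : Y)
    {M : ℝ} (h1 : ‖W₁‖ ≤ M) (h2 : ‖W₁'‖ ≤ M) (h3 : ‖W₂'‖ ≤ M) (h4 : ‖Z‖ ≤ M)
    (hv : ‖v‖ ≤ M) (hh : ‖h‖ ≤ M) (hg : ‖g‖ ≤ M) :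
    |energyFlux W₁ W₁' W₂' Z v h g| ≤ 3 * M ^ 3 := by
  have hM : 0 ≤ M := (norm_nonneg _).trans hv
  have e1 : |⟪W₁' v, v⟫_ℝ| ≤ M * M * M := (abs_real_inner_le_norm _ _).trans
    (mul_le_mul ((W₁'.le_opNorm v).trans (by gcongr)) hv (norm_nonneg _) (by positivity))
  have e2 : |⟪W₂' g, g⟫_ℝ| ≤ M * M * M := (abs_real_inner_le_norm _ _).trans
    (mul_le_mul ((W₂'.le_opNorm g).trans (by gcongr)) hg (norm_nonneg _) (by positivity))
  have e3 : |⟪g, Z v⟫_ℝ| ≤ M * (M * M) := (abs_real_inner_le_norm _ _).trans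
    (mul_le_mul hg ((Z.le_opNorm v).trans (by gcongr)) (norm_nonneg _) (by positivity))
  have e4 : |⟪h, W₁ v⟫_ℝ| ≤ M * (M * M) := (abs_real_inner_le_norm _ _).trans
    (mul_le_mul hh ((W₁.le_opNorm v).trans (by gcongr)) (norm_nonneg _) (by positivity))
  rw [abs_le] at *
  unfold energyFlux
  constructor <;> nlinarith [e1.1, e1.2, e2.1, e2.2, e3.1, e3.2, e4.1, e4.2]

lemma hasDerivAt_kineticEnergy {t : ℝ} {W₁ : ℝ → X →L[ℝ] X} {W₁' : X →L[ℝ] X}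
    {W₂ : ℝ → Y →L[ℝ] Y} {W₂' : Y →L[ℝ] Y} (h₁ : HasDerivAt W₁ W₁' t) (h₂ : HasDerivAt W₂ W₂' t)
    (s₁ : ∀ x y, ⟪W₁ t x, y⟫_ℝ = ⟪x, W₁ t y⟫_ℝ) (s₂ : ∀ x y, ⟪W₂ t x, y⟫_ℝ = ⟪x, W₂ t y⟫_ℝ)
    {v : ℝ → X} {v' : X} (hv : HasDerivAt v v' t) {g : ℝ → Y} {g' : Y} (hg : HasDerivAt g g' t) :
    HasDerivAt (fun t => kineticEnergy (W₁ t) (W₂ t) (v t) (g t))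
      ((⟪W₁' (v t), v t⟫_ℝ + ⟪W₂' (g t), g t⟫_ℝ) / 2 + ⟪v', W₁ t (v t)⟫_ℝ + ⟪g t, W₂ t g'⟫_ℝ)
      t := by
  refine ((((h₁.clm_apply hv).inner ℝ hv).add
    ((h₂.clm_apply hg).inner ℝ hg)).div_const 2).congr_deriv ?_
  rw [inner_add_left, inner_add_left, s₁ v', s₂ g', s₂ (g t), real_inner_comm v',
    ← s₂ (g t) g', real_inner_comm g']
  ring

/-- Abstract weak solutions on an open time interval of a wave equation `∂ₜv + ∇*g = h`, `g = ∇u`,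
`v = ∂ₜu`, where the graph of `∇` is the subspace `D`. -/
structure IsWeakWave (D : Submodule ℝ (X × Y)) (a b : ℝ) (u v h : ℝ → X) (g : ℝ → Y) : Prop where
  continuousOn_vel : ContinuousOn v (Ioo a b)
  continuousOn_grad : ContinuousOn g (Ioo a b)
  continuousOn_force : ContinuousOn h (Ioo a b)
  mem : ∀ t ∈ Ioo a b, (u t, g t) ∈ D
  hasDerivAt : ∀ t ∈ Ioo a b, HasDerivAt u (v t) t
  inner_sub : ∀ ψ ψ', (ψ, ψ') ∈ D → ∀ s ∈ Ioo a b, ∀ t ∈ Ioo a b,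
    ⟪v t - v s, ψ⟫_ℝ = -⟪∫ r in s..t, g r, ψ'⟫_ℝ + ⟪∫ r in s..t, h r, ψ⟫_ℝ

/-- Time-dependent symmetric operator weights preserving the domain `D` of the gradient, with time
derivatives `W₁'`, `W₂'` and commutator `Z` with the gradient. -/
structure IsOperatorWeight (D : Submodule ℝ (X × Y)) (a b : ℝ) (W₁ W₁' : ℝ → X →L[ℝ] X)
    (W₂ W₂' : ℝ → Y →L[ℝ] Y) (Z : ℝ → X →L[ℝ] Y) : Prop where
  hasDerivAt₁ : ∀ t ∈ Ioo a b, HasDerivAt W₁ (W₁' t) t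
  hasDerivAt₂ : ∀ t ∈ Ioo a b, HasDerivAt W₂ (W₂' t) t
  continuousOn₁ : ContinuousOn W₁' (Ioo a b)
  continuousOn₂ : ContinuousOn W₂' (Ioo a b)
  continuousOn_comm : ContinuousOn Z (Ioo a b)
  symm₁ : ∀ t ∈ Ioo a b, ∀ x y, ⟪W₁ t x, y⟫_ℝ = ⟪x, W₁ t y⟫_ℝ
  symm₂ : ∀ t ∈ Ioo a b, ∀ x y, ⟪W₂ t x, y⟫_ℝ = ⟪x, W₂ t y⟫_ℝ
  mem : ∀ t ∈ Ioo a b, ∀ ψ ψ', (ψ, ψ') ∈ D → (W₁ t ψ, W₂ t ψ' + Z t ψ) ∈ D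

variable {D : Submodule ℝ (X × Y)} {a b : ℝ} {u v h : ℝ → X}
  {g : ℝ → Y} {W₁ W₁' : ℝ → X →L[ℝ] X} {W₂ W₂' : ℝ → Y →L[ℝ] Y} {Z : ℝ → X →L[ℝ] Y}

lemma IsOperatorWeight.continuousOn_weight₁ (hW : IsOperatorWeight D a b W₁ W₁' W₂ W₂' Z) :
    ContinuousOn W₁ (Ioo a b) :=
  fun t ht => (hW.hasDerivAt₁ t ht).continuousAt.continuousWithinAt

lemma continuousOn_energyFlux (hW : IsOperatorWeight D a b W₁ W₁' W₂ W₂' Z) {S : Set ℝ}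
    (hS : S ⊆ Ioo a b) {v h : ℝ → X} {g : ℝ → Y} (hv : ContinuousOn v S) (hh : ContinuousOn h S)
    (hg : ContinuousOn g S) :
    ContinuousOn (fun t => energyFlux (W₁ t) (W₁' t) (W₂' t) (Z t) (v t) (h t) (g t)) S :=
  fun t ht => tendsto_energyFlux (hW.continuousOn_weight₁.mono hS t ht)
    (hW.continuousOn₁.mono hS t ht) (hW.continuousOn₂.mono hS t ht)
    (hW.continuousOn_comm.mono hS t ht) (hv t ht) (hh t ht) (hg t ht)

variable [CompleteSpace X] [CompleteSpace Y]

/-- The energy identity for time averages: their velocities lie in the domain of the gradient, and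
may therefore be used as test functions. -/
lemma IsWeakWave.hasDerivAt_kineticEnergy_steklov (hw : IsWeakWave D a b u v h g)
    (hW : IsOperatorWeight D a b W₁ W₁' W₂ W₂' Z) {r t : ℝ} (ht : t ∈ Ioo a b)
    (hth : t + r ∈ Ioo a b) :
    HasDerivAt (fun t => kineticEnergy (W₁ t) (W₂ t) (steklov r v t) (steklov r g t))
      (energyFlux (W₁ t) (W₁' t) (W₂' t) (Z t) (steklov r v t) (steklov r h t) (steklov r g t))
      t := by
  refine (hasDerivAt_kineticEnergy (hW.hasDerivAt₁ t ht) (hW.hasDerivAt₂ t ht) (hW.symm₁ t ht)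
    (hW.symm₂ t ht) (hasDerivAt_steklov hw.continuousOn_vel ht hth)
    (hasDerivAt_steklov hw.continuousOn_grad ht hth)).congr_deriv ?_
  have hv : steklov r v t = r⁻¹ • (u (t + r) - u t) := by
    rw [steklov, intervalIntegral.integral_eq_sub_of_hasDerivAt
      (fun s hs => hw.hasDerivAt s (ordConnected_Ioo.uIcc_subset ht hth hs))
      (intervalIntegrable_of_continuousOn_Ioo hw.continuousOn_vel ht hth)]
  have hg : (steklov r v t, r⁻¹ • (g (t + r) - g t)) ∈ D := by
    rw [hv]
    exact D.smul_mem r⁻¹ (D.sub_mem (hw.mem _ hth) (hw.mem _ ht))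
  have htest := hw.inner_sub _ _ (hW.mem t ht _ _ hg) t ht _ hth
  have hg' : ∫ r in t..t + r, g r = r • steklov r g t := by
    rcases eq_or_ne r 0 with rfl | hr
    · simp
    · rw [steklov, smul_inv_smul₀ hr]
  have hh' : ∫ r in t..t + r, h r = r • steklov r h t := by
    rcases eq_or_ne r 0 with rfl | hr
    · simp
    · rw [steklov, smul_inv_smul₀ hr]
  rw [hg', hh', real_inner_smul_left, real_inner_smul_left, inner_add_right] at htest
  rcases eq_or_ne r 0 with rfl | hr
  · simp [energyFlux, steklov]
  · rw [real_inner_smul_left, htest, energyFlux]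
    field_simp
    ring

lemma continuousOn_steklov {E : Type*} [NormedAddCommGroup E] [NormedSpace ℝ E] [CompleteSpace E]
    {γ : ℝ → E} (hγ : ContinuousOn γ (Ioo a b)) {r s t : ℝ} (hs : Icc s t ⊆ Ioo a b)
    (hr : ∀ x ∈ Icc s t, x + r ∈ Ioo a b) : ContinuousOn (steklov r γ) (Icc s t) :=
  fun x hx => (hasDerivAt_steklov hγ (hs hx) (hr x hx)).continuousAt.continuousWithinAt

lemma IsWeakWave.kineticEnergy_steklov_sub (hw : IsWeakWave D a b u v h g)
    (hW : IsOperatorWeight D a b W₁ W₁' W₂ W₂' Z) {r s t : ℝ} (hst : s ≤ t)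
    (hs : Icc s t ⊆ Ioo a b) (hr : ∀ x ∈ Icc s t, x + r ∈ Ioo a b) :
    kineticEnergy (W₁ t) (W₂ t) (steklov r v t) (steklov r g t)
      - kineticEnergy (W₁ s) (W₂ s) (steklov r v s) (steklov r g s)
    = ∫ x in s..t, energyFlux (W₁ x) (W₁' x) (W₂' x) (Z x)
        (steklov r v x) (steklov r h x) (steklov r g x) := by
  symm
  refine intervalIntegral.integral_eq_sub_of_hasDerivAt
    (f := fun x => kineticEnergy (W₁ x) (W₂ x) (steklov r v x) (steklov r g x)) (fun x hx => ?_) ?_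
  · rw [uIcc_of_le hst] at hx
    exact hw.hasDerivAt_kineticEnergy_steklov hW (hs hx) (hr x hx)
  · refine ContinuousOn.intervalIntegrable ?_
    rw [uIcc_of_le hst]
    exact continuousOn_energyFlux hW hs (continuousOn_steklov hw.continuousOn_vel hs hr)
      (continuousOn_steklov hw.continuousOn_force hs hr)
      (continuousOn_steklov hw.continuousOn_grad hs hr)

lemma IsWeakWave.tendsto_integral_energyFlux (hw : IsWeakWave D a b u v h g)
    (hW : IsOperatorWeight D a b W₁ W₁' W₂ W₂' Z) {s t c : ℝ} (hst : s ≤ t) (htc : t < c)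
    (hs : Icc s c ⊆ Ioo a b) :
    Tendsto (fun r => ∫ x in s..t, energyFlux (W₁ x) (W₁' x) (W₂' x) (Z x)
      (steklov r v x) (steklov r h x) (steklov r g x)) (𝓝[>] 0)
      (𝓝 (∫ x in s..t, energyFlux (W₁ x) (W₁' x) (W₂' x) (Z x) (v x) (h x) (g x))) := by
  have hst' : Icc s t ⊆ Ioo a b := fun x hx => hs ⟨hx.1, hx.2.trans htc.le⟩
  have hr : ∀ᶠ r in 𝓝[>] (0 : ℝ), r ∈ Ioo 0 (c - t) := Ioo_mem_nhdsGT (by linarith)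
  obtain ⟨m1, b1⟩ := isCompact_Icc.exists_bound_of_continuousOn (hW.continuousOn_weight₁.mono hs)
  obtain ⟨m2, b2⟩ := isCompact_Icc.exists_bound_of_continuousOn (hW.continuousOn₁.mono hs)
  obtain ⟨m3, b3⟩ := isCompact_Icc.exists_bound_of_continuousOn (hW.continuousOn₂.mono hs)
  obtain ⟨m4, b4⟩ := isCompact_Icc.exists_bound_of_continuousOn (hW.continuousOn_comm.mono hs)
  obtain ⟨m5, b5⟩ := isCompact_Icc.exists_bound_of_continuousOn (hw.continuousOn_vel.mono hs)
  obtain ⟨m6, b6⟩ := isCompact_Icc.exists_bound_of_continuousOn (hw.continuousOn_force.mono hs)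
  obtain ⟨m7, b7⟩ := isCompact_Icc.exists_bound_of_continuousOn (hw.continuousOn_grad.mono hs)
  obtain ⟨M, hM1, hM2, hM3, hM4, hM5, hM6, hM7⟩ : ∃ M, m1 ≤ M ∧ m2 ≤ M ∧ m3 ≤ M ∧ m4 ≤ M ∧
      m5 ≤ M ∧ m6 ≤ M ∧ m7 ≤ M :=
    ⟨max m1 (max m2 (max m3 (max m4 (max m5 (max m6 m7))))), by simp⟩
  refine intervalIntegral.tendsto_integral_filter_of_dominated_convergence (fun _ => 3 * M ^ 3)
    ?_ ?_ intervalIntegrable_const ?_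
  · filter_upwards [hr] with r hr
    have hr' : ∀ x ∈ Icc s t, x + r ∈ Ioo a b := fun x hx =>
      hs ⟨by linarith [hx.1, hr.1], by linarith [hx.2, hr.2]⟩
    refine ContinuousOn.aestronglyMeasurable ?_ measurableSet_uIoc
    rw [uIoc_of_le hst]
    exact (continuousOn_energyFlux hW hst' (continuousOn_steklov hw.continuousOn_vel hst' hr')
      (continuousOn_steklov hw.continuousOn_force hst' hr')
      (continuousOn_steklov hw.continuousOn_grad hst' hr')).mono Ioc_subset_Icc_self
  · filter_upwards [hr] with r hr
    refine ae_of_all _ fun x hx => ?_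
    rw [uIoc_of_le hst] at hx
    have hx' : x ∈ Icc s c := ⟨hx.1.le, hx.2.trans htc.le⟩
    have hsub : Icc x (x + r) ⊆ Icc s c :=
      Icc_subset_Icc hx.1.le (by linarith [hx.2, hr.2])
    exact abs_energyFlux_le _ _ _ _ _ _ _ ((b1 x hx').trans hM1) ((b2 x hx').trans hM2)
      ((b3 x hx').trans hM3) ((b4 x hx').trans hM4)
      (norm_steklov_le hr.1 fun y hy => (b5 y (hsub hy)).trans hM5)
      (norm_steklov_le hr.1 fun y hy => (b6 y (hsub hy)).trans hM6)
      (norm_steklov_le hr.1 fun y hy => (b7 y (hsub hy)).trans hM7)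
  · refine ae_of_all _ fun x hx => ?_
    rw [uIoc_of_le hst] at hx
    have hx' := hst' ⟨hx.1.le, hx.2⟩
    exact tendsto_energyFlux tendsto_const_nhds tendsto_const_nhds tendsto_const_nhds
      tendsto_const_nhds (tendsto_steklov hw.continuousOn_vel hx')
      (tendsto_steklov hw.continuousOn_force hx') (tendsto_steklov hw.continuousOn_grad hx')

/-- The weighted energy identity for weak solutions, in integrated form. -/
lemma IsWeakWave.kineticEnergy_sub (hw : IsWeakWave D a b u v h g)
    (hW : IsOperatorWeight D a b W₁ W₁' W₂ W₂' Z) {s t : ℝ} (hs : s ∈ Ioo a b) (ht : t ∈ Ioo a b)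
    (hst : s ≤ t) :
    kineticEnergy (W₁ t) (W₂ t) (v t) (g t) - kineticEnergy (W₁ s) (W₂ s) (v s) (g s)
      = ∫ r in s..t, energyFlux (W₁ r) (W₁' r) (W₂' r) (Z r) (v r) (h r) (g r) := by
  obtain ⟨c, htc, hcb⟩ := exists_between ht.2
  have hsub : Icc s c ⊆ Ioo a b := fun x hx => ⟨hs.1.trans_le hx.1, hx.2.trans_lt hcb⟩
  have hst' : Icc s t ⊆ Ioo a b := fun x hx => hsub ⟨hx.1, hx.2.trans htc.le⟩
  have hr : ∀ᶠ r in 𝓝[>] (0 : ℝ), r ∈ Ioo 0 (c - t) := Ioo_mem_nhdsGT (by linarith)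
  have hK : ∀ x ∈ Ioo a b, Tendsto
      (fun r => kineticEnergy (W₁ x) (W₂ x) (steklov r v x) (steklov r g x)) (𝓝[>] 0)
      (𝓝 (kineticEnergy (W₁ x) (W₂ x) (v x) (g x))) := fun x hx =>
    tendsto_kineticEnergy tendsto_const_nhds tendsto_const_nhds
      (tendsto_steklov hw.continuousOn_vel hx) (tendsto_steklov hw.continuousOn_grad hx)
  refine tendsto_nhds_unique ((hK t ht).sub (hK s hs)) ((hw.tendsto_integral_energyFlux hW hst htc hsub).congr' ?_)
  filter_upwards [hr] with r hr
  refine (hw.kineticEnergy_steklov_sub hW hst hst' fun x hx => hsub ⟨?_, ?_⟩).symm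
  · linarith [hx.1, hr.1]
  · linarith [hx.2, hr.2]

/-- The weighted energy identity for weak solutions. -/
lemma IsWeakWave.hasDerivAt_kineticEnergy (hw : IsWeakWave D a b u v h g)
    (hW : IsOperatorWeight D a b W₁ W₁' W₂ W₂' Z) {t : ℝ} (ht : t ∈ Ioo a b) :
    HasDerivAt (fun t => kineticEnergy (W₁ t) (W₂ t) (v t) (g t))
      (energyFlux (W₁ t) (W₁' t) (W₂' t) (Z t) (v t) (h t) (g t)) t := by
  obtain ⟨s, has, hst⟩ := exists_between ht.1
  have hs : s ∈ Ioo a b := ⟨has, hst.trans ht.2⟩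
  have h1 := hasDerivAt_primitive (continuousOn_energyFlux hW subset_rfl hw.continuousOn_vel
    hw.continuousOn_force hw.continuousOn_grad) hs ht
  refine (h1.add_const (kineticEnergy (W₁ s) (W₂ s) (v s) (g s))).congr_of_eventuallyEq ?_
  filter_upwards [Ioo_mem_nhds hst ht.2] with r hr
  rw [← hw.kineticEnergy_sub hW hs ⟨has.trans hr.1, hr.2⟩ hr.1.le, sub_add_cancel]

end Abstract

/-- The product of a bounded function and a square integrable function. -/
def mulBdd (F : Type*) [NormedAddCommGroup F] [NormedSpace ℝ F] :
    LpSpace N ℝ ∞ →L[ℝ] LpSpace N F 2 →L[ℝ]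
      LpSpace N F 2 :=
  (ContinuousLinearMap.lsmul ℝ ℝ : ℝ →L[ℝ] F →L[ℝ] F).holderL volume ∞ 2 2

/-- The product of a bounded vector field and a square integrable function. -/
def mulBddVec : LpSpace N (Space N) ∞ →L[ℝ] L2 N →L[ℝ] L2Vec N :=
  (ContinuousLinearMap.lsmul ℝ ℝ : ℝ →L[ℝ] Space N →L[ℝ] Space N).flip.holderL volume ∞ 2 2

lemma coeFn_mulBdd {F : Type*} [NormedAddCommGroup F] [NormedSpace ℝ F]
    (m : LpSpace N ℝ ∞) (u : LpSpace N F 2) :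
    mulBdd F m u =ᵐ[volume] fun x => m x • u x :=
  ContinuousLinearMap.coeFn_holder _ m u

lemma coeFn_mulBddVec (m : LpSpace N (Space N) ∞) (u : L2 N) :
    mulBddVec m u =ᵐ[volume] fun x => u x • m x :=
  ContinuousLinearMap.coeFn_holder _ m u

lemma inner_mulBdd {F : Type*} [NormedAddCommGroup F] [InnerProductSpace ℝ F]
    (m : LpSpace N ℝ ∞) (u w : LpSpace N F 2) :
    ⟪mulBdd F m u, w⟫_ℝ = ∫ x, m x * ⟪u x, w x⟫_ℝ := by
  rw [L2.inner_def]
  refine integral_congr_ae ?_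
  filter_upwards [coeFn_mulBdd m u] with x hx
  rw [hx, real_inner_smul_left]

lemma inner_mulBdd_symm {F : Type*} [NormedAddCommGroup F] [InnerProductSpace ℝ F]
    (m : LpSpace N ℝ ∞) (u w : LpSpace N F 2) :
    ⟪mulBdd F m u, w⟫_ℝ = ⟪u, mulBdd F m w⟫_ℝ := by
  rw [inner_mulBdd, real_inner_comm, inner_mulBdd]
  simp_rw [real_inner_comm]

attribute [irreducible] mulBdd mulBddVec

/-- Weak solutions on an open time interval of `∂ₜₜu - Δu = h`, as curves `u`, `v = ∂ₜu`,
`g = ∇u` in `L²`. -/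
structure IsWaveOn (a b : ℝ) (u v h : ℝ → L2 N) (g : ℝ → L2Vec N) : Prop where
  continuousOn_vel : ContinuousOn v (Ioo a b)
  continuousOn_grad : ContinuousOn g (Ioo a b)
  continuousOn_force : ContinuousOn h (Ioo a b)
  isWeakGradient : ∀ t ∈ Ioo a b, IsWeakGradient (u t) (g t)
  hasDerivAt : ∀ t ∈ Ioo a b, HasDerivAt u (v t) t
  equation : ∀ φ : Space N → ℝ, ContDiff ℝ ∞ φ → HasCompactSupport φ → ∀ t ∈ Ioo a b,
    HasDerivAt (fun s => ∫ x, v s x * φ x)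
      (-(∫ x, ⟪g t x, ∇ φ x⟫_ℝ) + ∫ x, h t x * φ x) t

variable {a b : ℝ} {u v h : ℝ → L2 N} {g : ℝ → L2Vec N}

lemma memLp_testFunction {φ : Space N → ℝ} (hφ : ContDiff ℝ ∞ φ) (hc : HasCompactSupport φ) :
    MemLp φ 2 volume := hφ.continuous.memLp_of_hasCompactSupport hc

lemma memLp_gradient_testFunction {φ : Space N → ℝ} (hφ : ContDiff ℝ ∞ φ)
    (hc : HasCompactSupport φ) : MemLp (∇ φ) 2 volume :=
  (continuous_gradient (hφ.of_le (by simp))).memLp_of_hasCompactSupport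
    ((hc.fderiv (𝕜 := ℝ)).comp_left (g := (InnerProductSpace.toDual ℝ (Space N)).symm) (map_zero _))

lemma inner_toLp {F : Type*} [NormedAddCommGroup F] [InnerProductSpace ℝ F]
    (w : LpSpace N F 2) {f : Space N → F} (hf : MemLp f 2 volume) :
    ⟪w, hf.toLp f⟫_ℝ = ∫ x, ⟪w x, f x⟫_ℝ := by
  rw [L2.inner_def]
  refine integral_congr_ae ?_
  filter_upwards [hf.coeFn_toLp] with x hx
  rw [hx]

/-- The integrated equation may be tested against any function of `H¹`. -/
lemma IsWaveOn.inner_vel_sub (hw : IsWaveOn a b u v h g) {ψ : L2 N} {ψ' : L2Vec N}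
    (hψ : IsWeakGradient ψ ψ') {s t : ℝ} (hs : s ∈ Ioo a b) (ht : t ∈ Ioo a b) :
    ⟪v t - v s, ψ⟫_ℝ = -⟪∫ r in s..t, g r, ψ'⟫_ℝ + ⟪∫ r in s..t, h r, ψ⟫_ℝ := by
  obtain ⟨φ, hφ, hφc, t1, t2, -⟩ := exists_testFunction_seq hψ
  have hgi := intervalIntegrable_of_continuousOn_Ioo hw.continuousOn_grad hs ht
  have hhi := intervalIntegrable_of_continuousOn_Ioo hw.continuousOn_force hs ht
  let P : ℕ → L2 N := fun n => (memLp_testFunction (hφ n) (hφc n)).toLp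
  let G : ℕ → L2Vec N := fun n => (memLp_gradient_testFunction (hφ n) (hφc n)).toLp
  have key : ∀ n, ⟪v t - v s, P n⟫_ℝ
      = -⟪∫ r in s..t, g r, G n⟫_ℝ + ⟪∫ r in s..t, h r, P n⟫_ℝ := by
    intro n
    have e1 : ∀ r ∈ Ioo a b, HasDerivAt (fun s => ⟪v s, P n⟫_ℝ)
        (-⟪g r, G n⟫_ℝ + ⟪h r, P n⟫_ℝ) r := by
      intro r hr
      have := hw.equation (φ n) (hφ n) (hφc n) r hr
      simp only [P, G, inner_toLp]
      simpa only [mul_comm, RCLike.inner_apply, conj_trivial] using this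
    have c1 : ContinuousOn (fun r => -⟪g r, G n⟫_ℝ + ⟪h r, P n⟫_ℝ) (Ioo a b) :=
      (hw.continuousOn_grad.inner continuousOn_const).neg.add
        (hw.continuousOn_force.inner continuousOn_const)
    have e2 := intervalIntegral.integral_eq_sub_of_hasDerivAt
      (fun r hr => e1 r (ordConnected_Ioo.uIcc_subset hs ht hr))
      (intervalIntegrable_of_continuousOn_Ioo c1 hs ht)
    rw [inner_sub_left, ← e2, intervalIntegral.integral_add, intervalIntegral.integral_neg]
    · congr 1
      · rw [real_inner_comm]
        simp_rw [real_inner_comm (G n)]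
        exact congrArg Neg.neg ((innerSL ℝ (G n)).intervalIntegral_comp_comm hgi)
      · rw [real_inner_comm]
        simp_rw [real_inner_comm (P n)]
        exact (innerSL ℝ (P n)).intervalIntegral_comp_comm hhi
    · exact (intervalIntegrable_of_continuousOn_Ioo
        (hw.continuousOn_grad.inner continuousOn_const).neg hs ht)
    · exact (intervalIntegrable_of_continuousOn_Ioo
        (hw.continuousOn_force.inner continuousOn_const) hs ht)
  have hP : Tendsto P atTop (𝓝 ψ) := by
    rw [Lp.tendsto_Lp_iff_tendsto_eLpNorm']
    refine t1.congr fun n => ?_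
    rw [← eLpNorm_neg]
    refine eLpNorm_congr_ae ?_
    filter_upwards [(memLp_testFunction (hφ n) (hφc n)).coeFn_toLp] with x hx
    simp [P, hx]
  have hG : Tendsto G atTop (𝓝 ψ') := by
    rw [Lp.tendsto_Lp_iff_tendsto_eLpNorm']
    refine t2.congr fun n => ?_
    rw [← eLpNorm_neg]
    refine eLpNorm_congr_ae ?_
    filter_upwards [(memLp_gradient_testFunction (hφ n) (hφc n)).coeFn_toLp] with x hx
    simp [G, hx]
  have l1 : Tendsto (fun n => ⟪v t - v s, P n⟫_ℝ) atTop (𝓝 ⟪v t - v s, ψ⟫_ℝ) :=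
    tendsto_const_nhds.inner hP
  have l2 := ((tendsto_const_nhds (x := ∫ r in s..t, g r)).inner (𝕜 := ℝ) hG).neg.add
    ((tendsto_const_nhds (x := ∫ r in s..t, h r)).inner (𝕜 := ℝ) hP)
  exact tendsto_nhds_unique (l1.congr key) l2

/-- The graph of the weak gradient. -/
def gradGraph (N : ℕ) : Submodule ℝ (L2 N × L2Vec N) where
  carrier := {w | IsWeakGradient w.1 w.2}
  zero_mem' := (SobolevH1 N).zero_mem
  add_mem' {x y} hx hy :=
    (SobolevH1 N).add_mem (x := WithLp.toLp 2 x) (y := WithLp.toLp 2 y) hx hy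
  smul_mem' c x hx := (SobolevH1 N).smul_mem (x := WithLp.toLp 2 x) c hx

lemma IsWaveOn.isWeakWave (hw : IsWaveOn a b u v h g) :
    IsWeakWave (gradGraph N) a b u v h g where
  continuousOn_vel := hw.continuousOn_vel
  continuousOn_grad := hw.continuousOn_grad
  continuousOn_force := hw.continuousOn_force
  mem := hw.isWeakGradient
  hasDerivAt := hw.hasDerivAt
  inner_sub _ _ hψ _ hs _ ht := hw.inner_vel_sub hψ hs ht

/-- A time-dependent weight `W`, with time derivative `W'` and gradient `Z`, both bounded. -/
structure IsWeight (a b : ℝ) (W W' : ℝ → LpSpace N ℝ ∞)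
    (Z : ℝ → LpSpace N (Space N) ∞) : Prop where
  hasDerivAt : ∀ t ∈ Ioo a b, HasDerivAt W (W' t) t
  continuousOn_deriv : ContinuousOn W' (Ioo a b)
  continuousOn_grad : ContinuousOn Z (Ioo a b)
  isWeakGradient_mul : ∀ t ∈ Ioo a b, ∀ ψ ψ', IsWeakGradient ψ ψ' →
    IsWeakGradient (mulBdd ℝ (W t) ψ) (mulBdd (Space N) (W t) ψ' + mulBddVec (Z t) ψ)

variable {W W' : ℝ → LpSpace N ℝ ∞}
  {Z : ℝ → LpSpace N (Space N) ∞}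

lemma IsWeight.isOperatorWeight (hW : IsWeight a b W W' Z) :
    IsOperatorWeight (gradGraph N) a b (fun t => mulBdd ℝ (W t)) (fun t => mulBdd ℝ (W' t))
      (fun t => mulBdd (Space N) (W t)) (fun t => mulBdd (Space N) (W' t))
      (fun t => mulBddVec (Z t)) where
  hasDerivAt₁ t ht := (mulBdd ℝ).hasFDerivAt.comp_hasDerivAt t (hW.hasDerivAt t ht)
  hasDerivAt₂ t ht := (mulBdd (Space N)).hasFDerivAt.comp_hasDerivAt t (hW.hasDerivAt t ht)
  continuousOn₁ := (mulBdd ℝ).continuous.comp_continuousOn hW.continuousOn_deriv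
  continuousOn₂ := (mulBdd (Space N)).continuous.comp_continuousOn hW.continuousOn_deriv
  continuousOn_comm := mulBddVec.continuous.comp_continuousOn hW.continuousOn_grad
  symm₁ _ _ := inner_mulBdd_symm _
  symm₂ _ _ := inner_mulBdd_symm _
  mem := hW.isWeakGradient_mul

/-- The weighted energy identity. -/
lemma IsWaveOn.hasDerivAt_kineticEnergy (hw : IsWaveOn a b u v h g) (hW : IsWeight a b W W' Z)
    {t : ℝ} (ht : t ∈ Ioo a b) :
    HasDerivAt (fun t => ((∫ x, W t x * (v t x * v t x))
        + ∫ x, W t x * ⟪g t x, g t x⟫_ℝ) / 2)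
      (((∫ x, W' t x * (v t x * v t x)) + ∫ x, W' t x * ⟪g t x, g t x⟫_ℝ) / 2
        - (∫ x, v t x * ⟪g t x, Z t x⟫_ℝ) + ∫ x, W t x * (v t x * h t x)) t := by
  have key := hw.isWeakWave.hasDerivAt_kineticEnergy hW.isOperatorWeight ht
  have e1 : ∀ (m : LpSpace N ℝ ∞) (x y : L2 N),
      ⟪mulBdd ℝ m x, y⟫_ℝ = ∫ z, m z * (x z * y z) := by
    intro m x y
    rw [inner_mulBdd]
    simp [mul_comm]
  have e2 : ∀ (m : LpSpace N (Space N) ∞) (x : L2Vec N) (y : L2 N),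
      ⟪x, mulBddVec m y⟫_ℝ = ∫ z, y z * ⟪x z, m z⟫_ℝ := by
    intro m x y
    rw [L2.inner_def]
    refine integral_congr_ae ?_
    filter_upwards [coeFn_mulBddVec m y] with z hz
    rw [hz, real_inner_smul_right]
  simp only [kineticEnergy, energyFlux, real_inner_comm _ (h t)] at key
  simp only [e1, e2, inner_mulBdd] at key
  exact key

end Kinetic

/-! ### Weights, and integral functionals along curves in `L²` -/

section Weights

variable {N : ℕ}

lemma inner_gradient {f : Space N → ℝ} (x v : Space N) : ⟪∇ f x, v⟫_ℝ = fderiv ℝ f x v :=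
  InnerProductSpace.toDual_symm_apply

/-- A square integrable `C¹` function with square integrable gradient has this gradient as weak
gradient. -/
lemma isWeakGradient_toLp {f : Space N → ℝ} (hf : ContDiff ℝ 1 f) (h1 : MemLp f 2 volume)
    (h2 : MemLp (∇ f) 2 volume) : IsWeakGradient h1.toLp h2.toLp := by
  intro φ hφ hc
  have e1 : ∫ x, h1.toLp f x • ∇ φ x = ∫ x, f x • ∇ φ x := by
    refine integral_congr_ae ?_
    filter_upwards [h1.coeFn_toLp] with x hx
    rw [hx]
  have e2 : ∫ x, φ x • h2.toLp (∇ f) x = ∫ x, φ x • ∇ f x := by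
    refine integral_congr_ae ?_
    filter_upwards [h2.coeFn_toLp] with x hx
    rw [hx]
  rw [e1, e2]
  have hφm := memLp_testFunction hφ hc
  have hφg := memLp_gradient_testFunction hφ hc
  have i1 : Integrable fun x => f x • ∇ φ x :=
    memLp_one_iff_integrable.1 (hφg.smul h1 (r := 1))
  have i2 : Integrable fun x => φ x • ∇ f x :=
    memLp_one_iff_integrable.1 (h2.smul hφm (r := 1))
  refine ext_inner_right ℝ fun v => ?_
  rw [inner_neg_left, real_inner_comm, real_inner_comm v]
  have j1 : ⟪v, ∫ x, f x • ∇ φ x⟫_ℝ = ∫ x, f x * fderiv ℝ φ x v := by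
    rw [← integral_inner i1]
    refine integral_congr_ae (ae_of_all _ fun x => ?_)
    simp only [real_inner_comm _ v, real_inner_smul_left, inner_gradient]
  have j2 : ⟪v, ∫ x, φ x • ∇ f x⟫_ℝ = ∫ x, fderiv ℝ f x v * φ x := by
    rw [← integral_inner i2]
    refine integral_congr_ae (ae_of_all _ fun x => ?_)
    simp only [real_inner_comm _ v, real_inner_smul_left, inner_gradient, mul_comm]
  rw [j1, j2]
  refine integral_mul_fderiv_eq_neg_fderiv_mul_of_integrable ?_ ?_ ?_
    (fun x _ => hf.differentiable (by simp) x) (fun x _ => hφ.differentiable (by simp) x)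
  · refine (i2.inner_const v).congr (ae_of_all _ fun x => ?_)
    simp only [inner_smul_left, inner_gradient, mul_comm, conj_trivial]
  · refine (i1.inner_const v).congr (ae_of_all _ fun x => ?_)
    simp only [inner_smul_left, inner_gradient, conj_trivial]
  · exact memLp_one_iff_integrable.1 (hφm.mul h1 (r := 1))

lemma isWeakGradient_of_tendsto {u : ℕ → L2 N} {g : ℕ → L2Vec N} {u₀ : L2 N} {g₀ : L2Vec N}
    (h : ∀ n, IsWeakGradient (u n) (g n)) (hu : Tendsto u atTop (𝓝 u₀))
    (hg : Tendsto g atTop (𝓝 g₀)) : IsWeakGradient u₀ g₀ := by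
  intro φ hφ hc
  have hφm := memLp_testFunction hφ hc
  have hφg := memLp_gradient_testFunction hφ hc
  refine ext_inner_right ℝ fun v => ?_
  have hv : MemLp (fun x => ⟪∇ φ x, v⟫_ℝ) 2 volume := hφg.inner_const v
  have hw : MemLp (fun x => φ x • v) 2 volume :=
    (memLp_top_const v).smul hφm
  have e1 : ∀ w : L2 N, ⟪∫ x, w x • ∇ φ x, v⟫_ℝ = ⟪w, hv.toLp⟫_ℝ := by
    intro w
    rw [inner_toLp, real_inner_comm, ← integral_inner (integrable_smul_gradient w hφ hc)]
    refine integral_congr_ae (ae_of_all _ fun x => ?_)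
    simp only [real_inner_comm _ v, real_inner_smul_left]
    simp [mul_comm]
  have e2 : ∀ w : L2Vec N, ⟪-∫ x, φ x • w x, v⟫_ℝ = -⟪w, hw.toLp⟫_ℝ := by
    intro w
    rw [inner_neg_left, inner_toLp, real_inner_comm, ← integral_inner (integrable_smul_field w hφ hc)]
    congr 1
    refine integral_congr_ae (ae_of_all _ fun x => ?_)
    simp only [real_inner_comm _ v, real_inner_smul_left, real_inner_smul_right]
  rw [e1, e2]
  refine tendsto_nhds_unique (hu.inner tendsto_const_nhds)
    (((hg.inner (𝕜 := ℝ) tendsto_const_nhds).neg).congr fun n => ?_)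
  rw [← e1, ← e2, h n φ hφ hc]

lemma tendsto_toLp_of_eLpNorm {E : Type*} [NormedAddCommGroup E] {f : ℕ → Space N → E}
    (hf : ∀ n, MemLp (f n) 2 volume) {u : LpSpace N E 2}
    (h : Tendsto (fun n => eLpNorm (fun x => u x - f n x) 2 volume) atTop (𝓝 0)) :
    Tendsto (fun n => (hf n).toLp) atTop (𝓝 u) := by
  rw [Lp.tendsto_Lp_iff_tendsto_eLpNorm']
  refine h.congr fun n => ?_
  rw [← eLpNorm_neg]
  refine eLpNorm_congr_ae ?_
  filter_upwards [(hf n).coeFn_toLp] with x hx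
  simp [hx]

/-- The Leibniz rule for the product of an `H¹` function and a bounded `C¹` function with bounded
gradient. -/
lemma IsWeakGradient.mul {ψ : L2 N} {ψ' : L2Vec N} (h : IsWeakGradient ψ ψ')
    {W : Space N → ℝ} (hW : ContDiff ℝ 1 W) (h1 : MemLp W ∞ volume) (h2 : MemLp (∇ W) ∞ volume) :
    IsWeakGradient (mulBdd ℝ h1.toLp ψ)
      (mulBdd (Space N) h1.toLp ψ' + mulBddVec h2.toLp ψ) := by
  obtain ⟨φ, hφ, hφc, t1, t2, -⟩ := exists_testFunction_seq h
  have hm := fun n => memLp_testFunction (hφ n) (hφc n)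
  have hg := fun n => memLp_gradient_testFunction (hφ n) (hφc n)
  have T1 := tendsto_toLp_of_eLpNorm hm t1
  have T2 := tendsto_toLp_of_eLpNorm hg t2
  refine isWeakGradient_of_tendsto (fun n => ?_)
    (((mulBdd ℝ h1.toLp).continuous.tendsto _).comp T1)
    ((((mulBdd (Space N) h1.toLp).continuous.tendsto _).comp T2).add
      (((mulBddVec h2.toLp).continuous.tendsto _).comp T1))
  have hP : MemLp (fun x => W x * φ n x) 2 volume := (hm n).mul h1
  have hgr : (∇ fun x => W x * φ n x) = fun x => W x • ∇ (φ n) x + φ n x • ∇ W x := by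
    ext1 x
    exact gradient_mul (hW.differentiable (by simp) x) ((hφ n).differentiable (by simp) x)
  have hG : MemLp (∇ fun x => W x * φ n x) 2 volume := by
    rw [hgr]
    exact ((hg n).smul h1).add (h2.smul (hm n))
  have key := isWeakGradient_toLp (hW.mul ((hφ n).of_le (by simp))) hP hG
  have e1 : mulBdd ℝ h1.toLp (hm n).toLp = hP.toLp := by
    refine Lp.ext ?_
    filter_upwards [coeFn_mulBdd h1.toLp (hm n).toLp, h1.coeFn_toLp, (hm n).coeFn_toLp,
      hP.coeFn_toLp] with x a1 a2 a3 a4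
    rw [a1, a2, a3, a4, smul_eq_mul]
  have e2 : mulBdd (Space N) h1.toLp (hg n).toLp + mulBddVec h2.toLp (hm n).toLp = hG.toLp := by
    refine Lp.ext ?_
    filter_upwards [coeFn_mulBdd h1.toLp (hg n).toLp, coeFn_mulBddVec h2.toLp (hm n).toLp,
      h1.coeFn_toLp, (hm n).coeFn_toLp, h2.coeFn_toLp, (hg n).coeFn_toLp, hG.coeFn_toLp,
      Lp.coeFn_add (mulBdd (Space N) h1.toLp (hg n).toLp) (mulBddVec h2.toLp (hm n).toLp)]
      with x a1 a2 a3 a4 a5 a6 a7 a8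
    rw [a8, Pi.add_apply, a1, a2, a3, a4, a5, a6, a7, hgr]
  simp only [Function.comp_apply]
  rw [e1, e2]
  exact key

lemma norm_toLp_top_le {E : Type*} [NormedAddCommGroup E] {f : Space N → E}
    (hf : MemLp f ∞ volume) {K : ℝ} (hK : 0 ≤ K) (h : ∀ x, ‖f x‖ ≤ K) : ‖hf.toLp f‖ ≤ K := by
  rw [Lp.norm_toLp]
  refine ENNReal.toReal_le_of_le_ofReal hK ?_
  rw [eLpNorm_exponent_top]
  refine eLpNormEssSup_le_of_ae_bound (ae_of_all _ h)

open Classical in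
/-- The class in `L^p` of a function, which is `0` by convention if the function is not in `L^p`. -/
def lpOf {E : Type*} [NormedAddCommGroup E] (p : ℝ≥0∞) (f : Space N → E) :
    LpSpace N E p :=
  if h : MemLp f p volume then h.toLp else 0

lemma lpOf_eq {E : Type*} [NormedAddCommGroup E] {p : ℝ≥0∞} {f : Space N → E}
    (h : MemLp f p volume) : lpOf p f = h.toLp := dif_pos h

lemma coeFn_lpOf {E : Type*} [NormedAddCommGroup E] {p : ℝ≥0∞} {f : Space N → E}
    (h : MemLp f p volume) : lpOf p f =ᵐ[volume] f := by
  rw [lpOf_eq h]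
  exact h.coeFn_toLp

/-- A criterion for time-dependent weights. -/
lemma isWeight_of_bounds {a b K : ℝ} {W W' : ℝ → Space N → ℝ}
    (h1 : ∀ t ∈ Ioo a b, MemLp (W t) ∞ volume) (h2 : ∀ t ∈ Ioo a b, MemLp (W' t) ∞ volume)
    (h3 : ∀ t ∈ Ioo a b, MemLp (∇ (W t)) ∞ volume) (hC : ∀ t ∈ Ioo a b, ContDiff ℝ 1 (W t))
    (hT : ∀ t ∈ Ioo a b, ∀ s ∈ Ioo a b, ∀ x, |W s x - W t x - (s - t) * W' t x| ≤ K * (s - t) ^ 2)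
    (hL : ∀ t ∈ Ioo a b, ∀ s ∈ Ioo a b, ∀ x, |W' s x - W' t x| ≤ K * |s - t|)
    (hG : ∀ t ∈ Ioo a b, ∀ s ∈ Ioo a b, ∀ x, ‖∇ (W s) x - ∇ (W t) x‖ ≤ K * |s - t|) :
    IsWeight a b (fun t => lpOf ∞ (W t)) (fun t => lpOf ∞ (W' t)) (fun t => lpOf ∞ (∇ (W t))) := by
  rcases le_or_gt b a with hab | hab
  · have : Ioo a b = ∅ := Ioo_eq_empty (not_lt.2 hab)
    exact ⟨by simp [this], by simp [this], by simp [this], by simp [this]⟩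
  have hK : 0 ≤ K := by
    obtain ⟨c, hc1, hc2⟩ := exists_between hab
    obtain ⟨d, hd1, hd2⟩ := exists_between hc2
    have := (norm_nonneg _).trans (hG c ⟨hc1, hc2⟩ d ⟨hc1.trans hd1, hd2⟩ 0)
    exact nonneg_of_mul_nonneg_left this (abs_pos.2 (by linarith))
  refine ⟨fun t ht => ?_, ?_, ?_, fun t ht ψ ψ' h => ?_⟩
  · rw [hasDerivAt_iff_isLittleO]
    refine Asymptotics.IsBigO.trans_isLittleO (g := fun s => (s - t) ^ 2) ?_ ?_
    · refine Asymptotics.IsBigO.of_bound K ?_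
      filter_upwards [isOpen_Ioo.mem_nhds ht] with s hs
      rw [lpOf_eq (h1 s hs), lpOf_eq (h1 t ht), lpOf_eq (h2 t ht), ← MemLp.toLp_sub,
        ← MemLp.toLp_const_smul, ← MemLp.toLp_sub]
      refine norm_toLp_top_le _ (by positivity) fun x => ?_
      rw [norm_eq_abs, norm_of_nonneg (sq_nonneg (s - t))]
      exact hT t ht s hs x
    · refine Asymptotics.isLittleO_iff.2 fun c hc => ?_
      filter_upwards [Metric.ball_mem_nhds t hc] with s hs
      rw [Metric.mem_ball, Real.dist_eq] at hs
      rw [norm_pow, norm_eq_abs, sq]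
      gcongr
  · intro t ht
    refine ContinuousAt.continuousWithinAt (tendsto_iff_norm_sub_tendsto_zero.2 ?_)
    have h0 : Tendsto (fun s => K * |s - t|) (𝓝 t) (𝓝 0) := by
      have : Continuous fun s => K * |s - t| := by fun_prop
      simpa using this.tendsto t
    refine squeeze_zero' (Eventually.of_forall fun s => norm_nonneg _) ?_ h0
    filter_upwards [isOpen_Ioo.mem_nhds ht] with s hs
    rw [lpOf_eq (h2 s hs), lpOf_eq (h2 t ht), ← MemLp.toLp_sub]
    exact norm_toLp_top_le _ (by positivity) fun x => hL t ht s hs x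
  · intro t ht
    refine ContinuousAt.continuousWithinAt (tendsto_iff_norm_sub_tendsto_zero.2 ?_)
    have h0 : Tendsto (fun s => K * |s - t|) (𝓝 t) (𝓝 0) := by
      have : Continuous fun s => K * |s - t| := by fun_prop
      simpa using this.tendsto t
    refine squeeze_zero' (Eventually.of_forall fun s => norm_nonneg _) ?_ h0
    filter_upwards [isOpen_Ioo.mem_nhds ht] with s hs
    rw [lpOf_eq (h3 s hs), lpOf_eq (h3 t ht), ← MemLp.toLp_sub]
    exact norm_toLp_top_le _ (by positivity) fun x => hG t ht s hs x
  · simp only [lpOf_eq (h1 t ht), lpOf_eq (h3 t ht)]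
    exact h.mul (hC t ht) (h1 t ht) (h3 t ht)

lemma aestronglyMeasurable_comp_Lp {G : Space N → ℝ → ℝ} (hG : Continuous (Function.uncurry G))
    (w : L2 N) : AEStronglyMeasurable (fun x => G x (w x)) volume :=
  hG.comp_aestronglyMeasurable (aestronglyMeasurable_id.prodMk (Lp.aestronglyMeasurable w))

lemma integrable_comp_Lp {G : Space N → ℝ → ℝ} (hG : Continuous (Function.uncurry G)) {L : ℝ}
    (hL : ∀ x e, |G x e| ≤ L * e ^ 2) (w : L2 N) : Integrable (fun x => G x (w x)) volume :=
  ((Lp.memLp w).integrable_sq.const_mul L).mono' (aestronglyMeasurable_comp_Lp hG w)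
    (ae_of_all _ fun _ => hL _ _)

lemma memLp_comp_Lp {G : Space N → ℝ → ℝ} (hG : Continuous (Function.uncurry G)) {L : ℝ}
    (hL : ∀ x e, |G x e| ≤ L * |e|) (w : L2 N) : MemLp (fun x => G x (w x)) 2 volume :=
  (Lp.memLp w).of_le_mul (aestronglyMeasurable_comp_Lp hG w) (ae_of_all _ fun _ => hL _ _)

lemma norm_sq_eq_integral (w : L2 N) : ‖w‖ ^ 2 = ∫ x, w x ^ 2 := by
  rw [← real_inner_self_eq_norm_sq, L2.inner_def]
  refine integral_congr_ae (ae_of_all _ fun x => ?_)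
  simp [sq]

lemma inner_lpOf {f : Space N → ℝ} (hf : MemLp f 2 volume) (w : L2 N) :
    ⟪lpOf 2 f, w⟫_ℝ = ∫ x, f x * w x := by
  rw [L2.inner_def]
  refine integral_congr_ae ?_
  filter_upwards [coeFn_lpOf hf] with x hx
  rw [hx]
  simp [mul_comm]

lemma tendsto_lpOf {ι E : Type*} [NormedAddCommGroup E] {l : Filter ι} {f : ι → Space N → E}
    {g : Space N → E} (hf : ∀ᶠ i in l, MemLp (f i) 2 volume) (hg : MemLp g 2 volume)
    (h : Tendsto (fun i => eLpNorm (fun x => f i x - g x) 2 volume) l (𝓝 0)) :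
    Tendsto (fun i => lpOf 2 (f i)) l (𝓝 (lpOf 2 g)) := by
  rw [Lp.tendsto_Lp_iff_tendsto_eLpNorm']
  refine h.congr' ?_
  filter_upwards [hf] with i hi
  refine eLpNorm_congr_ae ?_
  filter_upwards [coeFn_lpOf hi, coeFn_lpOf hg] with x h1 h2
  rw [Pi.sub_apply, h1, h2]

/-- The derivative of an integral functional along a differentiable curve in `L²`. -/
lemma hasDerivAt_integral_comp {a b L : ℝ} {Φ Φ' ψ : ℝ → Space N → ℝ → ℝ} {u : ℝ → L2 N} {v : L2 N}
    {t : ℝ} (ht : t ∈ Ioo a b) (hu : HasDerivAt u v t)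
    (hΦm : ∀ s ∈ Ioo a b, Continuous (Function.uncurry (Φ s)))
    (hψm : ∀ s ∈ Ioo a b, Continuous (Function.uncurry (ψ s)))
    (hΦ'm : Continuous (Function.uncurry (Φ' t)))
    (hΦ0 : ∀ s ∈ Ioo a b, ∀ x e, |Φ s x e| ≤ L * e ^ 2)
    (hΦ1 : ∀ s ∈ Ioo a b, ∀ x e e', |Φ s x e' - Φ s x e - ψ s x e * (e' - e)| ≤ L * (e' - e) ^ 2)
    (hψ : ∀ s ∈ Ioo a b, ∀ x e, |ψ s x e| ≤ L * |e|)
    (hΦt : ∀ s ∈ Ioo a b, ∀ x e, HasDerivAt (fun s => Φ s x e) (Φ' s x e) s)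
    (hΦ' : ∀ s ∈ Ioo a b, ∀ x e, |Φ' s x e| ≤ L * e ^ 2)
    (hψc : ∀ x e, ContinuousAt (fun s => ψ s x e) t) :
    Integrable (fun x => Φ' t x (u t x) + ψ t x (u t x) * v x) ∧
    HasDerivAt (fun s => ∫ x, Φ s x (u s x)) (∫ x, (Φ' t x (u t x) + ψ t x (u t x) * v x)) t := by
  have hI : Ioo a b ∈ 𝓝 t := isOpen_Ioo.mem_nhds ht
  have hP : ∀ s ∈ Ioo a b, MemLp (fun x => ψ s x (u t x)) 2 volume := fun s hs =>
    memLp_comp_Lp (hψm s hs) (hψ s hs) (u t)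
  set P : ℝ → L2 N := fun s => lpOf 2 fun x => ψ s x (u t x) with hPd
  have hPc : Tendsto P (𝓝 t) (𝓝 (P t)) := by
    refine tendsto_lpOf (by filter_upwards [hI] with s hs using hP s hs) (hP t ht) ?_
    refine tendsto_eLpNorm_two_of_dominated (b := fun x => L * |u t x| + L * |u t x|)
      ?_ (((Lp.memLp (u t)).norm.const_mul L).add ((Lp.memLp (u t)).norm.const_mul L)) ?_ ?_
    · filter_upwards [hI] with s hs using (hP s hs).1.sub (hP t ht).1
    · filter_upwards [hI] with s hs
      exact ae_of_all _ fun x => (norm_sub_le _ _).trans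
        (add_le_add (hψ s hs _ _) (hψ t ht _ _))
    · refine ae_of_all _ fun x => ?_
      simpa using (hψc x (u t x)).tendsto.sub_const (ψ t x (u t x))
  -- the functional at the frozen argument `u t`
  have h1 : HasDerivAt (fun s => ∫ x, Φ s x (u t x)) (∫ x, Φ' t x (u t x)) t :=
    (hasDerivAt_integral_of_dominated_loc_of_deriv_le (s := Ioo a b)
      (bound := fun x => L * u t x ^ 2) hI
      (by filter_upwards [hI] with s hs using aestronglyMeasurable_comp_Lp (hΦm s hs) _)
      (integrable_comp_Lp (hΦm t ht) (hΦ0 t ht) _) (aestronglyMeasurable_comp_Lp hΦ'm _)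
      (ae_of_all _ fun x s hs => hΦ' s hs _ _)
      ((Lp.memLp (u t)).integrable_sq.const_mul L)
      (ae_of_all _ fun x s hs => hΦt s hs _ _)).2
  -- the increment of the argument
  have hR : ∀ s ∈ Ioo a b, |(∫ x, Φ s x (u s x)) - (∫ x, Φ s x (u t x)) - ⟪P s, u s - u t⟫_ℝ|
      ≤ L * ‖u s - u t‖ ^ 2 := by
    intro s hs
    have e1 : ⟪P s, u s - u t⟫_ℝ = ∫ x, ψ s x (u t x) * (u s x - u t x) := by
      rw [hPd, inner_lpOf (hP s hs)]
      refine integral_congr_ae ?_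
      filter_upwards [Lp.coeFn_sub (u s) (u t)] with x hx
      rw [hx, Pi.sub_apply]
    have e2 : ‖u s - u t‖ ^ 2 = ∫ x, (u s x - u t x) ^ 2 := by
      rw [norm_sq_eq_integral]
      refine integral_congr_ae ?_
      filter_upwards [Lp.coeFn_sub (u s) (u t)] with x hx
      rw [hx, Pi.sub_apply]
    have i0 : MemLp (fun x => u s x - u t x) 2 volume := (Lp.memLp (u s)).sub (Lp.memLp (u t))
    have i1 := integrable_comp_Lp (hΦm s hs) (hΦ0 s hs) (u s)
    have i2 := integrable_comp_Lp (hΦm s hs) (hΦ0 s hs) (u t)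
    have i3 : Integrable (fun x => ψ s x (u t x) * (u s x - u t x)) :=
      memLp_one_iff_integrable.1 (i0.mul (hP s hs) (r := 1))
    have i12 : Integrable (fun x => Φ s x (u s x) - Φ s x (u t x)) := i1.sub i2
    rw [e1, e2, ← integral_sub i1 i2, ← integral_sub i12 i3, ← integral_const_mul]
    rw [← norm_eq_abs]
    refine norm_integral_le_of_norm_le (i0.integrable_sq.const_mul L) ?_
    exact ae_of_all _ fun x => hΦ1 s hs x (u t x) (u s x)
  have h2 : HasDerivAt (fun s => (∫ x, Φ s x (u s x)) - ∫ x, Φ s x (u t x)) ⟪P t, v⟫_ℝ t := by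
    rw [hasDerivAt_iff_isLittleO]
    have b1 : (fun s => u s - u t) =O[𝓝 t] fun s => s - t := hu.isBigO_sub
    have b2 : (fun s => u s - u t - (s - t) • v) =o[𝓝 t] fun s => s - t :=
      hasDerivAt_iff_isLittleO.1 hu
    have c1 : (fun s => (∫ x, Φ s x (u s x)) - (∫ x, Φ s x (u t x)) - ⟪P s, u s - u t⟫_ℝ)
        =o[𝓝 t] fun s => s - t := by
      have d1 : (fun s => (∫ x, Φ s x (u s x)) - (∫ x, Φ s x (u t x)) - ⟪P s, u s - u t⟫_ℝ)
          =O[𝓝 t] fun s => ‖u s - u t‖ ^ 2 := by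
        refine Asymptotics.IsBigO.of_bound L ?_
        filter_upwards [hI] with s hs
        rw [norm_pow, norm_norm]
        exact hR s hs
      refine d1.trans_isLittleO ?_
      have d2 : (fun s => ‖u s - u t‖) =o[𝓝 t] fun _ => (1 : ℝ) := by
        rw [Asymptotics.isLittleO_one_iff]
        simpa using (hu.continuousAt.tendsto.sub_const (u t)).norm
      simpa [sq] using d2.mul_isBigO b1.norm_left
    have c2 : (fun s => ⟪P s - P t, u s - u t⟫_ℝ) =o[𝓝 t] fun s => s - t := by
      have d2 : (fun s => ‖P s - P t‖) =o[𝓝 t] fun _ => (1 : ℝ) := by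
        rw [Asymptotics.isLittleO_one_iff]
        simpa using (hPc.sub_const (P t)).norm
      have d3 := d2.mul_isBigO b1.norm_left
      simp only [one_mul] at d3
      exact (Asymptotics.IsBigO.of_bound 1 (Eventually.of_forall fun s => by
        simpa using abs_real_inner_le_norm (P s - P t) (u s - u t))).trans_isLittleO d3
    have c3 : (fun s => ⟪P t, u s - u t - (s - t) • v⟫_ℝ) =o[𝓝 t] fun s => s - t :=
      (Asymptotics.IsBigO.of_bound ‖P t‖ (Eventually.of_forall fun s => by
        simpa using abs_real_inner_le_norm (P t) (u s - u t - (s - t) • v))).trans_isLittleO b2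
    refine ((c1.add c2).add c3).congr_left fun s => ?_
    rw [inner_sub_left, inner_sub_right (P t) (u s - u t), real_inner_smul_right, smul_eq_mul]
    ring
  have h3 := h1.add h2
  have j1 : Integrable fun x => Φ' t x (u t x) := integrable_comp_Lp hΦ'm (hΦ' t ht) (u t)
  have j2 : Integrable fun x => ψ t x (u t x) * v x :=
    memLp_one_iff_integrable.1 ((Lp.memLp v).mul (hP t ht) (r := 1))
  rw [hPd, inner_lpOf (hP t ht), ← integral_add j1 j2] at h3
  refine ⟨j1.add j2, h3.congr_of_eventuallyEq (Eventually.of_forall fun s => ?_)⟩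
  simp

end Weights

section Nonlinearity

/-! ### Cut-off functions -/

/-- Bounds for the first two derivatives of a cut-off function. -/
structure IsCutoffBound (χ : ℝ → ℝ) (M : ℝ) : Prop where
  one_le : 1 ≤ M
  deriv_le : ∀ s, |deriv χ s| ≤ M
  deriv_deriv_le : ∀ s, |deriv (deriv χ) s| ≤ M

variable {χ : ℝ → ℝ} {M : ℝ}

lemma IsCutoff.mem_Icc' (hχ : IsCutoff χ) (s : ℝ) : χ s ∈ Icc (0 : ℝ) 1 := by
  rcases le_total 0 s with h | h
  · exact hχ.mem_Icc s h
  · rw [← hχ.even]; exact hχ.mem_Icc (-s) (by simpa using h)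

lemma IsCutoff.eq_one' (hχ : IsCutoff χ) {s : ℝ} (hs : |s| ≤ 1) : χ s = 1 := by
  rcases le_total 0 s with h | h
  · exact hχ.eq_one s ⟨h, by rwa [abs_of_nonneg h] at hs⟩
  · rw [← hχ.even]
    exact hχ.eq_one (-s) ⟨by simpa using h, by rwa [abs_of_nonpos h] at hs⟩

lemma IsCutoff.eq_zero' (hχ : IsCutoff χ) {s : ℝ} (hs : 2 ≤ |s|) : χ s = 0 := by
  rcases le_total 0 s with h | h
  · exact hχ.eq_zero s (by rwa [abs_of_nonneg h] at hs)
  · rw [← hχ.even]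
    exact hχ.eq_zero (-s) (by rwa [abs_of_nonpos h] at hs)

lemma IsCutoff.deriv_eq_zero_of_le (hχ : IsCutoff χ) {s : ℝ} (hs : |s| ≤ 1) : deriv χ s = 0 :=
  IsLocalMax.deriv_eq_zero (Eventually.of_forall fun x => by
    rw [hχ.eq_one' hs]; exact (hχ.mem_Icc' x).2)

lemma IsCutoff.deriv_eq_zero_of_ge (hχ : IsCutoff χ) {s : ℝ} (hs : 2 ≤ |s|) : deriv χ s = 0 :=
  IsLocalMin.deriv_eq_zero (Eventually.of_forall fun x => by
    rw [hχ.eq_zero' hs]; exact (hχ.mem_Icc' x).1)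

lemma IsCutoff.contDiff_deriv (hχ : IsCutoff χ) : ContDiff ℝ ∞ (deriv χ) :=
  ((contDiff_infty_iff_deriv (f := χ)).1 hχ.smooth).2

lemma IsCutoff.contDiff_deriv_deriv (hχ : IsCutoff χ) : ContDiff ℝ ∞ (deriv (deriv χ)) :=
  ((contDiff_infty_iff_deriv (f := deriv χ)).1 hχ.contDiff_deriv).2

lemma IsCutoff.hasDerivAt (hχ : IsCutoff χ) (s : ℝ) : HasDerivAt χ (deriv χ s) s :=
  (hχ.smooth.differentiable (by simp) s).hasDerivAt

lemma IsCutoff.hasDerivAt_deriv (hχ : IsCutoff χ) (s : ℝ) :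
    HasDerivAt (deriv χ) (deriv (deriv χ) s) s :=
  (hχ.contDiff_deriv.differentiable (by simp) s).hasDerivAt

lemma IsCutoff.hasCompactSupport_deriv (hχ : IsCutoff χ) : HasCompactSupport (deriv χ) := by
  refine HasCompactSupport.intro (isCompact_Icc (a := (-2 : ℝ)) (b := 2)) fun s hs => ?_
  refine hχ.deriv_eq_zero_of_ge ?_
  by_contra h
  exact hs (abs_le.1 (not_le.1 h).le)

lemma IsCutoff.deriv_deriv_eq_zero (hχ : IsCutoff χ) {s : ℝ} (hs : 2 < |s|) :
    deriv (deriv χ) s = 0 := by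
  have : deriv χ =ᶠ[𝓝 s] fun _ => 0 := by
    filter_upwards [continuous_abs.continuousAt.eventually (lt_mem_nhds hs)] with x hx
    exact hχ.deriv_eq_zero_of_ge hx.le
  rw [this.deriv_eq]; simp

lemma IsCutoff.exists_bound (hχ : IsCutoff χ) : ∃ M, IsCutoffBound χ M := by
  obtain ⟨M₁, h1⟩ := hχ.contDiff_deriv.continuous.bounded_above_of_compact_support
    hχ.hasCompactSupport_deriv
  obtain ⟨M₂, h2⟩ := hχ.contDiff_deriv_deriv.continuous.bounded_above_of_compact_support
    hχ.hasCompactSupport_deriv.deriv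
  exact ⟨max 1 (max M₁ M₂), by simp, fun s => (h1 s).trans (by simp),
    fun s => (h2 s).trans (by simp)⟩

/-! ### Taylor estimates -/

/-- First order Taylor expansion with Lipschitz derivative. -/
lemma abs_sub_sub_le_of_lipschitz {f f' : ℝ → ℝ} {a b K : ℝ}
    (hf : ∀ x ∈ uIcc a b, HasDerivAt f (f' x) x)
    (hK : ∀ x ∈ uIcc a b, |f' x - f' a| ≤ K * |x - a|) (hK0 : 0 ≤ K) :
    |f b - f a - f' a * (b - a)| ≤ K * (b - a) ^ 2 := by
  have h1 : ∀ x ∈ uIcc a b, HasDerivWithinAt (fun x => f x - f' a * x) (f' x - f' a) (uIcc a b) x :=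
    fun x hx => by
      have := ((hf x hx).sub ((hasDerivAt_id x).const_mul (f' a))).hasDerivWithinAt (s := uIcc a b)
      simpa [Pi.sub_def] using this
  have h2 : ∀ x ∈ uIcc a b, ‖f' x - f' a‖ ≤ K * |b - a| := fun x hx =>
    (hK x hx).trans (mul_le_mul_of_nonneg_left (abs_sub_left_of_mem_uIcc hx) hK0)
  have := (convex_uIcc a b).norm_image_sub_le_of_norm_hasDerivWithin_le h1 h2 left_mem_uIcc
    right_mem_uIcc
  rw [norm_eq_abs, norm_eq_abs, mul_assoc, abs_mul_abs_self] at this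
  calc _ = |f b - f' a * b - (f a - f' a * a)| := by congr 1; ring
    _ ≤ _ := this.trans (le_of_eq (by ring))

lemma abs_sub_le_of_deriv {f f' : ℝ → ℝ} {a b K : ℝ}
    (hf : ∀ x ∈ uIcc a b, HasDerivAt f (f' x) x) (hK : ∀ x ∈ uIcc a b, |f' x| ≤ K) :
    |f b - f a| ≤ K * |b - a| :=
  (convex_uIcc a b).norm_image_sub_le_of_norm_hasDerivWithin_le
    (fun x hx => (hf x hx).hasDerivWithinAt) hK left_mem_uIcc right_mem_uIcc

/-! ### Truncated powers -/

/-- `f` is a `C¹` function with the properties of the nonlinearity `|u|^{p-1}u` truncated at height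
`B`, for constants `C` independent of `B` and `L` possibly depending on `B`. -/
structure IsTruncatedPower (p B C L : ℝ) (f f' : ℝ → ℝ) : Prop where
  pos : 0 < C
  nonneg : 0 ≤ L
  zero : f 0 = 0
  hasDerivAt : ∀ u, HasDerivAt f (f' u) u
  continuous_deriv : Continuous f'
  deriv_le : ∀ u, |f' u| ≤ C * |u| ^ (p - 1)
  deriv_bdd : ∀ u, |f' u| ≤ L
  eq : ∀ u ∈ Ioc 0 B, f u = u ^ p
  deriv_eq : ∀ u ∈ Ioc 0 B, f' u = p * u ^ (p - 1)
  taylor : ∀ u, 0 < u → ∀ e, |e| ≤ u / 2 →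
    |f (u + e) - f u - f' u * e| ≤ C * u ^ (p - 2) * e ^ 2

lemma hasDerivAt_nonlin {p : ℝ} (hp : 1 < p) (u : ℝ) :
    HasDerivAt (nonlin p) (p * |u| ^ (p - 1)) u := by
  rcases lt_trichotomy u 0 with hu | rfl | hu
  · have h1 : HasDerivAt (fun u : ℝ => -(-u) ^ p) (p * |u| ^ (p - 1)) u := by
      have := ((hasDerivAt_neg u).rpow_const (p := p) (Or.inl (by linarith))).neg
      rw [abs_of_neg hu]
      convert! this using 1
      ring
    refine h1.congr_of_eventuallyEq ?_
    filter_upwards [Iio_mem_nhds hu] with x hx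
    have hx' : 0 < -x := by simpa using hx
    rw [nonlin, abs_of_neg hx, ← neg_neg ((-x) ^ (p - 1) * x), ← mul_neg]
    nth_rewrite 2 [← rpow_one (-x)]
    rw [← rpow_add hx']
    ring_nf
  · rw [hasDerivAt_iff_tendsto_slope]
    have h0 : Tendsto (fun x : ℝ => |x| ^ (p - 1)) (𝓝[≠] 0) (𝓝 (|0| ^ (p - 1))) := by
      have : Continuous fun x : ℝ => |x| ^ (p - 1) :=
        continuous_abs.rpow_const fun _ => Or.inr (by linarith)
      exact this.continuousAt.tendsto.mono_left nhdsWithin_le_nhds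
    rw [abs_zero, zero_rpow (by linarith), mul_zero]
    rw [abs_zero, zero_rpow (by linarith)] at h0
    refine h0.congr' ?_
    filter_upwards [self_mem_nhdsWithin] with x hx
    have hx' : x ≠ 0 := hx
    simp [slope, nonlin]
    field_simp
  · have h1 : HasDerivAt (fun u : ℝ => u ^ p) (p * |u| ^ (p - 1)) u := by
      rw [abs_of_pos hu]
      exact hasDerivAt_rpow_const (Or.inl hu.ne')
    refine h1.congr_of_eventuallyEq ?_
    filter_upwards [Ioi_mem_nhds hu] with x hx using nonlin_of_pos hx

lemma abs_nonlin {p : ℝ} (u : ℝ) : |nonlin p u| = |u| ^ (p - 1) * |u| := by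
  rw [nonlin, abs_mul, abs_of_nonneg (rpow_nonneg (abs_nonneg u) _)]

/-- The derivative of the truncated nonlinearity. -/
def truncDeriv (p : ℝ) (χ : ℝ → ℝ) (B u : ℝ) : ℝ :=
  p * |u| ^ (p - 1) * χ (u / B) + nonlin p u * (deriv χ (u / B) / B)

lemma abs_mul_deriv_le (hχ : IsCutoff χ) (hM : IsCutoffBound χ M) (s : ℝ) :
    |s| * |deriv χ s| ≤ 2 * M := by
  rcases le_or_gt 2 |s| with h | h
  · rw [hχ.deriv_eq_zero_of_ge h, abs_zero, mul_zero]
    linarith [hM.one_le]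
  · exact mul_le_mul h.le (hM.deriv_le s) (abs_nonneg _) zero_le_two

lemma sq_mul_deriv_deriv_le (hχ : IsCutoff χ) (hM : IsCutoffBound χ M) (s : ℝ) :
    s ^ 2 * |deriv (deriv χ) s| ≤ 4 * M := by
  rcases le_or_gt |s| 2 with h | h
  · have : s ^ 2 ≤ 4 := by rw [← sq_abs]; nlinarith [abs_nonneg s]
    exact mul_le_mul this (hM.deriv_deriv_le s) (abs_nonneg _) (by norm_num)
  · rw [hχ.deriv_deriv_eq_zero h, abs_zero, mul_zero]
    linarith [hM.one_le]

lemma hasDerivAt_truncNonlin {p : ℝ} (hp : 1 < p) (hχ : IsCutoff χ) {B : ℝ} (u : ℝ) :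
    HasDerivAt (truncNonlin p χ B) (truncDeriv p χ B u) u := by
  have h1 : HasDerivAt (fun u => χ (u / B)) (deriv χ (u / B) * (1 / B)) u :=
    (hχ.hasDerivAt (u / B)).comp u ((hasDerivAt_id u).div_const B)
  refine ((hasDerivAt_nonlin hp u).mul h1).congr_deriv ?_
  rw [truncDeriv]; ring

lemma rpow_le_two_rpow_mul {u v q : ℝ} (hu : 0 < u) (h1 : u / 2 ≤ v) (h2 : v ≤ 2 * u) :
    v ^ q ≤ 2 ^ |q| * u ^ q := by
  have hv : 0 < v := by linarith
  have : v ^ q = (v / u) ^ q * u ^ q := by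
    rw [← mul_rpow (by positivity) hu.le, div_mul_cancel₀ _ hu.ne']
  rw [this]
  gcongr
  have hr1 : 1 / 2 ≤ v / u := by rw [le_div_iff₀ hu]; linarith
  have hr2 : v / u ≤ 2 := by rw [div_le_iff₀ hu]; linarith
  rcases le_total 0 q with hq | hq
  · rw [abs_of_nonneg hq]
    exact rpow_le_rpow (by positivity) hr2 hq
  · rw [abs_of_nonpos hq]
    calc (v / u) ^ q ≤ (1 / 2) ^ q := rpow_le_rpow_of_nonpos (by norm_num) hr1 hq
      _ = 2 ^ (-q) := by rw [one_div, Real.inv_rpow (by norm_num), rpow_neg (by norm_num)]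

lemma truncDeriv_lipschitz {p : ℝ} (hp : 1 < p) (hχ : IsCutoff χ) (hM : IsCutoffBound χ M)
    {B : ℝ} (hB : 0 < B) {u v : ℝ} (hu : 0 < u) (h1 : u / 2 ≤ v) (h2 : v ≤ 2 * u) :
    |truncDeriv p χ B v - truncDeriv p χ B u|
      ≤ 2 ^ |p - 2| * (p * (p - 1) + 4 * p * M + 4 * M) * u ^ (p - 2) * |v - u| := by
  set D : ℝ → ℝ := fun x => p * ((p - 1) * x ^ (p - 2)) * χ (x / B)
    + p * x ^ (p - 1) * (deriv χ (x / B) / B)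
    + (p * x ^ (p - 1) * (deriv χ (x / B) / B) + x ^ p * (deriv (deriv χ) (x / B) / B / B)) with hD
  have hpos : ∀ x ∈ uIcc u v, 0 < x ∧ u / 2 ≤ x ∧ x ≤ 2 * u := by
    intro x hx
    rcases le_total u v with h | h
    · rw [uIcc_of_le h] at hx
      exact ⟨by linarith [hx.1], by linarith [hx.1], hx.2.trans h2⟩
    · rw [uIcc_of_ge h] at hx
      exact ⟨by linarith [hx.1], by linarith [hx.1], by linarith [hx.2]⟩
  refine abs_sub_le_of_deriv (f := truncDeriv p χ B) (f' := D) (fun x hx => ?_) fun x hx => ?_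
  · have hx0 := (hpos x hx).1
    have c1 : HasDerivAt (fun u => χ (u / B)) (deriv χ (x / B) / B) x := by
      simpa [div_eq_mul_inv, Function.comp_def] using
        (hχ.hasDerivAt (x / B)).comp x ((hasDerivAt_id x).div_const B)
    have c2 : HasDerivAt (fun u => deriv χ (u / B) / B) (deriv (deriv χ) (x / B) / B / B) x := by
      have := ((hχ.hasDerivAt_deriv (x / B)).comp x ((hasDerivAt_id x).div_const B)).div_const B
      simpa [div_eq_mul_inv, Function.comp_def] using this
    have c3 : HasDerivAt (fun u : ℝ => p * u ^ (p - 1)) (p * ((p - 1) * x ^ (p - 2))) x := by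
      have := (hasDerivAt_rpow_const (x := x) (p := p - 1) (Or.inl hx0.ne')).const_mul p
      rwa [show p - 1 - 1 = p - 2 by ring] at this
    have c4 : HasDerivAt (fun u : ℝ => u ^ p) (p * x ^ (p - 1)) x :=
      hasDerivAt_rpow_const (Or.inl hx0.ne')
    refine ((c3.mul c1).add (c4.mul c2)).congr_of_eventuallyEq ?_
    filter_upwards [Ioi_mem_nhds hx0] with y hy
    have hy' : 0 < y := hy
    simp only [truncDeriv, nonlin_of_pos hy', abs_of_pos hy', Pi.add_apply, Pi.mul_apply]
  · obtain ⟨hx0, hx1, hx2⟩ := hpos x hx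
    have hxp := rpow_le_two_rpow_mul (q := p - 2) hu hx1 hx2
    have hp1 : x ^ (p - 1) = x ^ (p - 2) * x := by
      rw [← rpow_add_one hx0.ne']; ring_nf
    have hp2 : x ^ p = x ^ (p - 2) * x ^ 2 := by
      rw [← rpow_natCast x 2, ← rpow_add hx0]; norm_num
    have hxpos : 0 ≤ x ^ (p - 2) := rpow_nonneg hx0.le _
    have e : D x = x ^ (p - 2) * (p * (p - 1) * χ (x / B) + 2 * p * (x / B * deriv χ (x / B))
        + (x / B) ^ 2 * deriv (deriv χ) (x / B)) := by
      rw [hD]; simp only [hp1, hp2]; field_simp; ring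
    have b1 : |x / B * deriv χ (x / B)| ≤ 2 * M := by
      rw [abs_mul]; exact abs_mul_deriv_le hχ hM _
    have b2 : |(x / B) ^ 2 * deriv (deriv χ) (x / B)| ≤ 4 * M := by
      rw [abs_mul, abs_of_nonneg (sq_nonneg _)]; exact sq_mul_deriv_deriv_le hχ hM _
    have b3 := hχ.mem_Icc' (x / B)
    have b4 : |p * (p - 1) * χ (x / B) + 2 * p * (x / B * deriv χ (x / B))
        + (x / B) ^ 2 * deriv (deriv χ) (x / B)| ≤ p * (p - 1) + 4 * p * M + 4 * M := by
      refine (abs_add_le _ _).trans (add_le_add ((abs_add_le _ _).trans (add_le_add ?_ ?_)) b2)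
      · rw [abs_of_nonneg (mul_nonneg (by nlinarith) b3.1)]
        exact mul_le_of_le_one_right (by nlinarith) b3.2
      · rw [abs_mul, abs_of_nonneg (by linarith : (0 : ℝ) ≤ 2 * p)]
        nlinarith
    rw [e, abs_mul, abs_of_nonneg hxpos]
    calc x ^ (p - 2) * _ ≤ (2 ^ |p - 2| * u ^ (p - 2)) * (p * (p - 1) + 4 * p * M + 4 * M) :=
          mul_le_mul hxp b4 (abs_nonneg _) (by positivity)
      _ = _ := by ring

lemma exists_isTruncatedPower {p : ℝ} (hp : 1 < p) (hχ : IsCutoff χ) :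
    ∃ C, 0 < C ∧ ∀ B, 0 < B → ∃ L, IsTruncatedPower p B C L (truncNonlin p χ B) (truncDeriv p χ B) := by
  obtain ⟨M, hM⟩ := hχ.exists_bound
  have hM1 := hM.one_le
  set C₂ := 2 ^ |p - 2| * (p * (p - 1) + 4 * p * M + 4 * M)
  have hC₂0 : 0 ≤ C₂ := by
    have : 0 ≤ p * (p - 1) := by nlinarith
    positivity
  have hd : ∀ B, 0 < B → ∀ u, |truncDeriv p χ B u| ≤ (p + 2 * M) * |u| ^ (p - 1) := by
    intro B hB u
    have b3 := hχ.mem_Icc' (u / B)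
    rw [truncDeriv]
    refine (abs_add_le _ _).trans ?_
    rw [add_mul]
    refine add_le_add ?_ ?_
    · rw [abs_of_nonneg (mul_nonneg (by positivity) b3.1)]
      exact mul_le_of_le_one_right (by positivity) b3.2
    · have := abs_mul_deriv_le hχ hM (u / B)
      rw [abs_mul, abs_nonlin, abs_div, abs_of_pos hB]
      rw [abs_div, abs_of_pos hB] at this
      calc _ = (|u| / B * |deriv χ (u / B)|) * |u| ^ (p - 1) := by ring
        _ ≤ _ := by gcongr
  refine ⟨p + 2 * M + C₂, by positivity, fun B hB => ⟨(p + 2 * M) * (2 * B) ^ (p - 1), ?_⟩⟩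
  refine ⟨by positivity, by positivity, by simp [truncNonlin, nonlin],
    hasDerivAt_truncNonlin hp hχ, ?_, ?_, ?_, ?_, ?_, ?_⟩
  · have c1 : Continuous fun x : ℝ => |x| ^ (p - 1) :=
      continuous_abs.rpow_const fun _ => Or.inr (by linarith)
    have c2 : Continuous χ := hχ.smooth.continuous
    have c3 : Continuous (deriv χ) := hχ.contDiff_deriv.continuous
    have c4 : Continuous (nonlin p) := c1.mul continuous_id
    unfold truncDeriv
    fun_prop
  · intro u
    exact (hd B hB u).trans (mul_le_mul_of_nonneg_right (by linarith) (by positivity))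
  · intro u
    rcases le_or_gt (2 * B) |u| with h | h
    · have : 2 ≤ |u / B| := by rwa [abs_div, abs_of_pos hB, le_div_iff₀ hB]
      rw [truncDeriv, hχ.eq_zero' this, hχ.deriv_eq_zero_of_ge this]
      simp only [mul_zero, zero_div, add_zero, abs_zero]
      positivity
    · refine (hd B hB u).trans ?_
      gcongr
  · intro u hu
    have : |u / B| ≤ 1 := by
      rw [abs_div, abs_of_pos hB, abs_of_pos hu.1, div_le_one hB]; exact hu.2
    rw [truncNonlin, hχ.eq_one' this, nonlin_of_pos hu.1, mul_one]
  · intro u hu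
    have : |u / B| ≤ 1 := by
      rw [abs_div, abs_of_pos hB, abs_of_pos hu.1, div_le_one hB]; exact hu.2
    rw [truncDeriv, hχ.eq_one' this, hχ.deriv_eq_zero_of_le this, abs_of_pos hu.1]
    simp
  · intro u hu e he
    have key := abs_sub_sub_le_of_lipschitz (f := truncNonlin p χ B) (f' := truncDeriv p χ B)
      (a := u) (b := u + e) (K := C₂ * u ^ (p - 2)) (fun x _ => hasDerivAt_truncNonlin hp hχ x)
      (fun x hx => ?_) (by positivity)
    · rw [add_sub_cancel_left] at key
      refine key.trans ?_
      gcongr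
      exact le_add_of_nonneg_left (by positivity)
    · have hx' := abs_sub_left_of_mem_uIcc hx
      rw [add_sub_cancel_left] at hx'
      have := abs_le.1 (hx'.trans he)
      exact truncDeriv_lipschitz hp hχ hM hB hu (by linarith [this.1, this.2])
        (by linarith [this.1, this.2])

/-! ### The potential of the large values -/

section Potential

variable {p B C L : ℝ} {f f' : ℝ → ℝ}

/-- The Taylor remainder `F(U + e) - F(U) - f(U) e` of the primitive `F` of `f`. -/
def potRem (f : ℝ → ℝ) (U e : ℝ) : ℝ := (∫ s in U..U + e, f s) - f U * e

/-- The Taylor remainder of the primitive of `f`, restricted to values of `e` that are not small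
compared with `U`. -/
def potential (χ f : ℝ → ℝ) (U e : ℝ) : ℝ := (1 - χ (2 * e / U)) * potRem f U e

/-- The derivative of the potential with respect to `e`. -/
def potForce (χ f : ℝ → ℝ) (U e : ℝ) : ℝ :=
  -(deriv χ (2 * e / U) * (2 / U)) * potRem f U e + (1 - χ (2 * e / U)) * (f (U + e) - f U)

/-- The derivative of the potential with respect to `U`. -/
def potBase (χ f f' : ℝ → ℝ) (U e : ℝ) : ℝ :=
  deriv χ (2 * e / U) * (2 * e / U ^ 2) * potRem f U e
    + (1 - χ (2 * e / U)) * (f (U + e) - f U - f' U * e)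

/-- The derivative of `potForce` with respect to `e`. -/
def potForceDeriv (χ f f' : ℝ → ℝ) (U e : ℝ) : ℝ :=
  -(deriv (deriv χ) (2 * e / U) * (2 / U) * (2 / U)) * potRem f U e
    - 2 * (deriv χ (2 * e / U) * (2 / U)) * (f (U + e) - f U) + (1 - χ (2 * e / U)) * f' (U + e)

namespace IsTruncatedPower

lemma continuous (hf : IsTruncatedPower p B C L f f') : Continuous f :=
  continuous_iff_continuousAt.2 fun u => (hf.hasDerivAt u).continuousAt

lemma hasDerivAt_primitive (hf : IsTruncatedPower p B C L f f') (a u : ℝ) :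
    HasDerivAt (fun u => ∫ s in a..u, f s) (f u) u :=
  intervalIntegral.integral_hasDerivAt_right (hf.continuous.intervalIntegrable _ _)
    (hf.continuous.stronglyMeasurableAtFilter _ _) hf.continuous.continuousAt

lemma potRem_eq (hf : IsTruncatedPower p B C L f f') (U e : ℝ) :
    potRem f U e = (∫ s in 0..U + e, f s) - (∫ s in 0..U, f s) - f U * e := by
  rw [potRem, intervalIntegral.integral_interval_sub_left] <;>
    exact hf.continuous.intervalIntegrable _ _

lemma hasDerivAt_potRem (hf : IsTruncatedPower p B C L f f') (U e : ℝ) :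
    HasDerivAt (fun e => potRem f U e) (f (U + e) - f U) e := by
  simp_rw [hf.potRem_eq]
  have h1 : HasDerivAt (fun e => ∫ s in 0..U + e, f s) (f (U + e)) e := by
    simpa using (hf.hasDerivAt_primitive 0 (U + e)).comp_const_add U e
  simpa [Pi.sub_def] using (h1.sub_const _).sub ((hasDerivAt_id e).const_mul (f U))

lemma hasDerivAt_potRem_base (hf : IsTruncatedPower p B C L f f') (U e : ℝ) :
    HasDerivAt (fun U => potRem f U e) (f (U + e) - f U - f' U * e) U := by
  simp_rw [hf.potRem_eq]
  have h1 : HasDerivAt (fun U => ∫ s in 0..U + e, f s) (f (U + e)) U :=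
    (hf.hasDerivAt_primitive 0 (U + e)).comp_add_const U e
  exact (h1.sub (hf.hasDerivAt_primitive 0 U)).sub ((hf.hasDerivAt U).mul_const e)

lemma hasDerivAt_comp_arg {g : ℝ → ℝ} {g' U e : ℝ} (h : HasDerivAt g g' (2 * e / U)) :
    HasDerivAt (fun e => g (2 * e / U)) (g' * (2 / U)) e := by
  simpa [Function.comp_def] using h.comp e (((hasDerivAt_id e).const_mul 2).div_const U)

lemma hasDerivAt_potential (hf : IsTruncatedPower p B C L f f') (hχ : IsCutoff χ) (U e : ℝ) :
    HasDerivAt (fun e => potential χ f U e) (potForce χ f U e) e := by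
  refine (((hasDerivAt_comp_arg (hχ.hasDerivAt _)).const_sub 1).mul (hf.hasDerivAt_potRem U e)).congr_deriv ?_
  rw [potForce]

lemma hasDerivAt_potential_base (hf : IsTruncatedPower p B C L f f') (hχ : IsCutoff χ) {U : ℝ}
    (hU : 0 < U) (e : ℝ) :
    HasDerivAt (fun U => potential χ f U e) (potBase χ f f' U e) U := by
  have h1 : HasDerivAt (fun U => χ (2 * e / U)) (deriv χ (2 * e / U) * (-(2 * e / U ^ 2))) U := by
    have h2 := (hasDerivAt_const U (2 * e)).div (hasDerivAt_id U) hU.ne'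
    have := (hχ.hasDerivAt (2 * e / U)).comp U h2
    refine this.congr_deriv ?_
    simp; ring
  refine ((h1.const_sub 1).mul (hf.hasDerivAt_potRem_base U e)).congr_deriv ?_
  rw [potBase]; ring

lemma hasDerivAt_potForce (hf : IsTruncatedPower p B C L f f') (hχ : IsCutoff χ) (U e : ℝ) :
    HasDerivAt (fun e => potForce χ f U e) (potForceDeriv χ f f' U e) e := by
  have h2 := (hasDerivAt_comp_arg (hχ.hasDerivAt_deriv (2 * e / U))).mul_const (2 / U)
  have h3 : HasDerivAt (fun e => f (U + e) - f U) (f' (U + e)) e := by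
    simpa using ((hf.hasDerivAt (U + e)).comp_const_add U e).sub_const (f U)
  refine ((h2.neg.mul (hf.hasDerivAt_potRem U e)).add
    (((hasDerivAt_comp_arg (hχ.hasDerivAt _)).const_sub 1).mul h3)).congr_deriv ?_
  simp only [Pi.neg_apply, potForceDeriv]
  ring

lemma lipschitz (hf : IsTruncatedPower p B C L f f') (u v : ℝ) : |f v - f u| ≤ L * |v - u| :=
  abs_sub_le_of_deriv (fun x _ => hf.hasDerivAt x) fun x _ => hf.deriv_bdd x

lemma abs_add_sub_le (hf : IsTruncatedPower p B C L f f') (U e : ℝ) :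
    |f (U + e) - f U| ≤ L * |e| := by
  simpa using hf.lipschitz U (U + e)

lemma abs_increment_le (hp : 1 < p) (hf : IsTruncatedPower p B C L f f') {U : ℝ} (hU : 0 < U)
    (e : ℝ) : |f (U + e) - f U| ≤ C * (U + |e|) ^ (p - 1) * |e| := by
  have := abs_sub_le_of_deriv (a := U) (b := U + e) (K := C * (U + |e|) ^ (p - 1))
    (fun x _ => hf.hasDerivAt x) fun x hx => ?_
  · simpa using this
  · refine (hf.deriv_le x).trans ?_
    have hC := hf.pos
    have h1 := abs_sub_left_of_mem_uIcc hx
    rw [add_sub_cancel_left] at h1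
    have h2 : |x| ≤ U + |e| := by
      calc |x| = |U + (x - U)| := by ring_nf
        _ ≤ |U| + |x - U| := abs_add_le _ _
        _ ≤ _ := by rw [abs_of_pos hU]; gcongr
    gcongr

lemma abs_potRem_le_of (hf : IsTruncatedPower p B C L f f') {U e K : ℝ} (hK : 0 ≤ K)
    (h : ∀ x ∈ uIcc U (U + e), |f x - f U| ≤ K * |x - U|) : |potRem f U e| ≤ K * e ^ 2 := by
  have := abs_sub_sub_le_of_lipschitz (a := U) (b := U + e)
    (fun x _ => hf.hasDerivAt_primitive 0 x) h hK
  rw [hf.potRem_eq]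
  simpa using this

lemma abs_potRem_le (hp : 1 < p) (hf : IsTruncatedPower p B C L f f') {U : ℝ} (hU : 0 < U)
    (e : ℝ) : |potRem f U e| ≤ C * (U + |e|) ^ (p - 1) * e ^ 2 := by
  have hC := hf.pos
  refine hf.abs_potRem_le_of (by positivity) fun x hx => ?_
  have h1 := abs_sub_left_of_mem_uIcc hx
  rw [add_sub_cancel_left] at h1
  have := hf.abs_increment_le hp hU (x - U)
  rw [add_sub_cancel] at this
  refine this.trans ?_
  gcongr

lemma abs_potRem_le_lipschitz (hf : IsTruncatedPower p B C L f f') (U e : ℝ) :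
    |potRem f U e| ≤ L * e ^ 2 :=
  hf.abs_potRem_le_of hf.nonneg fun x _ => hf.lipschitz U x

lemma abs_one_sub_cutoff_le (hχ : IsCutoff χ) (s : ℝ) : |1 - χ s| ≤ 1 := by
  have := hχ.mem_Icc' s
  rw [abs_of_nonneg (by linarith [this.2])]
  linarith [this.1]

lemma abs_one_sub_cutoff_mul_le (hχ : IsCutoff χ) {s x b : ℝ} (h : |x| ≤ b) :
    |(1 - χ s) * x| ≤ b := by
  rw [abs_mul]
  exact (mul_le_of_le_one_left (abs_nonneg _) (abs_one_sub_cutoff_le hχ _)).trans h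

lemma abs_arg_le_iff {U : ℝ} (hU : 0 < U) (e c : ℝ) : |2 * e / U| ≤ c ↔ 2 * |e| ≤ c * U := by
  rw [abs_div, abs_of_pos hU, div_le_iff₀ hU, abs_mul, abs_two]

lemma two_lt_abs_arg {U e : ℝ} (hU : 0 < U) (h : U < |e|) : 2 < |2 * e / U| := by
  by_contra hc
  have := (abs_arg_le_iff hU e 2).1 (not_lt.1 hc)
  linarith

lemma large_rpow_le (hp : 1 < p) {U e : ℝ} (hU : 0 < U) (he : U ≤ 2 * |e|) :
    (U + |e|) ^ (p - 1) * e ^ 2 ≤ 3 ^ (p - 1) * |e| ^ (p + 1) := by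
  have he0 : 0 < |e| := by linarith
  have h1 : (U + |e|) ^ (p - 1) ≤ (3 * |e|) ^ (p - 1) :=
    rpow_le_rpow (by positivity) (by linarith) (by linarith)
  rw [mul_rpow (by norm_num) he0.le] at h1
  calc (U + |e|) ^ (p - 1) * e ^ 2 ≤ 3 ^ (p - 1) * |e| ^ (p - 1) * e ^ 2 := by gcongr
    _ = 3 ^ (p - 1) * (|e| ^ (p - 1) * |e| ^ (2 : ℝ)) := by
        rw [rpow_two, sq_abs]; ring
    _ = _ := by rw [← rpow_add he0]; ring_nf

lemma abs_potential_le (hp : 1 < p) (hf : IsTruncatedPower p B C L f f') (hχ : IsCutoff χ) {U : ℝ}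
    (hU : 0 < U) (e : ℝ) : |potential χ f U e| ≤ C * 3 ^ (p - 1) * |e| ^ (p + 1) := by
  have hC := hf.pos
  rw [potential]
  rcases le_total (2 * |e|) U with h | h
  · rw [hχ.eq_one' ((abs_arg_le_iff hU e 1).2 (by linarith)), sub_self, zero_mul, abs_zero]
    positivity
  · refine (abs_one_sub_cutoff_mul_le hχ (hf.abs_potRem_le hp hU e)).trans ?_
    rw [mul_assoc, mul_assoc]
    exact mul_le_mul_of_nonneg_left (large_rpow_le hp hU h) hC.le

lemma abs_potential_le_lipschitz (hf : IsTruncatedPower p B C L f f') (hχ : IsCutoff χ) (U e : ℝ) :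
    |potential χ f U e| ≤ L * e ^ 2 := by
  rw [potential]
  exact abs_one_sub_cutoff_mul_le hχ (hf.abs_potRem_le_lipschitz U e)

/-- `potBase` vanishes unless `U ≤ 2 |e|`, in which case its terms are comparable. -/
lemma abs_potBase_mul_le_of (hχ : IsCutoff χ) (hM : IsCutoffBound χ M) {U : ℝ} (hU : 0 < U)
    {e R : ℝ} (hR : 0 ≤ R) (h : U ≤ 2 * |e| → |potRem f U e| ≤ R ∧ |f (U + e) - f U| * |e| ≤ R ∧
      |f' U| * |e| * |e| ≤ R) : |potBase χ f f' U e * U| ≤ (2 * M + 4) * R := by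
  have hM1 := hM.one_le
  rcases le_total (2 * |e|) U with h' | h'
  · have h1 := (abs_arg_le_iff hU e 1).2 (by linarith)
    rw [potBase, hχ.eq_one' h1, hχ.deriv_eq_zero_of_le h1]
    simp only [sub_self, zero_mul, add_zero, abs_zero]
    positivity
  obtain ⟨h1, h2, h3⟩ := h h'
  have b1 : |2 * e / U * deriv χ (2 * e / U) * potRem f U e| ≤ 2 * M * R := by
    rw [abs_mul, abs_mul]
    exact mul_le_mul (abs_mul_deriv_le hχ hM _) h1 (abs_nonneg _) (by positivity)
  have b2 : |(f (U + e) - f U) * U| ≤ 2 * R := by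
    rw [abs_mul, abs_of_pos hU]
    nlinarith [mul_le_mul_of_nonneg_left h' (abs_nonneg (f (U + e) - f U))]
  have b3 : |f' U * e * U| ≤ 2 * R := by
    rw [abs_mul, abs_mul, abs_of_pos hU]
    nlinarith [mul_le_mul_of_nonneg_left h' (mul_nonneg (abs_nonneg (f' U)) (abs_nonneg e))]
  have e0 : potBase χ f f' U e * U = 2 * e / U * deriv χ (2 * e / U) * potRem f U e
      + (1 - χ (2 * e / U)) * ((f (U + e) - f U) * U - f' U * e * U) := by
    rw [potBase]; field_simp
  rw [e0]
  exact (abs_add_le _ _).trans ((add_le_add b1 (abs_one_sub_cutoff_mul_le hχ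
    ((abs_sub _ _).trans (add_le_add b2 b3)))).trans_eq (by ring))

lemma abs_potBase_mul_le (hp : 1 < p) (hf : IsTruncatedPower p B C L f f') (hχ : IsCutoff χ)
    (hM : IsCutoffBound χ M) {U : ℝ} (hU : 0 < U) (e : ℝ) :
    |potBase χ f f' U e * U| ≤ (2 * M + 4) * C * 3 ^ (p - 1) * |e| ^ (p + 1) := by
  have hC := hf.pos
  refine (abs_potBase_mul_le_of hχ hM hU (R := C * (3 ^ (p - 1) * |e| ^ (p + 1))) (by positivity)
    fun h => ?_).trans_eq (by ring)
  have hl : C * (U + |e|) ^ (p - 1) * e ^ 2 ≤ C * (3 ^ (p - 1) * |e| ^ (p + 1)) := by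
    rw [mul_assoc]; exact mul_le_mul_of_nonneg_left (large_rpow_le hp hU h) hC.le
  have h2 : |f' U| ≤ C * (U + |e|) ^ (p - 1) := by
    refine (hf.deriv_le U).trans ?_
    rw [abs_of_pos hU]
    gcongr
    linarith [abs_nonneg e]
  have h1 := (hf.abs_potRem_le hp hU e).trans hl
  rw [← sq_abs, sq, ← mul_assoc] at hl
  exact ⟨h1, (mul_le_mul_of_nonneg_right (hf.abs_increment_le hp hU e) (abs_nonneg _)).trans hl,
    le_trans (by gcongr) hl⟩

lemma abs_potBase_mul_le_lipschitz (hf : IsTruncatedPower p B C L f f') (hχ : IsCutoff χ)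
    (hM : IsCutoffBound χ M) {U : ℝ} (hU : 0 < U) (e : ℝ) :
    |potBase χ f f' U e * U| ≤ (2 * M + 4) * L * e ^ 2 := by
  have hL := hf.nonneg
  refine (abs_potBase_mul_le_of hχ hM hU (R := L * e ^ 2) (by positivity)
    fun _ => ⟨hf.abs_potRem_le_lipschitz U e, ?_⟩).trans_eq (by ring)
  rw [← sq_abs, sq, ← mul_assoc]
  exact ⟨mul_le_mul_of_nonneg_right (hf.abs_add_sub_le U e) (abs_nonneg _),
    by gcongr; exact hf.deriv_bdd U⟩

lemma abs_deriv_mul_potRem_le (hχ : IsCutoff χ)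
    (hM : IsCutoffBound χ M) {U : ℝ} (hU : 0 < U) (e : ℝ) {K : ℝ} (hK : 0 ≤ K)
    (h : |e| ≤ U → |potRem f U e| ≤ K * e ^ 2) :
    |deriv χ (2 * e / U) * (2 / U) * potRem f U e| ≤ 2 * M * K * |e| := by
  have hM1 := hM.one_le
  rcases le_or_gt |e| U with h1 | h1
  · rw [abs_mul, abs_mul, abs_of_pos (by positivity : 0 < 2 / U)]
    calc _ ≤ M * (2 / U) * (K * e ^ 2) := by
          gcongr
          · exact hM.deriv_le _
          · exact h h1
      _ = 2 * M * K * |e| * (|e| / U) := by rw [← sq_abs]; ring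
      _ ≤ _ := mul_le_of_le_one_right (by positivity) (by rwa [div_le_one hU])
  · rw [hχ.deriv_eq_zero_of_ge (two_lt_abs_arg hU h1).le]
    simp only [zero_mul, abs_zero]
    positivity

lemma abs_potForce_le_lipschitz (hf : IsTruncatedPower p B C L f f') (hχ : IsCutoff χ)
    (hM : IsCutoffBound χ M) {U : ℝ} (hU : 0 < U) (e : ℝ) :
    |potForce χ f U e| ≤ (2 * M + 1) * L * |e| := by
  have b1 := abs_deriv_mul_potRem_le hχ hM hU e hf.nonneg fun _ => hf.abs_potRem_le_lipschitz U e
  rw [potForce]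
  calc _ ≤ |-(deriv χ (2 * e / U) * (2 / U)) * potRem f U e|
        + |(1 - χ (2 * e / U)) * (f (U + e) - f U)| := abs_add_le _ _
    _ ≤ 2 * M * L * |e| + L * |e| := by
        exact add_le_add (by rwa [neg_mul, abs_neg])
          (abs_one_sub_cutoff_mul_le hχ (hf.abs_add_sub_le U e))
    _ = _ := by ring

lemma abs_potForceDeriv_le (hf : IsTruncatedPower p B C L f f') (hχ : IsCutoff χ)
    (hM : IsCutoffBound χ M) {U : ℝ} (hU : 0 < U) (e : ℝ) :
    |potForceDeriv χ f f' U e| ≤ (8 * M + 1) * L := by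
  have hL := hf.nonneg
  have hM1 := hM.one_le
  have b2 := hf.abs_add_sub_le U e
  have b3 : |(1 - χ (2 * e / U)) * f' (U + e)| ≤ L :=
    abs_one_sub_cutoff_mul_le hχ (hf.deriv_bdd _)
  rcases le_or_gt |e| U with h1 | h1
  · have hq : |e| / U ≤ 1 := by rwa [div_le_one hU]
    have hq0 : 0 ≤ |e| / U := by positivity
    have c1 : |-(deriv (deriv χ) (2 * e / U) * (2 / U) * (2 / U)) * potRem f U e| ≤ 4 * M * L := by
      rw [abs_mul, abs_neg, abs_mul, abs_mul, abs_of_pos (by positivity : 0 < 2 / U)]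
      calc _ ≤ M * (2 / U) * (2 / U) * (L * e ^ 2) := by
            gcongr
            · exact hM.deriv_deriv_le _
            · exact hf.abs_potRem_le_lipschitz U e
        _ = 4 * M * L * (|e| / U) ^ 2 := by rw [← sq_abs]; ring
        _ ≤ _ := mul_le_of_le_one_right (by positivity) (pow_le_one₀ hq0 hq)
    have c2 : |2 * (deriv χ (2 * e / U) * (2 / U)) * (f (U + e) - f U)| ≤ 4 * M * L := by
      rw [abs_mul, abs_mul, abs_mul, abs_of_pos (by positivity : 0 < 2 / U), abs_two]
      calc _ ≤ 2 * (M * (2 / U)) * (L * |e|) := by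
            gcongr
            exact hM.deriv_le _
        _ = 4 * M * L * (|e| / U) := by ring
        _ ≤ _ := mul_le_of_le_one_right (by positivity) hq
    rw [potForceDeriv]
    calc _ ≤ (4 * M * L + 4 * M * L) + L :=
          (abs_add_le _ _).trans (add_le_add ((abs_sub _ _).trans (add_le_add c1 c2)) b3)
      _ = _ := by ring
  · have h2 := two_lt_abs_arg hU h1
    rw [potForceDeriv, hχ.deriv_eq_zero_of_ge h2.le, hχ.deriv_deriv_eq_zero h2]
    simp only [zero_mul, neg_zero, mul_zero, sub_self, zero_add]
    refine b3.trans ?_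
    nlinarith

lemma abs_potential_taylor_le (hf : IsTruncatedPower p B C L f f') (hχ : IsCutoff χ)
    (hM : IsCutoffBound χ M) {U : ℝ} (hU : 0 < U) (e e' : ℝ) :
    |potential χ f U e' - potential χ f U e - potForce χ f U e * (e' - e)|
      ≤ (8 * M + 1) * L * (e' - e) ^ 2 := by
  have hL := hf.nonneg
  have hM1 := hM.one_le
  exact abs_sub_sub_le_of_lipschitz (fun x _ => hf.hasDerivAt_potential hχ U x)
    (fun x _ => abs_sub_le_of_deriv (fun y _ => hf.hasDerivAt_potForce hχ U y)
      fun y _ => hf.abs_potForceDeriv_le hχ hM hU y) (by positivity)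

/-- After subtraction of the linear part and of the force of the potential, the nonlinearity is
subcritical. -/
lemma abs_sub_potForce_le (hp : 1 < p) (hf : IsTruncatedPower p B C L f f') (hχ : IsCutoff χ)
    (hM : IsCutoffBound χ M) {U : ℝ} (hU : 0 < U) {s : ℝ} (hs0 : 0 ≤ s) (hs1 : s ≤ 1) (e : ℝ) :
    |f (U + e) - f U - f' U * e - potForce χ f U e|
      ≤ 2 * (2 * M + 2) * 2 ^ (p - 1) * C * (U ^ (p - 1 - s) * |e| ^ (1 + s)) := by
  have hC := hf.pos
  have hM1 := hM.one_le
  have h2p : (1 : ℝ) ≤ 2 ^ (p - 1) := Real.one_le_rpow (by norm_num) (by linarith)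
  rcases eq_or_ne e 0 with rfl | he
  · have h1 : |2 * (0 : ℝ) / U| ≤ 1 := by simp
    rw [potForce, hχ.deriv_eq_zero_of_le h1]
    simp only [add_zero, sub_self, mul_zero, zero_mul, neg_zero, abs_zero]
    positivity
  have he0 : 0 < |e| := abs_pos.2 he
  rcases le_total (2 * |e|) U with h | h
  · have h1 := (abs_arg_le_iff hU e 1).2 (by linarith)
    have h0 : potForce χ f U e = 0 := by
      rw [potForce, hχ.eq_one' h1, hχ.deriv_eq_zero_of_le h1]; ring
    rw [h0, sub_zero]
    have h2 : e ^ 2 = |e| ^ (1 - s) * |e| ^ (1 + s) := by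
      rw [← rpow_add he0, ← sq_abs, ← rpow_natCast]; norm_num
    have h3 : |e| ^ (1 - s) ≤ U ^ (1 - s) :=
      rpow_le_rpow he0.le (by linarith) (by linarith)
    have h4 : U ^ (p - 2) * U ^ (1 - s) = U ^ (p - 1 - s) := by
      rw [← rpow_add hU]; ring_nf
    have h5 : (1 : ℝ) ≤ 2 * (2 * M + 2) * 2 ^ (p - 1) := by nlinarith
    calc _ ≤ C * U ^ (p - 2) * e ^ 2 := hf.taylor U hU e (by linarith)
      _ = C * (U ^ (p - 2) * |e| ^ (1 - s) * |e| ^ (1 + s)) := by rw [h2]; ring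
      _ ≤ C * (U ^ (p - 2) * U ^ (1 - s) * |e| ^ (1 + s)) := by gcongr
      _ = 1 * C * (U ^ (p - 1 - s) * |e| ^ (1 + s)) := by rw [h4]; ring
      _ ≤ _ := by gcongr
  · have hbig : ∀ _ : |e| ≤ U, (U + |e|) ^ (p - 1) ≤ 2 ^ (p - 1) * U ^ (p - 1) := fun h1 => by
      rw [← mul_rpow (by norm_num) hU.le]
      exact rpow_le_rpow (by positivity) (by linarith) (by linarith)
    have b1 : |deriv χ (2 * e / U) * (2 / U) * potRem f U e|
        ≤ 2 * M * (C * (2 ^ (p - 1) * U ^ (p - 1))) * |e| :=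
      abs_deriv_mul_potRem_le hχ hM hU e (by positivity) fun h1 =>
        (hf.abs_potRem_le hp hU e).trans (by gcongr; exact hbig h1)
    have b2 : |χ (2 * e / U) * (f (U + e) - f U)| ≤ C * (2 ^ (p - 1) * U ^ (p - 1)) * |e| := by
      rcases le_or_gt |e| U with h1 | h1
      · have hm := hχ.mem_Icc' (2 * e / U)
        rw [abs_mul, abs_of_nonneg hm.1]
        refine (mul_le_of_le_one_left (abs_nonneg _) hm.2).trans
          ((hf.abs_increment_le hp hU e).trans ?_)
        gcongr
        exact hbig h1
      · rw [hχ.eq_zero' (two_lt_abs_arg hU h1).le, zero_mul, abs_zero]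
        positivity
    have b3 : |f' U * e| ≤ C * (2 ^ (p - 1) * U ^ (p - 1)) * |e| := by
      rw [abs_mul]
      gcongr
      refine (hf.deriv_le U).trans ?_
      rw [abs_of_pos hU]
      gcongr
      exact le_mul_of_one_le_left (by positivity) h2p
    have e0 : f (U + e) - f U - f' U * e - potForce χ f U e
        = χ (2 * e / U) * (f (U + e) - f U) - f' U * e
          + deriv χ (2 * e / U) * (2 / U) * potRem f U e := by
      rw [potForce]; ring
    have h6 : U ^ (p - 1) * |e| ≤ 2 * (U ^ (p - 1 - s) * |e| ^ (1 + s)) := by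
      have a1 : U ^ (p - 1) = U ^ (p - 1 - s) * U ^ s := by
        rw [← rpow_add hU]; ring_nf
      have a2 : U ^ s ≤ 2 * |e| ^ s := by
        calc U ^ s ≤ (2 * |e|) ^ s := rpow_le_rpow hU.le h hs0
          _ = 2 ^ s * |e| ^ s := mul_rpow (by norm_num) he0.le
          _ ≤ 2 ^ (1 : ℝ) * |e| ^ s := by gcongr; norm_num
          _ = _ := by rw [rpow_one]
      have a3 : |e| ^ (1 + s) = |e| * |e| ^ s := by rw [rpow_add he0, rpow_one]
      rw [a1, a3]
      calc U ^ (p - 1 - s) * U ^ s * |e| ≤ U ^ (p - 1 - s) * (2 * |e| ^ s) * |e| := by gcongr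
        _ = _ := by ring
    rw [e0]
    calc _ ≤ (C * (2 ^ (p - 1) * U ^ (p - 1)) * |e| + C * (2 ^ (p - 1) * U ^ (p - 1)) * |e|)
          + 2 * M * (C * (2 ^ (p - 1) * U ^ (p - 1))) * |e| :=
          (abs_add_le _ _).trans (add_le_add ((abs_sub _ _).trans (add_le_add b2 b3)) b1)
      _ = (2 * M + 2) * 2 ^ (p - 1) * C * (U ^ (p - 1) * |e|) := by ring
      _ ≤ (2 * M + 2) * 2 ^ (p - 1) * C * (2 * (U ^ (p - 1 - s) * |e| ^ (1 + s))) := by gcongr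
      _ = _ := by ring

end IsTruncatedPower

end Potential

end Nonlinearity

/-! ### The density of the energy inequality -/

section Density

/-- The weight `1 + d^(-2θ)`, `θ = (p+1)/(p-1)`, of the energy functional, as a function of
`d = t + A(x)`. -/
def weight (p d : ℝ) : ℝ := 1 + d ^ (-(2 * (expo p + 1)))

/-- The derivative of the weight. -/
def weightDeriv (p d : ℝ) : ℝ := -(2 * (expo p + 1)) * d ^ (-(2 * (expo p + 1)) - 1)

/-- The potential `f'(U₀) = θ (θ + 1) / d²` of the linearized equation. -/
def linPot (p d : ℝ) : ℝ := (expo p + 1) * (expo p + 2) / d ^ 2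

/-- The derivative of the linear potential. -/
def linPotDeriv (p d : ℝ) : ℝ := -(2 * ((expo p + 1) * (expo p + 2))) / d ^ 3

variable {p d : ℝ}

lemma one_le_weight (hd : 0 < d) : 1 ≤ weight p d := by
  have : 0 ≤ d ^ (-(2 * (expo p + 1))) := by positivity
  unfold weight; linarith

lemma weight_pos (hd : 0 < d) : 0 < weight p d :=
  zero_lt_one.trans_le (one_le_weight hd)

lemma linPot_pos (hp : 1 < p) (hd : 0 < d) : 0 < linPot p d := by
  have := expo_pos hp
  unfold linPot; positivity

lemma hasDerivAt_weight (hd : 0 < d) :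
    HasDerivAt (weight p) (weightDeriv p d) d :=
  (hasDerivAt_rpow_const (Or.inl hd.ne')).const_add 1

lemma hasDerivAt_linPot (hd : 0 < d) : HasDerivAt (linPot p) (linPotDeriv p d) d := by
  have h1 : HasDerivAt (fun d : ℝ => d ^ 2) (2 * d) d := by simpa using hasDerivAt_pow 2 d
  refine ((hasDerivAt_const d ((expo p + 1) * (expo p + 2))).div h1 (by positivity)).congr_deriv ?_
  rw [linPotDeriv]
  field_simp
  ring

lemma weightDeriv_eq (hd : 0 < d) :
    weightDeriv p d = -(2 * (expo p + 1)) * (d ^ (-(2 * (expo p + 1))) * d⁻¹) := by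
  rw [weightDeriv, Real.rpow_sub_one hd.ne', div_eq_mul_inv]

lemma rpow_le_weight : d ^ (-(2 * (expo p + 1))) ≤ weight p d := by
  unfold weight; linarith

lemma abs_weightDeriv_le (hp : 1 < p) (hd : 0 < d) :
    |weightDeriv p d| ≤ 2 * (expo p + 1) * (d⁻¹ * weight p d) := by
  have := expo_pos hp
  rw [weightDeriv_eq hd, abs_mul, abs_neg, abs_of_pos (by positivity), abs_of_pos (by positivity)]
  rw [mul_comm (d ^ _)]
  gcongr
  exact rpow_le_weight

/-- Powers of the weight dominate powers of `1/d`. -/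
lemma inv_rpow_le_weight_rpow (hp : 1 < p) (hd : 0 < d) {a b : ℝ} (ha : 0 ≤ a) (hb : 0 ≤ b)
    (hab : a ≤ 2 * (expo p + 1) * b) : d ^ (-a) ≤ weight p d ^ b := by
  have := expo_pos hp
  rcases le_total 1 d with h | h
  · exact (rpow_le_one_of_one_le_of_nonpos h (by linarith)).trans
      (Real.one_le_rpow (one_le_weight hd) hb)
  · calc d ^ (-a) ≤ d ^ (-(2 * (expo p + 1)) * b) :=
          rpow_le_rpow_of_exponent_ge hd h (by linarith)
      _ = (d ^ (-(2 * (expo p + 1)))) ^ b := rpow_mul hd.le _ _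
      _ ≤ _ := rpow_le_rpow (by positivity) rpow_le_weight hb

lemma inv_sq_le_weight (hp : 1 < p) (hd : 0 < d) : (d ^ 2)⁻¹ ≤ weight p d := by
  have := expo_pos hp
  have := inv_rpow_le_weight_rpow hp hd (a := 2) (b := 1) two_pos.le zero_le_one (by linarith)
  rwa [rpow_one, rpow_neg hd.le, rpow_two] at this

/-- The contribution of the quadratic terms. For the singular part of the weight these add up to
minus a square, because `linPot = θ (θ + 1) / d²` and the weight has exponent `-2θ`. -/
lemma quadratic_density_le (hp : 1 < p) (hd : 0 < d) (e v : ℝ) :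
    weightDeriv p d * v ^ 2 / 2 + weight p d * v * (linPot p d * e)
      + (weightDeriv p d * (linPot p d + 1) + weight p d * linPotDeriv p d) / 2 * e ^ 2
      + weight p d * (linPot p d + 1) * e * v
    ≤ ((expo p + 1) * (expo p + 2) + 1) *
      (weight p d * (v ^ 2 + (linPot p d + 1) * e ^ 2)) := by
  have hm := expo_pos hp
  have hV := linPot_pos hp hd
  set m := expo p
  set X := d ^ (-(2 * (m + 1)))
  set r := d⁻¹ with hr
  have hW : weight p d = 1 + X := rfl
  have hWd : weightDeriv p d = -(2 * (m + 1)) * (X * r) := weightDeriv_eq hd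
  have hVr : linPot p d = (m + 1) * (m + 2) * r ^ 2 := by
    rw [linPot, hr, inv_pow, div_eq_mul_inv]
  have hVd : linPotDeriv p d = -(2 * ((m + 1) * (m + 2))) * r ^ 3 := by
    rw [linPotDeriv, hr, inv_pow, div_eq_mul_inv]
  have h2 : r ^ 2 ≤ 1 + X := by rw [hr, inv_pow]; exact inv_sq_le_weight hp hd
  have h3 : linPot p d ≤ (m + 1) * (m + 2) * (1 + X) := by rw [hVr]; gcongr
  have e1 : weightDeriv p d * v ^ 2 / 2 + weight p d * v * (linPot p d * e)
      + (weightDeriv p d * (linPot p d + 1) + weight p d * linPotDeriv p d) / 2 * e ^ 2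
      + weight p d * (linPot p d + 1) * e * v
      = -((m + 1) * X * r * (v - (m + 2) * r * e) ^ 2) + 2 * linPot p d * (e * v)
        - (m + 1) * (m + 2) * r ^ 3 * e ^ 2 + (1 + X) * (e * v) - (m + 1) * X * r * e ^ 2 := by
    rw [hW, hWd, hVd, hVr]; ring
  have h4 : e * v ≤ |e * v| := le_abs_self _
  have h5 : 2 * |e * v| ≤ v ^ 2 + e ^ 2 := by
    rw [abs_mul]; nlinarith [sq_nonneg (|e| - |v|), sq_abs e, sq_abs v]
  have h6 : 2 * linPot p d * (e * v) ≤ (m + 1) * (m + 2) * (1 + X) * (v ^ 2 + e ^ 2) := by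
    calc 2 * linPot p d * (e * v) ≤ 2 * linPot p d * |e * v| := by gcongr
      _ = linPot p d * (2 * |e * v|) := by ring
      _ ≤ _ := mul_le_mul h3 h5 (by positivity) (by positivity)
  have h7 : (1 + X) * (e * v) ≤ (1 + X) * (v ^ 2 + e ^ 2) := by
    refine mul_le_mul_of_nonneg_left ?_ (by positivity)
    linarith [abs_nonneg (e * v)]
  have h8 : 0 ≤ (m + 1) * X * r * (v - (m + 2) * r * e) ^ 2 := by positivity
  have h9 : 0 ≤ (m + 1) * (m + 2) * r ^ 3 * e ^ 2 := by positivity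
  have h10 : 0 ≤ (m + 1) * X * r * e ^ 2 := by positivity
  have h11 : (1 + X) * (v ^ 2 + e ^ 2) ≤ (1 + X) * (v ^ 2 + (linPot p d + 1) * e ^ 2) := by
    gcongr
    nlinarith [mul_nonneg hV.le (sq_nonneg e)]
  have h12 : 0 ≤ (m + 1) * (m + 2) + 1 := by positivity
  have h13 := mul_le_mul_of_nonneg_left h11 h12
  rw [e1, hW]
  linarith

/-- The exponent `s` for which the subcritical part of the nonlinearity is estimated by
`U₀^(p-1-s) |e|^(1+s)`. -/
def subExponent (p : ℝ) : ℝ := min 1 ((p - 1) / 2)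

/-- The gain in powers of `t` in the estimate of the subcritical part of the nonlinearity. -/
def subGain (p : ℝ) : ℝ := min (subExponent p * (2 * expo p + 1) - 1) 1

lemma subExponent_pos (hp : 1 < p) : 0 < subExponent p := lt_min one_pos (by linarith)

lemma subExponent_le_one : subExponent p ≤ 1 := min_le_left _ _

lemma subExponent_le : subExponent p ≤ (p - 1) / 2 := min_le_right _ _

lemma subGain_le_one : subGain p ≤ 1 := min_le_right _ _

lemma subGain_le : subGain p ≤ subExponent p * (2 * expo p + 1) - 1 := min_le_left _ _

lemma subGain_pos (hp : 1 < p) : 0 < subGain p := by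
  have h1 := expo_pos hp
  have h2 := expo_mul hp
  refine lt_min ?_ one_pos
  rcases min_cases 1 ((p - 1) / 2) with ⟨h, _⟩ | ⟨h, _⟩ <;> rw [subExponent, h] <;> nlinarith

/-- The weighted square of the subcritical part of the nonlinearity. -/
lemma subcritical_sq_le (hp : 1 < p) {t : ℝ} (ht : 0 < t) (ht1 : t ≤ 1) (htd : t ≤ d) (e : ℝ) :
    weight p d * (d ^ (-2 + expo p * subExponent p) * |e| ^ (1 + subExponent p)) ^ 2
      ≤ t ^ (-2 + 2 * subGain p) *
        (weight p d * e ^ 2 + (weight p d ^ (1 / 2 : ℝ) * |e|) ^ (p + 1)) := by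
  have hd : 0 < d := ht.trans_le htd
  have hW := weight_pos (p := p) hd
  have hs := subExponent_pos hp
  have hs2 := subExponent_le (p := p)
  have hm := expo_pos hp
  have hmp := expo_mul hp
  have hg := subGain_le (p := p)
  have hg1 := subGain_le_one (p := p)
  set s := subExponent p
  set m := expo p
  set W := weight p d
  set z := W ^ (1 / 2 : ℝ) * |e| with hz
  have hz0 : 0 ≤ z := by positivity
  have hz2 : W * e ^ 2 = z ^ 2 := by
    rw [hz, mul_pow, ← rpow_natCast (W ^ (1 / 2 : ℝ)), ← rpow_mul hW.le, sq_abs]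
    norm_num
  have e1 : W * (d ^ (-2 + m * s) * |e| ^ (1 + s)) ^ 2
      = d ^ (-4 + 2 * (m * s)) * W ^ (-s) * z ^ (2 + 2 * s) := by
    rw [hz, mul_rpow (by positivity) (abs_nonneg e), ← rpow_mul hW.le, mul_pow,
      ← rpow_natCast (d ^ _), ← rpow_mul hd.le, ← rpow_natCast (|e| ^ _),
      ← rpow_mul (abs_nonneg e)]
    have : W = W ^ (-s) * W ^ (1 / 2 * (2 + 2 * s)) := by
      rw [← rpow_add hW]; ring_nf; rw [rpow_one]
    nth_rewrite 1 [this]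
    push_cast
    ring_nf
  have h1 : z ^ (2 + 2 * s) ≤ z ^ 2 + z ^ (p + 1) := by
    rcases le_total z 1 with h | h
    · rcases hz0.eq_or_lt with h0 | h0
      · rw [← h0, zero_rpow (by linarith), zero_rpow (by linarith)]; norm_num
      · have := rpow_le_rpow_of_exponent_ge h0 h (by linarith : (2 : ℝ) ≤ 2 + 2 * s)
        rw [rpow_two] at this
        have h3 : 0 ≤ z ^ (p + 1) := by positivity
        linarith
    · have := Real.rpow_le_rpow_of_exponent_le h (by linarith : 2 + 2 * s ≤ p + 1)
      have h3 : 0 ≤ z ^ 2 := by positivity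
      linarith
  have h2 : d ^ (-4 + 2 * (m * s)) * W ^ (-s) ≤ t ^ (-2 + 2 * subGain p) := by
    rcases le_total 1 d with h | h
    · have a1 : d ^ (-4 + 2 * (m * s)) ≤ 1 :=
        rpow_le_one_of_one_le_of_nonpos h (by nlinarith)
      have a2 : W ^ (-s) ≤ 1 :=
        rpow_le_one_of_one_le_of_nonpos (one_le_weight hd) (by linarith)
      have a3 : 1 ≤ t ^ (-2 + 2 * subGain p) :=
        Real.one_le_rpow_of_pos_of_le_one_of_nonpos ht ht1 (by linarith)
      exact (mul_le_one₀ a1 (by positivity) a2).trans a3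
    · have a2 : W ^ (-s) ≤ d ^ (2 * (m + 1) * s) := by
        have := inv_rpow_le_weight_rpow hp hd (a := 2 * (m + 1) * s) (b := s) (by positivity)
          hs.le le_rfl
        rw [rpow_neg hW.le]
        rw [rpow_neg hd.le] at this
        exact inv_le_of_inv_le₀ (by positivity) this
      calc d ^ (-4 + 2 * (m * s)) * W ^ (-s) ≤ d ^ (-4 + 2 * (m * s)) * d ^ (2 * (m + 1) * s) := by
            gcongr
        _ = d ^ (-4 + 2 * (s * (2 * m + 1))) := by rw [← rpow_add hd]; ring_nf
        _ ≤ d ^ (-2 + 2 * subGain p) := rpow_le_rpow_of_exponent_ge hd h (by linarith)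
        _ ≤ _ := rpow_le_rpow_of_nonpos ht htd (by linarith)
  rw [e1, hz2]
  exact mul_le_mul h2 h1 (by positivity) (by positivity)

lemma inv_mul_weight_le (hp : 1 < p) (hd : 0 < d) (e : ℝ) :
    d⁻¹ * weight p d * |e| ^ (p + 1)
      ≤ (weight p d ^ (1 / 2 : ℝ) * |e|) ^ (p + 1) := by
  have hW := weight_pos (p := p) hd
  have h1 := inv_rpow_le_weight_rpow hp hd (a := 1) (b := (p - 1) / 2) zero_le_one
    (by linarith) (by nlinarith [expo_mul hp])
  rw [Real.rpow_neg_one] at h1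
  rw [mul_rpow (by positivity) (abs_nonneg e), ← rpow_mul hW.le]
  have : weight p d ^ (1 / 2 * (p + 1))
      = weight p d ^ ((p - 1) / 2) * weight p d := by
    rw [← rpow_add_one hW.ne']; ring_nf
  rw [this]
  gcongr

lemma rpow_le_weight_rpow_mul (hd : 0 < d) (hp : 1 < p) (e : ℝ) :
    weight p d * |e| ^ (p + 1) ≤ (weight p d ^ (1 / 2 : ℝ) * |e|) ^ (p + 1) := by
  have hW := weight_pos (p := p) hd
  rw [mul_rpow (by positivity) (abs_nonneg e), ← rpow_mul hW.le]
  gcongr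
  nth_rewrite 1 [← rpow_one (weight p d)]
  exact Real.rpow_le_rpow_of_exponent_le (one_le_weight hd) (by linarith)

lemma two_mul_weighted_le {W ρ : ℝ} (hW : 0 ≤ W) (hρ : 0 < ρ) (v S : ℝ) :
    2 * (W * |v| * S) ≤ ρ * (W * v ^ 2) + ρ⁻¹ * (W * S ^ 2) := by
  have h1 : 0 ≤ W * ρ⁻¹ * (ρ * |v| - S) ^ 2 := by positivity
  have h2 : W * ρ⁻¹ * (ρ * |v| - S) ^ 2
      = ρ * (W * v ^ 2) + ρ⁻¹ * (W * S ^ 2) - 2 * (W * |v| * S) := by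
    rw [← sq_abs v]; field_simp; ring
  linarith

set_option maxHeartbeats 1000000 in
/-- The estimate of the density of the time derivative of the modified energy. -/
lemma energy_density_le (hp : 1 < p) {δ η μ C₀ : ℝ} (hδ : 0 < δ) (hη0 : 0 < η) (hη : η ≤ 1 - δ)
    (hη' : η ≤ subGain p) (hC₀ : 0 ≤ C₀) : ∃ C, 0 < C ∧ ∀ t d e v G c h ψ q E K : ℝ, 0 < t → t ≤ 1 →
      t ≤ d → 0 < K → 0 ≤ G → |c| ≤ C₀ * (d ^ (-δ) * weight p d) * (|v| * G) →
      |q| ≤ C₀ * (d⁻¹ * weight p d * |e| ^ (p + 1)) →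
      |h - linPot p d * e - ψ| ≤ C₀ * (d⁻¹ * |e|)
        + C₀ * (d ^ (-2 + expo p * subExponent p) * |e| ^ (1 + subExponent p)) + |E| →
      (weightDeriv p d * v ^ 2 + weightDeriv p d * G ^ 2) / 2 - c
        + weight p d * (v * h)
        + ((weightDeriv p d * (linPot p d + 1) + weight p d * linPotDeriv p d) / 2
          * e ^ 2 - q) + (weight p d * (linPot p d + 1) * e - weight p d * ψ) * v
      ≤ C * (t ^ (-1 + η) + K * t ^ (-1 + μ)) *
          (weight p d * (v ^ 2 + G ^ 2 + (linPot p d + 1) * e ^ 2))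
        + C * t ^ (-1 + η) * (weight p d ^ (1 / 2 : ℝ) * |e|) ^ (p + 1)
        + K⁻¹ * t ^ (1 - μ) * (weight p d * E ^ 2) := by
  have hm := expo_pos hp
  set m := expo p
  refine ⟨((m + 1) * (m + 2) + 1) + C₀ + C₀ + C₀ + 1, by positivity, ?_⟩
  intro t d e v G c h ψ q E K ht ht1 htd hK hG hc hq hh
  have hd : 0 < d := ht.trans_le htd
  have hW := weight_pos (p := p) hd
  have hV := linPot_pos hp hd
  have hquad := quadratic_density_le hp hd e v
  have hsub := subcritical_sq_le hp ht ht1 htd e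
  have hinv := inv_mul_weight_le hp hd e
  have hWd : weightDeriv p d ≤ 0 := by
    rw [weightDeriv]
    have : 0 ≤ d ^ (-(2 * (expo p + 1)) - 1) := by positivity
    nlinarith
  have hVd2 : (d⁻¹ * |e|) ^ 2 ≤ linPot p d * e ^ 2 := by
    rw [mul_pow, sq_abs, inv_pow, linPot, div_eq_mul_inv]
    gcongr
    exact le_mul_of_one_le_left (by positivity) (by nlinarith)
  set W := weight p d
  set V := linPot p d
  set Wd := weightDeriv p d
  set S := d ^ (-2 + m * subExponent p) * |e| ^ (1 + subExponent p)
  set Z := (W ^ (1 / 2 : ℝ) * |e|) ^ (p + 1)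
  have hZ0 : 0 ≤ Z := by positivity
  set r := t ^ (-1 + η) with hr
  have hr0 : 0 < r := by positivity
  have hr1 : 1 ≤ r := Real.one_le_rpow_of_pos_of_le_one_of_nonpos ht ht1 (by linarith)
  set Q := W * (v ^ 2 + G ^ 2 + (V + 1) * e ^ 2) with hQ
  have hQ0 : 0 ≤ Q := by positivity
  have q1 : W * (v ^ 2 + (V + 1) * e ^ 2) ≤ Q := by
    rw [hQ]; gcongr; nlinarith [sq_nonneg G]
  have q2 : W * v ^ 2 ≤ Q := by
    rw [hQ]
    gcongr
    have : 0 ≤ (V + 1) * e ^ 2 := by positivity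
    linarith [sq_nonneg G]
  have hv2 := sq_abs v
  have hVe : 0 ≤ V * e ^ 2 := by positivity
  -- the gradient of the weight
  have t1 : -c ≤ C₀ * (r * Q) := by
    have a1 : d ^ (-δ) ≤ r := by
      calc d ^ (-δ) ≤ t ^ (-δ) := rpow_le_rpow_of_nonpos ht htd (by linarith)
        _ ≤ r := rpow_le_rpow_of_exponent_ge ht ht1 (by linarith)
    calc -c ≤ |c| := neg_le_abs c
      _ ≤ C₀ * (d ^ (-δ) * W) * (|v| * G) := hc
      _ = C₀ * (d ^ (-δ) * (W * (|v| * G))) := by ring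
      _ ≤ C₀ * (r * Q) := by
          have a2 : |v| * G ≤ v ^ 2 + G ^ 2 + (V + 1) * e ^ 2 := by
            linarith [sq_nonneg (|v| - G), sq_nonneg e, sub_sq |v| G, sq_nonneg (|v| + G),
              add_sq |v| G]
          have a3 : W * (|v| * G) ≤ Q := mul_le_mul_of_nonneg_left a2 hW.le
          gcongr
  -- the remainder of the potential energy
  have t2 : -q ≤ C₀ * (r * Z) := by
    calc -q ≤ |q| := neg_le_abs q
      _ ≤ C₀ * (d⁻¹ * W * |e| ^ (p + 1)) := hq
      _ ≤ C₀ * (1 * Z) := by rw [one_mul]; gcongr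
      _ ≤ _ := by gcongr
  -- the remainder of the force
  have t3 : W * v * (h - V * e - ψ) ≤ C₀ * (r * Q) + C₀ * (r * (Q + Z))
      + (K * t ^ (-1 + μ) * Q + K⁻¹ * t ^ (1 - μ) * (W * E ^ 2)) := by
    have b0 : W * v * (h - V * e - ψ) ≤ W * |v| * (C₀ * (d⁻¹ * |e|) + C₀ * S + |E|) := by
      calc _ ≤ |W * v * (h - V * e - ψ)| := le_abs_self _
        _ = W * |v| * |h - V * e - ψ| := by rw [abs_mul, abs_mul, abs_of_pos hW]
        _ ≤ _ := by gcongr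
    have b1 : W * |v| * (d⁻¹ * |e|) ≤ r * Q := by
      have : |v| * (d⁻¹ * |e|) ≤ v ^ 2 + G ^ 2 + (V + 1) * e ^ 2 := by
        linarith [sq_nonneg (|v| - d⁻¹ * |e|), sq_nonneg (|v| + d⁻¹ * |e|), sq_nonneg e,
          sq_nonneg G, sub_sq |v| (d⁻¹ * |e|), add_sq |v| (d⁻¹ * |e|)]
      calc W * |v| * (d⁻¹ * |e|) = W * (|v| * (d⁻¹ * |e|)) := by ring
        _ ≤ 1 * Q := by rw [one_mul, hQ]; gcongr
        _ ≤ _ := by gcongr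
    have b2 : W * |v| * S ≤ r * (Q + Z) := by
      have c2 : t ^ (-2 + 2 * subGain p) ≤ r ^ 2 := by
        rw [hr, ← rpow_natCast, ← rpow_mul ht.le]
        exact rpow_le_rpow_of_exponent_ge ht ht1 (by push_cast; linarith)
      have c3 : W * e ^ 2 + Z ≤ Q + Z := by
        rw [hQ]; gcongr; linarith [sq_nonneg v, sq_nonneg G]
      have c1 : r⁻¹ * (W * S ^ 2) ≤ r * (Q + Z) := by
        calc r⁻¹ * (W * S ^ 2) ≤ r⁻¹ * (r ^ 2 * (Q + Z)) :=
              mul_le_mul_of_nonneg_left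
                (hsub.trans (mul_le_mul c2 c3 (by positivity) (by positivity))) (by positivity)
          _ = _ := by field_simp
      have c4 := two_mul_weighted_le hW.le hr0 v S
      have c5 : r * (W * v ^ 2) ≤ r * (Q + Z) := by
        refine mul_le_mul_of_nonneg_left ?_ hr0.le
        linarith
      linarith
    have b3 : W * |v| * |E| ≤ K * t ^ (-1 + μ) * Q + K⁻¹ * t ^ (1 - μ) * (W * E ^ 2) := by
      have hρ0 : 0 < K * t ^ (-1 + μ) := by positivity
      have e2 : K⁻¹ * t ^ (1 - μ) = (K * t ^ (-1 + μ))⁻¹ := by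
        rw [mul_inv, ← rpow_neg ht.le]; ring_nf
      have c4 := two_mul_weighted_le hW.le hρ0 v |E|
      rw [sq_abs] at c4
      have c5 := mul_le_mul_of_nonneg_left q2 hρ0.le
      have c6 : 0 ≤ (K * t ^ (-1 + μ))⁻¹ * (W * E ^ 2) := by positivity
      have c7 : 0 ≤ K * t ^ (-1 + μ) * (W * v ^ 2) := by positivity
      rw [e2]
      linarith
    calc _ ≤ W * |v| * (C₀ * (d⁻¹ * |e|) + C₀ * S + |E|) := b0
      _ = C₀ * (W * |v| * (d⁻¹ * |e|)) + C₀ * (W * |v| * S) + W * |v| * |E| := by ring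
      _ ≤ _ := by gcongr
  have t4 : Wd * G ^ 2 / 2 ≤ 0 := by nlinarith [sq_nonneg G]
  have t5 : ((m + 1) * (m + 2) + 1) * (W * (v ^ 2 + (V + 1) * e ^ 2))
      ≤ ((m + 1) * (m + 2) + 1) * (r * Q) :=
    mul_le_mul_of_nonneg_left (q1.trans (le_mul_of_one_le_left hQ0 hr1)) (by positivity)
  have f2 : 0 ≤ r * Q := by positivity
  have f5 : 0 ≤ ((m + 1) * (m + 2) + C₀ + C₀ + C₀ + 1) * (K * t ^ (-1 + μ) * Q) := by positivity
  have f6 : 0 ≤ ((m + 1) * (m + 2) + C₀ + 2) * (r * Z) := by positivity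
  linarith

end Density

/-! ### The bootstrap argument -/

section Bootstrap

variable {q η μ C : ℝ}

/-- Integration of the differential inequality, as long as `H ≤ S`. -/
lemma le_of_energy_inequality (hq : 1 ≤ q) (hη : 0 < η) (hη1 : η ≤ 1) (hμ : 0 < μ) (hμ1 : μ ≤ 1)
    (hC : 0 < C) {T t S K : ℝ} {H G G' : ℝ → ℝ} (hT : 0 < T) (hTt : T ≤ t) (hS1 : S ≤ 1)
    (hK : 0 < K) (hG : ContinuousOn G (Icc T t)) (hG0 : G T = 0)
    (hH : ∀ s ∈ Icc T t, 0 ≤ H s) (hHS : ∀ s ∈ Icc T t, H s ≤ S)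
    (hd : ∀ s ∈ Ioo T t, HasDerivAt G (G' s) s)
    (hd' : ∀ s ∈ Ioo T t, G' s ≤ C * (s ^ (-1 + η) + K * s ^ (-1 + μ)) * H s
      + C * s ^ (-1 + η) * H s ^ q + C * K⁻¹ * s ^ (-1 + μ)) :
    G t ≤ C * S * (2 * ((t - T) ^ η / η) + K * ((t - T) ^ μ / μ)) + C * K⁻¹ * ((t - T) ^ μ / μ) := by
  set Y : ℝ → ℝ := fun s => G s - (C * S * (2 * (s ^ η / η) + K * (s ^ μ / μ)) + C * K⁻¹ * (s ^ μ / μ))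
    with hY
  have hpow : ∀ {b : ℝ}, 0 < b → ∀ s, 0 < s → HasDerivAt (fun s => s ^ b / b) (s ^ (-1 + b)) s := by
    intro b hb s hs
    refine ((hasDerivAt_rpow_const (p := b) (Or.inl hs.ne')).div_const b).congr_deriv ?_
    rw [mul_div_assoc, mul_div_cancel₀ _ hb.ne']; ring_nf
  have hYd : ∀ s ∈ Ioo T t, HasDerivAt Y (G' s - (C * S * (2 * s ^ (-1 + η) + K * s ^ (-1 + μ))
      + C * K⁻¹ * s ^ (-1 + μ))) s := fun s hs =>
    (hd s hs).sub ((((((hpow hη s (hT.trans hs.1)).const_mul 2).add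
      ((hpow hμ s (hT.trans hs.1)).const_mul K)).const_mul (C * S))).add
      ((hpow hμ s (hT.trans hs.1)).const_mul (C * K⁻¹)))
  have hYc : ContinuousOn Y (Icc T t) := by
    have hc : ∀ {b : ℝ}, 0 < b → ContinuousOn (fun s : ℝ => s ^ b / b) (Icc T t) := fun hb s hs =>
      (hpow hb s (hT.trans_le hs.1)).continuousAt.continuousWithinAt
    exact hG.sub ((continuousOn_const.mul ((continuousOn_const.mul (hc hη)).add
      (continuousOn_const.mul (hc hμ)))).add (continuousOn_const.mul (hc hμ)))
  have hanti : AntitoneOn Y (Icc T t) := by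
    refine antitoneOn_of_deriv_nonpos (convex_Icc T t) hYc ?_ ?_
    · rw [interior_Icc]
      exact fun s hs => (hYd s hs).differentiableAt.differentiableWithinAt
    · rw [interior_Icc]
      intro s hs
      rw [(hYd s hs).deriv]
      have hs0 : 0 < s := hT.trans hs.1
      have h1 := hd' s hs
      have h2 := hH s (Ioo_subset_Icc_self hs)
      have h3 := hHS s (Ioo_subset_Icc_self hs)
      have h4 : H s ^ q ≤ S := by
        refine le_trans ?_ h3
        rcases h2.eq_or_lt with h | h
        · rw [← h, zero_rpow (by linarith)]
        · simpa using rpow_le_rpow_of_exponent_ge h (h3.trans hS1) hq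
      have h5 : C * (s ^ (-1 + η) + K * s ^ (-1 + μ)) * H s
          ≤ C * (s ^ (-1 + η) + K * s ^ (-1 + μ)) * S :=
        mul_le_mul_of_nonneg_left h3 (by positivity)
      have h6 : C * s ^ (-1 + η) * H s ^ q ≤ C * s ^ (-1 + η) * S :=
        mul_le_mul_of_nonneg_left h4 (by positivity)
      linarith
  have hle := hanti (left_mem_Icc.2 hTt) (right_mem_Icc.2 hTt) hTt
  have hsub : ∀ {b : ℝ}, 0 < b → b ≤ 1 → t ^ b / b - T ^ b / b ≤ (t - T) ^ b / b := by
    intro b hb hb1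
    have := Real.rpow_add_le_add_rpow hT.le (sub_nonneg.2 hTt) hb.le hb1
    rw [add_sub_cancel] at this
    rw [← sub_div]
    gcongr
    linarith
  have hS0 : 0 ≤ S := (hH T (left_mem_Icc.2 hTt)).trans (hHS T (left_mem_Icc.2 hTt))
  have m1 := mul_le_mul_of_nonneg_left (hsub hη hη1) (by positivity : 0 ≤ C * S * 2)
  have m2 := mul_le_mul_of_nonneg_left (hsub hμ hμ1) (by positivity : 0 ≤ C * S * K + C * K⁻¹)
  simp only [hY, hG0] at hle
  linarith

/-- The continuity argument: an energy `H` vanishing at `T` and controlled by a modified energy `G`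
whose derivative satisfies an inequality with integrable singular coefficients stays of size
`(t - T)^(2μ)`, on a time interval whose length does not depend on `T`. -/
lemma exists_bootstrap (hq : 1 < q) (hη : 0 < η) (hη1 : η ≤ 1) (hμ : 0 < μ) (hμ1 : μ ≤ 1)
    (hC : 0 < C) : ∃ δ₀ C' : ℝ, 0 < δ₀ ∧ δ₀ < 1 ∧ 0 < C' ∧ ∀ (T T' : ℝ) (H G G' : ℝ → ℝ), 0 < T →
      T' ≤ T + δ₀ → ContinuousOn H (Icc T T') → ContinuousOn G (Icc T T') → H T = 0 →
      (∀ t ∈ Icc T T', 0 ≤ H t) → (∀ t ∈ Icc T T', |G t - H t| ≤ C * H t ^ q) →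
      (∀ t ∈ Ioo T T', HasDerivAt G (G' t) t) →
      (∀ t ∈ Ioo T T', ∀ K, 0 < K → G' t ≤ C * (t ^ (-1 + η) + K * t ^ (-1 + μ)) * H t
        + C * t ^ (-1 + η) * H t ^ q + C * K⁻¹ * t ^ (-1 + μ)) →
      ∀ t ∈ Icc T T', H t ≤ C' * (t - T) ^ (2 * μ) := by
  have hlim : ∀ {b : ℝ}, 0 < b → ∀ (c : ℝ), Tendsto (fun δ : ℝ => c * δ ^ b) (𝓝[>] 0) (𝓝 0) := by
    intro b hb c
    have := (Real.continuousAt_rpow_const 0 b (Or.inr hb.le)).tendsto.const_mul c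
    rw [zero_rpow hb.ne', mul_zero] at this
    exact this.mono_left nhdsWithin_le_nhds
  obtain ⟨h₀, hhC, hh0, hh1⟩ := (((hlim (sub_pos.2 hq) C).eventually_lt_const
    (by norm_num : (0 : ℝ) < 1 / 4)).and (Ioo_mem_nhdsGT one_pos)).exists
  set C' := 16 * C ^ 2 / μ ^ 2 with hC'
  have hC'0 : 0 < C' := by positivity
  obtain ⟨δ₀, ⟨h1, h2⟩, h3, h4⟩ := (((hlim hη (2 * C / η)).eventually_lt_const
    (by norm_num : (0 : ℝ) < 1 / 4)).and ((hlim (by positivity : 0 < 2 * μ) C').eventually_lt_const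
    hh0)).and (Ioo_mem_nhdsGT one_pos) |>.exists
  refine ⟨δ₀, C', h3, h4, hC'0, ?_⟩
  intro T T' H G G' hT hT' hHc hGc hHT hH0 hGH hd hd'
  -- the improved bound, under the bootstrap assumption
  have improve : ∀ t ∈ Icc T T', (∀ s ∈ Icc T t, H s ≤ h₀) → H t ≤ C' * (t - T) ^ (2 * μ) := by
    intro t ht hb
    have hsub : Icc T t ⊆ Icc T T' := Icc_subset_Icc_right ht.2
    obtain ⟨r, hr, hmax⟩ := isCompact_Icc.exists_isMaxOn (nonempty_Icc.2 ht.1) (hHc.mono hsub)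
    have hrt := hmax (right_mem_Icc.2 ht.1)
    rcases hr.1.eq_or_lt with h | hTr
    · have : H t ≤ 0 := by rw [← hHT, h]; exact hrt
      exact this.trans (mul_nonneg hC'0.le (rpow_nonneg (by linarith [ht.1]) _))
    have hr' := hsub hr
    have hS0 := hH0 r hr'
    have hSh := hb r hr
    have hD : 0 < r - T := by linarith
    have hDδ : r - T ≤ δ₀ := by linarith [hr'.2]
    have hrsub : Icc T r ⊆ Icc T T' := Icc_subset_Icc_right hr'.2
    have hosub : Ioo T r ⊆ Ioo T T' := Ioo_subset_Ioo_right hr'.2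
    have hG0 : G T = 0 := by
      have := hGH T (left_mem_Icc.2 (ht.1.trans ht.2))
      rw [hHT, zero_rpow (by linarith), mul_zero, sub_zero] at this
      exact abs_nonpos_iff.1 this
    have hK : 0 < μ / (4 * C * (r - T) ^ μ) := by positivity
    have key := le_of_energy_inequality hq.le hη hη1 hμ hμ1 hC hT hTr.le (hSh.trans hh1.le) hK
      (hGc.mono hrsub) hG0 (fun s hs => hH0 s (hrsub hs))
      (fun s hs => hmax (Icc_subset_Icc_right hr.2 hs)) (fun s hs => hd s (hosub hs))
      (fun s hs => hd' s (hosub hs) _ hK)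
    have e1 : C * H r * (2 * ((r - T) ^ η / η)) ≤ H r / 4 := by
      have : 2 * C / η * (r - T) ^ η ≤ 1 / 4 := by
        refine le_trans ?_ h1.le
        gcongr
      calc _ = H r * (2 * C / η * (r - T) ^ η) := by ring
        _ ≤ H r * (1 / 4) := by gcongr
        _ = _ := by ring
    have e2 : C * H r * (μ / (4 * C * (r - T) ^ μ) * ((r - T) ^ μ / μ)) = H r / 4 := by
      field_simp
    have e3 : C * (μ / (4 * C * (r - T) ^ μ))⁻¹ * ((r - T) ^ μ / μ)
        = C' / 4 * (r - T) ^ (2 * μ) := by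
      have : (r - T) ^ (2 * μ) = (r - T) ^ μ * (r - T) ^ μ := by
        rw [← rpow_add hD]; ring_nf
      rw [this, hC']
      field_simp
      ring
    have e4 : C * H r ^ q ≤ H r / 4 := by
      rcases hS0.eq_or_lt with h | h
      · rw [← h, zero_rpow (by linarith)]; norm_num
      · have : H r ^ q = H r ^ (q - 1) * H r := by
          rw [← rpow_add_one h.ne']; ring_nf
        have h5 : H r ^ (q - 1) ≤ h₀ ^ (q - 1) := rpow_le_rpow h.le hSh (by linarith)
        calc C * H r ^ q = C * H r ^ (q - 1) * H r := by rw [this]; ring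
          _ ≤ C * h₀ ^ (q - 1) * H r := by gcongr
          _ ≤ 1 / 4 * H r := by gcongr
          _ = _ := by ring
    have e5 := (abs_le.1 (hGH r hr')).1
    have e6 : H r ≤ C' * (r - T) ^ (2 * μ) := by linarith
    have e7 : (r - T) ^ (2 * μ) ≤ (t - T) ^ (2 * μ) :=
      rpow_le_rpow hD.le (by linarith [hr.2]) (by positivity)
    calc H t ≤ H r := hrt
      _ ≤ _ := e6.trans (by gcongr)
  -- the bootstrap assumption holds on the whole interval
  have hbound : ∀ t ∈ Icc T T', H t ≤ h₀ := by
    by_contra hcon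
    push Not at hcon
    obtain ⟨t, ht, hlt⟩ := hcon
    have hcl : IsClosed (Icc T T' ∩ H ⁻¹' Ici h₀) := hHc.preimage_isClosed_of_isClosed isClosed_Icc
      isClosed_Ici
    obtain ⟨r, hr, hmin⟩ := (isCompact_Icc.of_isClosed_subset hcl inter_subset_left).exists_isLeast
      ⟨t, ht, hlt.le⟩
    have hTr : T < r := by
      refine lt_of_le_of_ne hr.1.1 fun h => ?_
      have h5 : h₀ ≤ H r := hr.2
      rw [← h, hHT] at h5
      linarith
    have hbelow : Icc T r ⊆ Icc T T' ∩ H ⁻¹' Iic h₀ := by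
      rw [← closure_Ico hTr.ne]
      refine closure_minimal ?_ (hHc.preimage_isClosed_of_isClosed isClosed_Icc isClosed_Iic)
      intro s hs
      have hs' : s ∈ Icc T T' := ⟨hs.1, hs.2.le.trans hr.1.2⟩
      refine ⟨hs', ?_⟩
      by_contra hc
      have hc' : h₀ < H s := not_le.1 hc
      exact absurd (hmin ⟨hs', hc'.le⟩) (not_le.2 hs.2)
    have h5 := improve r hr.1 fun s hs => (hbelow hs).2
    have h6 : (r - T) ^ (2 * μ) ≤ δ₀ ^ (2 * μ) :=
      rpow_le_rpow (by linarith) (by linarith [hr.1.2]) (by positivity)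
    have h7 : h₀ ≤ H r := hr.2
    have h8 : C' * (r - T) ^ (2 * μ) ≤ C' * δ₀ ^ (2 * μ) := by gcongr
    linarith
  exact fun t ht => improve t ht fun s hs => hbound s (Icc_subset_Icc_right ht.2 hs)

end Bootstrap

/-! ### Classical solutions as curves in `L²` -/

section Classical

variable {N : ℕ}

lemma HasOrder.contDiff_one {A : Space N → ℝ} {δ τ α : ℝ} {n : ℕ} {g : ℝ → Space N → ℝ}
    (hg : HasOrder A δ τ (n + 1) α g) {t : ℝ} (ht : t ∈ Ioo 0 τ) : ContDiff ℝ 1 (g t) :=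
  contDiff_one_iff_fderiv.2 ⟨hg.differentiable ht, hg.continuous_fderiv ht⟩

/-- Integration by parts against a test function. -/
lemma HasOrder.integral_laplacian_mul {A : Space N → ℝ} {δ τ α : ℝ} {n : ℕ}
    {g : ℝ → Space N → ℝ} (hg : HasOrder A δ τ (n + 2) α g) {t : ℝ} (ht : t ∈ Ioo 0 τ)
    {φ : Space N → ℝ} (hφ : ContDiff ℝ ∞ φ) (hc : HasCompactSupport φ) :
    ∫ x, Laplacian.laplacian (g t) x * φ x = -∫ x, ⟪∇ (g t) x, ∇ φ x⟫_ℝ := by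
  have hφ1 : Continuous (fderiv ℝ φ) := hφ.continuous_fderiv (by simp)
  have c1 : ∀ i, Continuous (NLW.pderiv i (g t)) := fun i => (hg.2.2 i).zero.continuous ht
  have c2 : ∀ i, Continuous (NLW.pderiv i (NLW.pderiv i (g t))) := fun i =>
    ((hg.2.2 i).2.2 i).zero.continuous ht
  have c3 : ∀ i, Continuous (NLW.pderiv i φ) := fun i => hφ1.clm_apply continuous_const
  have s1 : ∀ i, HasCompactSupport (NLW.pderiv i φ) := fun i => hc.fderiv_apply (𝕜 := ℝ) _
  have i1 : ∀ i, Integrable fun x => NLW.pderiv i (NLW.pderiv i (g t)) x * φ x := fun i =>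
    ((c2 i).mul hφ.continuous).integrable_of_hasCompactSupport hc.mul_left
  have i2 : ∀ i, Integrable fun x => NLW.pderiv i (g t) x * NLW.pderiv i φ x := fun i =>
    ((c1 i).mul (c3 i)).integrable_of_hasCompactSupport (s1 i).mul_left
  have i3 : ∀ i, Integrable fun x => NLW.pderiv i (g t) x * φ x := fun i =>
    ((c1 i).mul hφ.continuous).integrable_of_hasCompactSupport hc.mul_left
  have e1 : ∀ x, Laplacian.laplacian (g t) x * φ x
      = ∑ i, NLW.pderiv i (NLW.pderiv i (g t)) x * φ x := fun x => by
    rw [hg.laplacian_eq ht, Finset.sum_mul]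
  have e2 : ∀ x, ⟪∇ (g t) x, ∇ φ x⟫_ℝ = ∑ i, NLW.pderiv i (g t) x * NLW.pderiv i φ x := fun x => by
    rw [← (EuclideanSpace.basisFun (Fin N) ℝ).sum_inner_mul_inner]
    refine Finset.sum_congr rfl fun i _ => ?_
    rw [inner_gradient, real_inner_comm, inner_gradient, EuclideanSpace.basisFun_apply]
    rfl
  simp_rw [e1, e2]
  rw [integral_finsetSum _ fun i _ => i1 i, integral_finsetSum _ fun i _ => i2 i,
    ← Finset.sum_neg_distrib]
  refine Finset.sum_congr rfl fun i _ => ?_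
  have := integral_mul_fderiv_eq_neg_fderiv_mul_of_integrable (μ := volume)
    (v := EuclideanSpace.single i (1 : ℝ)) (i1 i) (i2 i) (i3 i)
    (fun x _ => (hg.2.2 i).2.1 t ht x) (fun x _ => hφ.differentiable (by simp) x)
  rw [eq_neg_iff_add_eq_zero, ← eq_neg_iff_add_eq_zero.1 this, add_comm]
  rfl

/-- Curves in `L²` given by functions that depend continuously on time and have a common
majorant. -/
lemma continuousOn_lpOf {E : Type*} [NormedAddCommGroup E] {a b : ℝ} {F : ℝ → Space N → E}
    {β : Space N → ℝ} (hβ : MemLp β 2 volume)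
    (hF : ∀ t ∈ Ioo a b, AEStronglyMeasurable (F t) volume)
    (hb : ∀ t ∈ Ioo a b, ∀ x, ‖F t x‖ ≤ β x) (hc : ∀ x, ContinuousOn (fun t => F t x) (Ioo a b)) :
    ContinuousOn (fun t => lpOf 2 (F t)) (Ioo a b) := by
  intro t ht
  have hI : Ioo a b ∈ 𝓝 t := isOpen_Ioo.mem_nhds ht
  have hm : ∀ s ∈ Ioo a b, MemLp (F s) 2 volume := fun s hs =>
    hβ.mono' (hF s hs) (ae_of_all _ (hb s hs))
  refine ContinuousAt.continuousWithinAt ?_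
  refine tendsto_lpOf (by filter_upwards [hI] with s hs using hm s hs) (hm t ht) ?_
  refine tendsto_eLpNorm_two_of_dominated (b := fun x => β x + β x) ?_ (hβ.add hβ) ?_ ?_
  · filter_upwards [hI] with s hs using (hF s hs).sub (hF t ht)
  · filter_upwards [hI] with s hs
    exact ae_of_all _ fun x => (norm_sub_le _ _).trans (add_le_add (hb s hs x) (hb t ht x))
  · refine ae_of_all _ fun x => ?_
    have := ((hc x).continuousAt hI).tendsto.sub_const (F t x)
    rwa [sub_self] at this

/-- Differentiable curves in `L²`. -/
lemma hasDerivAt_lpOf {a b : ℝ} {F F' : ℝ → Space N → ℝ}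
    {β : Space N → ℝ} (hβ : MemLp β 2 volume)
    (hF : ∀ t ∈ Ioo a b, AEStronglyMeasurable (F t) volume)
    (hF' : ∀ t ∈ Ioo a b, AEStronglyMeasurable (F' t) volume)
    (hb : ∀ t ∈ Ioo a b, ∀ x, ‖F t x‖ ≤ β x) (hb' : ∀ t ∈ Ioo a b, ∀ x, ‖F' t x‖ ≤ β x)
    (hd : ∀ t ∈ Ioo a b, ∀ x, HasDerivAt (fun t => F t x) (F' t x) t) {t : ℝ} (ht : t ∈ Ioo a b) :
    HasDerivAt (fun t => lpOf 2 (F t)) (lpOf 2 (F' t)) t := by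
  have hI : Ioo a b ∈ 𝓝 t := isOpen_Ioo.mem_nhds ht
  have hI' : Ioo a b ∈ 𝓝[≠] t := nhdsWithin_le_nhds hI
  have hm : ∀ s ∈ Ioo a b, MemLp (F s) 2 volume := fun s hs =>
    hβ.mono' (hF s hs) (ae_of_all _ (hb s hs))
  have hm' : ∀ s ∈ Ioo a b, MemLp (F' s) 2 volume := fun s hs =>
    hβ.mono' (hF' s hs) (ae_of_all _ (hb' s hs))
  have hs : ∀ s ∈ Ioo a b, MemLp (fun x => (s - t)⁻¹ • (F s x - F t x)) 2 volume := fun s hs =>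
    ((hm s hs).sub (hm t ht)).const_smul (s - t)⁻¹
  have hle : ∀ s ∈ Ioo a b, ∀ x, ‖(s - t)⁻¹ • (F s x - F t x)‖ ≤ β x := by
    intro s hs x
    have h1 : uIcc t s ⊆ Ioo a b := (convex_Ioo a b).ordConnected.uIcc_subset ht hs
    have h2 := abs_sub_le_of_deriv (fun y hy => hd y (h1 hy) x) fun y hy => hb' y (h1 hy) x
    rw [norm_smul, norm_inv, norm_eq_abs, norm_eq_abs]
    rcases eq_or_ne s t with hst | hst
    · simpa [hst] using (norm_nonneg _).trans (hb t ht x)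
    · rw [inv_mul_le_iff₀ (abs_pos.2 (sub_ne_zero.2 hst)), mul_comm]
      exact h2
  rw [hasDerivAt_iff_tendsto_slope]
  have key : Tendsto (fun s => lpOf 2 fun x => (s - t)⁻¹ • (F s x - F t x)) (𝓝[≠] t)
      (𝓝 (lpOf 2 (F' t))) := by
    refine tendsto_lpOf (by filter_upwards [hI'] with s h using hs s h) (hm' t ht) ?_
    refine tendsto_eLpNorm_two_of_dominated (b := fun x => β x + β x) ?_ (hβ.add hβ) ?_ ?_
    · filter_upwards [hI'] with s h using (hs s h).1.sub (hF' t ht)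
    · filter_upwards [hI'] with s h
      exact ae_of_all _ fun x =>
        (norm_sub_le _ _).trans (add_le_add (hle s h x) (hb' t ht x))
    · refine ae_of_all _ fun x => ?_
      have := (hasDerivAt_iff_tendsto_slope.1 (hd t ht x)).sub_const (F' t x)
      rw [sub_self] at this
      exact this
  refine key.congr' ?_
  filter_upwards [hI'] with s h
  rw [slope, vsub_eq_sub, lpOf_eq (hm s h), lpOf_eq (hm t ht), lpOf_eq (hs s h), ← MemLp.toLp_sub,
    ← MemLp.toLp_const_smul]
  rfl

/-- A classical solution of an inhomogeneous wave equation with a square-integrable majorant. -/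
lemma isWaveOn_of_classical {A : Space N → ℝ} {δ τ α : ℝ} {n : ℕ} {a : ℝ} (ha : 0 ≤ a)
    {U V Q : ℝ → Space N → ℝ} {β : Space N → ℝ} (hU : HasOrder A δ τ (n + 2) α U)
    (hβ : MemLp β 2 volume)
    (hVc : ∀ t ∈ Ioo a τ, Continuous (V t)) (hQc : ∀ t ∈ Ioo a τ, Continuous (Q t))
    (hVt : ∀ x, ContinuousOn (fun t => V t x) (Ioo a τ))
    (hQt : ∀ x, ContinuousOn (fun t => Q t x) (Ioo a τ))
    (bU : ∀ t ∈ Ioo a τ, ∀ x, |U t x| ≤ β x) (bV : ∀ t ∈ Ioo a τ, ∀ x, |V t x| ≤ β x)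
    (bQ : ∀ t ∈ Ioo a τ, ∀ x, |Q t x| ≤ β x) (bG : ∀ t ∈ Ioo a τ, ∀ x, ‖∇ (U t) x‖ ≤ β x)
    (bL : ∀ t ∈ Ioo a τ, ∀ x, |laplacian (U t) x| ≤ β x)
    (hd : ∀ t ∈ Ioo a τ, ∀ x, HasDerivAt (fun t => U t x) (V t x) t)
    (hdd : ∀ t ∈ Ioo a τ, ∀ x,
      HasDerivAt (fun t => V t x) (laplacian (U t) x + Q t x) t) :
    (∀ t ∈ Ioo a τ, MemLp (U t) 2 volume ∧ MemLp (V t) 2 volume ∧ MemLp (Q t) 2 volume) ∧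
    IsWaveOn a τ (fun t => lpOf 2 (U t)) (fun t => lpOf 2 (V t)) (fun t => lpOf 2 (Q t))
      (fun t => lpOf 2 (∇ (U t))) := by
  have h0 : Ioo a τ ⊆ Ioo 0 τ := Ioo_subset_Ioo_left ha
  have hC1 : ∀ t ∈ Ioo a τ, ContDiff ℝ 1 (U t) := fun t ht => hU.contDiff_one (h0 ht)
  have cL : ∀ t ∈ Ioo a τ, Continuous (laplacian (U t)) := fun t ht => by
    have : laplacian (U t) = fun x => ∑ i, NLW.pderiv i (NLW.pderiv i (U t)) x :=
      funext fun x => hU.laplacian_eq (h0 ht) x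
    rw [this]
    exact continuous_finsetSum _ fun i _ => ((hU.2.2 i).2.2 i).zero.continuous (h0 ht)
  have mU : ∀ t ∈ Ioo a τ, MemLp (U t) 2 volume := fun t ht =>
    hβ.mono' (hC1 t ht).continuous.aestronglyMeasurable (ae_of_all _ (bU t ht))
  have mV : ∀ t ∈ Ioo a τ, MemLp (V t) 2 volume := fun t ht =>
    hβ.mono' (hVc t ht).aestronglyMeasurable (ae_of_all _ (bV t ht))
  have mQ : ∀ t ∈ Ioo a τ, MemLp (Q t) 2 volume := fun t ht =>
    hβ.mono' (hQc t ht).aestronglyMeasurable (ae_of_all _ (bQ t ht))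
  have mL : ∀ t ∈ Ioo a τ, MemLp (laplacian (U t)) 2 volume := fun t ht =>
    hβ.mono' (cL t ht).aestronglyMeasurable (ae_of_all _ (bL t ht))
  have mG : ∀ t ∈ Ioo a τ, MemLp (∇ (U t)) 2 volume := fun t ht =>
    hβ.mono' (continuous_gradient (hC1 t ht)).aestronglyMeasurable (ae_of_all _ (bG t ht))
  refine ⟨fun t ht => ⟨mU t ht, mV t ht, mQ t ht⟩, ?_, ?_, ?_, ?_, ?_, ?_⟩
  · exact continuousOn_lpOf hβ (fun t ht => (hVc t ht).aestronglyMeasurable) bV hVt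
  · refine continuousOn_lpOf hβ (fun t ht => (mG t ht).1) bG fun x => ?_
    refine (InnerProductSpace.toDual ℝ (Space N)).symm.continuous.comp_continuousOn ?_
    exact hU.continuousOn_fderiv.comp (f := fun t : ℝ => (t, x))
      (continuous_id.prodMk continuous_const).continuousOn fun t ht => ⟨h0 ht, mem_univ x⟩
  · exact continuousOn_lpOf hβ (fun t ht => (hQc t ht).aestronglyMeasurable) bQ hQt
  · intro t ht
    simp only [lpOf_eq (mU t ht), lpOf_eq (mG t ht)]
    exact isWeakGradient_toLp (hC1 t ht) (mU t ht) (mG t ht)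
  · intro t ht
    exact hasDerivAt_lpOf hβ (fun t ht => (mU t ht).1) (fun t ht => (mV t ht).1) bU bV hd ht
  · intro φ hφ hc t ht
    have hI : Ioo a τ ∈ 𝓝 t := isOpen_Ioo.mem_nhds ht
    have hφ2 := memLp_testFunction hφ hc
    have e1 : ∀ s ∈ Ioo a τ, ∫ x, lpOf 2 (V s) x * φ x = ∫ x, V s x * φ x := fun s hs =>
      integral_congr_ae (by filter_upwards [coeFn_lpOf (mV s hs)] with x hx; rw [hx])
    have e2 : ∫ x, lpOf 2 (Q t) x * φ x = ∫ x, Q t x * φ x :=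
      integral_congr_ae (by filter_upwards [coeFn_lpOf (mQ t ht)] with x hx; rw [hx])
    have e3 : ∫ x, ⟪lpOf 2 (∇ (U t)) x, ∇ φ x⟫_ℝ = ∫ x, ⟪∇ (U t) x, ∇ φ x⟫_ℝ :=
      integral_congr_ae (by filter_upwards [coeFn_lpOf (mG t ht)] with x hx; rw [hx])
    have iQ : Integrable fun x => Q t x * φ x :=
      memLp_one_iff_integrable.1 (hφ2.mul (mQ t ht) (r := 1))
    have iL : Integrable fun x => laplacian (U t) x * φ x :=
      memLp_one_iff_integrable.1 (hφ2.mul (mL t ht) (r := 1))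
    have iβ : Integrable fun x => (β x + β x) * |φ x| :=
      memLp_one_iff_integrable.1 (hφ2.norm.mul (hβ.add hβ) (r := 1))
    rw [e2, e3, ← hU.integral_laplacian_mul (h0 ht) hφ hc, ← integral_add iL iQ]
    have key := (hasDerivAt_integral_of_dominated_loc_of_deriv_le (s := Ioo a τ)
      (F := fun s x => V s x * φ x) (bound := fun x => (β x + β x) * |φ x|)
      (F' := fun s x => (laplacian (U s) x + Q s x) * φ x) (μ := volume) hI
      (by filter_upwards [hI] with s hs using ((hVc s hs).mul hφ.continuous).aestronglyMeasurable)
      (memLp_one_iff_integrable.1 (hφ2.mul (mV t ht) (r := 1)))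
      (((cL t ht).add (hQc t ht)).mul hφ.continuous).aestronglyMeasurable
      (ae_of_all _ fun x s hs => by
        rw [norm_eq_abs, abs_mul]
        exact mul_le_mul_of_nonneg_right
          ((abs_add_le _ _).trans (add_le_add (bL s hs x) (bQ s hs x))) (abs_nonneg _)) iβ
      (ae_of_all _ fun x s hs => (hdd s hs x).mul_const (φ x))).2
    simp only [add_mul] at key
    refine key.congr_of_eventuallyEq ?_
    filter_upwards [hI] with s hs using e1 s hs

end Classical

/-! ### The energy weight -/

section SpaceWeight

variable {N : ℕ} {p : ℝ} {χ : ℝ → ℝ} {k : ℕ} {A : Space N → ℝ}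

lemma IsSetting.contDiff_one (hS : IsSetting p χ k A) : ContDiff ℝ 1 A :=
  hS.shape.contDiff.of_le (by have := hS.six_le; exact_mod_cast (by omega : 1 ≤ k - 1))

lemma IsSetting.exists_norm_gradient_le (hS : IsSetting p χ k A) :
    ∃ C, 0 < C ∧ ∀ t ∈ Ioc (0 : ℝ) 1, ∀ x, ‖∇ A x‖ ≤ C * (t + A x) ^ (1 - 1 / (k : ℝ)) := by
  have h6 := hS.six_le
  have h1 := hasOrder_shape (τ := 2) (by omega) hS.shape
  obtain ⟨n, hn⟩ : ∃ n, k - 1 = n + 1 := ⟨k - 2, by omega⟩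
  rw [hn] at h1
  choose c hc0 hc using fun i => (h1.partial_deriv i).zero.2
  refine ⟨1 + ∑ i, c i, by have := Finset.sum_nonneg fun i (_ : i ∈ Finset.univ) => (hc0 i).le
                           linarith, fun t ht x => ?_⟩
  have hd := hS.dist_pos ht.1 x
  have e : ∀ i, fderiv ℝ A x (EuclideanSpace.single i (1 : ℝ))
      = NLW.pderiv i (fun x => t + A x) x := fun i => by rw [NLW.pderiv, fderiv_const_add]
  rw [norm_gradient, add_mul, one_mul, Finset.sum_mul]
  refine (norm_clm_le_sum _).trans (le_add_of_nonneg_of_le (by positivity) ?_)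
  refine Finset.sum_le_sum fun i _ => ?_
  rw [e i]
  exact hc i t ⟨ht.1, by linarith [ht.2]⟩ x

lemma IsSetting.hasGradientAt_comp (hS : IsSetting p χ k A) {F : ℝ → ℝ} {F' t : ℝ} {x : Space N}
    (hF : HasDerivAt F F' (t + A x)) : HasGradientAt (fun x => F (t + A x)) (F' • ∇ A x) x := by
  have h1 : HasFDerivAt A (fderiv ℝ A x) x :=
    (hS.contDiff_one.differentiable (by simp) x).hasFDerivAt
  have h2 := hF.comp_hasFDerivAt x (h1.const_add t)
  rw [hasGradientAt_iff_hasFDerivAt]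
  refine h2.congr_fderiv ?_
  rw [map_smulₛₗ]
  simp only [gradient, LinearIsometryEquiv.apply_symm_apply]
  rfl

lemma hasDerivAt_weightDeriv {d : ℝ} (hd : 0 < d) :
    HasDerivAt (weightDeriv p) (-(2 * (expo p + 1)) * ((-(2 * (expo p + 1)) - 1)
      * d ^ (-(2 * (expo p + 1)) - 2))) d := by
  have := (hasDerivAt_rpow_const (p := -(2 * (expo p + 1)) - 1) (Or.inl hd.ne')).const_mul
    (-(2 * (expo p + 1)))
  refine this.congr_deriv ?_
  ring_nf

/-- The Lipschitz constant of the derivative of the weight decays at infinity. -/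
lemma abs_weightDeriv_sub_le (hS : IsSetting p χ k A) {a s t : ℝ} (ha : 0 < a) (hs : a ≤ s)
    (ht : a ≤ t) (x : Space N) :
    |weightDeriv p (s + A x) - weightDeriv p (t + A x)|
      ≤ (2 * (expo p + 1) * (2 * (expo p + 1) + 1) * (a + A x) ^ (-(2 * (expo p + 1)) - 2))
        * |s - t| := by
  have hm := expo_pos hS.one_lt
  have hd := hS.dist_pos ha x
  have := abs_sub_le_of_deriv (a := t + A x) (b := s + A x)
    (K := 2 * (expo p + 1) * (2 * (expo p + 1) + 1) * (a + A x) ^ (-(2 * (expo p + 1)) - 2))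
    (f := weightDeriv p)
    (f' := fun d => -(2 * (expo p + 1)) * ((-(2 * (expo p + 1)) - 1)
      * d ^ (-(2 * (expo p + 1)) - 2))) (fun y hy => ?_) (fun y hy => ?_)
  · simpa using this
  all_goals
    have hy' : a + A x ≤ y := by
      have := (convex_Ici (a + A x)).ordConnected.uIcc_subset
        (show t + A x ∈ Ici (a + A x) by simpa using ht)
        (show s + A x ∈ Ici (a + A x) by simpa using hs) hy
      exact this
  · exact hasDerivAt_weightDeriv (hd.trans_le hy')
  · have h1 : y ^ (-(2 * (expo p + 1)) - 2) ≤ (a + A x) ^ (-(2 * (expo p + 1)) - 2) :=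
      rpow_le_rpow_of_nonpos hd hy' (by linarith)
    have h2 : 0 ≤ y ^ (-(2 * (expo p + 1)) - 2) := rpow_nonneg (hd.le.trans hy') _
    rw [← mul_assoc, abs_mul, abs_of_nonneg h2]
    have h3 : -(2 * (expo p + 1)) * (-(2 * (expo p + 1)) - 1)
        = 2 * (expo p + 1) * (2 * (expo p + 1) + 1) := by ring
    rw [h3, abs_of_nonneg (by positivity)]
    gcongr

lemma weight_le {a d : ℝ} (hp : 1 < p) (ha : 0 < a) (had : a ≤ d) :
    weight p d ≤ weight p a := by
  have hm := expo_pos hp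
  unfold weight
  have := rpow_le_rpow_of_nonpos ha had (by linarith : -(2 * (expo p + 1)) ≤ 0)
  linarith

lemma contDiff_weight (hS : IsSetting p χ k A) {t : ℝ} (ht : 0 < t) :
    ContDiff ℝ 1 (fun x => weight p (t + A x)) := by
  unfold weight
  refine contDiff_const.add (ContDiff.rpow_const_of_ne (contDiff_const.add hS.contDiff_one)
    fun x => (hS.dist_pos ht x).ne')

lemma gradient_weight (hS : IsSetting p χ k A) {t : ℝ} (ht : 0 < t) (x : Space N) :
    ∇ (fun x => weight p (t + A x)) x = weightDeriv p (t + A x) • ∇ A x :=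
  (hS.hasGradientAt_comp (hasDerivAt_weight (hS.dist_pos ht x))).gradient

/-- The gradient of the weight is of lower order because the level sets of `A` are flat. -/
lemma IsSetting.exists_norm_gradient_weight_le (hS : IsSetting p χ k A) :
    ∃ C, 0 < C ∧ ∀ t ∈ Ioc (0 : ℝ) 1, ∀ x, ‖weightDeriv p (t + A x) • ∇ A x‖
      ≤ C * ((t + A x) ^ (-(1 / (k : ℝ))) * weight p (t + A x)) := by
  obtain ⟨C, hC, h⟩ := hS.exists_norm_gradient_le
  have hm := expo_pos hS.one_lt
  refine ⟨2 * (expo p + 1) * C, by positivity, fun t ht x => ?_⟩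
  have hd := hS.dist_pos ht.1 x
  have hW := weight_pos (p := p) hd
  rw [norm_smul, norm_eq_abs]
  calc _ ≤ 2 * (expo p + 1) * ((t + A x)⁻¹ * weight p (t + A x))
        * (C * (t + A x) ^ (1 - 1 / (k : ℝ))) := by
        gcongr
        · exact abs_weightDeriv_le hS.one_lt hd
        · exact h t ht x
    _ = 2 * (expo p + 1) * C * (((t + A x)⁻¹ * (t + A x) ^ (1 - 1 / (k : ℝ)))
        * weight p (t + A x)) := by ring
    _ = _ := by
        rw [← Real.rpow_neg_one, ← rpow_add hd]; ring_nf

lemma IsSetting.inv_nat_mem (hS : IsSetting p χ k A) : 0 < 1 / (k : ℝ) ∧ 1 / (k : ℝ) ≤ 1 / 6 := by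
  have h6 : (6 : ℝ) ≤ k := by exact_mod_cast hS.six_le
  exact ⟨by positivity, by gcongr⟩

lemma memLp_weight (hS : IsSetting p χ k A) {t : ℝ} (ht : 0 < t) :
    MemLp (fun x => weight p (t + A x)) ∞ volume :=
  memLp_top_of_bound (contDiff_weight hS ht).continuous.aestronglyMeasurable
    (weight p t) (ae_of_all _ fun x => by
      rw [norm_of_nonneg (weight_pos (hS.dist_pos ht x)).le]
      exact weight_le hS.one_lt ht (by linarith [hS.shape.nonneg x]))

lemma continuous_weightDeriv (hS : IsSetting p χ k A) {t : ℝ} (ht : 0 < t) :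
    Continuous (fun x => weightDeriv p (t + A x)) := by
  unfold weightDeriv
  exact continuous_const.mul ((continuous_const.add hS.contDiff_one.continuous).rpow_const
    fun x => Or.inl (hS.dist_pos ht x).ne')

lemma memLp_weightDeriv (hS : IsSetting p χ k A) {t : ℝ} (ht : 0 < t) :
    MemLp (fun x => weightDeriv p (t + A x)) ∞ volume := by
  have hm := expo_pos hS.one_lt
  refine memLp_top_of_bound (continuous_weightDeriv hS ht).aestronglyMeasurable
    (2 * (expo p + 1) * (t⁻¹ * weight p t)) (ae_of_all _ fun x => ?_)
  have hA := hS.shape.nonneg x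
  have hd := hS.dist_pos ht x
  have hW := weight_pos (p := p) hd
  refine (abs_weightDeriv_le hS.one_lt hd).trans ?_
  gcongr
  · linarith
  · exact weight_le hS.one_lt ht (by linarith)

lemma memLp_gradient_weight (hS : IsSetting p χ k A) {t : ℝ} (ht : t ∈ Ioc (0 : ℝ) 1) :
    MemLp (∇ (fun x => weight p (t + A x))) ∞ volume := by
  obtain ⟨C, hC, h⟩ := hS.exists_norm_gradient_weight_le
  have hδ := hS.inv_nat_mem
  refine memLp_top_of_bound
    (continuous_gradient (contDiff_weight hS ht.1)).aestronglyMeasurable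
    (C * (t ^ (-(1 / (k : ℝ))) * weight p t)) (ae_of_all _ fun x => ?_)
  have hA := hS.shape.nonneg x
  have hW := weight_pos (p := p) (hS.dist_pos ht.1 x)
  have ht0 := ht.1
  rw [gradient_weight hS ht.1]
  have h1 : (t + A x) ^ (-(1 / (k : ℝ))) ≤ t ^ (-(1 / (k : ℝ))) :=
    rpow_le_rpow_of_nonpos ht.1 (by linarith) (by linarith)
  have h2 := weight_le (p := p) hS.one_lt ht.1 (by linarith : t ≤ t + A x)
  exact (h t ht x).trans (mul_le_mul_of_nonneg_left (mul_le_mul h1 h2 hW.le (by positivity)) hC.le)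

/-- The weight of the energy functional is admissible away from the blow-up time. -/
lemma isWeight_weight (hS : IsSetting p χ k A) {a b : ℝ} (ha : 0 < a) (hb : b ≤ 1) :
    IsWeight a b (fun t => lpOf ∞ fun x => weight p (t + A x))
      (fun t => lpOf ∞ fun x => weightDeriv p (t + A x))
      (fun t => lpOf ∞ (∇ fun x => weight p (t + A x))) := by
  have hm := expo_pos hS.one_lt
  have hδ := hS.inv_nat_mem
  rcases le_or_gt b a with hab | hab
  · have : Ioo a b = ∅ := Ioo_eq_empty (not_lt.2 hab)
    exact ⟨by simp [this], by simp [this], by simp [this], by simp [this]⟩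
  obtain ⟨C, hC, h⟩ := hS.exists_norm_gradient_le
  set c := 2 * (expo p + 1) * (2 * (expo p + 1) + 1)
  have hc0 : 0 < c := by positivity
  have hI : ∀ t ∈ Ioo a b, t ∈ Ioc (0 : ℝ) 1 := fun t ht => ⟨ha.trans ht.1, ht.2.le.trans hb⟩
  have hK : ∀ x, c * (a + A x) ^ (-(2 * (expo p + 1)) - 2) ≤ c * a ^ (-(2 * (expo p + 1)) - 2) :=
    fun x => mul_le_mul_of_nonneg_left
      (rpow_le_rpow_of_nonpos ha (by linarith [hS.shape.nonneg x]) (by linarith)) hc0.le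
  refine isWeight_of_bounds (K := c * a ^ (-(2 * (expo p + 1)) - 2)
    + c * C * a ^ (-(2 * (expo p + 1)) - 1 - 1 / (k : ℝ)))
    (fun t ht => memLp_weight hS (hI t ht).1) (fun t ht => memLp_weightDeriv hS (hI t ht).1)
    (fun t ht => memLp_gradient_weight hS (hI t ht))
    (fun t ht => contDiff_weight hS (hI t ht).1) ?_ ?_ ?_
  · intro t ht s hs x
    have h1 : ∀ y ∈ uIcc t s, a ≤ y := fun y hy =>
      ((convex_Ioo a b).ordConnected.uIcc_subset ht hs hy).1.le
    have := abs_sub_sub_le_of_lipschitz (a := t) (b := s)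
      (f := fun s => weight p (s + A x)) (f' := fun s => weightDeriv p (s + A x))
      (K := c * a ^ (-(2 * (expo p + 1)) - 2))
      (fun y hy => (hasDerivAt_weight (hS.dist_pos (ha.trans_le (h1 y hy)) x)).comp_add_const y
        (A x))
      (fun y hy => (abs_weightDeriv_sub_le hS ha (h1 y hy) ht.1.le x).trans
        (mul_le_mul_of_nonneg_right (hK x) (abs_nonneg _))) (by positivity)
    rw [mul_comm (s - t)]
    refine this.trans (mul_le_mul_of_nonneg_right ?_ (sq_nonneg _))
    exact le_add_of_nonneg_right (by positivity)
  · intro t ht s hs x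
    refine (abs_weightDeriv_sub_le hS ha hs.1.le ht.1.le x).trans
      (mul_le_mul_of_nonneg_right ?_ (abs_nonneg _))
    exact (hK x).trans (le_add_of_nonneg_right (by positivity))
  · intro t ht s hs x
    have hd := hS.dist_pos ha x
    rw [gradient_weight hS (hI t ht).1, gradient_weight hS (hI s hs).1, ← sub_smul,
      norm_smul, norm_eq_abs]
    have h2 : (a + A x) ^ (-(2 * (expo p + 1)) - 2) * (a + A x) ^ (1 - 1 / (k : ℝ))
        = (a + A x) ^ (-(2 * (expo p + 1)) - 1 - 1 / (k : ℝ)) := by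
      rw [← rpow_add hd]; ring_nf
    have h3 : (a + A x) ^ (-(2 * (expo p + 1)) - 1 - 1 / (k : ℝ))
        ≤ a ^ (-(2 * (expo p + 1)) - 1 - 1 / (k : ℝ)) :=
      rpow_le_rpow_of_nonpos ha (by linarith [hS.shape.nonneg x]) (by linarith)
    calc _ ≤ c * (a + A x) ^ (-(2 * (expo p + 1)) - 2) * |s - t|
          * (C * (a + A x) ^ (1 - 1 / (k : ℝ))) := by
          gcongr
          · exact abs_weightDeriv_sub_le hS ha hs.1.le ht.1.le x
          · exact h a ⟨ha, by linarith⟩ x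
      _ = c * C * ((a + A x) ^ (-(2 * (expo p + 1)) - 2) * (a + A x) ^ (1 - 1 / (k : ℝ)))
          * |s - t| := by ring
      _ ≤ c * C * a ^ (-(2 * (expo p + 1)) - 1 - 1 / (k : ℝ)) * |s - t| := by
          rw [h2]; gcongr
      _ ≤ _ := by
          gcongr
          exact le_add_of_nonneg_left (by positivity)

/-- Square-integrable functions in terms of a bound for their squares. -/
lemma eLpNorm_two_le_of_sq_le {E : Type*} [NormedAddCommGroup E] {f : Space N → E}
    {D : Space N → ℝ} (hf : AEStronglyMeasurable f volume) (hD : Integrable D) {K : ℝ}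
    (h : ∀ x, ‖f x‖ ^ 2 ≤ K * D x) :
    MemLp f 2 volume ∧ eLpNorm f 2 volume ≤ ENNReal.ofReal ((K * ∫ x, D x) ^ (1 / 2 : ℝ)) := by
  have h1 : MemLp f 2 volume := by
    rw [memLp_two_iff_integrable_sq_norm hf]
    exact (hD.const_mul K).mono' (hf.norm.pow 2) (ae_of_all _ fun x => by
      rw [norm_of_nonneg (by positivity)]; exact h x)
  refine ⟨h1, ?_⟩
  rw [h1.eLpNorm_eq_integral_rpow_norm (by simp) (by simp)]
  refine ENNReal.ofReal_le_ofReal ?_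
  simp only [ENNReal.toReal_ofNat, rpow_two]
  rw [one_div]
  refine rpow_le_rpow (integral_nonneg fun x => by positivity) ?_ (by norm_num)
  rw [← integral_const_mul]
  exact integral_mono_of_nonneg (ae_of_all _ fun x => by positivity) (hD.const_mul K)
    (ae_of_all _ h)

lemma linPot_le {a d : ℝ} (hp : 1 < p) (ha : 0 < a) (had : a ≤ d) : linPot p d ≤ linPot p a := by
  have := expo_pos hp
  unfold linPot
  gcongr

lemma continuous_linPot (hS : IsSetting p χ k A) {t : ℝ} (ht : 0 < t) :
    Continuous (fun x => linPot p (t + A x)) := by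
  unfold linPot
  exact continuous_const.div ((continuous_const.add hS.contDiff_one.continuous).pow 2)
    fun x => (pow_pos (hS.dist_pos ht x) 2).ne'

lemma integrable_bdd_mul {F D : Space N → ℝ} {K : ℝ} (hF : Continuous F) (hK : ∀ x, |F x| ≤ K)
    (hD : Integrable D) : Integrable fun x => F x * D x :=
  hD.bdd_mul hF.aestronglyMeasurable (ae_of_all _ hK)

/-- The densities of the weighted energy are integrable. -/
lemma integrable_weight_mul (hS : IsSetting p χ k A) {t : ℝ} (ht : 0 < t) {D : Space N → ℝ}
    (hD : Integrable D) : Integrable fun x => weight p (t + A x) * D x :=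
  integrable_bdd_mul (contDiff_weight hS ht).continuous (fun x => by
    rw [abs_of_pos (weight_pos (hS.dist_pos ht x))]
    exact weight_le hS.one_lt ht (by linarith [hS.shape.nonneg x])) hD

lemma integrable_linPot_mul (hS : IsSetting p χ k A) {t : ℝ} (ht : 0 < t) {D : Space N → ℝ}
    (hD : Integrable D) : Integrable fun x => linPot p (t + A x) * D x :=
  integrable_bdd_mul (continuous_linPot hS ht) (fun x => by
    rw [abs_of_pos (linPot_pos hS.one_lt (hS.dist_pos ht x))]
    exact linPot_le hS.one_lt ht (by linarith [hS.shape.nonneg x])) hD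

lemma integrable_energy_density (hS : IsSetting p χ k A) {t : ℝ} (ht : 0 < t) (v u : L2 N)
    (g : L2Vec N) : Integrable fun x => weight p (t + A x) *
      (v x ^ 2 + ‖g x‖ ^ 2 + (linPot p (t + A x) + 1) * u x ^ 2) := by
  refine integrable_weight_mul hS ht
    (((Lp.memLp v).integrable_sq.add
      ((memLp_two_iff_integrable_sq_norm (Lp.aestronglyMeasurable g)).1 (Lp.memLp g))).add ?_)
  have := (integrable_linPot_mul hS ht (Lp.memLp u).integrable_sq).add (Lp.memLp u).integrable_sq
  refine this.congr (ae_of_all _ fun x => ?_)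
  simp only [Pi.add_apply]; ring

/-- The Sobolev inequality with the weight of the energy functional, uniformly in time. -/
lemma exists_energy_sobolev (hS : IsSetting p χ k A) (hN : 1 ≤ N)
    (hp' : 3 ≤ N → p < ((N : ℝ) + 2) / ((N : ℝ) - 2)) :
    ∃ C, 0 < C ∧ ∀ t ∈ Ioc (0 : ℝ) 1, ∀ (v u : L2 N) (g : L2Vec N), IsWeakGradient u g →
      Integrable (fun x => (weight p (t + A x) ^ (1 / 2 : ℝ) * |u x|) ^ (p + 1)) ∧
      ∫ x, (weight p (t + A x) ^ (1 / 2 : ℝ) * |u x|) ^ (p + 1)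
        ≤ C * (∫ x, weight p (t + A x) *
          (v x ^ 2 + ‖g x‖ ^ 2 + (linPot p (t + A x) + 1) * u x ^ 2)) ^ ((p + 1) / 2) := by
  have hp := hS.one_lt
  have hm := expo_pos hp
  have hδ := hS.inv_nat_mem
  obtain ⟨C, hC⟩ := exists_weighted_sobolev (N := N) hN (q := p + 1) (by linarith) fun h => by
    have h3 : (3 : ℝ) ≤ N := by exact_mod_cast h
    have h4 := hp' h
    rw [lt_div_iff₀ (by linarith)] at h4
    rw [le_div_iff₀ (by linarith)]
    linarith
  obtain ⟨C₁, hC₁, hg⟩ := hS.exists_norm_gradient_weight_le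
  set K := 2 + 2 * C₁ ^ 2 with hKd
  have hK0 : 0 < K := by positivity
  set M : ℝ := C * (1 + K ^ (1 / 2 : ℝ)) with hM
  have hM0 : 0 ≤ M := by positivity
  refine ⟨M ^ (p + 1) + 1, by positivity, fun t ht v u g h => ?_⟩
  set W := fun x => weight p (t + A x) with hW
  set D := fun x => weight p (t + A x) *
    (v x ^ 2 + ‖g x‖ ^ 2 + (linPot p (t + A x) + 1) * u x ^ 2) with hD
  have hDi : Integrable D := integrable_energy_density hS ht.1 v u g
  have hW0 : ∀ x, 0 < W x := fun x => weight_pos (hS.dist_pos ht.1 x)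
  have hW1 : ∀ x, 1 ≤ W x := fun x => one_le_weight (hS.dist_pos ht.1 x)
  have hWC : ContDiff ℝ 1 W := contDiff_weight hS ht.1
  set ζ := fun x => W x ^ (1 / 2 : ℝ) with hζ
  have hζC : ContDiff ℝ 1 ζ := hWC.rpow_const_of_ne fun x => (hW0 x).ne'
  have hζ0 : ∀ x, 0 < ζ x := fun x => rpow_pos_of_pos (hW0 x) _
  have hζ2 : ∀ x, ζ x ^ 2 = W x := fun x => by
    simp only [hζ]
    rw [← rpow_natCast, ← rpow_mul (hW0 x).le]; norm_num
  have hζg : ∀ x, ‖∇ ζ x‖ ≤ C₁ * ((t + A x) ^ (-(1 / (k : ℝ))) * ζ x) := fun x => by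
    have h1 : HasGradientAt ζ ((1 / 2 * W x ^ ((1 : ℝ) / 2 - 1) * weightDeriv p (t + A x)) • ∇ A x)
        x := by
      refine hS.hasGradientAt_comp (F := fun d => weight p d ^ (1 / 2 : ℝ)) ?_
      exact ((hasDerivAt_weight (hS.dist_pos ht.1 x)).rpow_const
        (Or.inl (hW0 x).ne')).congr_deriv (by simp only [hW]; ring)
    rw [h1.gradient, mul_smul, norm_smul, norm_of_nonneg (by have := hW0 x; positivity)]
    have h2 : W x ^ ((1 : ℝ) / 2 - 1) * W x = ζ x := by
      rw [← rpow_add_one (hW0 x).ne']; norm_num [hζ]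
    have h3 : 0 < W x ^ ((1 : ℝ) / 2 - 1) := rpow_pos_of_pos (hW0 x) _
    have h4 := hS.dist_pos ht.1 x
    calc _ ≤ 1 / 2 * W x ^ ((1 : ℝ) / 2 - 1) * (C₁ * ((t + A x) ^ (-(1 / (k : ℝ))) * W x)) := by
          gcongr; exact hg t ht x
      _ = 1 / 2 * (C₁ * ((t + A x) ^ (-(1 / (k : ℝ))) * (W x ^ ((1 : ℝ) / 2 - 1) * W x))) := by ring
      _ ≤ _ := by
          rw [h2]
          have := hζ0 x
          have : 0 ≤ C₁ * ((t + A x) ^ (-(1 / (k : ℝ))) * ζ x) := by positivity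
          linarith
  have hζb : ∀ x, ζ x ≤ weight p t ^ (1 / 2 : ℝ) := fun x =>
    rpow_le_rpow (hW0 x).le
      (weight_le hp ht.1 (by linarith [hS.shape.nonneg x])) (by norm_num)
  have hVd : ∀ x, ((t + A x) ^ (-(1 / (k : ℝ)))) ^ 2 ≤ linPot p (t + A x) + 1 := fun x => by
    have hd := hS.dist_pos ht.1 x
    have h0 := linPot_pos hp hd
    rw [← rpow_natCast, ← rpow_mul hd.le]
    rcases le_total 1 (t + A x) with h1 | h1
    · have := rpow_le_one_of_one_le_of_nonpos h1
        (by push_cast; linarith : -(1 / (k : ℝ)) * ((2 : ℕ) : ℝ) ≤ 0)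
      linarith
    · have h2 := rpow_le_rpow_of_exponent_ge hd h1
        (by push_cast; linarith : (-2 : ℝ) ≤ -(1 / (k : ℝ)) * ((2 : ℕ) : ℝ))
      rw [rpow_neg hd.le, rpow_two] at h2
      have h3 : ((t + A x) ^ 2)⁻¹ ≤ linPot p (t + A x) := by
        rw [linPot, div_eq_mul_inv]
        exact le_mul_of_one_le_left (by positivity) (by nlinarith)
      linarith
  have b1 : ∀ x, ‖ζ x * u x‖ ^ 2 ≤ 1 * D x := fun x => by
    have := linPot_pos hp (hS.dist_pos ht.1 x)
    rw [one_mul, norm_mul, mul_pow, norm_eq_abs, norm_eq_abs, sq_abs, sq_abs, hζ2]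
    simp only [hD]
    refine mul_le_mul_of_nonneg_left ?_ (hW0 x).le
    nlinarith [sq_nonneg (v x), sq_nonneg ‖g x‖, mul_nonneg this.le (sq_nonneg (u x))]
  have b2 : ∀ x, ‖ζ x • g x + u x • ∇ ζ x‖ ^ 2 ≤ K * D x := fun x => by
    have h1 : ‖u x • ∇ ζ x‖ ^ 2 ≤ C₁ ^ 2 * (W x * ((linPot p (t + A x) + 1) * u x ^ 2)) := by
      have h2 : ‖∇ ζ x‖ ^ 2 ≤ C₁ ^ 2 * (((t + A x) ^ (-(1 / (k : ℝ)))) ^ 2 * W x) := by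
        have := pow_le_pow_left₀ (norm_nonneg _) (hζg x) 2
        rwa [mul_pow, mul_pow, hζ2] at this
      rw [norm_smul, mul_pow, norm_eq_abs, sq_abs]
      have := hW0 x
      calc _ ≤ u x ^ 2 * (C₁ ^ 2 * ((linPot p (t + A x) + 1) * W x)) := by
            refine mul_le_mul_of_nonneg_left (h2.trans ?_) (sq_nonneg _)
            gcongr
            exact hVd x
        _ = _ := by ring
    have h3 : ‖ζ x • g x‖ ^ 2 = W x * ‖g x‖ ^ 2 := by
      rw [norm_smul, mul_pow, norm_eq_abs, sq_abs, hζ2]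
    have h4 : ‖ζ x • g x + u x • ∇ ζ x‖ ^ 2 ≤ 2 * (‖ζ x • g x‖ ^ 2 + ‖u x • ∇ ζ x‖ ^ 2) :=
      (pow_le_pow_left₀ (norm_nonneg _) (norm_add_le _ _) 2).trans (add_sq_le)
    have h5 := hW0 x
    have h6 := linPot_pos hp (hS.dist_pos ht.1 x)
    have h7 : 0 ≤ K * (W x * v x ^ 2) + 2 * C₁ ^ 2 * (W x * ‖g x‖ ^ 2)
      + 2 * (W x * ((linPot p (t + A x) + 1) * u x ^ 2)) := by positivity
    simp only [hD, hKd, hW] at *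
    linarith
  have hum := Lp.aestronglyMeasurable u
  have hgm := Lp.aestronglyMeasurable g
  obtain ⟨m1, n1⟩ := eLpNorm_two_le_of_sq_le
    (hζC.continuous.aestronglyMeasurable.mul hum) hDi b1
  obtain ⟨m2, n2⟩ := eLpNorm_two_le_of_sq_le ((hζC.continuous.aestronglyMeasurable.smul hgm).add
    (hum.smul (continuous_gradient hζC).aestronglyMeasurable)) hDi b2
  have key := hC u g h ζ hζC ⟨_, fun x => by rw [abs_of_pos (hζ0 x)]; exact hζb x⟩
    ⟨C₁ * (t ^ (-(1 / (k : ℝ))) * weight p t ^ (1 / 2 : ℝ)), fun x => by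
      have h1 : (t + A x) ^ (-(1 / (k : ℝ))) ≤ t ^ (-(1 / (k : ℝ))) :=
        rpow_le_rpow_of_nonpos ht.1 (by linarith [hS.shape.nonneg x]) (by linarith)
      have := ht.1
      exact (hζg x).trans (mul_le_mul_of_nonneg_left
        (mul_le_mul h1 (hζb x) (hζ0 x).le (by positivity)) hC₁.le)⟩
  set I := ∫ x, D x
  have hI0 : 0 ≤ I := integral_nonneg fun x => by
    have := linPot_pos hp (hS.dist_pos ht.1 x)
    have := hW0 x
    simp only [hD]; positivity
  have key2 : eLpNorm (fun x => ζ x * u x) (ENNReal.ofReal (p + 1)) volume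
      ≤ ENNReal.ofReal (M * I ^ (1 / 2 : ℝ)) := by
    refine key.trans ?_
    calc _ ≤ (C : ℝ≥0∞) * (ENNReal.ofReal ((1 * I) ^ (1 / 2 : ℝ))
          + ENNReal.ofReal ((K * I) ^ (1 / 2 : ℝ))) := by gcongr; exact n1; exact n2
      _ = _ := by
        rw [← ENNReal.ofReal_add (by positivity) (by positivity), ← ENNReal.ofReal_coe_nnreal,
          ← ENNReal.ofReal_mul (by positivity), mul_rpow hK0.le hI0, one_mul, hM]
        ring_nf
  have hq0 : ENNReal.ofReal (p + 1) ≠ 0 := by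
    rw [Ne, ENNReal.ofReal_eq_zero]; linarith
  have hmem : MemLp (fun x => ζ x * u x) (ENNReal.ofReal (p + 1)) volume :=
    ⟨m1.1, key2.trans_lt ENNReal.ofReal_lt_top⟩
  have hn : ∀ x, ‖ζ x * u x‖ = weight p (t + A x) ^ (1 / 2 : ℝ) * |u x| := fun x => by
    rw [norm_mul, norm_of_nonneg (hζ0 x).le, norm_eq_abs]
  have hr : (ENNReal.ofReal (p + 1)).toReal = p + 1 := ENNReal.toReal_ofReal (by linarith)
  have hint := hmem.integrable_norm_rpow hq0 ENNReal.ofReal_ne_top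
  rw [hr] at hint
  rw [hmem.eLpNorm_eq_integral_rpow_norm hq0 ENNReal.ofReal_ne_top, hr,
    ENNReal.ofReal_le_ofReal_iff (by positivity)] at key2
  simp only [hn] at hint key2
  refine ⟨hint, ?_⟩
  set Z := ∫ x, (weight p (t + A x) ^ (1 / 2 : ℝ) * |u x|) ^ (p + 1)
  have hZ0 : 0 ≤ Z := integral_nonneg fun x => by
    have := hW0 x
    positivity
  have e1 : Z = (Z ^ (p + 1)⁻¹) ^ (p + 1) := by
    rw [← rpow_mul hZ0, inv_mul_cancel₀ (by linarith), rpow_one]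
  rw [e1]
  calc _ ≤ (M * I ^ (1 / 2 : ℝ)) ^ (p + 1) :=
        rpow_le_rpow (by positivity) key2 (by linarith)
    _ = M ^ (p + 1) * I ^ ((p + 1) / 2) := by
        rw [mul_rpow hM0 (by positivity), ← rpow_mul hI0]; ring_nf
    _ ≤ _ := by gcongr; linarith

end SpaceWeight

/-! ### Properties of the refined ansatz -/

section AnsatzFacts

/-- The properties of the refined ansatz `U = U_J` on `(0, τ]` used in the energy estimates: its
residual has order `α`, it is comparable and close to `U₀`, and equal to `U₀` far from the origin. -/
structure IsBlowUpAnsatz {N : ℕ} (p : ℝ) (k : ℕ) (A : Space N → ℝ) (τ : ℝ) (r : ℕ) (α : ℝ)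
    (U : ℝ → Space N → ℝ) : Prop where
  regular : IsRegularAnsatz p A (1 / k) τ r α U
  time_pos : 0 < τ
  time_le : τ ≤ 1
  ratio_mem : ∀ t ∈ Ioc 0 τ, ∀ x, U t x / ansatzZero p A t x ∈ Icc (3 / 4 : ℝ) (5 / 4)
  close : ∀ t ∈ Ioc 0 τ, ∀ x, |U t x - ansatzZero p A t x|
    ≤ (1 + ansatzZero p A t x) ^ (-((p - 1) / 2)) * ansatzZero p A t x
  far : ∀ x, 2 < A x → ∀ t, U t x = ansatzZero p A t x
  order_ge : expo p + rate p / 2 ≤ α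

variable {N : ℕ} {p : ℝ} {χ : ℝ → ℝ} {k : ℕ} {A : Space N → ℝ} {τ : ℝ} {r : ℕ} {α : ℝ}
  {U : ℝ → Space N → ℝ} {a σ : ℕ → ℝ}

/-- The largeness of `k` makes the loss of derivatives harmless. -/
lemma le_residualOrder (hS : IsSetting p χ k A) :
    expo p + rate p / 2 ≤ residualOrder p (1 / k) (numSteps p) := by
  have hp := hS.one_lt
  have hm := expo_pos hp
  have hr := rate_pos hp
  have hk : (0 : ℝ) < k := by have := hS.six_le; exact_mod_cast (by omega : 0 < k)
  have h1 : 2 * (p + 1) / (rate p * (p - 1)) = 2 * (expo p + 1) / rate p := by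
    have : p - 1 ≠ 0 := by linarith
    rw [expo]; field_simp; ring
  have h2 := hS.large
  rw [h1] at h2
  have h2' : 2 * (expo p + 1) ≤ (k - 2) * rate p := by
    rw [← div_le_iff₀ hr]; linarith
  have h3 := numSteps_le hp
  have h4 : 2 * ((numSteps p : ℝ) + 1) * (1 / (k : ℝ))
      ≤ 2 * (numSteps p : ℝ) - 2 * expo p - rate p / 2 := by
    rw [mul_one_div, div_le_iff₀ hk]
    rcases min_cases ((numSteps p : ℝ) - 2 / (p - 1)) (1 / 2 : ℝ) with ⟨h, _⟩ | ⟨h, h5⟩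
    · have e : rate p = numSteps p - expo p := h
      nlinarith
    · have e : rate p = 1 / 2 := h
      have h6 : (1 : ℝ) / 2 < numSteps p - expo p := h5
      rw [e] at h2' ⊢
      nlinarith
  rw [residualOrder]
  linarith

lemma isBlowUpAnsatz_ansatz (hS : IsSetting p χ k A)
    (h : IsParameterChoiceUpTo (numSteps p) p χ A a σ) :
    IsBlowUpAnsatz p k A (σ (numSteps p)) (k - 3 - 2 * numSteps p)
      (residualOrder p (1 / k) (numSteps p)) (ansatz p χ A a σ (numSteps p)) where
  regular := ansatz_regular hS le_rfl h le_rfl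
  time_pos := h.time_pos _ le_rfl
  time_le := by
    have : ∀ j ≤ numSteps p, σ j ≤ 1 := fun j => by
      induction j with
      | zero => exact fun _ => h.time_zero.le
      | succ j ih => exact fun hj => (h.time_anti j (by omega)).trans (ih (by omega))
    exact this _ le_rfl
  ratio_mem t ht x := div_ansatzZero_mem hS h le_rfl ht x
  close t ht x := by
    refine (h.close _ (numSteps_pos hS.one_lt) le_rfl t ht x).2.trans ?_
    have h1 := ansatzZero_pos hS ht.1 x
    have h2 : (0 : ℝ) ≤ 2⁻¹ ^ numSteps p := by positivity
    refine mul_le_mul_of_nonneg_right ?_ h1.le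
    exact mul_le_of_le_one_left (by positivity) (by linarith)
  far x hx t := ansatz_eq_far hS h le_rfl hx t
  order_ge := le_residualOrder hS

namespace IsBlowUpAnsatz

lemma bounds (hS : IsSetting p χ k A) (H : IsBlowUpAnsatz p k A τ r α U) {t : ℝ} (ht : t ∈ Ioc 0 τ)
    (x : Space N) : 3 / 4 * ansatzZero p A t x ≤ U t x ∧ U t x ≤ 5 / 4 * ansatzZero p A t x := by
  have h0 := ansatzZero_pos hS ht.1 x
  have := H.ratio_mem t ht x
  exact ⟨(le_div_iff₀ h0).1 this.1, (div_le_iff₀ h0).1 this.2⟩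

lemma pos (hS : IsSetting p χ k A) (H : IsBlowUpAnsatz p k A τ r α U) {t : ℝ} (ht : t ∈ Ioc 0 τ)
    (x : Space N) : 0 < U t x := by
  have := H.bounds hS ht x
  have := ansatzZero_pos hS ht.1 x
  linarith

lemma residual_far (H : IsBlowUpAnsatz p k A τ r α U) (hS : IsSetting p χ k A) {t : ℝ} (ht : 0 < t)
    {x : Space N} (hx : 2 < A x) :
    residual p U t x = laplacian (ansatzZero p A t) x := by
  rw [← residual_ansatzZero hS ht, residual, residual]
  have h1 : (fun s => U s x) = fun s => ansatzZero p A s x := funext fun s => H.far x hx s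
  have h2 : U t =ᶠ[𝓝 x] ansatzZero p A t := by
    filter_upwards [hS.contDiff_one.continuous.continuousAt.eventually (lt_mem_nhds hx)] with y hy
    exact H.far y hy t
  rw [h1, (InnerProductSpace.laplacian_congr_nhds h2).eq_of_nhds, H.far x hx t]

lemma exists_residual_far_le (H : IsBlowUpAnsatz p k A τ r α U) (hS : IsSetting p χ k A) :
    ∃ C, 0 < C ∧ ∀ t ∈ Ioo 0 τ, ∀ x, 2 < A x → |residual p U t x| ≤ C * (t + A x) ^ (-expo p) := by
  have hδ := hS.inv_nat_mem
  have h1 : HasOrder A (1 / k) τ (k - 3 + 2) (-expo p) (ansatzZero p A) := by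
    have := hS.six_le
    have e : k - 1 = k - 3 + 2 := by omega
    exact e ▸ ansatzZero_order_one hS
  obtain ⟨-, C, hC, h⟩ := (h1.laplacian hS.shape.nonneg).zero
  refine ⟨C, hC, fun t ht x hx => ?_⟩
  rw [H.residual_far hS ht.1 hx]
  refine (h t ht x).trans ?_
  gcongr
  · linarith [ht.1]
  · linarith

lemma residual_orderZero (H : IsBlowUpAnsatz p k A τ r α U) (hS : IsSetting p χ k A) :
    HasOrderZero A τ (-expo p) (residual p U) := by
  obtain ⟨hc, C, hC, h⟩ := H.regular.residual_order.zero
  obtain ⟨C', hC', h'⟩ := H.exists_residual_far_le hS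
  have hm := expo_pos hS.one_lt
  have hα : 0 < α + expo p := by linarith [H.order_ge, rate_pos hS.one_lt]
  refine ⟨hc, C * 3 ^ (α + expo p) + C', by positivity, fun t ht x => ?_⟩
  have hd := hS.dist_pos ht.1 x
  rcases le_or_gt (A x) 2 with hx | hx
  · have h3 : t + A x ≤ 3 := by linarith [ht.2, H.time_le]
    have h4 : (t + A x) ^ α = (t + A x) ^ (α + expo p) * (t + A x) ^ (-expo p) := by
      rw [← rpow_add hd]; ring_nf
    have h5 : (t + A x) ^ (α + expo p) ≤ 3 ^ (α + expo p) :=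
      rpow_le_rpow hd.le h3 hα.le
    calc _ ≤ C * (t + A x) ^ α := h t ht x
      _ = C * (t + A x) ^ (α + expo p) * (t + A x) ^ (-expo p) := by rw [h4]; ring
      _ ≤ C * 3 ^ (α + expo p) * (t + A x) ^ (-expo p) := by gcongr
      _ ≤ _ := by
        gcongr
        linarith
  · refine (h' t ht x hx).trans ?_
    gcongr
    have : 0 < C * 3 ^ (α + expo p) := by positivity
    linarith

/-- Away from the blow-up time, quantities that decay at least like `U₀` have a common majorant. -/
lemma exists_majorant (hS : IsSetting p χ k A) {a : ℝ} (ha : 0 < a) (ha1 : a ≤ 1) {β : ℝ}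
    (hβ : β ≤ -expo p) {g : ℝ → Space N → ℝ} (hg : HasOrderZero A τ β g) :
    ∃ C, 0 < C ∧ ∀ t ∈ Ioo a τ, ∀ x, |g t x| ≤ C * ansatzZero p A 1 x := by
  obtain ⟨-, C, hC, h⟩ := hg
  have hκ := kappa_pos hS.one_lt
  have hm := expo_pos hS.one_lt
  refine ⟨C * a ^ (β + expo p) * a ^ (-expo p) * (kappa p)⁻¹, by positivity, fun t ht x => ?_⟩
  have hA := hS.shape.nonneg x
  have ht0 := ha.trans ht.1
  have hd := hS.dist_pos ht0 x
  have h1 : (t + A x) ^ β = (t + A x) ^ (β + expo p) * (t + A x) ^ (-expo p) := by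
    rw [← rpow_add hd]; ring_nf
  have h2 : (t + A x) ^ (β + expo p) ≤ a ^ (β + expo p) :=
    rpow_le_rpow_of_nonpos ha (by linarith [ht.1]) (by linarith)
  have h3 : (t + A x) ^ (-expo p) ≤ a ^ (-expo p) * (1 + A x) ^ (-expo p) := by
    rw [← mul_rpow ha.le (by positivity)]
    exact rpow_le_rpow_of_nonpos (by positivity) (by nlinarith [ht.1]) (by linarith)
  calc _ ≤ C * (t + A x) ^ β := h t ⟨ht0, ht.2⟩ x
    _ ≤ C * (a ^ (β + expo p) * (a ^ (-expo p) * (1 + A x) ^ (-expo p))) := by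
        rw [h1]; gcongr
    _ = _ := by rw [ansatzZero, ← expo]; field_simp

lemma nonlin_orderZero (hS : IsSetting p χ k A) (H : IsBlowUpAnsatz p k A τ r α U) :
    HasOrderZero A τ (-expo p - 2) (fun t x => nonlin p (U t x)) := by
  have hp := hS.one_lt
  have hκ := kappa_pos hp
  refine HasOrderZero.congr (g := fun t x => U t x ^ p) ⟨?_, (5 / 4) ^ p * kappa p ^ p, by positivity,
    fun t ht x => ?_⟩ fun t ht x => nonlin_of_pos (H.pos hS ⟨ht.1, ht.2.le⟩ x)
  · exact H.regular.order.zero.1.rpow_const fun q hq => Or.inr (by linarith)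
  · have h1 := H.bounds hS ⟨ht.1, ht.2.le⟩ x
    have h0 := H.pos hS ⟨ht.1, ht.2.le⟩ x
    have h2 := ansatzZero_pos hS ht.1 x
    rw [abs_of_nonneg (by positivity)]
    have e : -expo p - 2 = -(expo p * p) := by linarith [expo_mul hp]
    calc U t x ^ p ≤ (5 / 4 * ansatzZero p A t x) ^ p := rpow_le_rpow h0.le h1.2 (by linarith)
      _ = _ := by rw [mul_rpow (by norm_num) h2.le, ansatzZero_rpow hS ht.1, e, mul_assoc]

/-- The force in the wave equation satisfied by the ansatz. -/
lemma isWaveOn (hS : IsSetting p χ k A) (H : IsBlowUpAnsatz p k A τ r α U)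
    (hL : MemLp (ansatzZero p A 1) 2 volume) {a : ℝ} (ha : 0 < a) (ha1 : a ≤ 1) :
    (∀ t ∈ Ioo a τ, MemLp (U t) 2 volume ∧ MemLp (fun x => deriv (fun s => U s x) t) 2 volume ∧
      MemLp (fun x => nonlin p (U t x) - residual p U t x) 2 volume) ∧
    IsWaveOn a τ (fun t => lpOf 2 (U t)) (fun t => lpOf 2 fun x => deriv (fun s => U s x) t)
      (fun t => lpOf 2 fun x => nonlin p (U t x) - residual p U t x)
      (fun t => lpOf 2 (∇ (U t))) := by
  have hδ := hS.inv_nat_mem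
  have hN := nonlin_orderZero hS H
  have hE := H.residual_orderZero hS
  have hR := H.regular
  obtain ⟨C₁, hC₁, h1⟩ := exists_majorant hS ha ha1 le_rfl hR.order.zero
  obtain ⟨C₂, hC₂, h2⟩ := exists_majorant hS ha ha1 (by linarith) hR.deriv_order
  obtain ⟨C₃, hC₃, h3⟩ := exists_majorant hS ha ha1 (by linarith) hN
  obtain ⟨C₄, hC₄, h4⟩ := exists_majorant hS ha ha1 le_rfl hE
  obtain ⟨C₅, hC₅, h5⟩ := exists_majorant hS ha ha1 (by linarith)
    (hR.order.laplacian hS.shape.nonneg).zero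
  choose c hc0 hc using fun i => exists_majorant hS ha ha1 (by linarith)
    (hR.order.partial_deriv i).zero
  have hc1 : 0 ≤ ∑ i, c i := Finset.sum_nonneg fun i _ => (hc0 i).le
  set C := C₁ + C₂ + C₃ + C₄ + C₅ + ∑ i, c i
  have hu : ∀ x, 0 < ansatzZero p A 1 x := fun x => ansatzZero_pos hS one_pos x
  have hI : Ioo a τ ⊆ Ioo 0 τ := Ioo_subset_Ioo_left ha.le
  have up : ∀ {c y : ℝ} {x}, y ≤ c * ansatzZero p A 1 x → c ≤ C → y ≤ C * ansatzZero p A 1 x :=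
    fun h hc => h.trans (mul_le_mul_of_nonneg_right hc (hu _).le)
  refine isWaveOn_of_classical ha.le hR.order (hL.const_mul C)
    (fun t ht => hR.deriv_order.continuous (hI ht))
    (fun t ht => (hN.continuous (hI ht)).sub (hE.continuous (hI ht)))
    (fun x => (hR.deriv_order.continuousOn_time x).mono hI)
    (fun x => ((hN.continuousOn_time x).sub (hE.continuousOn_time x)).mono hI)
    (fun t ht x => up (h1 t ht x) (by linarith)) (fun t ht x => up (h2 t ht x) (by linarith))
    (fun t ht x => up ((abs_sub _ _).trans ((add_le_add (h3 t ht x) (h4 t ht x)).trans_eq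
      (add_mul _ _ _).symm)) (by linarith)) (fun t ht x => ?_)
    (fun t ht x => up (h5 t ht x) (by linarith)) (fun t ht x => (hR.differentiable t (hI ht) x).hasDerivAt) fun t ht x => ?_
  · rw [norm_gradient]
    refine up ((norm_clm_le_sum _).trans ((Finset.sum_le_sum fun i _ => hc i t ht x).trans_eq
      (Finset.sum_mul _ _ _).symm)) (by linarith)
  · refine (hR.differentiable_deriv t (hI ht) x).hasDerivAt.congr_deriv ?_
    rw [residual, iteratedDeriv_succ, iteratedDeriv_one]
    ring

/-- The weighted size of the residual: this is where the number `J` of corrections enters. -/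
lemma exists_residual_weighted_le (hS : IsSetting p χ k A) (H : IsBlowUpAnsatz p k A τ r α U)
    (hL : MemLp (ansatzZero p A 1) 2 volume) :
    ∃ C, 0 < C ∧ ∀ t ∈ Ioo 0 τ,
      Integrable (fun x => weight p (t + A x) * residual p U t x ^ 2) ∧
      ∫ x, weight p (t + A x) * residual p U t x ^ 2 ≤ C * t ^ (-2 + rate p) := by
  have hp := hS.one_lt
  have hm := expo_pos hp
  have hκ := kappa_pos hp
  have hr := rate_pos hp
  have hr2 := rate_le_half (p := p)
  obtain ⟨-, C₁, hC₁, h1⟩ := H.regular.residual_order.zero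
  obtain ⟨C₂, hC₂, h2⟩ := H.exists_residual_far_le hS
  set D : Space N → ℝ := fun x => (Metric.closedBall (0 : Space N) 2).indicator (fun _ => 1) x
    + ansatzZero p A 1 x ^ 2 with hD
  have hDi : Integrable D := by
    refine Integrable.add ?_ hL.integrable_sq
    exact (integrableOn_const (C := (1 : ℝ)) (measure_closedBall_lt_top (x := (0 : Space N))
      (r := 2)).ne).integrable_indicator measurableSet_closedBall
  have hD0 : ∀ x, 0 ≤ D x := fun x =>
    add_nonneg (indicator_nonneg (fun _ _ => zero_le_one) x) (sq_nonneg _)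
  set γ := 2 * α - 2 * (expo p + 1) + 2 - rate p with hγ
  have hγ0 : 0 ≤ γ := by linarith [H.order_ge]
  set K := (3 ^ (2 * (expo p + 1)) + 1) * C₁ ^ 2 * 3 ^ γ
    + 2 * (C₂ * 2 ^ expo p * (kappa p)⁻¹) ^ 2 with hK
  have hK0 : 0 < K := by positivity
  have key : ∀ t ∈ Ioo 0 τ, ∀ x, weight p (t + A x) * residual p U t x ^ 2
      ≤ K * t ^ (-2 + rate p) * D x := by
    intro t ht x
    have hA := hS.shape.nonneg x
    have hd := hS.dist_pos ht.1 x
    have ht0 := ht.1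
    have ht1 : 1 ≤ t ^ (-2 + rate p) :=
      Real.one_le_rpow_of_pos_of_le_one_of_nonpos ht.1 (ht.2.le.trans H.time_le) (by linarith)
    rcases le_or_gt (A x) 2 with hx | hx
    · have hball : x ∈ Metric.closedBall (0 : Space N) 2 := by
        rw [mem_closedBall_zero_iff]
        by_contra hc
        rw [not_le] at hc
        have h6 := hS.six_le
        have h3 := le_self_pow₀ (by linarith : 1 ≤ ‖x‖) (by omega : k ≠ 0)
        rw [← hS.shape.eq_far x hc.le] at h3
        linarith
      have hD1 : 1 ≤ D x := by
        simp only [hD]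
        rw [indicator_of_mem hball]
        exact le_add_of_nonneg_right (sq_nonneg _)
      have h3 : t + A x ≤ 3 := by linarith [ht.2, H.time_le]
      have w1 : weight p (t + A x)
          ≤ (3 ^ (2 * (expo p + 1)) + 1) * (t + A x) ^ (-(2 * (expo p + 1))) := by
        have : 1 ≤ 3 ^ (2 * (expo p + 1)) * (t + A x) ^ (-(2 * (expo p + 1))) := by
          rw [rpow_neg hd.le, ← div_eq_mul_inv, one_le_div (by positivity)]
          exact rpow_le_rpow hd.le h3 (by positivity)
        rw [weight, add_mul, one_mul]
        linarith
      have w2 : residual p U t x ^ 2 ≤ C₁ ^ 2 * (t + A x) ^ (2 * α) := by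
        have := pow_le_pow_left₀ (abs_nonneg _) (h1 t ht x) 2
        rw [sq_abs, mul_pow, ← rpow_natCast ((t + A x) ^ α), ← rpow_mul hd.le] at this
        rwa [Nat.cast_ofNat, mul_comm α] at this
      have w3 : (t + A x) ^ (-(2 * (expo p + 1))) * (t + A x) ^ (2 * α)
          = (t + A x) ^ (-2 + rate p) * (t + A x) ^ γ := by
        rw [← rpow_add hd, ← rpow_add hd]; congr 1; rw [hγ]; ring
      have w4 : (t + A x) ^ (-2 + rate p) ≤ t ^ (-2 + rate p) :=
        rpow_le_rpow_of_nonpos ht.1 (by linarith) (by linarith)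
      have w5 : (t + A x) ^ γ ≤ 3 ^ γ := rpow_le_rpow hd.le h3 hγ0
      calc _ ≤ ((3 ^ (2 * (expo p + 1)) + 1) * (t + A x) ^ (-(2 * (expo p + 1))))
            * (C₁ ^ 2 * (t + A x) ^ (2 * α)) := by gcongr
        _ = (3 ^ (2 * (expo p + 1)) + 1) * C₁ ^ 2
            * ((t + A x) ^ (-(2 * (expo p + 1))) * (t + A x) ^ (2 * α)) := by ring
        _ ≤ (3 ^ (2 * (expo p + 1)) + 1) * C₁ ^ 2 * (t ^ (-2 + rate p) * 3 ^ γ) := by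
            rw [w3]
            refine mul_le_mul_of_nonneg_left ?_ (by positivity)
            exact mul_le_mul w4 w5 (by positivity) (by positivity)
        _ = (3 ^ (2 * (expo p + 1)) + 1) * C₁ ^ 2 * 3 ^ γ * t ^ (-2 + rate p) * 1 := by ring
        _ ≤ _ := by
            refine mul_le_mul ?_ hD1 zero_le_one (by positivity)
            refine mul_le_mul_of_nonneg_right ?_ (by positivity)
            rw [hK]
            exact le_add_of_nonneg_right (by positivity)
    · have w1 : weight p (t + A x) ≤ 2 := by
        have := rpow_le_one_of_one_le_of_nonpos (by linarith : 1 ≤ t + A x)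
          (by linarith : -(2 * (expo p + 1)) ≤ 0)
        rw [weight]; linarith
      have w2 : |residual p U t x| ≤ C₂ * 2 ^ expo p * (kappa p)⁻¹ * ansatzZero p A 1 x := by
        have h3 : (t + A x) ^ (-expo p) ≤ 2 ^ expo p * (1 + A x) ^ (-expo p) := by
          have : (2 : ℝ) ^ expo p = (2⁻¹ : ℝ) ^ (-expo p) := by
            rw [rpow_neg (by norm_num), Real.inv_rpow (by norm_num), inv_inv]
          rw [this, ← mul_rpow (by norm_num) (by positivity)]
          exact rpow_le_rpow_of_nonpos (by positivity) (by linarith) (by linarith)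
        calc _ ≤ C₂ * (t + A x) ^ (-expo p) := h2 t ht x hx
          _ ≤ C₂ * (2 ^ expo p * (1 + A x) ^ (-expo p)) := by gcongr
          _ = _ := by rw [ansatzZero, ← expo]; field_simp
      have w3 := pow_le_pow_left₀ (abs_nonneg _) w2 2
      rw [sq_abs, mul_pow] at w3
      have w4 : ansatzZero p A 1 x ^ 2 ≤ D x :=
        le_add_of_nonneg_left (indicator_nonneg (fun _ _ => zero_le_one) x)
      calc _ ≤ 2 * ((C₂ * 2 ^ expo p * (kappa p)⁻¹) ^ 2 * D x) := by
            refine mul_le_mul w1 (w3.trans ?_) (sq_nonneg _) (by norm_num)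
            gcongr
        _ = 2 * (C₂ * 2 ^ expo p * (kappa p)⁻¹) ^ 2 * 1 * D x := by ring
        _ ≤ _ := by
            refine mul_le_mul_of_nonneg_right ?_ (hD0 x)
            refine mul_le_mul ?_ ht1 zero_le_one hK0.le
            rw [hK]
            exact le_add_of_nonneg_left (by positivity)
  have hDI : 0 ≤ ∫ x, D x := integral_nonneg hD0
  refine ⟨K * (∫ x, D x) + 1, by positivity, fun t ht => ?_⟩
  have hnn : ∀ x, 0 ≤ weight p (t + A x) * residual p U t x ^ 2 := fun x =>
    mul_nonneg (weight_pos (hS.dist_pos ht.1 x)).le (sq_nonneg _)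
  have hcont : Continuous fun x => weight p (t + A x) * residual p U t x ^ 2 :=
    (contDiff_weight hS ht.1).continuous.mul
      ((H.regular.residual_order.zero.continuous ht).pow 2)
  refine ⟨(hDi.const_mul (K * t ^ (-2 + rate p))).mono' hcont.aestronglyMeasurable
    (ae_of_all _ fun x => by rw [norm_of_nonneg (hnn x)]; exact key t ht x), ?_⟩
  have := integral_mono_of_nonneg (ae_of_all _ hnn)
    (hDi.const_mul (K * t ^ (-2 + rate p))) (ae_of_all _ (key t ht))
  rw [integral_const_mul] at this
  refine this.trans ?_
  have : 0 ≤ t ^ (-2 + rate p) := rpow_nonneg ht.1.le _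
  nlinarith

/-- The linearization at the ansatz differs from the one at `U₀` by `O(1/d)`. -/
lemma exists_linearization_le (hS : IsSetting p χ k A) :
    ∃ C, 0 < C ∧ ∀ {τ : ℝ} {r : ℕ} {α : ℝ} {U : ℝ → Space N → ℝ}, IsBlowUpAnsatz p k A τ r α U →
      ∀ t ∈ Ioc 0 τ, ∀ x, |p * U t x ^ (p - 1) - linPot p (t + A x)| ≤ C * (t + A x)⁻¹ := by
  have hp := hS.one_lt
  have hmp := expo_mul hp
  have hκ := kappa_pos hp
  have hp1 : 0 < p - 1 := by linarith
  refine ⟨p * ((p - 1) * 2 ^ |p - 2|) * kappa p ^ ((p - 1) / 2), by positivity, ?_⟩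
  intro τ r α U H t ht x
  have hd := hS.dist_pos ht.1 x
  have hu := ansatzZero_pos hS ht.1 x
  set u := ansatzZero p A t x with hud
  set Y := U t x / u with hY
  have hYm : Y ∈ Icc (3 / 4 : ℝ) (5 / 4) := H.ratio_mem t ht x
  have hYu : U t x = Y * u := by rw [hY]; field_simp
  have h1 : |Y - 1| ≤ (1 + u) ^ (-((p - 1) / 2)) := by
    have := H.close t ht x
    rw [← hud, hYu] at this
    have e : Y * u - u = (Y - 1) * u := by ring
    rw [e, abs_mul, abs_of_pos hu] at this
    exact le_of_mul_le_mul_right this hu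
  have h2 : |Y ^ (p - 1) - 1| ≤ (p - 1) * 2 ^ |p - 2| * |Y - 1| := by
    have hsub : ∀ y ∈ uIcc 1 Y, y ∈ Icc (3 / 4 : ℝ) (5 / 4) := fun y hy =>
      (convex_Icc (3 / 4 : ℝ) (5 / 4)).ordConnected.uIcc_subset (by norm_num) hYm hy
    have := abs_sub_le_of_deriv (a := 1) (b := Y) (f := fun y => y ^ (p - 1))
      (f' := fun y => (p - 1) * y ^ (p - 1 - 1)) (K := (p - 1) * 2 ^ |p - 2|)
      (fun y hy => hasDerivAt_rpow_const (Or.inl (by have := hsub y hy; linarith [this.1])))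
      fun y hy => ?_
    · simpa using this
    · have hy' := hsub y hy
      have hy0 : 0 < y := by linarith [hy'.1]
      rw [abs_of_nonneg (by positivity), show p - 1 - 1 = p - 2 by ring]
      refine mul_le_mul_of_nonneg_left ?_ hp1.le
      simpa using rpow_le_two_rpow_mul (q := p - 2) one_pos (by linarith [hy'.1])
        (by linarith [hy'.2])
  have h3 : p * u ^ (p - 1) = linPot p (t + A x) := by
    rw [hud, ansatzZero_rpow hS ht.1, kappa_rpow hp, hmp, rpow_neg hd.le, rpow_two, linPot,
      div_eq_mul_inv]
    have : p * expo p = expo p + 2 := by linarith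
    calc _ = (p * expo p) * (expo p + 1) * ((t + A x) ^ 2)⁻¹ := by ring
      _ = _ := by rw [this]; ring
  have h4 : u ^ (p - 1) * (1 + u) ^ (-((p - 1) / 2)) ≤ kappa p ^ ((p - 1) / 2) * (t + A x)⁻¹ := by
    have a1 : (1 + u) ^ (-((p - 1) / 2)) ≤ u ^ (-((p - 1) / 2)) :=
      rpow_le_rpow_of_nonpos hu (by linarith) (by linarith)
    calc _ ≤ u ^ (p - 1) * u ^ (-((p - 1) / 2)) := by gcongr
      _ = u ^ ((p - 1) / 2) := by rw [← rpow_add hu]; ring_nf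
      _ = _ := by
        rw [hud, ansatzZero_rpow hS ht.1, show -(expo p * ((p - 1) / 2)) = -1 by linarith,
          Real.rpow_neg_one]
  have e1 : p * U t x ^ (p - 1) - linPot p (t + A x) = p * (u ^ (p - 1) * (Y ^ (p - 1) - 1)) := by
    rw [← h3, hYu, mul_rpow (by linarith [hYm.1]) hu.le]; ring
  rw [e1, abs_mul, abs_mul, abs_of_pos (by linarith : 0 < p), abs_of_pos (by positivity : 0 < u ^ (p - 1))]
  calc _ ≤ p * (u ^ (p - 1) * ((p - 1) * 2 ^ |p - 2| * (1 + u) ^ (-((p - 1) / 2)))) := by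
        gcongr
        exact h2.trans (by gcongr)
    _ = p * ((p - 1) * 2 ^ |p - 2|) * (u ^ (p - 1) * (1 + u) ^ (-((p - 1) / 2))) := by ring
    _ ≤ p * ((p - 1) * 2 ^ |p - 2|) * (kappa p ^ ((p - 1) / 2) * (t + A x)⁻¹) := by gcongr
    _ = _ := by ring

/-- The relative size of the time derivative of the ansatz. -/
lemma exists_deriv_le (hS : IsSetting p χ k A) (H : IsBlowUpAnsatz p k A τ r α U) :
    ∃ C, 0 < C ∧ ∀ t ∈ Ioo 0 τ, ∀ x, |deriv (fun s => U s x) t| ≤ C * ((t + A x)⁻¹ * U t x) := by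
  obtain ⟨-, C, hC, h⟩ := H.regular.deriv_order
  have hκ := kappa_pos hS.one_lt
  refine ⟨C * (4 / 3 * (kappa p)⁻¹), by positivity, fun t ht x => ?_⟩
  have hd := hS.dist_pos ht.1 x
  have h1 := (H.bounds hS ⟨ht.1, ht.2.le⟩ x).1
  refine (h t ht x).trans ?_
  have e : (t + A x) ^ (-expo p - 1) = (t + A x)⁻¹ * ((kappa p)⁻¹ * ansatzZero p A t x) := by
    rw [ansatzZero, ← expo, Real.rpow_sub_one hd.ne']; field_simp
  rw [e]
  have : C * (4 / 3 * (kappa p)⁻¹) * ((t + A x)⁻¹ * U t x)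
      = C * ((t + A x)⁻¹ * ((kappa p)⁻¹ * (4 / 3 * U t x))) := by ring
  rw [this]
  gcongr
  linarith

lemma rpow_sub_le (hS : IsSetting p χ k A) (H : IsBlowUpAnsatz p k A τ r α U) {t : ℝ}
    (ht : t ∈ Ioc 0 τ) (x : Space N) : U t x ^ (p - 1 - subExponent p)
      ≤ (5 / 4 * kappa p) ^ (p - 1 - subExponent p)
        * (t + A x) ^ (-2 + expo p * subExponent p) := by
  have hp := hS.one_lt
  have hd := hS.dist_pos ht.1 x
  have hκ := kappa_pos hp
  have hs := subExponent_le (p := p)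
  have h0 := H.pos hS ht x
  calc _ ≤ (5 / 4 * kappa p * (t + A x) ^ (-expo p)) ^ (p - 1 - subExponent p) := by
        refine rpow_le_rpow h0.le ?_ (by linarith)
        rw [mul_assoc]
        exact (H.bounds hS ht x).2
    _ = _ := by
      rw [mul_rpow (by positivity) (by positivity), ← rpow_mul hd.le]
      congr 2
      linarith [expo_mul hp]

/-- The truncation height bounds the ansatz. -/
lemma le_supNorm (hS : IsSetting p χ k A) (H : IsBlowUpAnsatz p k A τ r α U) {T t : ℝ} (hT : 0 < T)
    (ht : t ∈ Ico T τ) (x : Space N) : U t x ≤ supNorm U T τ := by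
  have hp := hS.one_lt
  have hκ := kappa_pos hp
  have hm := expo_pos hp
  have hbd : ∀ s ∈ Icc T τ, eLpNorm (U s) ∞ volume ≤ ENNReal.ofReal (5 / 4 * kappa p * T ^ (-expo p)) := by
    intro s hs
    have hs0 : s ∈ Ioc 0 τ := ⟨hT.trans_le hs.1, hs.2⟩
    refine (eLpNorm_exponent_top).le.trans (eLpNormEssSup_le_of_ae_bound (ae_of_all _ fun x => ?_))
    rw [norm_of_nonneg (H.pos hS hs0 x).le]
    refine (H.bounds hS hs0 x).2.trans ?_
    rw [mul_assoc]
    refine mul_le_mul_of_nonneg_left ?_ (by norm_num)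
    rw [ansatzZero, ← expo]
    refine mul_le_mul_of_nonneg_left ?_ hκ.le
    exact rpow_le_rpow_of_nonpos hT (by linarith [hs.1, hS.shape.nonneg x]) (by linarith)
  have hfin : (⨆ s ∈ Icc T τ, eLpNorm (U s) ∞ volume) ≠ (⊤ : ℝ≥0∞) :=
    ((iSup₂_le hbd).trans_lt ENNReal.ofReal_lt_top).ne
  have ht0 : t ∈ Ioo 0 τ := ⟨hT.trans_le ht.1, ht.2⟩
  have h1 : eLpNorm (U t) ∞ volume ≤ ⨆ s ∈ Icc T τ, eLpNorm (U s) ∞ volume :=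
    le_iSup₂_of_le t ⟨ht.1, ht.2.le⟩ le_rfl
  have hc : Continuous (U t) := H.regular.order.zero.continuous ht0
  have h2 : ∀ᵐ y, U t y ≤ supNorm U T τ := by
    filter_upwards [ae_le_eLpNormEssSup (f := U t) (μ := volume)] with y hy
    rw [← eLpNorm_exponent_top] at hy
    have := ENNReal.toReal_mono hfin (hy.trans h1)
    rw [toReal_enorm] at this
    exact (le_abs_self _).trans this
  have h3 : Dense {y | U t y ≤ supNorm U T τ} := Measure.dense_of_ae h2
  have h4 : IsClosed {y | U t y ≤ supNorm U T τ} := isClosed_le hc continuous_const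
  have : x ∈ closure {y | U t y ≤ supNorm U T τ} := h3 x
  rwa [h4.closure_eq] at this

end IsBlowUpAnsatz

end AnsatzFacts

/-! ### Solutions in the energy space, and the energy functionals -/

section EnergyCurves

variable {N : ℕ}

lemma continuous_pos : Continuous (pos : EnergySpace N → L2 N) :=
  (WithLp.continuous_fst 2 (L2 N) (L2Vec N)).comp
    (continuous_subtype_val.comp (WithLp.continuous_fst 2 (SobolevH1 N) (L2 N)))

lemma continuous_grad : Continuous (grad : EnergySpace N → L2Vec N) :=
  (WithLp.continuous_snd 2 (L2 N) (L2Vec N)).comp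
    (continuous_subtype_val.comp (WithLp.continuous_fst 2 (SobolevH1 N) (L2 N)))

lemma continuous_vel : Continuous (vel : EnergySpace N → L2 N) :=
  WithLp.continuous_snd 2 (SobolevH1 N) (L2 N)

/-- The element of the energy space with given components. -/
def energyMk (u v : L2 N) (g : L2Vec N) (h : IsWeakGradient u g) : EnergySpace N :=
  WithLp.toLp 2 (⟨WithLp.toLp 2 (u, g), h⟩, v)

lemma norm_sq_energyMk (u v : L2 N) (g : L2Vec N) (h : IsWeakGradient u g) :
    ‖energyMk u v g h‖ ^ 2 = ‖u‖ ^ 2 + ‖g‖ ^ 2 + ‖v‖ ^ 2 := by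
  rw [WithLp.prod_norm_sq_eq_of_L2, energyMk, Submodule.coe_norm, WithLp.prod_norm_sq_eq_of_L2]
  rfl

lemma isWeakGradient_sub {u u' : L2 N} {g g' : L2Vec N} (h : IsWeakGradient u g)
    (h' : IsWeakGradient u' g') : IsWeakGradient (u - u') (g - g') :=
  (SobolevH1 N).sub_mem (x := WithLp.toLp 2 (u, g)) (y := WithLp.toLp 2 (u', g')) h h'

/-- Weak gradients are unique. -/
lemma IsWeakGradient.eq_zero {g : L2Vec N} (h : IsWeakGradient 0 g) : g = 0 := by
  refine (Lp.eq_zero_iff_ae_eq_zero).2 ?_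
  refine ae_eq_zero_of_integral_contDiff_smul_eq_zero
    ((Lp.memLp g).locallyIntegrable (by norm_num)) fun φ hφ hc => ?_
  have h1 : ∫ x, (0 : L2 N) x • ∇ φ x = 0 := by
    rw [integral_eq_zero_of_ae]
    filter_upwards [Lp.coeFn_zero ℝ 2 (volume : Measure (Space N))] with x hx
    rw [hx]; simp
  have := h φ hφ hc
  rw [h1] at this
  exact neg_eq_zero.1 this.symm

variable {a b : ℝ} {u v h u' v' h' : ℝ → L2 N} {g g' : ℝ → L2Vec N}

lemma IsWaveOn.mono {a' : ℝ} (hw : IsWaveOn a b u v h g) (ha : a ≤ a') :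
    IsWaveOn a' b u v h g := by
  have hs : Ioo a' b ⊆ Ioo a b := Ioo_subset_Ioo_left ha
  exact ⟨hw.1.mono hs, hw.2.mono hs, hw.3.mono hs, fun t ht => hw.4 t (hs ht),
    fun t ht => hw.5 t (hs ht), fun φ hφ hc t ht => hw.6 φ hφ hc t (hs ht)⟩

lemma integrable_mul_testFunction (u : L2 N) {φ : Space N → ℝ} (hφ : ContDiff ℝ ∞ φ)
    (hc : HasCompactSupport φ) : Integrable fun x => u x * φ x :=
  memLp_one_iff_integrable.1 ((memLp_testFunction hφ hc).mul (Lp.memLp u) (r := 1))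

lemma integral_sub_mul_testFunction (u u' : L2 N) {φ : Space N → ℝ} (hφ : ContDiff ℝ ∞ φ)
    (hc : HasCompactSupport φ) :
    ∫ x, (u - u') x * φ x = (∫ x, u x * φ x) - ∫ x, u' x * φ x := by
  rw [← integral_sub (integrable_mul_testFunction u hφ hc) (integrable_mul_testFunction u' hφ hc)]
  refine integral_congr_ae ?_
  filter_upwards [Lp.coeFn_sub u u'] with x hx
  rw [hx, Pi.sub_apply, sub_mul]

lemma integral_inner_sub_testFunction (g g' : L2Vec N) {φ : Space N → ℝ} (hφ : ContDiff ℝ ∞ φ)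
    (hc : HasCompactSupport φ) :
    ∫ x, ⟪(g - g') x, ∇ φ x⟫_ℝ = (∫ x, ⟪g x, ∇ φ x⟫_ℝ) - ∫ x, ⟪g' x, ∇ φ x⟫_ℝ := by
  have hm := memLp_gradient_testFunction hφ hc
  rw [← inner_toLp _ hm, ← inner_toLp _ hm, ← inner_toLp _ hm, inner_sub_left]

lemma IsWaveOn.sub (hw : IsWaveOn a b u v h g) (hw' : IsWaveOn a b u' v' h' g') :
    IsWaveOn a b (fun t => u t - u' t) (fun t => v t - v' t) (fun t => h t - h' t)
      (fun t => g t - g' t) where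
  continuousOn_vel := hw.1.sub hw'.1
  continuousOn_grad := hw.2.sub hw'.2
  continuousOn_force := hw.3.sub hw'.3
  isWeakGradient t ht := isWeakGradient_sub (hw.4 t ht) (hw'.4 t ht)
  hasDerivAt t ht := (hw.5 t ht).sub (hw'.5 t ht)
  equation φ hφ hc t ht := by
    have h1 := (hw.6 φ hφ hc t ht).sub (hw'.6 φ hφ hc t ht)
    simp only [integral_sub_mul_testFunction _ _ hφ hc, integral_inner_sub_testFunction _ _ hφ hc]
    refine h1.congr_deriv ?_
    ring

/-- Finite-energy solutions of an equation with globally Lipschitz nonlinearity. -/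
lemma IsEnergySolution.isWaveOn {F : ℝ → ℝ} {T : ℝ} {u₀ v₀ : Space N → ℝ} {w : ℝ → EnergySpace N}
    (hw : IsEnergySolution F T u₀ v₀ w) {L : NNReal} (hF : LipschitzWith L F) (hF0 : F 0 = 0) (b : ℝ) :
    IsWaveOn T b (fun t => pos (w t)) (fun t => vel (w t)) (fun t => hF.compLp hF0 (pos (w t)))
      (fun t => grad (w t)) := by
  have hs : Ioo T b ⊆ Ici T := fun t ht => ht.1.le
  refine ⟨(continuous_vel.comp_continuousOn hw.continuousOn).mono hs,
    (continuous_grad.comp_continuousOn hw.continuousOn).mono hs,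
    ((hF.continuous_compLp hF0).comp_continuousOn
      (continuous_pos.comp_continuousOn hw.continuousOn)).mono hs,
    fun t ht => (w t).fst.2, fun t ht => (hw.hasDeriv t (hs ht)).hasDerivAt (Ici_mem_nhds ht.1),
    fun φ hφ hc t ht => ?_⟩
  have h1 := (hw.equation φ hφ hc t (hs ht)).hasDerivAt (Ici_mem_nhds ht.1)
  refine h1.congr_deriv ?_
  congr 1
  refine integral_congr_ae ?_
  filter_upwards [hF.coeFn_compLp hF0 (pos (w t))] with x hx
  rw [hx, Function.comp_apply]

end EnergyCurves

section PotentialContinuity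

variable {p B C L : ℝ} {f f' χ : ℝ → ℝ}

namespace IsTruncatedPower

lemma continuous_potRem (hf : IsTruncatedPower p B C L f f') :
    Continuous fun q : ℝ × ℝ => potRem f q.1 q.2 := by
  simp_rw [hf.potRem_eq]
  have h1 : Continuous fun u => ∫ s in (0 : ℝ)..u, f s :=
    continuous_iff_continuousAt.2 fun u => (hf.hasDerivAt_primitive 0 u).continuousAt
  have h2 := hf.continuous
  exact ((h1.comp (continuous_fst.add continuous_snd)).sub (h1.comp continuous_fst)).sub
    ((h2.comp continuous_fst).mul continuous_snd)

lemma continuousOn_cutoff_arg {ρ : ℝ → ℝ} (hρ : Continuous ρ) :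
    ContinuousOn (fun q : ℝ × ℝ => ρ (2 * q.2 / q.1)) {q | 0 < q.1} :=
  hρ.comp_continuousOn (((continuous_const.mul continuous_snd).continuousOn).div
    continuous_fst.continuousOn fun _ hq => (ne_of_gt hq))

lemma continuousOn_potential (hf : IsTruncatedPower p B C L f f') (hχ : IsCutoff χ) :
    ContinuousOn (fun q : ℝ × ℝ => potential χ f q.1 q.2) {q | 0 < q.1} :=
  (continuousOn_const.sub (continuousOn_cutoff_arg hχ.smooth.continuous)).mul
    hf.continuous_potRem.continuousOn

lemma continuousOn_potForce (hf : IsTruncatedPower p B C L f f') (hχ : IsCutoff χ) :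
    ContinuousOn (fun q : ℝ × ℝ => potForce χ f q.1 q.2) {q | 0 < q.1} := by
  have h1 : ContinuousOn (fun q : ℝ × ℝ => 2 / q.1) {q | 0 < q.1} :=
    continuousOn_const.div continuous_fst.continuousOn fun _ hq => (ne_of_gt hq)
  have h2 := hf.continuous
  exact ((((continuousOn_cutoff_arg hχ.contDiff_deriv.continuous).mul h1).neg).mul
    hf.continuous_potRem.continuousOn).add
    ((continuousOn_const.sub (continuousOn_cutoff_arg hχ.smooth.continuous)).mul
      ((h2.comp (continuous_fst.add continuous_snd)).sub (h2.comp continuous_fst)).continuousOn)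

lemma continuousOn_potBase (hf : IsTruncatedPower p B C L f f') (hχ : IsCutoff χ) :
    ContinuousOn (fun q : ℝ × ℝ => potBase χ f f' q.1 q.2) {q | 0 < q.1} := by
  have h1 : ContinuousOn (fun q : ℝ × ℝ => 2 * q.2 / q.1 ^ 2) {q | 0 < q.1} :=
    (continuous_const.mul continuous_snd).continuousOn.div (continuous_fst.pow 2).continuousOn
      fun _ hq => (pow_pos hq 2).ne'
  have h2 := hf.continuous
  have h3 := hf.continuous_deriv
  exact (((continuousOn_cutoff_arg hχ.contDiff_deriv.continuous).mul h1).mul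
    hf.continuous_potRem.continuousOn).add
    ((continuousOn_const.sub (continuousOn_cutoff_arg hχ.smooth.continuous)).mul
      (((h2.comp (continuous_fst.add continuous_snd)).sub (h2.comp continuous_fst)).sub
        ((h3.comp continuous_fst).mul continuous_snd)).continuousOn)

end IsTruncatedPower

end PotentialContinuity

section EnergyFunctionals

variable {N : ℕ} {p : ℝ} {χ : ℝ → ℝ} {k : ℕ} {A : Space N → ℝ}

/-- The quadratic energy functional, with weight `1 + d^(-2θ)`, `d = t + A`. -/
def quadEnergy (p : ℝ) (A : Space N → ℝ) (t : ℝ) (v u : L2 N) (g : L2Vec N) : ℝ :=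
  (∫ x, weight p (t + A x) *
    (v x ^ 2 + ‖g x‖ ^ 2 + (linPot p (t + A x) + 1) * u x ^ 2)) / 2

/-- The superquadratic part of the energy. -/
def potEnergy (p : ℝ) (A : Space N → ℝ) (χ f : ℝ → ℝ) (U : Space N → ℝ) (t : ℝ) (u : L2 N) : ℝ :=
  ∫ x, weight p (t + A x) * potential χ f (U x) (u x)

lemma quadEnergy_density_nonneg (hS : IsSetting p χ k A) {t : ℝ} (ht : 0 < t) (x : Space N)
    (v u G : ℝ) : 0 ≤ weight p (t + A x) * (v ^ 2 + G ^ 2 + (linPot p (t + A x) + 1) * u ^ 2) := by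
  have h1 := linPot_pos hS.one_lt (hS.dist_pos ht x)
  have h2 := weight_pos (p := p) (hS.dist_pos ht x)
  positivity

lemma quadEnergy_nonneg (hS : IsSetting p χ k A) {t : ℝ} (ht : 0 < t) (v u : L2 N) (g : L2Vec N) :
    0 ≤ quadEnergy p A t v u g :=
  div_nonneg (integral_nonneg fun x => quadEnergy_density_nonneg hS ht x _ _ _) two_pos.le

lemma norm_sq_eq_integral_norm {E : Type*} [NormedAddCommGroup E] [InnerProductSpace ℝ E]
    (g : LpSpace N E 2) : ‖g‖ ^ 2 = ∫ x, ‖g x‖ ^ 2 := by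
  rw [← real_inner_self_eq_norm_sq, L2.inner_def]
  refine integral_congr_ae (ae_of_all _ fun x => ?_)
  simp

lemma integral_sq_add (v u : L2 N) (g : L2Vec N) :
    Integrable (fun x => v x ^ 2 + ‖g x‖ ^ 2 + u x ^ 2) ∧
    ∫ x, (v x ^ 2 + ‖g x‖ ^ 2 + u x ^ 2) = ‖v‖ ^ 2 + ‖g‖ ^ 2 + ‖u‖ ^ 2 := by
  have i1 := (Lp.memLp v).integrable_sq
  have i2 := (memLp_two_iff_integrable_sq_norm (Lp.aestronglyMeasurable g)).1 (Lp.memLp g)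
  have i3 := (Lp.memLp u).integrable_sq
  have i12 : Integrable fun x => v x ^ 2 + ‖g x‖ ^ 2 := i1.add i2
  refine ⟨i12.add i3, ?_⟩
  rw [integral_add i12 i3, integral_add i1 i2, norm_sq_eq_integral, norm_sq_eq_integral,
    norm_sq_eq_integral_norm]

/-- The energy controls the norm of `H¹ × L²`. -/
lemma norm_sq_le_quadEnergy (hS : IsSetting p χ k A) {t : ℝ} (ht : 0 < t) (v u : L2 N)
    (g : L2Vec N) : ‖v‖ ^ 2 + ‖g‖ ^ 2 + ‖u‖ ^ 2 ≤ 2 * quadEnergy p A t v u g := by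
  obtain ⟨h1, h2⟩ := integral_sq_add v u g
  rw [quadEnergy, mul_div_cancel₀ _ two_ne_zero, ← h2]
  refine integral_mono h1 (integrable_energy_density hS ht v u g) fun x => ?_
  have h3 := linPot_pos hS.one_lt (hS.dist_pos ht x)
  have h4 := one_le_weight (p := p) (hS.dist_pos ht x)
  calc v x ^ 2 + ‖g x‖ ^ 2 + u x ^ 2
      ≤ v x ^ 2 + ‖g x‖ ^ 2 + (linPot p (t + A x) + 1) * u x ^ 2 := by
        nlinarith [mul_nonneg h3.le (sq_nonneg (u x))]
    _ ≤ _ := le_mul_of_one_le_left (by positivity) h4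

/-- Away from the blow-up time, the energy is controlled by the norm of `H¹ × L²`. -/
lemma quadEnergy_le (hS : IsSetting p χ k A) {T t : ℝ} (hT : 0 < T) (ht : T ≤ t) (v u : L2 N)
    (g : L2Vec N) : quadEnergy p A t v u g
      ≤ weight p T * (linPot p T + 1) * (‖v‖ ^ 2 + ‖g‖ ^ 2 + ‖u‖ ^ 2) := by
  have hp := hS.one_lt
  have ht0 := hT.trans_le ht
  obtain ⟨h1, h2⟩ := integral_sq_add v u g
  have hW := weight_pos (p := p) hT
  have hV := linPot_pos hp hT
  have key : 2 * quadEnergy p A t v u g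
      ≤ weight p T * (linPot p T + 1) * (‖v‖ ^ 2 + ‖g‖ ^ 2 + ‖u‖ ^ 2) := by
    rw [quadEnergy, mul_div_cancel₀ _ two_ne_zero, ← h2, ← integral_const_mul]
    refine integral_mono (integrable_energy_density hS ht0 v u g) (h1.const_mul _) fun x => ?_
    have hTd : T ≤ t + A x := by linarith [hS.shape.nonneg x]
    have h3 := linPot_pos hp (hS.dist_pos ht0 x)
    have h5 := linPot_le hp hT hTd
    have h6 := weight_le hp hT hTd
    simp only []
    rw [mul_assoc]
    refine mul_le_mul h6 ?_ (by positivity) hW.le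
    nlinarith [sq_nonneg (v x), sq_nonneg ‖g x‖, sq_nonneg (u x), mul_nonneg hV.le (sq_nonneg (v x)),
      mul_nonneg hV.le (sq_nonneg ‖g x‖), mul_le_mul_of_nonneg_right h5 (sq_nonneg (u x))]
  have h7 : 0 ≤ weight p T * (linPot p T + 1) * (‖v‖ ^ 2 + ‖g‖ ^ 2 + ‖u‖ ^ 2) := by positivity
  linarith [quadEnergy_nonneg hS ht0 v u g]

end EnergyFunctionals

/-! ### Time derivatives of the energy functionals -/

section EnergyDerivative

variable {N : ℕ} {p : ℝ} {χ : ℝ → ℝ} {k : ℕ} {A : Space N → ℝ} {τ : ℝ} {r : ℕ} {α : ℝ}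
  {U : ℝ → Space N → ℝ} {B C L M : ℝ} {f f' : ℝ → ℝ}

lemma abs_linPotDeriv (hp : 1 < p) {d : ℝ} (hd : 0 < d) :
    |linPotDeriv p d| = 2 * (d⁻¹ * linPot p d) := by
  have := expo_pos hp
  rw [linPotDeriv, abs_div, abs_neg, abs_of_pos (by positivity), abs_of_pos (by positivity), linPot]
  field_simp

lemma continuous_linPotDeriv (hS : IsSetting p χ k A) {t : ℝ} (ht : 0 < t) :
    Continuous (fun x => linPotDeriv p (t + A x)) := by
  unfold linPotDeriv
  exact continuous_const.div ((continuous_const.add hS.contDiff_one.continuous).pow 3)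
    fun x => (pow_pos (hS.dist_pos ht x) 3).ne'

lemma hasDerivAt_linearEnergy (hS : IsSetting p χ k A) {T t : ℝ} (hT : 0 < T) (ht : t ∈ Ioo T τ)
    {u : ℝ → L2 N} {v : L2 N} (hu : HasDerivAt u v t) :
    Integrable (fun x => (weightDeriv p (t + A x) * (linPot p (t + A x) + 1)
        + weight p (t + A x) * linPotDeriv p (t + A x)) / 2 * u t x ^ 2
      + weight p (t + A x) * (linPot p (t + A x) + 1) * u t x * v x) ∧
    HasDerivAt (fun s => ∫ x, weight p (s + A x) * (linPot p (s + A x) + 1) / 2 * u s x ^ 2)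
      (∫ x, ((weightDeriv p (t + A x) * (linPot p (t + A x) + 1)
          + weight p (t + A x) * linPotDeriv p (t + A x)) / 2 * u t x ^ 2
        + weight p (t + A x) * (linPot p (t + A x) + 1) * u t x * v x)) t := by
  have hp := hS.one_lt
  have hm := expo_pos hp
  have hW := weight_pos (p := p) hT
  have hV := linPot_pos hp hT
  have hA := hS.shape.nonneg
  have hd : ∀ s ∈ Ioo T τ, ∀ x, 0 < s + A x := fun s hs x => hS.dist_pos (hT.trans hs.1) x
  have hTd : ∀ s ∈ Ioo T τ, ∀ x, T ≤ s + A x := fun s hs x => by linarith [hA x, hs.1]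
  -- the coefficient of the energy density and its derivative
  let P : ℝ → ℝ := fun d => weight p d * (linPot p d + 1)
  let P' : ℝ → ℝ := fun d => weightDeriv p d * (linPot p d + 1) + weight p d * linPotDeriv p d
  have cP : ∀ s ∈ Ioo T τ, Continuous fun x => P (s + A x) := fun s hs =>
    (contDiff_weight hS (hT.trans hs.1)).continuous.mul
      ((continuous_linPot hS (hT.trans hs.1)).add continuous_const)
  have dP : ∀ s ∈ Ioo T τ, ∀ x, HasDerivAt (fun s => P (s + A x)) (P' (s + A x)) s := fun s hs x =>
    ((hasDerivAt_weight (hd s hs x)).mul ((hasDerivAt_linPot (hd s hs x)).add_const 1)).comp_add_const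
      s (A x)
  have hL₁0 : 0 < P T := by positivity
  have hP0 : ∀ s ∈ Ioo T τ, ∀ x, 0 < P (s + A x) := by
    intro s hs x
    have h2 := weight_pos (p := p) (hd s hs x)
    have h3 := linPot_pos hp (hd s hs x)
    positivity
  have b1 : ∀ s ∈ Ioo T τ, ∀ x, P (s + A x) ≤ P T := by
    intro s hs x
    have h1 := weight_le hp hT (hTd s hs x)
    have h2 := linPot_le hp hT (hTd s hs x)
    have h3 := linPot_pos hp (hd s hs x)
    simp only [P]; gcongr
  have b2 : ∀ s ∈ Ioo T τ, ∀ x, |P' (s + A x)| ≤ 2 * (expo p + 2) * T⁻¹ * P T := by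
    intro s hs x
    have h0 := hd s hs x
    have h1 := abs_weightDeriv_le hp h0
    have h2 := weight_pos (p := p) h0
    have h3 := linPot_pos hp h0
    have h4 : (s + A x)⁻¹ ≤ T⁻¹ := inv_anti₀ hT (hTd s hs x)
    have h5 := b1 s hs x
    have h6 := hP0 s hs x
    calc _ ≤ |weightDeriv p (s + A x)| * (linPot p (s + A x) + 1)
          + weight p (s + A x) * |linPotDeriv p (s + A x)| := by
          refine (abs_add_le _ _).trans (le_of_eq ?_)
          rw [abs_mul, abs_mul, abs_of_pos h2, abs_of_pos (by linarith : 0 < linPot p (s + A x) + 1)]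
      _ ≤ 2 * (expo p + 1) * ((s + A x)⁻¹ * weight p (s + A x)) * (linPot p (s + A x) + 1)
          + weight p (s + A x) * (2 * ((s + A x)⁻¹ * (linPot p (s + A x) + 1))) := by
          rw [abs_linPotDeriv hp h0]
          gcongr
          linarith
      _ = 2 * (expo p + 2) * (s + A x)⁻¹ * P (s + A x) := by simp only [P]; ring
      _ ≤ _ := by gcongr
  have hL₂ : P T ≤ P T + (expo p + 2) * T⁻¹ * P T := le_add_of_nonneg_right (by positivity)
  refine hasDerivAt_integral_comp (L := P T + (expo p + 2) * T⁻¹ * P T)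
    (Φ := fun s x e => P (s + A x) / 2 * e ^ 2) (Φ' := fun s x e => P' (s + A x) / 2 * e ^ 2)
    (ψ := fun s x e => P (s + A x) * e) ht hu
    (fun s hs => (((cP s hs).div_const 2).comp continuous_fst).mul (continuous_snd.pow 2))
    (fun s hs => ((cP s hs).comp continuous_fst).mul continuous_snd) ?_ ?_ ?_ ?_
    (fun s hs x e => ((dP s hs x).div_const 2).mul_const (e ^ 2)) ?_
    fun x e => ((dP t ht x).mul_const e).continuousAt
  · have h1 := continuous_weightDeriv hS (hT.trans ht.1)
    have h2 := continuous_linPotDeriv hS (hT.trans ht.1)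
    have h3 := continuous_linPot hS (hT.trans ht.1)
    have h4 := (contDiff_weight hS (hT.trans ht.1)).continuous
    exact ((((h1.mul (h3.add continuous_const)).add (h4.mul h2)).div_const 2).comp
      continuous_fst).mul (continuous_snd.pow 2)
  · intro s hs x e
    rw [abs_mul, abs_of_nonneg (sq_nonneg e), abs_of_pos (half_pos (hP0 s hs x))]
    gcongr
    linarith [hP0 s hs x, b1 s hs x]
  · intro s hs x e e'
    rw [show P (s + A x) / 2 * e' ^ 2 - P (s + A x) / 2 * e ^ 2 - P (s + A x) * e * (e' - e)
      = P (s + A x) / 2 * (e' - e) ^ 2 by ring, abs_mul, abs_of_nonneg (sq_nonneg (e' - e)),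
      abs_of_pos (half_pos (hP0 s hs x))]
    gcongr
    linarith [hP0 s hs x, b1 s hs x]
  · intro s hs x e
    rw [abs_mul, abs_of_pos (hP0 s hs x)]
    gcongr
    exact (b1 s hs x).trans hL₂
  · intro s hs x e
    rw [abs_mul, abs_of_nonneg (sq_nonneg e), abs_div, abs_two]
    gcongr
    linarith [b2 s hs x]

lemma hasDerivAt_potEnergy (hS : IsSetting p χ k A) (H : IsBlowUpAnsatz p k A τ r α U)
    (hf : IsTruncatedPower p B C L f f') (hM : IsCutoffBound χ M) {T t : ℝ} (hT : 0 < T)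
    (ht : t ∈ Ioo T τ) {u : ℝ → L2 N} {v : L2 N} (hu : HasDerivAt u v t) :
    Integrable (fun x => weightDeriv p (t + A x) * potential χ f (U t x) (u t x)
        + weight p (t + A x) * (potBase χ f f' (U t x) (u t x) * deriv (fun s => U s x) t)
      + weight p (t + A x) * potForce χ f (U t x) (u t x) * v x) ∧
    HasDerivAt (fun s => potEnergy p A χ f (U s) s (u s))
      (∫ x, (weightDeriv p (t + A x) * potential χ f (U t x) (u t x)
          + weight p (t + A x) * (potBase χ f f' (U t x) (u t x) * deriv (fun s => U s x) t)
        + weight p (t + A x) * potForce χ f (U t x) (u t x) * v x)) t := by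
  have hp := hS.one_lt
  have hχ := hS.cutoff
  have hm := expo_pos hp
  have hW := weight_pos (p := p) hT
  have hL := hf.nonneg
  have hM1 := hM.one_le
  obtain ⟨c, hc0, hc⟩ := H.exists_deriv_le hS
  have hI : Ioo T τ ⊆ Ioo 0 τ := Ioo_subset_Ioo_left hT.le
  have hd : ∀ s ∈ Ioo T τ, ∀ x, 0 < s + A x := fun s hs x => hS.dist_pos (hT.trans hs.1) x
  have hTd : ∀ s ∈ Ioo T τ, ∀ x, T ≤ s + A x := fun s hs x => by linarith [hS.shape.nonneg x, hs.1]
  have hU : ∀ s ∈ Ioo T τ, ∀ x, 0 < U s x := fun s hs x => H.pos hS ⟨(hI hs).1, hs.2.le⟩ x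
  have cW : ∀ s ∈ Ioo T τ, Continuous fun x => weight p (s + A x) := fun s hs =>
    (contDiff_weight hS (hT.trans hs.1)).continuous
  have cU : ∀ s ∈ Ioo T τ, Continuous (U s) := fun s hs => H.regular.order.zero.continuous (hI hs)
  have cD : Continuous fun x => deriv (fun s => U s x) t := H.regular.deriv_order.continuous (hI ht)
  have comp : ∀ {Θ : ℝ → ℝ → ℝ}, ContinuousOn (fun q : ℝ × ℝ => Θ q.1 q.2) {q | 0 < q.1} →
      ∀ s ∈ Ioo T τ, Continuous fun q : Space N × ℝ => Θ (U s q.1) q.2 := fun hΘ s hs =>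
    hΘ.comp_continuous (f := fun q : Space N × ℝ => (U s q.1, q.2))
      (((cU s hs).comp continuous_fst).prodMk continuous_snd) fun q => hU s hs q.1
  have hWs : ∀ s ∈ Ioo T τ, ∀ x, |weight p (s + A x)| ≤ weight p T := fun s hs x => by
    rw [abs_of_pos (weight_pos (hd s hs x))]
    exact weight_le hp hT (hTd s hs x)
  set K := (8 * M + 1) * L * weight p T
    + (2 * (expo p + 1) + c * (2 * M + 4)) * T⁻¹ * (L * weight p T) with hK
  have hK1 : (8 * M + 1) * L * weight p T ≤ K := le_add_of_nonneg_right (by positivity)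
  have hLW : 0 ≤ L * weight p T := by positivity
  refine hasDerivAt_integral_comp (L := K)
    (Φ := fun s x e => weight p (s + A x) * potential χ f (U s x) e)
    (Φ' := fun s x e => weightDeriv p (s + A x) * potential χ f (U s x) e
          + weight p (s + A x) * (potBase χ f f' (U s x) e * deriv (fun s => U s x) s))
    (ψ := fun s x e => weight p (s + A x) * potForce χ f (U s x) e) ht hu
    ?_ ?_ ?_ ?_ ?_ ?_ ?_ ?_ ?_
  · intro s hs
    exact ((cW s hs).comp continuous_fst).mul (comp (hf.continuousOn_potential hχ) s hs)
  · intro s hs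
    exact ((cW s hs).comp continuous_fst).mul (comp (hf.continuousOn_potForce hχ) s hs)
  · exact (((continuous_weightDeriv hS (hT.trans ht.1)).comp continuous_fst).mul
      (comp (hf.continuousOn_potential hχ) t ht)).add (((cW t ht).comp continuous_fst).mul
      ((comp (hf.continuousOn_potBase hχ) t ht).mul (cD.comp continuous_fst)))
  · intro s hs x e
    rw [abs_mul]
    calc _ ≤ weight p T * (L * e ^ 2) :=
          mul_le_mul (hWs s hs x) (hf.abs_potential_le_lipschitz hχ _ _) (abs_nonneg _) hW.le
      _ = L * weight p T * e ^ 2 := by ring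
      _ ≤ _ := by
          gcongr
          nlinarith
  · intro s hs x e e'
    have := hf.abs_potential_taylor_le hχ hM (hU s hs x) e e'
    rw [mul_assoc, ← mul_sub, ← mul_sub, abs_mul]
    calc _ ≤ weight p T * ((8 * M + 1) * L * (e' - e) ^ 2) :=
          mul_le_mul (hWs s hs x) this (abs_nonneg _) hW.le
      _ = (8 * M + 1) * L * weight p T * (e' - e) ^ 2 := by ring
      _ ≤ _ := by gcongr
  · intro s hs x e
    rw [abs_mul]
    calc _ ≤ weight p T * ((2 * M + 1) * L * |e|) :=
          mul_le_mul (hWs s hs x) (hf.abs_potForce_le_lipschitz hχ hM (hU s hs x) e)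
            (abs_nonneg _) hW.le
      _ = (2 * M + 1) * (L * weight p T) * |e| := by ring
      _ ≤ _ := by
          gcongr
          nlinarith
  · intro s hs x e
    have h1 := (hasDerivAt_weight (p := p) (hd s hs x)).comp_add_const s (A x)
    have h2 := (hf.hasDerivAt_potential_base hχ (hU s hs x) e).comp s
      (H.regular.differentiable s (hI hs) x).hasDerivAt
    exact h1.mul h2
  · intro s hs x e
    have h1 : |weightDeriv p (s + A x)| ≤ 2 * (expo p + 1) * (T⁻¹ * weight p T) := by
      refine (abs_weightDeriv_le hp (hd s hs x)).trans ?_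
      gcongr
      exacts [(weight_pos (hd s hs x)).le, hTd s hs x, weight_le hp hT (hTd s hs x)]
    have h2 : |potBase χ f f' (U s x) e * deriv (fun s => U s x) s|
        ≤ c * T⁻¹ * ((2 * M + 4) * L * e ^ 2) := by
      have hu := hU s hs x
      have h3 := hf.abs_potBase_mul_le_lipschitz hχ hM hu e
      have h4 : (s + A x)⁻¹ ≤ T⁻¹ := inv_anti₀ hT (hTd s hs x)
      rw [abs_mul, abs_of_pos hu] at h3
      rw [abs_mul]
      calc _ ≤ |potBase χ f f' (U s x) e| * (c * (T⁻¹ * U s x)) := by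
            refine mul_le_mul_of_nonneg_left ((hc s (hI hs) x).trans ?_) (abs_nonneg _)
            gcongr
        _ = c * T⁻¹ * (|potBase χ f f' (U s x) e| * U s x) := by ring
        _ ≤ _ := by gcongr
    calc _ ≤ |weightDeriv p (s + A x)| * |potential χ f (U s x) e|
          + |weight p (s + A x)| * |potBase χ f f' (U s x) e * deriv (fun s => U s x) s| := by
          refine (abs_add_le _ _).trans (le_of_eq ?_)
          rw [abs_mul, abs_mul]
      _ ≤ 2 * (expo p + 1) * (T⁻¹ * weight p T) * (L * e ^ 2)
          + weight p T * (c * T⁻¹ * ((2 * M + 4) * L * e ^ 2)) := by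
          gcongr
          · exact hf.abs_potential_le_lipschitz hχ _ _
          · exact hWs s hs x
      _ = (2 * (expo p + 1) + c * (2 * M + 4)) * T⁻¹ * (L * weight p T) * e ^ 2 := by ring
      _ ≤ _ := by
          refine mul_le_mul_of_nonneg_right ?_ (sq_nonneg e)
          rw [hK]
          exact le_add_of_nonneg_left (by positivity)
  · intro x e
    have h1 := (hasDerivAt_weight (p := p) (hd t ht x)).comp_add_const t (A x)
    have h2 : ContinuousAt (fun q : ℝ × ℝ => potForce χ f q.1 q.2) (U t x, e) :=
      (hf.continuousOn_potForce hχ).continuousAt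
        ((isOpen_lt continuous_const continuous_fst).mem_nhds (hU t ht x))
    have h3 : ContinuousAt (fun s => U s x) t := (H.regular.differentiable t (hI ht) x).continuousAt
    exact h1.continuousAt.mul (h2.comp (f := fun s => (U s x, e)) (h3.prodMk continuousAt_const))

/-- The weighted energy identity for the derivatives of first order, with the weight
`weight p (t + A)`. -/
lemma hasDerivAt_weightedKinetic (hS : IsSetting p χ k A) {T t : ℝ} (hT : 0 < T) (hτ : τ ≤ 1)
    (ht : t ∈ Ioo T τ) {u v h : ℝ → L2 N} {g : ℝ → L2Vec N} (hw : IsWaveOn T τ u v h g) :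
    Integrable (fun x => weightDeriv p (t + A x) * (v t x ^ 2 + ‖g t x‖ ^ 2) / 2
      - v t x * ⟪g t x, weightDeriv p (t + A x) • ∇ A x⟫_ℝ
      + weight p (t + A x) * (v t x * h t x)) ∧
    HasDerivAt (fun s => ∫ x, weight p (s + A x) * (v s x ^ 2 + ‖g s x‖ ^ 2) / 2)
      (∫ x, (weightDeriv p (t + A x) * (v t x ^ 2 + ‖g t x‖ ^ 2) / 2
        - v t x * ⟪g t x, weightDeriv p (t + A x) • ∇ A x⟫_ℝ
        + weight p (t + A x) * (v t x * h t x))) t := by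
  have ht0 : 0 < t := hT.trans ht.1
  have ht1 : t ∈ Ioc (0 : ℝ) 1 := ⟨ht0, ht.2.le.trans hτ⟩
  have hD := hw.hasDerivAt_kineticEnergy (isWeight_weight hS hT hτ) ht
  have mW' := memLp_weightDeriv (p := p) hS ht0
  have mZ := memLp_gradient_weight hS ht1
  have hmul : ∀ {F D : Space N → ℝ}, MemLp F ∞ volume → Integrable D →
      Integrable fun x => F x * D x := fun hF hD =>
    memLp_one_iff_integrable.1 ((memLp_one_iff_integrable.2 hD).mul' hF (r := 1))
  have iv : ∀ s, Integrable fun x => v s x ^ 2 := fun s => (Lp.memLp (v s)).integrable_sq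
  have ig : ∀ s, Integrable fun x => ‖g s x‖ ^ 2 := fun s =>
    (memLp_two_iff_integrable_sq_norm (Lp.aestronglyMeasurable _)).1 (Lp.memLp (g s))
  have ivh : Integrable fun x => v t x * h t x :=
    memLp_one_iff_integrable.1 ((Lp.memLp (h t)).mul' (Lp.memLp (v t)) (r := 1))
  have j1 : Integrable fun x => weightDeriv p (t + A x) * (v t x ^ 2 + ‖g t x‖ ^ 2) / 2 :=
    (hmul mW' ((iv t).add (ig t))).div_const 2
  have j2 : Integrable fun x => v t x * ⟪g t x, weightDeriv p (t + A x) • ∇ A x⟫_ℝ := by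
    have m1 : MemLp (fun x => v t x • ∇ (fun x => weight p (t + A x)) x) 2 volume :=
      mZ.smul (Lp.memLp (v t))
    refine (L2.integrable_inner (𝕜 := ℝ) (g t) (m1.toLp)).congr ?_
    filter_upwards [m1.coeFn_toLp] with x hx
    rw [hx, real_inner_smul_right, gradient_weight hS ht0]
  have j3 : Integrable fun x => weight p (t + A x) * (v t x * h t x) :=
    integrable_weight_mul hS ht0 ivh
  have j12 : Integrable fun x => weightDeriv p (t + A x) * (v t x ^ 2 + ‖g t x‖ ^ 2) / 2
      - v t x * ⟪g t x, weightDeriv p (t + A x) • ∇ A x⟫_ℝ := j1.sub j2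
  have hsplit : ∀ {F : Space N → ℝ} (s : ℝ), MemLp F ∞ volume →
      (∫ x, lpOf ∞ F x * (v s x * v s x)) + ∫ x, lpOf ∞ F x * ⟪g s x, g s x⟫_ℝ
        = ∫ x, F x * (v s x ^ 2 + ‖g s x‖ ^ 2) := fun {F} s hF => by
    have h1 : (∫ x, lpOf ∞ F x * (v s x * v s x)) = ∫ x, F x * v s x ^ 2 :=
      integral_congr_ae (by filter_upwards [coeFn_lpOf hF] with x hx; rw [hx, sq])
    have h2 : (∫ x, lpOf ∞ F x * ⟪g s x, g s x⟫_ℝ) = ∫ x, F x * ‖g s x‖ ^ 2 :=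
      integral_congr_ae (by
        filter_upwards [coeFn_lpOf hF] with x hx; rw [hx, real_inner_self_eq_norm_sq])
    rw [h1, h2, ← integral_add (hmul hF (iv s)) (hmul hF (ig s))]
    simp only [mul_add]
  refine ⟨j12.add j3, (hD.congr_of_eventuallyEq ?_).congr_deriv ?_⟩
  · filter_upwards [isOpen_Ioo.mem_nhds ht] with s hs
    rw [integral_div, hsplit s (memLp_weight hS (hT.trans hs.1))]
  · rw [integral_add j12 j3, integral_sub j1 j2, integral_div, hsplit t mW']
    congr 1
    · congr 1
      refine integral_congr_ae ?_
      filter_upwards [coeFn_lpOf mZ] with x hx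
      rw [hx, gradient_weight hS ht0]
    · refine integral_congr_ae ?_
      filter_upwards [coeFn_lpOf (memLp_weight (p := p) hS ht0)] with x hx
      rw [hx]

end EnergyDerivative

/-! ### The energy inequality -/

section EnergyInequality

variable {N : ℕ} {p : ℝ} {χ : ℝ → ℝ} {k : ℕ} {A : Space N → ℝ} {τ : ℝ} {r : ℕ} {α : ℝ}
  {U : ℝ → Space N → ℝ} {C₁ M η μ : ℝ}

lemma exists_energy_density_le (hS : IsSetting p χ k A) (H : IsBlowUpAnsatz p k A τ r α U)
    (hM : IsCutoffBound χ M) (hC₁ : 0 < C₁) (hη0 : 0 < η) (hη : η ≤ 1 - 1 / (k : ℝ))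
    (hη' : η ≤ subGain p) :
    ∃ C, 0 < C ∧ ∀ {B L : ℝ} {f f' : ℝ → ℝ}, IsTruncatedPower p B C₁ L f f' →
      ∀ t ∈ Ioo 0 τ, ∀ x, U t x ≤ B → ∀ (v e E K : ℝ) (G : Space N), 0 < K →
      weightDeriv p (t + A x) * (v ^ 2 + ‖G‖ ^ 2) / 2
        - v * ⟪G, weightDeriv p (t + A x) • ∇ A x⟫_ℝ
        + weight p (t + A x) * (v * (f (U t x + e) - f (U t x) + E))
        + ((weightDeriv p (t + A x) * (linPot p (t + A x) + 1)
            + weight p (t + A x) * linPotDeriv p (t + A x)) / 2 * e ^ 2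
          + weight p (t + A x) * (linPot p (t + A x) + 1) * e * v)
        - (weightDeriv p (t + A x) * potential χ f (U t x) e
          + weight p (t + A x) * (potBase χ f f' (U t x) e * deriv (fun s => U s x) t)
          + weight p (t + A x) * potForce χ f (U t x) e * v)
      ≤ C * (t ^ (-1 + η) + K * t ^ (-1 + μ)) *
          (weight p (t + A x) * (v ^ 2 + ‖G‖ ^ 2 + (linPot p (t + A x) + 1) * e ^ 2))
        + C * t ^ (-1 + η) * (weight p (t + A x) ^ (1 / 2 : ℝ) * |e|) ^ (p + 1)
        + K⁻¹ * t ^ (1 - μ) * (weight p (t + A x) * E ^ 2) := by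
  have hp := hS.one_lt
  have hχ := hS.cutoff
  have hm := expo_pos hp
  have hκ := kappa_pos hp
  have hM1 := hM.one_le
  have hs0 := subExponent_pos hp
  obtain ⟨c₁, hc₁0, hc₁⟩ := hS.exists_norm_gradient_weight_le
  obtain ⟨c₂, hc₂0, hc₂⟩ := H.exists_deriv_le hS
  obtain ⟨c₃, hc₃0, hc₃⟩ := IsBlowUpAnsatz.exists_linearization_le hS
  set c₄ := C₁ * 3 ^ (p - 1) with hc₄
  set c₅ := 2 * (2 * M + 2) * 2 ^ (p - 1) * C₁ * (5 / 4 * kappa p) ^ (p - 1 - subExponent p) with hc₅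
  have hc₅0 : 0 < c₅ := by positivity
  set C₀ := c₁ + (2 * (expo p + 1) * c₄ + c₂ * ((2 * M + 4) * c₄)) + c₃ + c₅ with hC₀
  have hC₀0 : 0 < C₀ := by positivity
  have hq0 : 0 < 2 * (expo p + 1) * c₄ + c₂ * ((2 * M + 4) * c₄) := by positivity
  obtain ⟨C, hC, hmain⟩ := energy_density_le (μ := μ) hp hS.inv_nat_mem.1 hη0 hη hη' hC₀0.le
  refine ⟨C, hC, fun {B L f f'} hf t ht x hB v e E K G hK => ?_⟩
  have hA := hS.shape.nonneg x
  have hd := hS.dist_pos ht.1 x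
  have ht1 : t ≤ 1 := ht.2.le.trans H.time_le
  have hW := weight_pos (p := p) hd
  have hU := H.pos hS ⟨ht.1, ht.2.le⟩ x
  have key := hmain t (t + A x) e v ‖G‖ (v * ⟪G, weightDeriv p (t + A x) • ∇ A x⟫_ℝ)
    (f (U t x + e) - f (U t x) + E) (potForce χ f (U t x) e)
    (weightDeriv p (t + A x) * potential χ f (U t x) e
      + weight p (t + A x) * (potBase χ f f' (U t x) e * deriv (fun s => U s x) t)) E K
    ht.1 ht1 (by linarith) hK (norm_nonneg G) ?_ ?_ ?_
  · refine le_trans (le_of_eq ?_) key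
    ring
  · rw [abs_mul]
    calc |v| * |⟪G, weightDeriv p (t + A x) • ∇ A x⟫_ℝ|
        ≤ |v| * (‖G‖ * (c₁ * ((t + A x) ^ (-(1 / (k : ℝ))) * weight p (t + A x)))) := by
          refine mul_le_mul_of_nonneg_left ((abs_real_inner_le_norm _ _).trans ?_) (abs_nonneg _)
          exact mul_le_mul_of_nonneg_left (hc₁ t ⟨ht.1, ht1⟩ x) (norm_nonneg _)
      _ = c₁ * ((t + A x) ^ (-(1 / (k : ℝ))) * weight p (t + A x)) * (|v| * ‖G‖) := by ring
      _ ≤ _ := by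
          have : c₁ ≤ C₀ := by rw [hC₀]; linarith
          gcongr
  · have h1 := abs_weightDeriv_le hp hd
    have h2 := hf.abs_potential_le hp hχ hU e
    have h3 := hf.abs_potBase_mul_le hp hχ hM hU e
    have h4 := hc₂ t ht x
    rw [abs_mul, abs_of_pos hU] at h3
    calc _ ≤ |weightDeriv p (t + A x)| * |potential χ f (U t x) e|
          + weight p (t + A x) *
            (|potBase χ f f' (U t x) e| * |deriv (fun s => U s x) t|) := by
          refine (abs_add_le _ _).trans (le_of_eq ?_)
          rw [abs_mul, abs_mul (weight p _), abs_of_pos hW, abs_mul]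
      _ ≤ 2 * (expo p + 1) * ((t + A x)⁻¹ * weight p (t + A x)) * (c₄ * |e| ^ (p + 1))
          + weight p (t + A x) *
            (|potBase χ f f' (U t x) e| * (c₂ * ((t + A x)⁻¹ * U t x))) := by
          gcongr
      _ = 2 * (expo p + 1) * ((t + A x)⁻¹ * weight p (t + A x)) * (c₄ * |e| ^ (p + 1))
          + weight p (t + A x) * (c₂ * (t + A x)⁻¹) *
            (|potBase χ f f' (U t x) e| * U t x) := by ring
      _ ≤ 2 * (expo p + 1) * ((t + A x)⁻¹ * weight p (t + A x)) * (c₄ * |e| ^ (p + 1))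
          + weight p (t + A x) * (c₂ * (t + A x)⁻¹) *
            ((2 * M + 4) * C₁ * 3 ^ (p - 1) * |e| ^ (p + 1)) := by gcongr
      _ = (2 * (expo p + 1) * c₄ + c₂ * ((2 * M + 4) * c₄))
          * ((t + A x)⁻¹ * weight p (t + A x) * |e| ^ (p + 1)) := by rw [hc₄]; ring
      _ ≤ _ := by
          have : 2 * (expo p + 1) * c₄ + c₂ * ((2 * M + 4) * c₄) ≤ C₀ := by rw [hC₀]; linarith
          gcongr
  · have h1 := hf.abs_sub_potForce_le hp hχ hM hU hs0.le subExponent_le_one e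
    have h2 := H.rpow_sub_le hS ⟨ht.1, ht.2.le⟩ x
    have h3 := hc₃ H t ⟨ht.1, ht.2.le⟩ x
    rw [← hf.deriv_eq (U t x) ⟨hU, hB⟩] at h3
    have e1 : f (U t x + e) - f (U t x) + E - linPot p (t + A x) * e - potForce χ f (U t x) e
        = (f' (U t x) - linPot p (t + A x)) * e
          + (f (U t x + e) - f (U t x) - f' (U t x) * e - potForce χ f (U t x) e) + E := by ring
    rw [e1]
    refine (abs_add_le _ _).trans (add_le_add ((abs_add_le _ _).trans (add_le_add ?_ ?_)) le_rfl)
    · rw [abs_mul]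
      calc _ ≤ c₃ * (t + A x)⁻¹ * |e| := by gcongr
        _ = c₃ * ((t + A x)⁻¹ * |e|) := by ring
        _ ≤ _ := by
            have : c₃ ≤ C₀ := by rw [hC₀]; linarith
            gcongr
    · calc _ ≤ 2 * (2 * M + 2) * 2 ^ (p - 1) * C₁ * (((5 / 4 * kappa p) ^ (p - 1 - subExponent p)
              * (t + A x) ^ (-2 + expo p * subExponent p)) * |e| ^ (1 + subExponent p)) :=
            h1.trans (by gcongr)
        _ = c₅ * ((t + A x) ^ (-2 + expo p * subExponent p) * |e| ^ (1 + subExponent p)) := by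
            rw [hc₅]; ring
        _ ≤ _ := by
            have : c₅ ≤ C₀ := by rw [hC₀]; linarith
            gcongr

/-- The superquadratic part of the energy is a higher order term. -/
lemma exists_abs_potEnergy_le (hS : IsSetting p χ k A) (H : IsBlowUpAnsatz p k A τ r α U)
    (hN : 1 ≤ N) (hp' : 3 ≤ N → p < ((N : ℝ) + 2) / ((N : ℝ) - 2)) (hC₁ : 0 < C₁) :
    ∃ C, 0 < C ∧ ∀ {B L : ℝ} {f f' : ℝ → ℝ}, IsTruncatedPower p B C₁ L f f' →
      ∀ t ∈ Ioc 0 τ, ∀ (v u : L2 N) (g : L2Vec N), IsWeakGradient u g →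
      |potEnergy p A χ f (U t) t u| ≤ C * quadEnergy p A t v u g ^ ((p + 1) / 2) := by
  have hp := hS.one_lt
  obtain ⟨C, hC, hsob⟩ := exists_energy_sobolev hS hN hp'
  refine ⟨C₁ * 3 ^ (p - 1) * (C * 2 ^ ((p + 1) / 2)), by positivity, fun {B L f f'} hf t ht v u g hg => ?_⟩
  obtain ⟨h1, h2⟩ := hsob t ⟨ht.1, ht.2.trans H.time_le⟩ v u g hg
  have e1 : ∫ x, weight p (t + A x) *
      (v x ^ 2 + ‖g x‖ ^ 2 + (linPot p (t + A x) + 1) * u x ^ 2) = 2 * quadEnergy p A t v u g := by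
    rw [quadEnergy]; ring
  rw [e1, mul_rpow two_pos.le (quadEnergy_nonneg hS ht.1 v u g)] at h2
  have h3 : |potEnergy p A χ f (U t) t u| ≤ ∫ x, C₁ * 3 ^ (p - 1) *
      (weight p (t + A x) ^ (1 / 2 : ℝ) * |u x|) ^ (p + 1) := by
    rw [← norm_eq_abs, potEnergy]
    refine norm_integral_le_of_norm_le (h1.const_mul _) (ae_of_all _ fun x => ?_)
    have hd := hS.dist_pos ht.1 x
    have hW := weight_pos (p := p) hd
    rw [norm_eq_abs, abs_mul, abs_of_pos hW]
    calc _ ≤ weight p (t + A x) * (C₁ * 3 ^ (p - 1) * |u x| ^ (p + 1)) := by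
          gcongr
          exact hf.abs_potential_le hp hS.cutoff (H.pos hS ht x) _
      _ = C₁ * 3 ^ (p - 1) * (weight p (t + A x) * |u x| ^ (p + 1)) := by ring
      _ ≤ _ := mul_le_mul_of_nonneg_left (rpow_le_weight_rpow_mul hd hp _) (by positivity)
  rw [integral_const_mul] at h3
  refine h3.trans ?_
  rw [mul_assoc (C₁ * 3 ^ (p - 1)), mul_assoc C]
  exact mul_le_mul_of_nonneg_left h2 (by positivity)

/-- The energy inequality for the difference between a solution of the truncated equation and the
ansatz. The first conclusion is the differentiability of the quadratic energy. -/
lemma exists_energy_inequality (hS : IsSetting p χ k A) (H : IsBlowUpAnsatz p k A τ r α U)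
    (hL : MemLp (ansatzZero p A 1) 2 volume)
    (hN : 1 ≤ N) (hp' : 3 ≤ N → p < ((N : ℝ) + 2) / ((N : ℝ) - 2))
    (hM : IsCutoffBound χ M) (hC₁ : 0 < C₁) (hη0 : 0 < η) (hη : η ≤ 1 - 1 / (k : ℝ))
    (hη' : η ≤ subGain p) :
    ∃ C, 0 < C ∧ ∀ {B L : ℝ} {f f' : ℝ → ℝ}, IsTruncatedPower p B C₁ L f f' →
      ∀ {T : ℝ}, 0 < T → (∀ t ∈ Ico T τ, ∀ x, U t x ≤ B) →
      ∀ {u v h : ℝ → L2 N} {g : ℝ → L2Vec N}, IsWaveOn T τ u v h g →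
      (∀ t ∈ Ioo T τ, ∀ᵐ x, h t x = f (U t x + u t x) - f (U t x) + residual p U t x) →
      ∀ t ∈ Ioo T τ, (∃ D, HasDerivAt (fun s => quadEnergy p A s (v s) (u s) (g s)) D t) ∧
        ∃ D, HasDerivAt (fun s => quadEnergy p A s (v s) (u s) (g s)
            - potEnergy p A χ f (U s) s (u s)) D t ∧
          ∀ K, 0 < K → D ≤ C * (t ^ (-1 + η) + K * t ^ (-1 + rate p / 2))
                * quadEnergy p A t (v t) (u t) (g t)
              + C * t ^ (-1 + η) * quadEnergy p A t (v t) (u t) (g t) ^ ((p + 1) / 2)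
              + C * K⁻¹ * t ^ (-1 + rate p / 2) := by
  obtain ⟨c₁, hc₁0, hdens⟩ := exists_energy_density_le (μ := rate p / 2) hS H hM hC₁ hη0 hη hη'
  obtain ⟨c₂, hc₂0, hsob⟩ := exists_energy_sobolev hS hN hp'
  obtain ⟨c₃, hc₃0, hres⟩ := H.exists_residual_weighted_le hS hL
  refine ⟨2 * c₁ + c₁ * (c₂ * 2 ^ ((p + 1) / 2)) + c₃, by positivity, ?_⟩
  intro B L f f' hf T hT hB u v h g hw hh t ht
  have ht0 : 0 < t := hT.trans ht.1
  have htτ : t ∈ Ioo 0 τ := ⟨ht0, ht.2⟩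
  obtain ⟨i0, d0⟩ := hasDerivAt_weightedKinetic hS hT H.time_le ht hw
  obtain ⟨i1, d1⟩ := hasDerivAt_linearEnergy hS hT ht (hw.hasDerivAt t ht)
  obtain ⟨i2, d2⟩ := hasDerivAt_potEnergy hS H hf hM hT ht (hw.hasDerivAt t ht)
  have hQ := ((d0.add d1).congr_of_eventuallyEq (f₁ := fun s => quadEnergy p A s (v s) (u s) (g s)) (by
    filter_upwards [isOpen_Ioo.mem_nhds ht] with s hs
    have hs0 : 0 < s := hT.trans hs.1
    have a1 : Integrable fun x => weight p (s + A x) * (v s x ^ 2 + ‖g s x‖ ^ 2) / 2 :=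
      (integrable_weight_mul hS hs0 ((Lp.memLp (v s)).integrable_sq.add
        ((memLp_two_iff_integrable_sq_norm (Lp.aestronglyMeasurable (g s))).1
          (Lp.memLp (g s))))).div_const 2
    have a2 : Integrable fun x => weight p (s + A x) * (linPot p (s + A x) + 1) / 2 * u s x ^ 2 := by
      have := (((integrable_energy_density (p := p) hS hs0 (v s) (u s) (g s)).div_const 2).sub a1)
      refine this.congr (ae_of_all _ fun x => ?_)
      simp only [Pi.sub_apply]
      ring
    simp only [Pi.add_apply]
    rw [quadEnergy, ← integral_div, ← integral_add a1 a2]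
    refine integral_congr_ae (ae_of_all _ fun x => ?_)
    simp only []
    ring))
  refine ⟨⟨_, hQ⟩, _, hQ.sub d2, fun K hK => ?_⟩
  set Q := quadEnergy p A t (v t) (u t) (g t) with hQd
  have hQ0 : 0 ≤ Q := quadEnergy_nonneg hS ht0 _ _ _
  have jd := integrable_energy_density (p := p) hS ht0 (v t) (u t) (g t)
  obtain ⟨js, bs⟩ := hsob t ⟨ht0, ht.2.le.trans H.time_le⟩ (v t) (u t) (g t) (hw.isWeakGradient t ht)
  obtain ⟨jr, br⟩ := hres t htτ
  have e1 : ∫ x, weight p (t + A x) *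
      (v t x ^ 2 + ‖g t x‖ ^ 2 + (linPot p (t + A x) + 1) * u t x ^ 2) = 2 * Q := by
    rw [hQd, quadEnergy]; ring
  rw [e1, mul_rpow two_pos.le hQ0] at bs
  have e0 := integral_sub (i0.add i1) i2
  rw [← integral_add i0 i1]
  refine e0.symm.le.trans ?_
  set P₁ := c₁ * (t ^ (-1 + η) + K * t ^ (-1 + rate p / 2)) with hP₁
  set P₂ := c₁ * t ^ (-1 + η) with hP₂
  set P₃ := K⁻¹ * t ^ (1 - rate p / 2) with hP₃
  have hP₂0 : 0 ≤ P₂ := by positivity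
  have hP₃0 : 0 ≤ P₃ := by positivity
  have jsum := ((jd.const_mul P₁).add (js.const_mul P₂)).add (jr.const_mul P₃)
  refine (integral_mono_ae ((i0.add i1).sub i2) jsum ?_).trans ?_
  · filter_upwards [hh t ht] with x hx
    have := hdens hf t htτ x (hB t ⟨ht.1.le, ht.2⟩ x) (v t x) (u t x) (residual p U t x) K (g t x) hK
    simp only [Pi.add_apply, Pi.sub_apply]
    rw [hx]
    exact this
  · have e2 := integral_add ((jd.const_mul P₁).add (js.const_mul P₂)) (jr.const_mul P₃)
    have e3 := integral_add (jd.const_mul P₁) (js.const_mul P₂)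
    simp only [integral_const_mul] at e2 e3
    simp only [Pi.add_apply] at e2 e3 ⊢
    rw [e2, e3, e1]
    have hrp : t ^ (1 - rate p / 2) * t ^ (-2 + rate p) = t ^ (-1 + rate p / 2) := by
      rw [← rpow_add ht0]; ring_nf
    have b1 : P₃ * ∫ x, weight p (t + A x) * residual p U t x ^ 2
        ≤ c₃ * K⁻¹ * t ^ (-1 + rate p / 2) := by
      refine (mul_le_mul_of_nonneg_left br hP₃0).trans (le_of_eq ?_)
      rw [← hrp, hP₃]; ring
    have b2 := mul_le_mul_of_nonneg_left bs hP₂0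
    set X₁ := (t ^ (-1 + η) + K * t ^ (-1 + rate p / 2)) * Q with hX₁
    have hX₁0 : 0 ≤ X₁ := by positivity
    set X₂ := t ^ (-1 + η) * Q ^ ((p + 1) / 2) with hX₂
    have hX₂0 : 0 ≤ X₂ := by positivity
    set X₃ := K⁻¹ * t ^ (-1 + rate p / 2) with hX₃
    have hX₃0 : 0 ≤ X₃ := by positivity
    set c₄ := c₂ * 2 ^ ((p + 1) / 2) with hc₄
    calc _ ≤ P₁ * (2 * Q) + P₂ * (c₂ * (2 ^ ((p + 1) / 2) * Q ^ ((p + 1) / 2)))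
          + c₃ * K⁻¹ * t ^ (-1 + rate p / 2) := add_le_add (add_le_add le_rfl b2) b1
      _ = 2 * c₁ * X₁ + c₁ * c₄ * X₂ + c₃ * X₃ := by
          rw [hP₁, hP₂, hX₁, hX₂, hX₃, hc₄]; ring
      _ ≤ (2 * c₁ + c₁ * c₄ + c₃) * X₁ + (2 * c₁ + c₁ * c₄ + c₃) * X₂
          + (2 * c₁ + c₁ * c₄ + c₃) * X₃ := by
          have : 0 < c₁ * c₄ := by positivity
          refine add_le_add (add_le_add ?_ ?_) ?_ <;>
            refine mul_le_mul_of_nonneg_right (by linarith) (by assumption)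
      _ = _ := by rw [hX₁, hX₂, hX₃]; ring

end EnergyInequality

/-! ### Stability of the ansatz -/

section Stability

variable {N : ℕ} {p : ℝ} {χ : ℝ → ℝ} {k : ℕ} {A : Space N → ℝ} {τ : ℝ} {r : ℕ} {α : ℝ}
  {U : ℝ → Space N → ℝ}

/-- A finite-energy solution can only start from the ansatz if the latter is square integrable. -/
lemma memLp_of_isEnergySolution (hS : IsSetting p χ k A) (H : IsBlowUpAnsatz p k A τ r α U)
    {F : ℝ → ℝ} {T : ℝ} (hT : T ∈ Ioo 0 τ) {v₀ : Space N → ℝ} {w : ℝ → EnergySpace N}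
    (hw : IsEnergySolution F T (U T) v₀ w) : MemLp (ansatzZero p A 1) 2 volume := by
  have hκ := kappa_pos hS.one_lt
  have hm := expo_pos hS.one_lt
  have hc : Continuous (ansatzZero p A 1) := by
    unfold ansatzZero
    exact continuous_const.mul ((continuous_const.add hS.contDiff_one.continuous).rpow_const
      fun x => Or.inl (hS.dist_pos one_pos x).ne')
  refine (Lp.memLp (pos (w T))).of_le_mul (c := 4 / 3) hc.aestronglyMeasurable ?_
  filter_upwards [hw.initial_pos] with x hx
  have h1 := (H.bounds hS ⟨hT.1, hT.2.le⟩ x).1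
  have h2 := H.pos hS ⟨hT.1, hT.2.le⟩ x
  have h3 : ansatzZero p A 1 x ≤ ansatzZero p A T x :=
    mul_le_mul_of_nonneg_left (rpow_le_rpow_of_nonpos (hS.dist_pos hT.1 x)
      (by linarith [hT.2, H.time_le]) (neg_nonpos.2 hm.le)) hκ.le
  rw [hx, norm_of_nonneg (ansatzZero_pos hS one_pos x).le, norm_of_nonneg h2.le]
  linarith

lemma IsTruncatedPower.lipschitzWith {B C L : ℝ} {f f' : ℝ → ℝ}
    (hf : IsTruncatedPower p B C L f f') : LipschitzWith ⟨L, hf.nonneg⟩ f :=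
  LipschitzWith.of_dist_le_mul fun u v => by
    rw [Real.dist_eq, Real.dist_eq]
    exact hf.lipschitz v u

/-- Continuity at the initial time of a curve in the energy space for the quadratic energy. -/
lemma continuousWithinAt_quadEnergy (hS : IsSetting p χ k A) {T : ℝ} {s : Set ℝ} (hT : 0 < T)
    (hs : s ⊆ Ici T) {u v : ℝ → L2 N} {g : ℝ → L2Vec N} (hu : ContinuousWithinAt u s T)
    (hv : ContinuousWithinAt v s T) (hg : ContinuousWithinAt g s T) (hu0 : u T = 0) (hv0 : v T = 0)
    (hg0 : g T = 0) :
    quadEnergy p A T (v T) (u T) (g T) = 0 ∧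
      Tendsto (fun t => quadEnergy p A t (v t) (u t) (g t)) (𝓝[s] T) (𝓝 0) := by
  have e0 : ‖v T‖ ^ 2 + ‖g T‖ ^ 2 + ‖u T‖ ^ 2 = 0 := by simp [hu0, hv0, hg0]
  constructor
  · have h1 := quadEnergy_le hS hT le_rfl (v T) (u T) (g T)
    rw [e0, mul_zero] at h1
    exact le_antisymm h1 (quadEnergy_nonneg hS hT _ _ _)
  · have h1 : Tendsto (fun t => weight p T * (linPot p T + 1)
        * (‖v t‖ ^ 2 + ‖g t‖ ^ 2 + ‖u t‖ ^ 2)) (𝓝[s] T) (𝓝 0) := by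
      have := (((hv.norm.pow 2).add (hg.norm.pow 2)).add (hu.norm.pow 2)).tendsto.const_mul
        (weight p T * (linPot p T + 1))
      simp only [Pi.add_apply, Pi.pow_apply] at this
      rwa [e0, mul_zero] at this
    refine squeeze_zero' ?_ ?_ h1
    · filter_upwards [self_mem_nhdsWithin] with t ht
      exact quadEnergy_nonneg hS (hT.trans_le (hs ht)) _ _ _
    · filter_upwards [self_mem_nhdsWithin] with t ht
      exact quadEnergy_le hS hT (hs ht) _ _ _

/-- Stability of the ansatz: solutions of the truncated equation that start from it at a time
`T > 0` stay close to it for a time that does not depend on `T`. -/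
lemma exists_stability (hS : IsSetting p χ k A) (H : IsBlowUpAnsatz p k A τ r α U)
    (hL : MemLp (ansatzZero p A 1) 2 volume)
    (hN : 1 ≤ N) (hp' : 3 ≤ N → p < ((N : ℝ) + 2) / ((N : ℝ) - 2)) :
    ∃ C δ₀ : ℝ, 0 < C ∧ 0 < δ₀ ∧ δ₀ < 1 ∧ ∀ T T' : ℝ, 0 < T → T < T' → T' ≤ T + δ₀ → T' < τ →
      ∀ w : ℝ → EnergySpace N,
        IsEnergySolution (truncNonlin p χ (supNorm U T τ)) T (U T)
          (fun x => deriv (fun s => U s x) T) w →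
        ∀ t ∈ Icc T T', ∃ ε : EnergySpace N, (∀ᵐ x, pos (w t) x = U t x + pos ε x) ∧
          (∀ᵐ x, vel (w t) x = deriv (fun s => U s x) t + vel ε x) ∧
          ‖ε‖ ≤ C * (t - T) ^ (rate p / 2) := by
  have hp := hS.one_lt
  have hχ := hS.cutoff
  have hr := rate_pos hp
  have hr2 := rate_le_half (p := p)
  have hk := hS.inv_nat_mem
  obtain ⟨M, hM⟩ := hχ.exists_bound
  obtain ⟨C₁, hC₁, htrunc⟩ := exists_isTruncatedPower hp hχ
  set η := min (1 - 1 / (k : ℝ)) (subGain p)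
  have hη0 : 0 < η := lt_min (by linarith) (subGain_pos hp)
  have hη1 : η ≤ 1 := (min_le_right _ _).trans subGain_le_one
  obtain ⟨c₁, hc₁, hpot⟩ := exists_abs_potEnergy_le hS H hN hp' hC₁
  obtain ⟨c₂, hc₂, hineq⟩ := exists_energy_inequality hS H hL hN hp' hM hC₁ hη0
    (min_le_left _ _) (min_le_right _ _)
  obtain ⟨δ₀, C', hδ₀, hδ₁, hC', hboot⟩ := exists_bootstrap (q := (p + 1) / 2) (η := η)
    (μ := rate p / 2) (C := c₁ + c₂) (by linarith) hη0 hη1 (by linarith) (by linarith) (by linarith)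
  refine ⟨√(2 * C'), δ₀, by positivity, hδ₀, hδ₁, fun T T' hT hTT' hT' hT'τ w hw => ?_⟩
  have hTτ : T < τ := hTT'.trans hT'τ
  -- the truncated nonlinearity
  have hUB : ∀ t ∈ Ico T τ, ∀ x, U t x ≤ supNorm U T τ := fun t ht x => H.le_supNorm hS hT ht x
  set B := supNorm U T τ with hB
  have hB0 : 0 < B := (H.pos hS ⟨hT, hTτ.le⟩ 0).trans_le (hUB T ⟨le_rfl, hTτ⟩ 0)
  obtain ⟨L, hf⟩ := htrunc B hB0
  have hF := hf.lipschitzWith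
  -- the ansatz as a curve in the energy space
  have hI' : Ico T τ ⊆ Ioo (T / 2) τ := fun t ht => ⟨by linarith [ht.1], ht.2⟩
  obtain ⟨hmem, hW⟩ := H.isWaveOn hS hL (a := T / 2) (by linarith)
    (by linarith [H.time_le])
  -- the difference
  set u : ℝ → L2 N := fun t => pos (w t) - lpOf 2 (U t) with hu
  set v : ℝ → L2 N := fun t => vel (w t) - lpOf 2 fun x => deriv (fun s => U s x) t with hv
  set g : ℝ → L2Vec N := fun t => grad (w t) - lpOf 2 (∇ (U t))
  have hD := (hw.isWaveOn hF hf.zero τ).sub (hW.mono (a' := T) (by linarith))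
  have au : ∀ t ∈ Ico T τ, ∀ᵐ x, pos (w t) x = U t x + u t x := fun t ht => by
    filter_upwards [Lp.coeFn_sub (pos (w t)) (lpOf 2 (U t)), coeFn_lpOf (hmem t (hI' ht)).1] with x h1 h2
    rw [hu]
    simp only []
    rw [h1, Pi.sub_apply, h2]; ring
  have av : ∀ t ∈ Ico T τ, ∀ᵐ x, vel (w t) x = deriv (fun s => U s x) t + v t x := fun t ht => by
    filter_upwards [Lp.coeFn_sub (vel (w t)) (lpOf 2 fun x => deriv (fun s => U s x) t),
      coeFn_lpOf (hmem t (hI' ht)).2.1] with x h1 h2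
    rw [hv]
    simp only []
    rw [h1, Pi.sub_apply, h2]; ring
  have hweak : ∀ t ∈ Ico T τ, IsWeakGradient (u t) (g t) := fun t ht =>
    isWeakGradient_sub (w t).fst.2 (hW.isWeakGradient t (hI' ht))
  have hforce : ∀ t ∈ Ioo T τ, ∀ᵐ x, (hF.compLp hf.zero (pos (w t))
      - lpOf 2 fun x => nonlin p (U t x) - residual p U t x : L2 N) x
      = truncNonlin p χ B (U t x + u t x) - truncNonlin p χ B (U t x) + residual p U t x := by
    intro t ht
    have ht' : t ∈ Ico T τ := ⟨ht.1.le, ht.2⟩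
    filter_upwards [Lp.coeFn_sub (hF.compLp hf.zero (pos (w t)))
      (lpOf 2 fun x => nonlin p (U t x) - residual p U t x), hF.coeFn_compLp hf.zero (pos (w t)),
      coeFn_lpOf (hmem t (hI' ht')).2.2, au t ht'] with x h1 h2 h3 h4
    have hUx := H.pos hS ⟨hT.trans ht.1, ht.2.le⟩ x
    rw [h1, Pi.sub_apply, h2, h3, Function.comp_apply, h4, hf.eq _ ⟨hUx, hUB t ht' x⟩,
      nonlin_of_pos hUx]
    ring
  -- the initial time
  have hT0 : T ∈ Ico T τ := ⟨le_rfl, hTτ⟩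
  have hu0 : u T = 0 := by
    refine sub_eq_zero.2 (Lp.ext ?_)
    filter_upwards [hw.initial_pos, coeFn_lpOf (hmem T (hI' hT0)).1] with x h1 h2
    rw [h1, h2]
  have hv0 : v T = 0 := by
    refine sub_eq_zero.2 (Lp.ext ?_)
    filter_upwards [hw.initial_vel, coeFn_lpOf (hmem T (hI' hT0)).2.1] with x h1 h2
    rw [h1, h2]
  have hg0 : g T = 0 := by
    have := hweak T hT0
    rw [hu0] at this
    exact this.eq_zero
  have hsub : Icc T T' ⊆ Ici T := fun t ht => ht.1
  have hTm : T ∈ Icc T T' := ⟨le_rfl, hTT'.le⟩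
  have hWT : Ioo (T / 2) τ ∈ 𝓝 T := isOpen_Ioo.mem_nhds (hI' hT0)
  have cw : ContinuousWithinAt w (Icc T T') T := (hw.continuousOn T self_mem_Ici).mono hsub
  have cu : ContinuousWithinAt u (Icc T T') T :=
    (continuous_pos.continuousAt.comp_continuousWithinAt cw).sub
      (hW.hasDerivAt T (hI' hT0)).continuousAt.continuousWithinAt
  have cv : ContinuousWithinAt v (Icc T T') T :=
    (continuous_vel.continuousAt.comp_continuousWithinAt cw).sub
      (hW.continuousOn_vel.continuousAt hWT).continuousWithinAt
  have cg : ContinuousWithinAt g (Icc T T') T :=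
    (continuous_grad.continuousAt.comp_continuousWithinAt cw).sub
      (hW.continuousOn_grad.continuousAt hWT).continuousWithinAt
  obtain ⟨hQ0, hQT⟩ := continuousWithinAt_quadEnergy (p := p) hS hT hsub cu cv cg hu0 hv0 hg0
  -- the energies
  have hJ : ∀ t ∈ Icc T T', t = T ∨ t ∈ Ioo T τ := fun t ht =>
    ht.1.eq_or_lt.imp Eq.symm fun h => ⟨h, ht.2.trans_lt hT'τ⟩
  have hJ' : ∀ t ∈ Icc T T', t ∈ Ico T τ := fun t ht => ⟨ht.1, ht.2.trans_lt hT'τ⟩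
  have hen := hineq hf hT hUB hD hforce
  have hQn : ∀ t ∈ Icc T T', 0 ≤ quadEnergy p A t (v t) (u t) (g t) := fun t ht =>
    quadEnergy_nonneg hS (hT.trans_le ht.1) _ _ _
  have hP : ∀ t ∈ Icc T T', |potEnergy p A χ (truncNonlin p χ B) (U t) t (u t)|
      ≤ c₁ * quadEnergy p A t (v t) (u t) (g t) ^ ((p + 1) / 2) := fun t ht =>
    hpot hf t ⟨hT.trans_le ht.1, (hJ' t ht).2.le⟩ _ _ _ (hweak t (hJ' t ht))
  have hPT : Tendsto (fun t => potEnergy p A χ (truncNonlin p χ B) (U t) t (u t))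
      (𝓝[Icc T T'] T) (𝓝 0) := by
    have h1 := (hQT.rpow_const (p := (p + 1) / 2) (Or.inr (by linarith))).const_mul c₁
    rw [zero_rpow (by linarith), mul_zero] at h1
    refine squeeze_zero_norm' ?_ h1
    filter_upwards [self_mem_nhdsWithin] with t ht using hP t ht
  have hP0 : potEnergy p A χ (truncNonlin p χ B) (U T) T (u T) = 0 := by
    have := hP T hTm
    rw [hQ0, zero_rpow (by linarith), mul_zero] at this
    exact abs_nonpos_iff.1 this
  have hcQ : ContinuousOn (fun t => quadEnergy p A t (v t) (u t) (g t)) (Icc T T') := by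
    intro t ht
    rcases hJ t ht with rfl | h
    · rw [ContinuousWithinAt, hQ0]; exact hQT
    · obtain ⟨D, h1⟩ := (hen t h).1
      exact h1.continuousAt.continuousWithinAt
  have hcG : ContinuousOn (fun t => quadEnergy p A t (v t) (u t) (g t)
      - potEnergy p A χ (truncNonlin p χ B) (U t) t (u t)) (Icc T T') := by
    intro t ht
    rcases hJ t ht with rfl | h
    · rw [ContinuousWithinAt, hQ0, hP0]; exact hQT.sub hPT
    · obtain ⟨D, h1, -⟩ := (hen t h).2
      exact h1.continuousAt.continuousWithinAt
  have hJo : ∀ t ∈ Ioo T T', t ∈ Ioo T τ := fun t ht => ⟨ht.1, ht.2.trans hT'τ⟩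
  choose! G' hG' using fun t ht => (hen t ht).2
  have hfin := hboot T T' _ _ G' hT hT' hcQ hcG hQ0 hQn (fun t ht => ?_)
    (fun t ht => (hG' t (hJo t ht)).1) (fun t ht K hK => ?_)
  · intro t ht
    refine ⟨energyMk (u t) (v t) (g t) (hweak t (hJ' t ht)), au t (hJ' t ht), av t (hJ' t ht), ?_⟩
    have h0 : 0 ≤ t - T := sub_nonneg.2 ht.1
    have h1 := norm_sq_energyMk (u t) (v t) (g t) (hweak t (hJ' t ht))
    have h2 := norm_sq_le_quadEnergy hS (hT.trans_le ht.1) (v t) (u t) (g t)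
    have h3 := hfin t ht
    refine (pow_le_pow_iff_left₀ (norm_nonneg _) (by positivity) two_ne_zero).1 ?_
    rw [h1, mul_pow, Real.sq_sqrt (by positivity), ← Real.rpow_mul_natCast h0]
    have e : rate p / 2 * ((2 : ℕ) : ℝ) = 2 * (rate p / 2) := by push_cast; ring
    rw [e]
    linarith
  · rw [sub_sub_cancel_left, abs_neg]
    refine (hP t ht).trans (mul_le_mul_of_nonneg_right (by linarith) ?_)
    exact rpow_nonneg (hQn t ht) _
  · refine ((hG' t (hJo t ht)).2 K hK).trans ?_
    have ht0 : 0 < t := hT.trans ht.1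
    have k3 := hQn t ⟨ht.1.le, ht.2.le⟩
    have k4 : c₂ ≤ c₁ + c₂ := by linarith
    gcongr

end Stability

end NLW

end

theorem proposition2 (N : ℕ) (hN : 1 ≤ N) (p : ℝ) (hp : 1 < p)
    (hp' : 3 ≤ N → p < ((N : ℝ) + 2) / ((N : ℝ) - 2))
    (χ : ℝ → ℝ) (hχ : IsCutoff χ)
    (k : ℕ) (hk : 2 * numSteps p + 2 ≤ k)
    (hk' : 2 * (p + 1) / (rate p * (p - 1)) + 2 ≤ (k : ℝ))
    (A : Space N → ℝ) (hA : IsBlowUpShape k A) :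
    (∃ a τ : ℕ → ℝ, IsParameterChoice p χ A a τ) ∧
    ∀ a τ : ℕ → ℝ, IsParameterChoice p χ A a τ →
      ∃ (C : ℝ) (n₀ : ℕ) (δ₀ : ℝ), 0 < C ∧ 0 < n₀ ∧ 0 < δ₀ ∧ δ₀ < 1 ∧
        ∀ n : ℕ, n₀ ≤ n →
          1 / (n : ℝ) + δ₀ ≤ τ (numSteps p) ∧
          ∀ w : ℝ → EnergySpace N,
            IsEnergySolution
              (truncNonlin p χ
                (supNorm (ansatz p χ A a τ (numSteps p)) (1 / (n : ℝ)) (τ (numSteps p))))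
              (1 / (n : ℝ))
              (fun x => ansatz p χ A a τ (numSteps p) (1 / (n : ℝ)) x)
              (fun x => deriv (fun s => ansatz p χ A a τ (numSteps p) s x) (1 / (n : ℝ)))
              w →
            ∀ t ∈ Set.Icc (1 / (n : ℝ)) (1 / (n : ℝ) + δ₀),
              ∃ ε : EnergySpace N,
                (∀ᵐ x, pos (w t) x = ansatz p χ A a τ (numSteps p) t x + pos ε x) ∧
                (∀ᵐ x, vel (w t) x
                  = deriv (fun s => ansatz p χ A a τ (numSteps p) s x) t + vel ε x) ∧
                ‖ε‖ ≤ C * (t - 1 / (n : ℝ)) ^ (rate p / 2) := by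
  have hS : IsSetting p χ k A := ⟨hp, hχ, hk', hA⟩
  refine ⟨?_, fun a τ hpar => ?_⟩
  · obtain ⟨a, τ, h⟩ := exists_parameterChoiceUpTo hS le_rfl
    exact ⟨a, τ, (isParameterChoice_iff hp).2 h⟩
  have H := isBlowUpAnsatz_ansatz hS ((isParameterChoice_iff hp).1 hpar)
  have hτ := H.time_pos
  have hτ1 := H.time_le
  obtain ⟨n₀, hn₀⟩ := exists_nat_ge (4 / τ (numSteps p))
  have hn₀0 : 0 < n₀ := by
    have : (0 : ℝ) < n₀ := lt_of_lt_of_le (by positivity) hn₀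
    exact_mod_cast this
  have hn : ∀ n : ℕ, n₀ ≤ n → 0 < 1 / (n : ℝ) ∧ 1 / (n : ℝ) ≤ τ (numSteps p) / 4 := by
    intro n hn
    have h1 : (n₀ : ℝ) ≤ n := by exact_mod_cast hn
    have h2 : (0 : ℝ) < n := by exact_mod_cast hn₀0.trans_le hn
    refine ⟨by positivity, ?_⟩
    rw [div_le_iff₀ h2]
    have := (div_le_iff₀ hτ).1 (hn₀.trans h1)
    linarith
  by_cases hL : MemLp (ansatzZero p A 1) 2 volume
  · obtain ⟨C, δ₀, hC, hδ₀, hδ₁, hst⟩ := exists_stability hS H hL hN hp'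
    refine ⟨C, n₀, min δ₀ (τ (numSteps p) / 4), hC, hn₀0, lt_min hδ₀ (by linarith),
      (min_le_left _ _).trans_lt hδ₁, fun n hnn => ?_⟩
    obtain ⟨h1, h2⟩ := hn n hnn
    have h3 := min_le_left δ₀ (τ (numSteps p) / 4)
    have h4 := min_le_right δ₀ (τ (numSteps p) / 4)
    have h5 : 0 < min δ₀ (τ (numSteps p) / 4) := lt_min hδ₀ (by linarith)
    exact ⟨by linarith, fun w hw => hst _ _ h1 (by linarith) (by linarith) (by linarith) w hw⟩
  · -- no solution starts from the ansatz
    refine ⟨1, n₀, τ (numSteps p) / 4, one_pos, hn₀0, by linarith, by linarith, fun n hnn => ?_⟩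
    obtain ⟨h1, h2⟩ := hn n hnn
    exact ⟨by linarith, fun w hw =>
      absurd (memLp_of_isEnergySolution hS H ⟨h1, by linarith⟩ hw) hL⟩
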